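/- \textbf{Theorem ($L^1$ stability).} Let $R,V,L>0$. Let $v\in C^2([0,R];[0,V])$ with $v'\le 0$, $v(0)=V$, $v(R)=0$; let $f\in C^1([0,R];[0,1])$ with $f'\le 0$, $f(0)=1$, $f(R)=0$, extended by $f=1$ on $(-\infty,0)$ and $f=0$ on $(R,\infty)$; let $\omega\in C^1([0,L];[0,\infty))$ with $\omega'\le 0$ and $\int_0^L\omega(s)\,ds=1$. (Extend $v$ by $V$ on $(-\infty,0)$ and by $0$ on $(R,\infty)$.) Put $F(s)=s f(s)$ and $(\rho*\omega)(t,x)=\int_0^L\rho(t,x+s)\,\omega(s)\,ds$. For $T,\tau>0$ and $\rho^0\in L^1(\mathbb R;[0,R])$, a function $\rho\in L^1([0,T]\times\mathbb R;\mathbb R)$, extended by $\rho(t,\cdot)=\rho^0$ for $t\in[-\tau,0]$, is an \emph{entropy weak solution} of $$\partial_t\rho+\partial_x\big(\rho f(\rho)\,v((\rho*\omega)(t-\tau,x))\big)=0,\qquad \rho(t,\cdot)=\rho^0\ \text{ for } t\in[-\tau,0],$$ if for all $\varphi\in C^1_c([0,T)\times\mathbb R;[0,\infty))$ and all $\kappa\in\mathbb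 R$ $$\int_0^T\!\!\int_{\mathbb R}\Big(|\rho-\kappa|\,\partial_t\varphi+\operatorname{sgn}(\rho-\kappa)(F(\rho)-F(\kappa))\,v((\rho*\omega)(t-\tau,x))\,\partial_x\varphi-\operatorname{sgn}(\rho-\kappa)F(\kappa)\,\partial_x v((\rho*\omega)(t-\tau,x))\,\varphi\Big)dx\,dt+\int_{\mathbb R}|\rho^0-\kappa|\,\varphi(0,x)\,dx\ge 0 .$$ Write $\|\cdot\|$ for sup norms on $[0,R]$ or $[0,L]$, $\mathrm{TV}$ for the total variation on $\mathbb R$ (of an $L^1$ class), and $\|u\|_{BV}=\|u\|_1+\mathrm{TV}(u)$. Let $T,\tau_1,\tau_2>0$, let $\rho^0,\sigma^0\in BV(\mathbb R;[0,R])\subset L^1(\mathbb R)$, and let $\rho$ and $\sigma$ be entropy weak solutions on $[0,T]\times\mathbb R$ with initial data $\rho^0,\sigma^0$ and delays $\tau_1,\tau_2$, respectively. Then $\rho$ and $\sigma$ have representatives in $C([0,T];L^1(\mathbb R))$ with $\rho(0,\cdot)=\rho^0$ and $\sigma(0,\cdot)=\sigma^0$; for these, $\sup_{t\in[0,T]}\|\rho(t,\cdot)\|_{BV}<\infty$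 and $$\|\rho(t,\cdot)-\sigma(t,\cdot)\|_1\le e^{K_1T}\big(K_3\|\rho^0-\sigma^0\|_1+K_2|\tau_1-\tau_2|\big)\qquad\text{for all } t\in[0,T],$$ where $$K_1=\|\omega\|\,\|v'\|\,(1+R\|f'\|)\sup_{t\in[0,T]}\|\rho(t,\cdot)\|_{BV}+R\big(2\|v'\|\,\|\omega\|+2R\,\|v''\|\,\|\omega\|\big),$$ $$K_2=K_1\,\mathcal K\,T,\qquad K_3=1+K_1\min\{\tau_1,\tau_2\},$$ $$\mathcal K=V(1+R\|f'\|)\,C\;\mathrm{TV}(\rho^0)+2R\,\|\omega\|\,\|v'\|\,\|\rho^0\|_1,\qquad C=\big(2e^{\mathcal M(T-\lfloor T/\tau_1\rfloor\tau_1)}-1\big)\big(2e^{\mathcal M\tau_1}-1\big)^{\lfloor T/\tau_1\rfloor},$$ $$\mathcal M=2\|\omega\|R\big(\|v'\|+R\max\{3\|v''\|,\ \|v'\|\,\|f'\|\}\big).$$ In particular, if $\rho^0=\sigma^0$ almost everywhere, then $\|\rho(t,\cdot)-\sigma(t,\cdot)\|_1\le e^{K_1T}K_2|\tau_1-\tau_2|$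 for all $t\in[0,T]$; and if moreover $\tau_1=\tau_2$, then $\rho=\sigma$ almost everywhere on $[0,T]\times\mathbb R$. -/

import Mathlib

open Set MeasureTheory Filter Topology
open scoped ENNReal

noncomputable section

/-- The supremum norm of `g` on the compact interval `[a, b]`. -/
def supNormOn (a b : ℝ) (g : ℝ → ℝ) : ℝ :=
  sSup ((fun x => |g x|) '' Icc a b)

/-- Total variation of (the class of) a locally integrable function on the line, by duality with
`C¹` test functions of compact support. It depends only on the almost everywhere class. -/
def totalVar (u : ℝ → ℝ) : ℝ≥0∞ :=
  ⨆ (φ : ℝ → ℝ) (_ : ContDiff ℝ 1 φ) (_ : HasCompactSupport φ) (_ : ∀ x, |φ x| ≤ 1),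
    ENNReal.ofReal (∫ x, u x * deriv φ x)

/-- The norm of `BV(ℝ) ⊆ L¹(ℝ)`. -/
def bvNorm (u : ℝ → ℝ) : ℝ≥0∞ :=
  eLpNorm u 1 volume + totalVar u

/-- The space `BV(ℝ; [0, R])`. -/
structure IsBVDatum (R : ℝ) (u : ℝ → ℝ) : Prop where
  integrable : Integrable u
  mem_Icc : ∀ᵐ x, u x ∈ Icc 0 R
  totalVar_lt_top : totalVar u < ⊤

/-- The data of the model: maximal density `R`, maximal speed `V`, look-ahead distance `L`,
speed law `v`, saturation function `f` and kernel `ω`, with the standing assumptions.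
Only the values of `v`, `f` on `[0, R]` and of `ω` on `[0, L]` are ever used. -/
structure TrafficModel where
  R : ℝ
  V : ℝ
  L : ℝ
  v : ℝ → ℝ
  f : ℝ → ℝ
  ω : ℝ → ℝ
  R_pos : 0 < R
  V_pos : 0 < V
  L_pos : 0 < L
  v_contDiffOn : ContDiffOn ℝ 2 v (Icc 0 R)
  v_mapsTo : MapsTo v (Icc 0 R) (Icc 0 V)
  v_deriv_nonpos : ∀ s ∈ Icc 0 R, derivWithin v (Icc 0 R) s ≤ 0
  v_zero : v 0 = V
  v_R : v R = 0
  f_contDiffOn : ContDiffOn ℝ 1 f (Icc 0 R)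
  f_mapsTo : MapsTo f (Icc 0 R) (Icc 0 1)
  f_deriv_nonpos : ∀ s ∈ Icc 0 R, derivWithin f (Icc 0 R) s ≤ 0
  f_zero : f 0 = 1
  f_R : f R = 0
  ω_contDiffOn : ContDiffOn ℝ 1 ω (Icc 0 L)
  ω_nonneg : ∀ s ∈ Icc 0 L, 0 ≤ ω s
  ω_deriv_nonpos : ∀ s ∈ Icc 0 L, derivWithin ω (Icc 0 L) s ≤ 0
  ω_integral : ∫ s in Icc 0 L, ω s = 1

namespace TrafficModel

variable (m : TrafficModel)

/-- The nearest point of `[0, R]`. -/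
def clamp (s : ℝ) : ℝ := max 0 (min s m.R)

/-- The flux factor `F(s) = s f(s)`, where `f = 1` on `(-∞, 0)` and `f = 0` on `(R, ∞)`. -/
def F (s : ℝ) : ℝ := s * m.f (m.clamp s)

/-- The speed law, extended to the line by its end values `V` and `0`. -/
def speed (s : ℝ) : ℝ := m.v (m.clamp s)

/-- The downstream average `(u * ω)(x) = ∫₀ᴸ u(x + s) ω(s) ds`. -/
def average (u : ℝ → ℝ) (x : ℝ) : ℝ := ∫ s in Icc 0 m.L, u (x + s) * m.ω s

/-- The velocity field `v((ρ * ω)(t - τ, x))`, where `ρ(t, ·) = ρ₀` for `t ≤ 0`. -/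
def velocity (τ : ℝ) (ρ₀ : ℝ → ℝ) (ρ : ℝ → ℝ → ℝ) (t x : ℝ) : ℝ :=
  m.speed (m.average (if t - τ ≤ 0 then ρ₀ else ρ (t - τ)) x)

/-- Nonnegative test functions of class `C¹` with compact support in `[0, T) × ℝ`, given as
restrictions of `C¹` functions on the plane with compact support in `(-∞, T) × ℝ`. -/
structure IsTest (T : ℝ) (φ : ℝ × ℝ → ℝ) : Prop where
  contDiff : ContDiff ℝ 1 φ
  hasCompactSupport : HasCompactSupport φ
  tsupport_subset : tsupport φ ⊆ Iio T ×ˢ univ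
  nonneg : ∀ t x : ℝ, 0 ≤ t → 0 ≤ φ (t, x)

/-- Entropy weak solutions on `[0, T] × ℝ` with delay `τ` and initial datum `ρ₀`.
The field `velocity` is absolutely continuous in `x` for almost every `t`, so its pointwise
`x`-derivative exists almost everywhere and is its weak derivative. -/
structure IsEntropySolution (T τ : ℝ) (ρ₀ : ℝ → ℝ) (ρ : ℝ → ℝ → ℝ) : Prop where
  integrableOn : IntegrableOn (fun p : ℝ × ℝ => ρ p.1 p.2) (Icc 0 T ×ˢ univ)
  entropy : ∀ (φ : ℝ × ℝ → ℝ) (κ : ℝ), IsTest T φ →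
    0 ≤ (∫ t in Icc 0 T, ∫ x,
          (|ρ t x - κ| * deriv (fun s => φ (s, x)) t
            + Real.sign (ρ t x - κ) * (m.F (ρ t x) - m.F κ) * m.velocity τ ρ₀ ρ t x
                * deriv (fun y => φ (t, y)) x
            - Real.sign (ρ t x - κ) * m.F κ * deriv (fun y => m.velocity τ ρ₀ ρ t y) x
                * φ (t, x)))
        + ∫ x, |ρ₀ x - κ| * φ (0, x)

/-- `r` is the representative of `ρ` in `C([0, T]; L¹(ℝ))`, with value `ρ₀` at time `0`. -/
structure IsContinuousRep (T : ℝ) (ρ₀ : ℝ → ℝ) (ρ : ℝ → ℝ → ℝ)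
    (r : ℝ → (ℝ →₁[volume] ℝ)) : Prop where
  continuousOn : ContinuousOn r (Icc 0 T)
  ae_eq : ∀ᵐ t ∂volume.restrict (Icc 0 T), (r t : ℝ → ℝ) =ᵐ[volume] ρ t
  initial : (r 0 : ℝ → ℝ) =ᵐ[volume] ρ₀

/-- `sup_{t ∈ [0, T]} ‖r(t)‖_BV`. -/
def supBV (T : ℝ) (r : ℝ → (ℝ →₁[volume] ℝ)) : ℝ≥0∞ :=
  ⨆ t ∈ Icc 0 T, bvNorm (r t)

def normω : ℝ := supNormOn 0 m.L m.ω

def normv' : ℝ := supNormOn 0 m.R (derivWithin m.v (Icc 0 m.R))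

def normv'' : ℝ := supNormOn 0 m.R (iteratedDerivWithin 2 m.v (Icc 0 m.R))

def normf' : ℝ := supNormOn 0 m.R (derivWithin m.f (Icc 0 m.R))

/-- The growth rate of the total variation. -/
def rateM : ℝ :=
  2 * m.normω * m.R * (m.normv' + m.R * max (3 * m.normv'') (m.normv' * m.normf'))

/-- The growth factor of the total variation on `[0, T]` for the delay `τ`. -/
def factorC (T τ : ℝ) : ℝ :=
  (2 * Real.exp (m.rateM * (T - (⌊T / τ⌋₊ : ℝ) * τ)) - 1)
    * (2 * Real.exp (m.rateM * τ) - 1) ^ ⌊T / τ⌋₊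

/-- The Lipschitz constant in time, with values in `L¹`, for the delay `τ` and the datum `ρ₀`. -/
def lipTime (T τ : ℝ) (ρ₀ : ℝ → ℝ) : ℝ :=
  m.V * (1 + m.R * m.normf') * m.factorC T τ * (totalVar ρ₀).toReal
    + 2 * m.R * m.normω * m.normv' * ∫ x, |ρ₀ x|

/-- The constant `K₁`, where `B` stands for `sup_{t ∈ [0, T]} ‖ρ(t)‖_BV`. The kernel, extended
by zero, jumps at the ends of `[0, L]`: the total mass of its derivative is `2 ‖ω‖`, and the
derivative of an average of a function with values in `[0, R]` is bounded by `2 R ‖ω‖`. -/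
def K₁ (B : ℝ) : ℝ :=
  m.normω * m.normv' * (1 + m.R * m.normf') * B
    + m.R * (m.normv' * (2 * m.normω) + m.normv'' * (2 * m.R * m.normω))

def K₂ (B T τ : ℝ) (ρ₀ : ℝ → ℝ) : ℝ := m.K₁ B * m.lipTime T τ ρ₀ * T

def K₃ (B τ₁ τ₂ : ℝ) : ℝ := 1 + m.K₁ B * min τ₁ τ₂

end TrafficModel

end

/-! The velocity at time `t` is computed from the density at time `t - τ`. It can therefore be
treated as a given field `V(t, x)`, bounded and Lipschitz in `x`, with `∂ₓV` of bounded variation.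
What remains is Kruzhkov's method for `∂ₜu + ∂ₓ(F(u) V) = 0`, followed by Gronwall arguments across
the delay.

Setting. A solution is extended to `t ≤ 0` by its initial datum, and the velocity is switched off
there. The entropy inequality then holds on `(-∞, T)` with no initial term
(`IsEntropySolution.isKruzkov`). Since `F` vanishes at `0` and at `R`, the constants `κ = 0, R`
carry no source; they yield the maximum principle, the bound on the mass
(`IsEntropySolution.ae_bounds`) and the weak formulation (`IsKruzkov.weak`).

Stability. Doubling the variables for two solutions `u`, `w` with velocities `V`, `W` bounds the
growth of the smeared distance `∬ |u(x) - w(y)| η(x - y)` (`doubling_kernel`). If `u(t)` has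
variation `n` and `η` is an approximate identity, then in the limit `‖u - w‖₁` grows at a rate of at
most `A n ‖V - W‖_∞ + R ‖∂ₓV - ∂ₓW‖₁`, where `A` is the Lipschitz constant of `F`
(`ae_integral_abs_sub_le`).

Variation. Comparing `u` with its translates gives `y' ≤ A Λ y + R TV(∂ₓV)` for the variation `y` of
`u(t)`, where `Λ` bounds `∂ₓV`. This needs `y` to be finite beforehand, which is not assumed of the
solution. Finiteness is `exists_hasVarLE`: with a kernel satisfying `|z η'| ≤ 4 η`, the doubled
distance of `u` to itself obeys a closed differential inequality, and its size at scale `1/l` gives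
a linear modulus of continuity. Because `TV(∂ₓV(t))` is at most a constant times `TV(u(t - τ))`, on
a time interval of length at most `τ` the inequality reads `y' ≤ ℳ (y + b)`, with `b` a bound from
earlier times. Each full delay contributes the factor `2 exp(ℳ τ) - 1` (`ae_hasVarLE_exp`,
`ae_hasVarLE_of_delay`).

Time. The flux has bounded variation, so the solution is Lipschitz in time with values in `L¹`
(`exists_lipschitz_times`). This produces the continuous representative
(`IsEntropySolution.exists_continuousRep`).

Conclusion. The two velocities at time `t` differ through the distance of `u(t - τ₁)` and `w(t -
τ₂)`, which is at most `𝒦 |τ₁ - τ₂| + D(t - τ₂)` with `D = ‖u - w‖₁`. Stability gives `D(t) ≤ D(0) +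
∫₀ᵗ K₁ (𝒦 |τ₁ - τ₂| + D(s - τ₂)) ds`, and `ae_le_of_delay_integral` finishes. The argument yields
the estimate even with `K₃` replaced by `1`. -/

/-! ### Test functions and mollifiers on the line -/

/-- A nonnegative `C¹` function of compact support on the line, with its derivative. -/
structure IsTestFn (α α' : ℝ → ℝ) : Prop where
  hasDeriv : ∀ t, HasDerivAt α (α' t) t
  cont' : Continuous α'
  supp : HasCompactSupport α
  nonneg : ∀ t, 0 ≤ α t

/-- A test function supported in `(-∞, T)`. -/
structure IsTimeTest (T : ℝ) (θ θ' : ℝ → ℝ) : Prop extends IsTestFn θ θ' where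
  zero_of_le : ∃ b < T, ∀ t, b ≤ t → θ t = 0

namespace IsTestFn

variable {α α' : ℝ → ℝ}

theorem continuous (h : IsTestFn α α') : Continuous α :=
  continuous_iff_continuousAt.2 fun t => (h.hasDeriv t).continuousAt

theorem deriv_eq (h : IsTestFn α α') : deriv α = α' := funext fun t => (h.hasDeriv t).deriv

theorem supp' (h : IsTestFn α α') : HasCompactSupport α' := h.deriv_eq ▸ h.supp.deriv

theorem contDiff (h : IsTestFn α α') : ContDiff ℝ 1 α :=
  contDiff_one_iff_deriv.2 ⟨fun t => (h.hasDeriv t).differentiableAt, h.deriv_eq ▸ h.cont'⟩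

theorem integrable (h : IsTestFn α α') : Integrable α :=
  h.continuous.integrable_of_hasCompactSupport h.supp

theorem integrable' (h : IsTestFn α α') : Integrable α' :=
  h.cont'.integrable_of_hasCompactSupport h.supp'

theorem of_contDiff (h : ContDiff ℝ 1 α) (hs : HasCompactSupport α) (h0 : ∀ t, 0 ≤ α t) :
    IsTestFn α (deriv α) where
  hasDeriv t := (h.differentiable (by norm_num) t).hasDerivAt
  cont' := h.continuous_deriv (by norm_num)
  supp := hs
  nonneg := h0

/-- A common bound for the values and the support. -/
theorem exists_bound (h : IsTestFn α α') :
    ∃ C : ℝ, 0 < C ∧ (∀ t, |α t| ≤ C) ∧ (∀ t, |α' t| ≤ C) ∧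
      (∀ t, C < |t| → α t = 0) ∧ (∀ t, C < |t| → α' t = 0) := by
  obtain ⟨c₁, h₁⟩ := h.supp.exists_bound_of_continuous h.continuous
  obtain ⟨c₂, h₂⟩ := h.supp'.exists_bound_of_continuous h.cont'
  obtain ⟨c₃, h₃⟩ := h.supp.isCompact.isBounded.subset_closedBall 0
  obtain ⟨c₄, h₄⟩ := h.supp'.isCompact.isBounded.subset_closedBall 0
  refine ⟨max 1 (max (max c₁ c₂) (max c₃ c₄)), by positivity, fun t => (h₁ t).trans (by simp),
    fun t => (h₂ t).trans (by simp), fun t ht => ?_, fun t ht => ?_⟩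
  · by_contra hne
    have := h₃ (subset_tsupport _ (Function.mem_support.2 hne))
    rw [mem_closedBall_zero_iff, Real.norm_eq_abs] at this
    simp only [max_lt_iff] at ht
    linarith
  · by_contra hne
    have := h₄ (subset_tsupport _ (Function.mem_support.2 hne))
    rw [mem_closedBall_zero_iff, Real.norm_eq_abs] at this
    simp only [max_lt_iff] at ht
    linarith

/-- A `C¹` function that vanishes off a bounded interval. -/
theorem of_bounded_support (h : ∀ t, HasDerivAt α (α' t) t) (hc : Continuous α')
    (h0 : ∀ t, 0 ≤ α t) {a b : ℝ} (hs : ∀ t, t ∉ Icc a b → α t = 0) : IsTestFn α α' where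
  hasDeriv := h
  cont' := hc
  supp := HasCompactSupport.intro isCompact_Icc hs
  nonneg := h0

theorem integral_deriv (h : IsTestFn α α') : ∫ t, α' t = 0 := by
  rw [← h.deriv_eq]
  exact integral_eq_zero_of_hasDerivAt_of_integrable (fun t => by
    simpa [h.deriv_eq] using h.hasDeriv t) (h.deriv_eq ▸ h.integrable') h.integrable

theorem comp_sub_right (h : IsTestFn α α') (k : ℝ) :
    IsTestFn (fun t => α (t - k)) (fun t => α' (t - k)) where
  hasDeriv _ := (h.hasDeriv _).comp_sub_const _ k
  cont' := h.cont'.comp (continuous_id.sub continuous_const)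
  supp := h.supp.comp_homeomorph (Homeomorph.subRight k)
  nonneg _ := h.nonneg _

end IsTestFn

noncomputable section

/-- A smooth bump on the line of outer radius `1 / (n + 1)`. -/
def lineBump (n : ℕ) : ContDiffBump (0 : ℝ) where
  rIn := 1 / (2 * ((n : ℝ) + 1))
  rOut := 1 / ((n : ℝ) + 1)
  rIn_pos := by positivity
  rIn_lt_rOut := by
    apply one_div_lt_one_div_of_lt <;> linarith [(Nat.cast_nonneg n : (0 : ℝ) ≤ n)]

/-- The standard mollifiers. -/
def moll (n : ℕ) : ℝ → ℝ := (lineBump n).normed volume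

/-- The primitive of a mollifier. -/
def mollPrim (n : ℕ) (x : ℝ) : ℝ := ∫ y in (-2 : ℝ)..x, moll n y

end

theorem moll_nonneg (n : ℕ) (x : ℝ) : 0 ≤ moll n x := (lineBump n).nonneg_normed x

theorem moll_contDiff (n : ℕ) : ContDiff ℝ 1 (moll n) := by
  have := (lineBump n).contDiff_normed (μ := volume) (n := 1)
  exact_mod_cast this

theorem moll_continuous (n : ℕ) : Continuous (moll n) := (moll_contDiff n).continuous

theorem moll_integrable (n : ℕ) : Integrable (moll n) := (lineBump n).integrable_normed

theorem moll_integral (n : ℕ) : ∫ x, moll n x = 1 := (lineBump n).integral_normed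

theorem moll_neg (n : ℕ) (x : ℝ) : moll n (-x) = moll n x := (lineBump n).normed_neg x

theorem moll_eq_zero {n : ℕ} {x : ℝ} (h : 1 / ((n : ℝ) + 1) ≤ |x|) : moll n x = 0 := by
  by_contra hne
  have := (lineBump n).support_normed_eq (μ := (volume : Measure ℝ)) ▸ (Function.mem_support.2 hne)
  rw [mem_ball_zero_iff, Real.norm_eq_abs] at this
  exact absurd h (not_le.2 this)

theorem moll_isTestFn (n : ℕ) : IsTestFn (moll n) (deriv (moll n)) :=
  .of_contDiff (moll_contDiff n) (lineBump n).hasCompactSupport_normed (moll_nonneg n)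

theorem one_div_succ_le_one (n : ℕ) : 1 / ((n : ℝ) + 1) ≤ 1 := by
  rw [div_le_one (by positivity)]; linarith [(Nat.cast_nonneg n : (0 : ℝ) ≤ n)]

theorem mollPrim_hasDerivAt (n : ℕ) (x : ℝ) : HasDerivAt (mollPrim n) (moll n x) x :=
  (moll_continuous n).integral_hasStrictDerivAt _ _ |>.hasDerivAt

theorem mollPrim_mono (n : ℕ) : Monotone (mollPrim n) :=
  monotone_of_hasDerivAt_nonneg (mollPrim_hasDerivAt n) (moll_nonneg n)

theorem mollPrim_of_le {n : ℕ} {x : ℝ} (h : x ≤ -(1 / ((n : ℝ) + 1))) : mollPrim n x = 0 := by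
  have h1 := one_div_succ_le_one n
  have hp : (0 : ℝ) < 1 / ((n : ℝ) + 1) := by positivity
  refine intervalIntegral.integral_zero_ae (Eventually.of_forall fun y hy => moll_eq_zero ?_)
  have : y ≤ -(1 / ((n : ℝ) + 1)) := by
    rcases le_total (-2) x with hx | hx
    · rw [uIoc_of_le hx] at hy; exact hy.2.trans h
    · rw [uIoc_of_ge hx] at hy; linarith [hy.2]
  rw [abs_of_nonpos (by linarith)]
  linarith

theorem mollPrim_of_ge {n : ℕ} {x : ℝ} (h : 1 / ((n : ℝ) + 1) ≤ x) : mollPrim n x = 1 := by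
  have h1 := one_div_succ_le_one n
  have hp : (0 : ℝ) < 1 / ((n : ℝ) + 1) := by positivity
  rw [← moll_integral n, mollPrim, intervalIntegral.integral_of_le (by linarith)]
  refine setIntegral_eq_integral_of_forall_compl_eq_zero fun y hy => moll_eq_zero ?_
  simp only [mem_Ioc, not_and_or, not_lt, not_le] at hy
  rcases hy with hy | hy
  · rw [abs_of_nonpos (by linarith)]; linarith
  · rw [abs_of_nonneg (by linarith)]; linarith

theorem mollPrim_nonneg (n : ℕ) (x : ℝ) : 0 ≤ mollPrim n x := by
  rw [← mollPrim_of_le (n := n) (min_le_right x _)]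
  exact mollPrim_mono n (min_le_left _ _)

theorem mollPrim_le_one (n : ℕ) (x : ℝ) : mollPrim n x ≤ 1 := by
  rw [← mollPrim_of_ge (n := n) (le_max_right x _)]
  exact mollPrim_mono n (le_max_left _ _)

theorem tendsto_moll_radius : Tendsto (fun n : ℕ => 1 / ((n : ℝ) + 1)) atTop (𝓝 0) :=
  tendsto_one_div_add_atTop_nhds_zero_nat

/-- Lebesgue differentiation applies because the outer radius of each bump is exactly twice the
inner one. Evenness of `moll` turns the convolution into a pairing with `moll n (t - r)`, the
derivative of a shifted `mollPrim`. -/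
theorem ae_tendsto_moll {E : ℝ → ℝ} (hE : LocallyIntegrable E) :
    ∀ᵐ r, Tendsto (fun n => ∫ t, moll n (t - r) * E t) atTop (𝓝 (E r)) := by
  have h := ContDiffBump.ae_convolution_tendsto_right_of_locallyIntegrable (μ := volume)
    (φ := lineBump) (l := atTop) (K := 2) (g := E) tendsto_moll_radius
    (Eventually.of_forall fun n => le_of_eq (by
      change 1 / ((n : ℝ) + 1) = 2 * (1 / (2 * ((n : ℝ) + 1)))
      field_simp)) hE
  filter_upwards [h] with r hr
  refine hr.congr fun n => ?_
  rw [convolution_lsmul_swap]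
  refine integral_congr_ae (Eventually.of_forall fun t => ?_)
  change moll n (r - t) * E t = _
  rw [← moll_neg, neg_sub]

theorem IsTestFn.integrable_mul {α α' : ℝ → ℝ} (h : IsTestFn α α') {E : ℝ → ℝ}
    (hE : LocallyIntegrable E) : Integrable (fun t => α t * E t) := by
  simpa [mul_comm] using hE.integrable_smul_left_of_hasCompactSupport h.continuous h.supp

theorem IsTestFn.integrable_mul' {α α' : ℝ → ℝ} (h : IsTestFn α α') {E : ℝ → ℝ}
    (hE : LocallyIntegrable E) : Integrable (fun t => α' t * E t) := by
  simpa [mul_comm] using hE.integrable_smul_left_of_hasCompactSupport h.cont' h.supp'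

/-! ### Distributional inequalities in time; translation and duality in `L¹` -/

/-- A distributional differential inequality holds in integrated form almost everywhere. -/
theorem ae_le_add_integral_of_distrib {E Y : ℝ → ℝ} {t₀ T E₀ : ℝ} (hE : LocallyIntegrable E)
    (hY : LocallyIntegrable Y) (hY0 : ∀ t, 0 ≤ Y t) (hE0 : ∀ᵐ t, t ∈ Ioo (t₀ - 2) t₀ → E t ≤ E₀)
    (H : ∀ θ θ', IsTimeTest T θ θ' → 0 ≤ ∫ t, (θ' t * E t + θ t * Y t)) :
    ∀ᵐ t, t ∈ Ioo t₀ T → E t ≤ E₀ + ∫ s in t₀..t, Y s := by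
  filter_upwards [ae_tendsto_moll hE] with r hr hrI
  have hYi : ∀ a b, IntervalIntegrable Y volume a b := fun a b =>
    (hY.integrableOn_isCompact isCompact_uIcc).intervalIntegrable
  have hcont : Continuous fun b => ∫ s in t₀..b, Y s :=
    intervalIntegral.continuous_primitive hYi t₀
  have hlim : Tendsto (fun n : ℕ => E₀ + ((∫ s in t₀..(r + 1 / ((n : ℝ) + 1)), Y s)
      - ∫ s in t₀..(t₀ - 2 * (1 / ((n : ℝ) + 1))), Y s)) atTop
      (𝓝 (E₀ + ((∫ s in t₀..(r + 0), Y s) - ∫ s in t₀..(t₀ - 2 * 0), Y s))) := by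
    refine tendsto_const_nhds.add (Tendsto.sub ?_ ?_)
    · exact (hcont.tendsto _).comp (tendsto_const_nhds.add tendsto_moll_radius)
    · exact (hcont.tendsto _).comp
        (tendsto_const_nhds.sub (tendsto_const_nhds.mul tendsto_moll_radius))
  have hev : ∀ᶠ n : ℕ in atTop, 1 / ((n : ℝ) + 1) < T - r :=
    tendsto_moll_radius.eventually_lt_const (by linarith [hrI.2])
  refine (le_of_tendsto_of_tendsto hr hlim ?_).trans (by simp)
  filter_upwards [hev] with n hn
  set ε : ℝ := 1 / ((n : ℝ) + 1) with hε
  have hεp : 0 < ε := by positivity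
  -- The test function climbs from 0 to 1 around `c` and descends around `r`. With this `c` the
  -- climb takes place in `(t₀ - 2ε, t₀)`, inside the window `(t₀ - 2, t₀)` on which `E ≤ E₀` is
  -- known, because `ε ≤ 1`.
  set c : ℝ := t₀ - ε with hc
  have hcr : c ≤ r := by linarith [hrI.1]
  have htest : IsTimeTest T (fun t => mollPrim n (t - c) - mollPrim n (t - r))
      (fun t => moll n (t - c) - moll n (t - r)) := by
    refine ⟨.of_bounded_support (a := c - ε) (b := r + ε) (fun t => ?_) ?_ (fun t => ?_)
      (fun t ht => ?_), r + ε, by linarith, fun t ht => ?_⟩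
    · exact ((mollPrim_hasDerivAt n _).comp_sub_const t c).sub
        ((mollPrim_hasDerivAt n _).comp_sub_const t r)
    · have := moll_continuous n; fun_prop
    · exact sub_nonneg.2 (mollPrim_mono n (by linarith))
    · simp only [mem_Icc, not_and_or, not_le] at ht
      rcases ht with ht | ht
      · rw [mollPrim_of_le (by linarith), mollPrim_of_le (by linarith), sub_self]
      · rw [mollPrim_of_ge (by linarith), mollPrim_of_ge (by linarith), sub_self]
    · rw [mollPrim_of_ge (by linarith), mollPrim_of_ge (by linarith), sub_self]
  have h0 := H _ _ htest
  rw [integral_add (htest.integrable_mul' hE) (htest.integrable_mul hY)] at h0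
  have i1 : Integrable fun t => moll n (t - c) * E t :=
    ((moll_isTestFn n).comp_sub_right c).integrable_mul hE
  have i2 : Integrable fun t => moll n (t - r) * E t :=
    ((moll_isTestFn n).comp_sub_right r).integrable_mul hE
  simp_rw [sub_mul (moll n _)] at h0
  rw [integral_sub i1 i2] at h0
  have h1 : ∫ t, moll n (t - c) * E t ≤ E₀ := by
    have : ∫ t, moll n (t - c) * E₀ = E₀ := by
      rw [integral_mul_const, integral_sub_right_eq_self (moll n), moll_integral, one_mul]
    rw [← this]
    refine integral_mono_ae i1 (((moll_integrable n).comp_sub_right c).mul_const _) ?_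
    filter_upwards [hE0] with t ht
    by_cases htt : t ∈ Ioo (t₀ - 2) t₀
    · exact mul_le_mul_of_nonneg_left (ht htt) (moll_nonneg n _)
    · have hε1 : ε ≤ 1 := one_div_succ_le_one n
      have : moll n (t - c) = 0 := moll_eq_zero (by
        rw [mem_Ioo, not_and_or, not_lt, not_lt] at htt
        rcases htt with htt | htt
        · rw [abs_of_nonpos (by linarith)]; linarith
        · rw [abs_of_nonneg (by linarith)]; linarith)
      simp [this]
  have h2 : ∫ t, (mollPrim n (t - c) - mollPrim n (t - r)) * Y t
      ≤ ∫ s in (t₀ - 2 * ε)..(r + ε), Y s := by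
    rw [intervalIntegral.integral_of_le (by linarith [hrI.1]),
      ← integral_indicator measurableSet_Ioc]
    refine integral_mono (htest.integrable_mul hY)
      ((hYi _ _).1.integrable_indicator measurableSet_Ioc) fun t => ?_
    by_cases ht : t ∈ Ioc (t₀ - 2 * ε) (r + ε)
    · rw [indicator_of_mem ht]
      exact mul_le_of_le_one_left (hY0 t) (by
        linarith [mollPrim_le_one n (t - c), mollPrim_nonneg n (t - r)])
    · rw [indicator_of_notMem ht]
      simp only [mem_Ioc, not_and_or, not_lt, not_le] at ht
      rcases ht with ht | ht
      · simp [mollPrim_of_le (n := n) (x := t - c) (by linarith),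
          mollPrim_of_le (n := n) (x := t - r) (by linarith)]
      · simp [mollPrim_of_ge (n := n) (x := t - c) (by linarith),
          mollPrim_of_ge (n := n) (x := t - r) (by linarith)]
  rw [intervalIntegral.integral_interval_sub_left (hYi _ _) (hYi _ _)]
  linarith

instance isAddRightInvariant_volume_prod₃ :
    (volume : Measure (ℝ × ℝ × ℝ)).IsAddRightInvariant :=
  inferInstanceAs ((volume : Measure ℝ).prod (volume : Measure (ℝ × ℝ))).IsAddRightInvariant

/-- Translations are a continuous family of measure preserving maps, and composition with such a
family is continuous on `L¹`. -/
theorem tendsto_integral_abs_translate_sub {f : ℝ × ℝ × ℝ → ℝ} (hf : Integrable f) :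
    Tendsto (fun v : ℝ × ℝ × ℝ => ∫ x, |f (x + v) - f x|) (𝓝 0) (𝓝 0) := by
  let g : ℝ × ℝ × ℝ → C(ℝ × ℝ × ℝ, ℝ × ℝ × ℝ) := fun v => ⟨fun x => x + v, by fun_prop⟩
  have hg : Continuous g := by
    refine ContinuousMap.continuous_of_continuous_uncurry _ ?_
    change Continuous fun p : (ℝ × ℝ × ℝ) × (ℝ × ℝ × ℝ) => p.2 + p.1
    fun_prop
  have hm : ∀ v, MeasurePreserving (g v) (volume : Measure (ℝ × ℝ × ℝ)) volume := fun v =>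
    measurePreserving_add_right volume v
  have h := Tendsto.compMeasurePreservingLp (E := ℝ) (p := 1)
    (f := fun _ : ℝ × ℝ × ℝ => hf.toL1 f) (l := 𝓝 0) tendsto_const_nhds (hg.tendsto 0)
    hm (hm 0) ENNReal.one_ne_top
  rw [tendsto_iff_norm_sub_tendsto_zero] at h
  refine h.congr fun v => ?_
  rw [L1.norm_eq_integral_norm]
  refine integral_congr_ae ?_
  have e1 := Lp.coeFn_compMeasurePreserving (hf.toL1 f) (hm v)
  have e0 := Lp.coeFn_compMeasurePreserving (hf.toL1 f) (hm 0)
  have c := hf.coeFn_toL1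
  filter_upwards [Lp.coeFn_sub (Lp.compMeasurePreserving _ (hm v) (hf.toL1 f))
    (Lp.compMeasurePreserving _ (hm 0) (hf.toL1 f)), e1, e0,
    (hm v).quasiMeasurePreserving.ae c, (hm 0).quasiMeasurePreserving.ae c] with x h1 h2 h3 h4 h5
  rw [h1, Pi.sub_apply, h2, h3, Function.comp_apply, Function.comp_apply, h4, h5, Real.norm_eq_abs]
  simp [g]

/-- A countable family of test functions that computes the `L¹` norm by duality. -/
theorem exists_dual_family : ∃ ψ : ℕ × ℕ → ℝ → ℝ,
    (∀ n, ContDiff ℝ 1 (ψ n) ∧ HasCompactSupport (ψ n) ∧ ∀ x, |ψ n x| ≤ 1) ∧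
    ∀ v : ℝ → ℝ, Integrable v → ∀ ε > 0, ∃ n, (∫ x, |v x|) - ε ≤ ∫ x, v x * ψ n x := by
  have hD := Lp.dense_hasCompactSupport_contDiff (E := ℝ) (F := ℝ) (μ := volume) (p := 1)
    ENNReal.one_ne_top
  have : Fact ((1 : ℝ≥0∞) ≠ ∞) := ⟨ENNReal.one_ne_top⟩
  obtain ⟨t, htD, htc, htd⟩ := hD.exists_countable_dense_subset
  obtain ⟨s, rfl⟩ := htc.exists_eq_range htd.nonempty
  choose g hg using fun j : ℕ => htD (mem_range_self j)
  have hsq : ∀ (j m : ℕ) (x : ℝ), 0 < g j x ^ 2 + (1 / ((m : ℝ) + 1)) ^ 2 := fun j m x => by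
    positivity
  have hint : ∀ j, Integrable (g j) := fun j =>
    (hg j).2.2.continuous.integrable_of_hasCompactSupport (hg j).2.1
  have hcd : ∀ (j m : ℕ), ContDiff ℝ 1
      fun x => g j x / Real.sqrt (g j x ^ 2 + (1 / ((m : ℝ) + 1)) ^ 2) := fun j m => by
    have h1 : ContDiff ℝ 1 (g j) := (hg j).2.2.of_le (by exact_mod_cast le_top)
    exact h1.div (((h1.pow 2).add contDiff_const).sqrt fun x => (hsq j m x).ne')
      fun x => (Real.sqrt_pos.2 (hsq j m x)).ne'
  have hle : ∀ (j m : ℕ) (x : ℝ), |g j x / Real.sqrt (g j x ^ 2 + (1 / ((m : ℝ) + 1)) ^ 2)| ≤ 1 :=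
      fun j m x => by
    rw [abs_div, abs_of_nonneg (Real.sqrt_nonneg _), div_le_one (Real.sqrt_pos.2 (hsq j m x))]
    exact Real.le_sqrt_of_sq_le (by rw [sq_abs]; nlinarith [sq_nonneg (1 / ((m : ℝ) + 1))])
  -- Smoothed signs of a countable dense set of test functions: `g / √(g² + δ²)` is bounded by 1,
  -- and its product with `g` tends to `|g|` as `δ → 0`. Countability lets one null set of times
  -- serve the whole family in `exists_lipschitz_times`.
  refine ⟨fun p x => g p.1 x / Real.sqrt (g p.1 x ^ 2 + (1 / ((p.2 : ℝ) + 1)) ^ 2),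
    fun p => ⟨hcd _ _, (hg p.1).2.1.mono fun x hx => ?_, hle _ _⟩, fun v hv ε hε => ?_⟩
  · rw [Function.mem_support] at hx ⊢
    intro h0
    exact hx (by simp [h0])
  obtain ⟨_, hj, ⟨j, rfl⟩⟩ := Metric.dense_iff.1 htd (hv.toL1 v) (ε / 3) (by positivity)
  have hdist : ∫ x, |v x - g j x| < ε / 3 := by
    rw [Metric.mem_ball, dist_comm, dist_eq_norm, L1.norm_eq_integral_norm] at hj
    refine lt_of_eq_of_lt (integral_congr_ae ?_) hj
    filter_upwards [Lp.coeFn_sub (hv.toL1 v) (s j), hv.coeFn_toL1, (hg j).1] with x h1 h2 h3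
    rw [h1, Pi.sub_apply, h2, h3, Real.norm_eq_abs]
  have hlim : Tendsto (fun m : ℕ => ∫ x, g j x *
      (g j x / Real.sqrt (g j x ^ 2 + (1 / ((m : ℝ) + 1)) ^ 2))) atTop (𝓝 (∫ x, |g j x|)) := by
    refine tendsto_integral_of_dominated_convergence (fun x => |g j x|)
      (fun m => ((hg j).2.2.continuous.mul (hcd j m).continuous).aestronglyMeasurable)
      (hint j).abs (fun m => Eventually.of_forall fun x => ?_) (Eventually.of_forall fun x => ?_)
    · rw [Real.norm_eq_abs, abs_mul]
      exact mul_le_of_le_one_right (abs_nonneg _) (hle j m x)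
    · by_cases h0 : g j x = 0
      · simp [h0]
      · have hc : Tendsto (fun m : ℕ => g j x ^ 2 + (1 / ((m : ℝ) + 1)) ^ 2) atTop
            (𝓝 (g j x ^ 2 + 0 ^ 2)) := tendsto_const_nhds.add (tendsto_moll_radius.pow 2)
        have h2 := (tendsto_const_nhds (x := g j x)).mul
          ((tendsto_const_nhds (x := g j x)).div (hc.sqrt) (by positivity))
        convert h2 using 2
        · rfl
        rw [zero_pow two_ne_zero, add_zero, Real.sqrt_sq_eq_abs, eq_comm, mul_div_assoc',
          ← sq, ← sq_abs, sq, mul_self_div_self]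
  obtain ⟨m, hm⟩ := (hlim.eventually_const_lt (sub_lt_self _ (by positivity : 0 < ε / 3))).exists
  refine ⟨(j, m), ?_⟩
  set ψ : ℝ → ℝ := fun x => g j x / Real.sqrt (g j x ^ 2 + (1 / ((m : ℝ) + 1)) ^ 2) with hψ
  have hψc : AEStronglyMeasurable ψ volume := (hcd j m).continuous.aestronglyMeasurable
  have hψb : ∀ᵐ x, ‖ψ x‖ ≤ 1 := Eventually.of_forall (hle j m)
  have i1 : Integrable fun x => v x * ψ x := hv.mul_bdd hψc hψb
  have i2 : Integrable fun x => g j x * ψ x := (hint j).mul_bdd hψc hψb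
  have hi3 : Integrable fun x => |v x - g j x| := (hv.sub (hint j)).abs
  have a1 : (∫ x, g j x * ψ x) - ∫ x, |v x - g j x| ≤ ∫ x, v x * ψ x := by
    rw [← integral_sub i2 hi3]
    refine integral_mono (i2.sub hi3) i1 fun x => ?_
    have : |(v x - g j x) * ψ x| ≤ |v x - g j x| := by
      rw [abs_mul]; exact mul_le_of_le_one_right (abs_nonneg _) (hle j m x)
    have h' := neg_abs_le ((v x - g j x) * ψ x)
    change g j x * ψ x - |v x - g j x| ≤ v x * ψ x
    nlinarith
  have a2 : (∫ x, |v x|) - ∫ x, |v x - g j x| ≤ ∫ x, |g j x| := by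
    rw [← integral_sub hv.abs hi3]
    refine integral_mono (hv.abs.sub hi3) (hint j).abs fun x => ?_
    have := abs_sub_abs_le_abs_sub (v x) (g j x)
    change |v x| - |v x - g j x| ≤ |g j x|
    linarith
  linarith

/-! ### Total variation as an `L¹` modulus of continuity -/

/-- `u` has variation at most `N`: its `L¹` modulus of continuity is at most `N |k|`. -/
def HasVarLE (u : ℝ → ℝ) (N : ℝ) : Prop := ∀ k, ∫ x, |u (x + k) - u x| ≤ N * |k|

theorem HasVarLE.mono {u : ℝ → ℝ} {N N' : ℝ} (h : HasVarLE u N) (hN : N ≤ N') : HasVarLE u N' :=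
  fun k => (h k).trans (by gcongr)

theorem HasVarLE.congr {u w : ℝ → ℝ} {N : ℝ} (h : HasVarLE u N) (huw : u =ᵐ[volume] w) :
    HasVarLE w N := fun k => by
  refine (le_of_eq (integral_congr_ae ?_)).trans (h k)
  filter_upwards [huw, (measurePreserving_add_right volume k).quasiMeasurePreserving.ae huw]
    with x h1 h2
  rw [h1, h2]

theorem HasVarLE.nonneg {u : ℝ → ℝ} {N : ℝ} (h : HasVarLE u N) : 0 ≤ N := by
  have := h 1
  rw [abs_one, mul_one] at this
  exact (integral_nonneg fun _ => abs_nonneg _).trans this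

/-- Difference quotients of a Lipschitz function against an integrable one. -/
theorem tendsto_integral_diffQuot {X : Type*} [MeasurableSpace X] {μ : Measure X}
    {u : X → ℝ} {φ : ℝ → X → ℝ} {φ' bd : X → ℝ} (hum : AEStronglyMeasurable u μ)
    (hφm : ∀ k, AEStronglyMeasurable (φ k) μ)
    (hbd : Integrable (fun x => u x * bd x) μ)
    (hlip : ∀ n : ℕ, ∀ᵐ x ∂μ, |φ (1 / ((n : ℝ) + 1)) x - φ 0 x| ≤ bd x * (1 / ((n : ℝ) + 1)))
    (hd : ∀ᵐ x ∂μ, HasDerivAt (fun k => φ k x) (φ' x) 0) :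
    Tendsto (fun n : ℕ => ∫ x, u x * ((φ (1 / ((n : ℝ) + 1)) x - φ 0 x) * ((n : ℝ) + 1)) ∂μ) atTop
      (𝓝 (∫ x, u x * φ' x ∂μ)) := by
  refine tendsto_integral_of_dominated_convergence (fun x => ‖u x * bd x‖)
    (fun n => hum.mul (((hφm _).sub (hφm _)).mul_const _)) hbd.norm (fun n => ?_) ?_
  · filter_upwards [hlip n] with x hx
    have hn : (0 : ℝ) < (n : ℝ) + 1 := by positivity
    simp only [Real.norm_eq_abs, abs_mul, abs_of_pos hn]
    refine mul_le_mul_of_nonneg_left ?_ (abs_nonneg _)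
    have h2 : |φ (1 / ((n : ℝ) + 1)) x - φ 0 x| * ((n : ℝ) + 1) ≤ bd x := by
      rw [← le_div_iff₀ hn, div_eq_mul_one_div (bd x)]; exact hx
    exact h2.trans (le_abs_self _)
  · filter_upwards [hd] with x hx
    refine tendsto_const_nhds.mul ?_
    have h1 := hx.tendsto_slope_zero
    have h2 : Tendsto (fun n : ℕ => 1 / ((n : ℝ) + 1)) atTop (𝓝[≠] 0) :=
      tendsto_nhdsWithin_iff.2 ⟨tendsto_moll_radius, Eventually.of_forall fun n => by
        simp only [mem_compl_iff, mem_singleton_iff]; positivity⟩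
    refine (h1.comp h2).congr fun n => ?_
    simp only [Function.comp_apply, zero_add, smul_eq_mul]
    field_simp

/-- Discrete integration by parts: translation invariance of the measure carries the shift from `u`
over to the test function. -/
theorem integral_shift_sub_mul {u φ : ℝ → ℝ} (hu : Integrable u) (hφ : Continuous φ)
    {C : ℝ} (hC : ∀ x, |φ x| ≤ C) (k : ℝ) :
    ∫ x, (u (x + k) - u x) * φ x = ∫ x, u x * (φ (x - k) - φ x) := by
  have i1 : Integrable fun x => u x * φ x :=
    hu.mul_bdd hφ.aestronglyMeasurable (Eventually.of_forall hC)
  have i2 : Integrable fun x => u (x + k) * φ x :=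
    (hu.comp_add_right k).mul_bdd hφ.aestronglyMeasurable (Eventually.of_forall hC)
  have i3 : Integrable fun x => u x * φ (x - k) :=
    hu.mul_bdd (by fun_prop) (Eventually.of_forall fun x => hC (x - k))
  simp_rw [sub_mul, mul_sub]
  rw [integral_sub i2 i1, integral_sub i3 i1]
  congr 1
  rw [← integral_add_right_eq_self (fun x => u x * φ (x - k)) k]
  simp

theorem lipschitz_of_hasDerivAt {φ φ' : ℝ → ℝ} {C : ℝ} (h : ∀ x, HasDerivAt φ (φ' x) x)
    (hC : ∀ x, |φ' x| ≤ C) (x y : ℝ) : |φ x - φ y| ≤ C * |x - y| := by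
  simpa [Real.norm_eq_abs] using Convex.norm_image_sub_le_of_norm_hasDerivWithin_le
    (f := φ) (f' := φ') (s := univ) (x := y) (y := x)
    (fun x _ => (h x).hasDerivWithinAt) (fun x _ => hC x) convex_univ (mem_univ _) (mem_univ _)

/-- The bound only needs to be checked on a sequence of small shifts. -/
theorem totalVar_le_of_shift {u : ℝ → ℝ} {N : ℝ} (hu : Integrable u)
    (h : ∀ n : ℕ, ∫ x, |u (x + 1 / ((n : ℝ) + 1)) - u x| ≤ N * (1 / ((n : ℝ) + 1))) :
    totalVar u ≤ ENNReal.ofReal N := by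
  refine iSup_le fun φ => iSup_le fun hφ => iSup_le fun hs => iSup_le fun h1 => ?_
  refine ENNReal.ofReal_le_ofReal ?_
  have hd : ∀ x, HasDerivAt φ (deriv φ x) x := fun x =>
    (hφ.differentiable (by norm_num) x).hasDerivAt
  obtain ⟨C, hC⟩ := hs.deriv.exists_bound_of_continuous (hφ.continuous_deriv (by norm_num))
  -- Along the shifts `1 / (n + 1)` the difference quotients of `φ` already converge to `-φ'`, so no
  -- other shifts are needed to bound the pairing of `u` with `φ'`.
  have hlim := tendsto_integral_diffQuot (μ := volume) (u := u) (φ := fun k x => φ (x - k))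
    (φ' := fun x => -deriv φ x) (bd := fun _ => C) hu.1
    (fun k => (hφ.continuous.comp (continuous_id.sub continuous_const)).aestronglyMeasurable)
    (hu.mul_const C)
    (fun n => Eventually.of_forall fun x => by
      have := lipschitz_of_hasDerivAt hd hC (x - 1 / ((n : ℝ) + 1)) (x - 0)
      rwa [show |x - 1 / ((n : ℝ) + 1) - (x - 0)| = 1 / ((n : ℝ) + 1) by
        rw [← abs_neg, abs_of_nonneg] <;> ring_nf; positivity] at this)
    (Eventually.of_forall fun x => by
      have h0 : HasDerivAt φ (deriv φ x) (x - 0) := by simpa using hd x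
      simpa using h0.comp_const_sub x 0)
  have hneg : ∫ x, u x * -deriv φ x = -∫ x, u x * deriv φ x := by
    simp_rw [mul_neg]; rw [integral_neg]
  rw [hneg] at hlim
  have := ge_of_tendsto hlim (b := -N) (Eventually.of_forall fun n => ?_)
  · linarith
  have hn : (0 : ℝ) < (n : ℝ) + 1 := by positivity
  have e : ∫ x, u x * ((φ (x - 1 / ((n : ℝ) + 1)) - φ (x - 0)) * ((n : ℝ) + 1))
      = (∫ x, (u (x + 1 / ((n : ℝ) + 1)) - u x) * φ x) * ((n : ℝ) + 1) := by
    rw [integral_shift_sub_mul hu hφ.continuous h1, ← integral_mul_const]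
    simp [mul_assoc]
  rw [e]
  have h2 : |∫ x, (u (x + 1 / ((n : ℝ) + 1)) - u x) * φ x| ≤ N * (1 / ((n : ℝ) + 1)) := by
    refine (abs_integral_le_integral_abs).trans (le_trans (integral_mono_of_nonneg
      (Eventually.of_forall fun _ => abs_nonneg _) ((hu.comp_add_right _).sub hu).abs
      (Eventually.of_forall fun x => ?_)) (h n))
    change |(u (x + 1 / ((n : ℝ) + 1)) - u x) * φ x| ≤ |u (x + 1 / ((n : ℝ) + 1)) - u x|
    rw [abs_mul]
    exact mul_le_of_le_one_right (abs_nonneg _) (h1 x)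
  have h3 := neg_abs_le (∫ x, (u (x + 1 / ((n : ℝ) + 1)) - u x) * φ x)
  calc -N = -(N * (1 / ((n : ℝ) + 1))) * ((n : ℝ) + 1) := by field_simp
    _ ≤ _ := mul_le_mul_of_nonneg_right (by linarith) hn.le

theorem HasVarLE.totalVar_le {u : ℝ → ℝ} {N : ℝ} (hu : Integrable u) (h : HasVarLE u N) :
    totalVar u ≤ ENNReal.ofReal N :=
  totalVar_le_of_shift hu fun n => by
    simpa [abs_of_nonneg (by positivity : (0 : ℝ) ≤ (n : ℝ) + 1)] using h (1 / ((n : ℝ) + 1))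

theorem integral_mul_deriv_le {u : ℝ → ℝ} {N : ℝ} (hN : 0 ≤ N)
    (h : totalVar u ≤ ENNReal.ofReal N) {φ : ℝ → ℝ} (hφ : ContDiff ℝ 1 φ)
    (hs : HasCompactSupport φ) (h1 : ∀ x, |φ x| ≤ 1) : ∫ x, u x * deriv φ x ≤ N := by
  have : ENNReal.ofReal (∫ x, u x * deriv φ x) ≤ ENNReal.ofReal N := by
    refine le_trans ?_ h
    refine le_iSup_of_le φ ?_
    refine le_iSup_of_le hφ ?_
    refine le_iSup_of_le hs ?_
    exact le_iSup_of_le h1 le_rfl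
  exact (ENNReal.ofReal_le_ofReal_iff hN).1 this

/-- By duality it suffices to pair `u(x + k) - u(x)` with `|ψ| ≤ 1`. If `P` is a primitive of `ψ`,
then `Ψ(x) = (P(x - k) - P(x)) / |k|` is an average of `±ψ` over an interval of length `|k|`. It is
thus an admissible test function for the total variation, and `|k| Ψ'` is exactly the difference
that appears after moving the shift onto `ψ`. -/
theorem hasVarLE_of_totalVar_le {u : ℝ → ℝ} {N : ℝ} (hu : Integrable u) (hN : 0 ≤ N)
    (h : totalVar u ≤ ENNReal.ofReal N) : HasVarLE u N := by
  intro k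
  rcases eq_or_ne k 0 with rfl | hk
  · simp
  obtain ⟨ψ, hψ, hfam⟩ := exists_dual_family
  refine le_of_forall_pos_le_add fun ε hε => ?_
  obtain ⟨n, hn⟩ := hfam (fun x => u (x + k) - u x) ((hu.comp_add_right k).sub hu) ε hε
  obtain ⟨hc, hs, h1⟩ := hψ n
  have hint : ∀ a b, IntervalIntegrable (ψ n) volume a b := fun a b =>
    hc.continuous.intervalIntegrable a b
  set P : ℝ → ℝ := fun x => ∫ y in (0 : ℝ)..x, ψ n y with hP
  have hPd : ∀ x, HasDerivAt P (ψ n x) x := fun x =>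
    (hc.continuous.integral_hasStrictDerivAt _ _).hasDerivAt
  have hk' : 0 < |k| := abs_pos.2 hk
  set Ψ : ℝ → ℝ := fun x => (P (x - k) - P x) / |k| with hΨ
  have hΨd : ∀ x, HasDerivAt Ψ ((ψ n (x - k) - ψ n x) / |k|) x := fun x =>
    (((hPd (x - k)).comp_sub_const x k).sub (hPd x)).div_const _
  have hΨc : ContDiff ℝ 1 Ψ := by
    refine contDiff_one_iff_deriv.2 ⟨fun x => (hΨd x).differentiableAt, ?_⟩
    rw [show deriv Ψ = fun x => (ψ n (x - k) - ψ n x) / |k| from funext fun x => (hΨd x).deriv]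
    have := hc.continuous
    fun_prop
  have hΨ1 : ∀ x, |Ψ x| ≤ 1 := fun x => by
    rw [hΨ]
    simp only
    rw [abs_div, abs_abs, div_le_one hk']
    have := lipschitz_of_hasDerivAt hPd h1 (x - k) x
    simpa using this
  obtain ⟨a, ha⟩ := hs.isCompact.isBounded.subset_closedBall 0
  have hz : ∀ x, a < |x| → ψ n x = 0 := fun x hx => by
    by_contra hne
    have := ha (subset_tsupport _ (Function.mem_support.2 hne))
    rw [mem_closedBall_zero_iff, Real.norm_eq_abs] at this
    linarith
  have hΨs : HasCompactSupport Ψ := by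
    refine HasCompactSupport.intro (isCompact_Icc (a := -(|a| + |k|)) (b := |a| + |k|)) fun x hx => ?_
    have : P (x - k) - P x = 0 := by
      rw [hP]
      simp only
      rw [intervalIntegral.integral_interval_sub_left (hint _ _) (hint _ _)]
      refine intervalIntegral.integral_zero_ae (Eventually.of_forall fun y hy => hz y ?_)
      have h4 : |y - x| ≤ |k| := by
        have := abs_sub_left_of_mem_uIcc (uIoc_subset_uIcc hy)
        simpa using this
      have h5 : |a| + |k| < |x| := by
        rw [mem_Icc, ← abs_le, not_le] at hx; exact hx
      have h6 := abs_sub_abs_le_abs_sub x y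
      rw [abs_sub_comm] at h6
      linarith [le_abs_self a]
    simp [hΨ, this]
  have key := integral_mul_deriv_le hN h hΨc hΨs hΨ1
  have e : ∫ x, u x * deriv Ψ x = (∫ x, u x * (ψ n (x - k) - ψ n x)) / |k| := by
    rw [← integral_div]
    refine integral_congr_ae (Eventually.of_forall fun x => ?_)
    simp only [(hΨd x).deriv, mul_div_assoc]
  rw [e, div_le_iff₀ hk', ← integral_shift_sub_mul hu hc.continuous h1] at key
  linarith

/-! ### Kruzhkov fluxes, densities and velocity fields -/

theorem abs_sign_le_one (x : ℝ) : |Real.sign x| ≤ 1 := by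
  rcases Real.sign_apply_eq x with h | h | h <;> simp [h]

theorem measurable_real_sign : Measurable Real.sign :=
  Measurable.ite measurableSet_Iio measurable_const
    (Measurable.ite measurableSet_Ioi measurable_const measurable_const)

/-- A flux factor on `[0, R]`. -/
structure IsFluxFactor (F : ℝ → ℝ) (R A : ℝ) : Prop where
  measurable : Measurable F
  R_pos : 0 < R
  A_nonneg : 0 ≤ A
  nonneg : ∀ s ∈ Icc 0 R, 0 ≤ F s
  le_self : ∀ s ∈ Icc 0 R, F s ≤ s
  lip : ∀ s ∈ Icc 0 R, ∀ r ∈ Icc 0 R, |F s - F r| ≤ A * |s - r|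
  at_R : F R = 0

/-- The Kruzhkov flux `sgn(a - b) (F(a) - F(b))`. -/
noncomputable def kruzFlux (F : ℝ → ℝ) (a b : ℝ) : ℝ := Real.sign (a - b) * (F a - F b)

theorem measurable_kruzFlux {X : Type*} [MeasurableSpace X] {F : ℝ → ℝ} (hF : Measurable F)
    {u w : X → ℝ} (hu : Measurable u) (hw : Measurable w) :
    Measurable fun x => kruzFlux F (u x) (w x) :=
  (measurable_real_sign.comp (hu.sub hw)).mul ((hF.comp hu).sub (hF.comp hw))

theorem kruzFlux_comm (F : ℝ → ℝ) (a b : ℝ) : kruzFlux F a b = kruzFlux F b a := by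
  rw [kruzFlux, kruzFlux, ← neg_sub b a, Real.sign_neg]; ring

namespace IsFluxFactor

variable {F : ℝ → ℝ} {R A : ℝ}

theorem abs_le (h : IsFluxFactor F R A) {s : ℝ} (hs : s ∈ Icc 0 R) : |F s| ≤ R := by
  rw [abs_of_nonneg (h.nonneg s hs)]; exact (h.le_self s hs).trans hs.2

theorem abs_kruzFlux_le (h : IsFluxFactor F R A) {a b : ℝ} (ha : a ∈ Icc 0 R)
    (hb : b ∈ Icc 0 R) : |kruzFlux F a b| ≤ A * |a - b| := by
  rw [kruzFlux, abs_mul]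
  exact (mul_le_of_le_one_left (abs_nonneg _) (abs_sign_le_one _)).trans (h.lip a ha b hb)

/-- The Kruzhkov flux keeps the Lipschitz constant of `F`. On one side of `b` the sign is constant.
If `b` separates `a` and `a'`, the bounds on the two pieces add up, since `|a - b| + |b - a'| = |a -
a'|`. -/
theorem kruzFlux_lip (h : IsFluxFactor F R A) {a a' b : ℝ} (ha : a ∈ Icc 0 R)
    (ha' : a' ∈ Icc 0 R) (hb : b ∈ Icc 0 R) :
    |kruzFlux F a b - kruzFlux F a' b| ≤ A * |a - a'| := by
  have key : ∀ {a a' : ℝ}, a ∈ Icc 0 R → a' ∈ Icc 0 R → a' ≤ a →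
      |kruzFlux F a b - kruzFlux F a' b| ≤ A * |a - a'| := by
    intro a a' ha ha' hle
    have h1 := _root_.abs_le.1 (h.lip a ha a' ha')
    have h2 := _root_.abs_le.1 (h.lip a ha b hb)
    have h3 := _root_.abs_le.1 (h.lip a' ha' b hb)
    have hA := h.A_nonneg
    rw [abs_of_nonneg (sub_nonneg.2 hle)] at *
    rw [_root_.abs_le]
    unfold kruzFlux
    rcases lt_trichotomy a b with hab | hab | hab
    · rw [Real.sign_of_neg (by linarith), Real.sign_of_neg (by linarith)]
      constructor <;> linarith
    · subst hab
      rcases hle.lt_or_eq with h' | h'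
      · rw [sub_self, Real.sign_zero, Real.sign_of_neg (by linarith)]
        constructor <;> linarith
      · simp [h']
    · rw [Real.sign_of_pos (by linarith)]
      rw [abs_of_pos (by linarith)] at h2
      rcases lt_trichotomy a' b with hab' | hab' | hab'
      · rw [Real.sign_of_neg (by linarith)]
        rw [abs_of_neg (by linarith)] at h3
        constructor <;> nlinarith
      · subst hab'
        rw [sub_self, Real.sign_zero]
        constructor <;> linarith
      · rw [Real.sign_of_pos (by linarith)]
        constructor <;> linarith
  rcases le_total a' a with hle | hle
  · exact key ha ha' hle
  · rw [abs_sub_comm, abs_sub_comm a]; exact key ha' ha hle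

end IsFluxFactor

/-- The integrand of the Kruzhkov inequality, with `a`, `b`, `d` the values of `∂ₜφ`, `∂ₓφ`, `φ`. -/
noncomputable def kruzIntegrand (F : ℝ → ℝ) (κ u V Vx a b d : ℝ) : ℝ :=
  |u - κ| * a + kruzFlux F u κ * V * b - Real.sign (u - κ) * F κ * Vx * d

/-- The integrand obtained by doubling variables. -/
noncomputable def pairIntegrand (F : ℝ → ℝ) (u w V W Vx Wx a b c d : ℝ) : ℝ :=
  |u - w| * a + kruzFlux F u w * (V * b + W * c + Vx * d) + F u * |Wx - Vx| * d

/-- A bounded velocity field, Lipschitz continuous in space, with its spatial derivative. -/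
structure IsVelocity (c Λ : ℝ) (V Vx : ℝ → ℝ → ℝ) : Prop where
  measurable : Measurable fun p : ℝ × ℝ => V p.1 p.2
  measurable_x : Measurable fun p : ℝ × ℝ => Vx p.1 p.2
  abs_le : ∀ t x, |V t x| ≤ c
  abs_x_le : ∀ t x, |Vx t x| ≤ Λ
  lip : ∀ t x y, |V t x - V t y| ≤ Λ * |x - y|
  hasDerivAt : ∀ t, ∀ᵐ x, HasDerivAt (V t) (Vx t x) x
  integrable_x : ∀ t, Integrable (Vx t)

/-- A measurable density with values in `[0, R]` and mass at most `M` at every time. -/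
structure IsDensity (R M : ℝ) (u : ℝ → ℝ → ℝ) : Prop where
  measurable : Measurable fun p : ℝ × ℝ => u p.1 p.2
  mem : ∀ t x, u t x ∈ Icc 0 R
  integrable : ∀ t, Integrable (u t)
  mass_le : ∀ t, ∫ x, u t x ≤ M

/-- The Kruzhkov inequality on `(-∞, T) × ℝ`, for product test functions. -/
def IsKruzkov (F : ℝ → ℝ) (R T : ℝ) (u V Vx : ℝ → ℝ → ℝ) : Prop :=
  ∀ κ ∈ Icc 0 R, ∀ α α' β β', IsTimeTest T α α' → IsTestFn β β' →
    0 ≤ ∫ p : ℝ × ℝ, kruzIntegrand F κ (u p.1 p.2) (V p.1 p.2) (Vx p.1 p.2)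
      (α' p.1 * β p.2) (α p.1 * β' p.2) (α p.1 * β p.2)

/-- A nonnegative `C¹` function of compact support on the plane, with its partial derivatives. -/
structure IsTestFn₂ (ψ ψx ψy : ℝ → ℝ → ℝ) : Prop where
  hasDeriv_x : ∀ x y, HasDerivAt (fun x => ψ x y) (ψx x y) x
  hasDeriv_y : ∀ x y, HasDerivAt (fun y => ψ x y) (ψy x y) y
  cont : Continuous fun z : ℝ × ℝ => ψ z.1 z.2
  cont_x : Continuous fun z : ℝ × ℝ => ψx z.1 z.2
  cont_y : Continuous fun z : ℝ × ℝ => ψy z.1 z.2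
  nonneg : ∀ x y, 0 ≤ ψ x y
  exists_bound : ∃ C : ℝ, 0 < C ∧ (∀ x y, |ψ x y| ≤ C ∧ |ψx x y| ≤ C ∧ |ψy x y| ≤ C) ∧
    ∀ x y, C < |x| ∨ C < |y| → ψ x y = 0 ∧ ψx x y = 0 ∧ ψy x y = 0

theorem IsTestFn₂.isTestFn_left {ψ ψx ψy : ℝ → ℝ → ℝ} (h : IsTestFn₂ ψ ψx ψy) (y : ℝ) :
    IsTestFn (fun x => ψ x y) (fun x => ψx x y) := by
  obtain ⟨C, _, _, hz⟩ := h.exists_bound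
  refine .of_bounded_support (a := -C) (b := C) (fun x => h.hasDeriv_x x y)
    (h.cont_x.comp (by fun_prop : Continuous fun x : ℝ => (x, y))) (fun x => h.nonneg x y)
    fun x hx => (hz x y (Or.inl ?_)).1
  rwa [mem_Icc, ← abs_le, not_le] at hx

theorem IsTestFn₂.isTestFn_right {ψ ψx ψy : ℝ → ℝ → ℝ} (h : IsTestFn₂ ψ ψx ψy) (x : ℝ) :
    IsTestFn (fun y => ψ x y) (fun y => ψy x y) := by
  obtain ⟨C, _, _, hz⟩ := h.exists_bound
  refine .of_bounded_support (a := -C) (b := C) (fun y => h.hasDeriv_y x y)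
    (h.cont_y.comp (by fun_prop : Continuous fun y : ℝ => (x, y))) (fun y => h.nonneg x y)
    fun y hy => (hz x y (Or.inr ?_)).1
  rwa [mem_Icc, ← abs_le, not_le] at hy

/-! ### Doubling of variables -/

section Integrable

variable {X : Type*} [MeasurableSpace X] {μ : Measure X} {F : ℝ → ℝ} {R A c Λ : ℝ}
  {u w V W Vx Wx a b d e : X → ℝ}

theorem integrable_kruzIntegrand (hF : IsFluxFactor F R A) (hu : Measurable u) (hw : Measurable w)
    (hV : Measurable V) (hVx : Measurable Vx) (hur : ∀ z, u z ∈ Icc 0 R)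
    (hwr : ∀ z, w z ∈ Icc 0 R) (hVb : ∀ z, |V z| ≤ c) (hVxb : ∀ z, |Vx z| ≤ Λ)
    (ha : Integrable a μ) (hb : Integrable b μ) (hd : Integrable d μ) :
    Integrable (fun z => kruzIntegrand F (w z) (u z) (V z) (Vx z) (a z) (b z) (d z)) μ := by
  have huw : ∀ z, |u z - w z| ≤ R := fun z => abs_sub_le_of_nonneg_of_le (hur z).1 (hur z).2
    (hwr z).1 (hwr z).2
  have hA := hF.A_nonneg
  refine ((ha.bdd_mul (c := R) ((hu.sub hw).abs).aestronglyMeasurable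
    (Eventually.of_forall fun z => ?_)).add (hb.bdd_mul (c := A * R * c)
      ((measurable_kruzFlux hF.measurable hu hw).mul hV).aestronglyMeasurable
      (Eventually.of_forall fun z => ?_))).sub (hd.bdd_mul (c := 1 * R * Λ)
      (((measurable_real_sign.comp (hu.sub hw)).mul (hF.measurable.comp hw)).mul
        hVx).aestronglyMeasurable (Eventually.of_forall fun z => ?_))
  · rw [Real.norm_eq_abs]; simpa using huw z
  · simp only [Real.norm_eq_abs, abs_mul, Pi.mul_apply]
    have h1 := hF.abs_kruzFlux_le (hur z) (hwr z)
    have h2 := mul_le_mul_of_nonneg_left (huw z) hA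
    exact mul_le_mul (h1.trans h2) (hVb z) (abs_nonneg _) ((abs_nonneg _).trans (h1.trans h2))
  · simp only [Real.norm_eq_abs, abs_mul]
    exact mul_le_mul (mul_le_mul (abs_sign_le_one _) (hF.abs_le (hwr z)) (abs_nonneg _)
      zero_le_one) (hVxb z) (abs_nonneg _) (by have := hF.R_pos; positivity)

theorem integrable_pairIntegrand (hF : IsFluxFactor F R A) (hu : Measurable u) (hw : Measurable w)
    (hV : Measurable V) (hW : Measurable W) (hVx : Measurable Vx) (hWx : Measurable Wx)
    (hur : ∀ z, u z ∈ Icc 0 R) (hwr : ∀ z, w z ∈ Icc 0 R) (hVb : ∀ z, |V z| ≤ c)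
    (hWb : ∀ z, |W z| ≤ c) (hVxb : ∀ z, |Vx z| ≤ Λ) (hWxb : ∀ z, |Wx z| ≤ Λ)
    (ha : Integrable a μ) (hb : Integrable b μ) (hd : Integrable d μ) (he : Integrable e μ) :
    Integrable (fun z => pairIntegrand F (u z) (w z) (V z) (W z) (Vx z) (Wx z)
      (a z) (b z) (d z) (e z)) μ := by
  have huw : ∀ z, |u z - w z| ≤ R := fun z => abs_sub_le_of_nonneg_of_le (hur z).1 (hur z).2
    (hwr z).1 (hwr z).2
  have hA := hF.A_nonneg
  refine ((ha.bdd_mul (c := R) ((hu.sub hw).abs).aestronglyMeasurable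
    (Eventually.of_forall fun z => ?_)).add (Integrable.bdd_mul (c := A * R)
      (((hb.bdd_mul (c := c) hV.aestronglyMeasurable (Eventually.of_forall hVb)).add
        (hd.bdd_mul (c := c) hW.aestronglyMeasurable (Eventually.of_forall hWb))).add
        (he.bdd_mul (c := Λ) hVx.aestronglyMeasurable (Eventually.of_forall hVxb)))
      (measurable_kruzFlux hF.measurable hu hw).aestronglyMeasurable
      (Eventually.of_forall fun z => ?_))).add (he.bdd_mul (c := R * (Λ + Λ))
      ((hF.measurable.comp hu).mul (hWx.sub hVx).abs).aestronglyMeasurable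
      (Eventually.of_forall fun z => ?_))
  · rw [Real.norm_eq_abs]; simpa using huw z
  · rw [Real.norm_eq_abs]
    exact (hF.abs_kruzFlux_le (hur z) (hwr z)).trans (mul_le_mul_of_nonneg_left (huw z) hA)
  · simp only [Real.norm_eq_abs, abs_mul]
    have : |(Wx - Vx) z| ≤ Λ + Λ := (abs_sub _ _).trans (add_le_add (hWxb z) (hVxb z))
    exact mul_le_mul (hF.abs_le (hur z)) (by simpa using this) (abs_nonneg _) hF.R_pos.le

end Integrable

/-- Adding the two Kruzhkov inequalities. -/
theorem kruzIntegrand_add_le {F : ℝ → ℝ} {R A : ℝ} (hF : IsFluxFactor F R A)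
    {u w V W Vx Wx θ θ' δ δ' ψ ψx ψy : ℝ} (hu : u ∈ Icc 0 R) (h0 : 0 ≤ θ * δ * ψ) :
    kruzIntegrand F w u V Vx ((θ' * δ - θ * δ') * ψ) (θ * δ * ψx) (θ * δ * ψ)
      + kruzIntegrand F u w W Wx (θ * δ' * ψ) (θ * δ * ψy) (θ * δ * ψ)
      ≤ pairIntegrand F u w V W Vx Wx (θ' * δ * ψ) (θ * δ * ψx) (θ * δ * ψy) (θ * δ * ψ) := by
  -- The source terms sum to `sgn(u - w) (F u * Wx - F w * Vx)`. This equals `kruzFlux F u w * Vx +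
  -- F u * sgn(u - w) * (Wx - Vx)`, and only the last summand is estimated. The terms with `δ'`
  -- cancel.
  have e : pairIntegrand F u w V W Vx Wx (θ' * δ * ψ) (θ * δ * ψx) (θ * δ * ψy) (θ * δ * ψ)
      - (kruzIntegrand F w u V Vx ((θ' * δ - θ * δ') * ψ) (θ * δ * ψx) (θ * δ * ψ)
      + kruzIntegrand F u w W Wx (θ * δ' * ψ) (θ * δ * ψy) (θ * δ * ψ))
      = F u * (|Wx - Vx| - Real.sign (u - w) * (Wx - Vx)) * (θ * δ * ψ) := by
    unfold kruzIntegrand pairIntegrand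
    rw [kruzFlux_comm F w u, abs_sub_comm w u, ← neg_sub u w, Real.sign_neg]
    unfold kruzFlux
    ring
  have h1 : Real.sign (u - w) * (Wx - Vx) ≤ |Wx - Vx| := by
    refine (le_abs_self _).trans ?_
    rw [abs_mul]
    exact mul_le_of_le_one_left (abs_nonneg _) (abs_sign_le_one _)
  have := mul_nonneg (mul_nonneg (hF.nonneg u hu) (sub_nonneg.2 h1)) h0
  linarith

/-- Only the data of the second solution change, as they do when its time is shifted; this is what
lets the two times merge in `tendsto_shiftIntegral`. The difference is split so that each summand
replaces `w`, `W` or `Wx` in one factor. -/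
theorem abs_pairIntegrand_sub_le {F : ℝ → ℝ} {R A c Λ B : ℝ} (hF : IsFluxFactor F R A)
    {u w w₁ V W W₁ Vx Wx Wx₁ a b d e : ℝ} (hu : u ∈ Icc 0 R) (hw : w ∈ Icc 0 R)
    (hw₁ : w₁ ∈ Icc 0 R) (hV : |V| ≤ c) (hW : |W₁| ≤ c) (hVx : |Vx| ≤ Λ)
    (ha : |a| ≤ B) (hb : |b| ≤ B) (hd : |d| ≤ B) (he : |e| ≤ B) :
    |pairIntegrand F u w₁ V W₁ Vx Wx₁ a b d e - pairIntegrand F u w V W Vx Wx a b d e|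
      ≤ B * ((1 + A * (2 * c + Λ)) * |w₁ - w| + A * R * |W₁ - W| + R * |Wx₁ - Wx|) := by
  have hB : 0 ≤ B := (abs_nonneg _).trans ha
  have hA := hF.A_nonneg
  have hR := hF.R_pos
  have huw : |u - w| ≤ R := abs_sub_le_of_nonneg_of_le hu.1 hu.2 hw.1 hw.2
  have e1 : pairIntegrand F u w₁ V W₁ Vx Wx₁ a b d e - pairIntegrand F u w V W Vx Wx a b d e
      = (|u - w₁| - |u - w|) * a
        + (kruzFlux F u w₁ - kruzFlux F u w) * (V * b + W₁ * d + Vx * e)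
        + kruzFlux F u w * ((W₁ - W) * d)
        + F u * ((|Wx₁ - Vx| - |Wx - Vx|) * e) := by
    unfold pairIntegrand; ring
  have t1 : |(|u - w₁| - |u - w|) * a| ≤ |w₁ - w| * B := by
    rw [abs_mul]
    refine mul_le_mul ?_ ha (abs_nonneg _) (abs_nonneg _)
    refine (abs_abs_sub_abs_le_abs_sub _ _).trans (le_of_eq ?_)
    rw [← abs_neg]; congr 1; ring
  have t2 : |(kruzFlux F u w₁ - kruzFlux F u w) * (V * b + W₁ * d + Vx * e)|
      ≤ A * |w₁ - w| * (c * B + c * B + Λ * B) := by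
    rw [abs_mul]
    refine mul_le_mul ?_ ?_ (abs_nonneg _) (by positivity)
    · rw [kruzFlux_comm F u, kruzFlux_comm F u]
      exact hF.kruzFlux_lip hw₁ hw hu
    · refine (abs_add_le _ _).trans (add_le_add ((abs_add_le _ _).trans (add_le_add ?_ ?_)) ?_) <;>
        rw [abs_mul]
      · exact mul_le_mul hV hb (abs_nonneg _) ((abs_nonneg _).trans hV)
      · exact mul_le_mul hW hd (abs_nonneg _) ((abs_nonneg _).trans hV)
      · exact mul_le_mul hVx he (abs_nonneg _) ((abs_nonneg _).trans hVx)
  have t3 : |kruzFlux F u w * ((W₁ - W) * d)| ≤ A * R * (|W₁ - W| * B) := by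
    rw [abs_mul, abs_mul]
    exact mul_le_mul ((hF.abs_kruzFlux_le hu hw).trans (mul_le_mul_of_nonneg_left huw hA))
      (mul_le_mul_of_nonneg_left hd (abs_nonneg _)) (by positivity) (by positivity)
  have t4 : |F u * ((|Wx₁ - Vx| - |Wx - Vx|) * e)| ≤ R * (|Wx₁ - Wx| * B) := by
    rw [abs_mul, abs_mul]
    refine mul_le_mul (hF.abs_le hu) (mul_le_mul ?_ he (abs_nonneg _) (abs_nonneg _))
      (by positivity) hR.le
    refine (abs_abs_sub_abs_le_abs_sub _ _).trans (le_of_eq ?_)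
    congr 1; ring
  rw [e1]
  refine (abs_add_le _ _).trans ((add_le_add ((abs_add_le _ _).trans (add_le_add
    ((abs_add_le _ _).trans (add_le_add t1 t2)) t3)) t4).trans (le_of_eq ?_))
  ring

/-- Continuity of translation in time for a bounded function, on a box. -/
theorem tendsto_box_translate {w : ℝ → ℝ → ℝ} (hw : Measurable fun p : ℝ × ℝ => w p.1 p.2) {c : ℝ}
    (hc : ∀ t x, |w t x| ≤ c) (a : ℝ) :
    (∀ h, Integrable ((Icc (-a) a ×ˢ (Icc (-a) a ×ˢ Icc (-a) a)).indicator
      fun q : ℝ × ℝ × ℝ => |w (q.2.1 + h) q.1 - w q.2.1 q.1|)) ∧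
    Tendsto (fun h => ∫ q : ℝ × ℝ × ℝ, (Icc (-a) a ×ˢ (Icc (-a) a ×ˢ Icc (-a) a)).indicator
      (fun q => |w (q.2.1 + h) q.1 - w q.2.1 q.1|) q) (𝓝 0) (𝓝 0) := by
  have hm : ∀ h, Measurable fun q : ℝ × ℝ × ℝ => w (q.2.1 + h) q.1 := fun h =>
    hw.comp (by fun_prop : Measurable fun q : ℝ × ℝ × ℝ => (q.2.1 + h, q.1))
  have hm0 : Measurable fun q : ℝ × ℝ × ℝ => w q.2.1 q.1 := by simpa using hm 0
  have hintg : ∀ {S : Set (ℝ × ℝ × ℝ)}, IsCompact S → ∀ {g : ℝ × ℝ × ℝ → ℝ}, Measurable g →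
      ∀ {b : ℝ}, (∀ q, |g q| ≤ b) → Integrable (S.indicator g) := by
    intro S hS g hg b hb
    rw [integrable_indicator_iff hS.measurableSet]
    have : IsFiniteMeasure ((volume : Measure (ℝ × ℝ × ℝ)).restrict S) :=
      ⟨by rw [Measure.restrict_apply_univ]; exact hS.measure_lt_top⟩
    exact (integrable_const b).mono' hg.aestronglyMeasurable (Eventually.of_forall hb)
  -- The box is enlarged by 1 in the time direction: for `|h| < 1` the shifted point stays inside
  -- it, and the indicator does not interfere.
  set S : Set (ℝ × ℝ × ℝ) := Icc (-a) a ×ˢ (Icc (-(a + 1)) (a + 1) ×ˢ Icc (-a) a) with hS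
  have hint : Integrable (S.indicator fun q => w q.2.1 q.1) :=
    hintg (isCompact_Icc.prod (isCompact_Icc.prod isCompact_Icc)) hm0 fun q => hc _ _
  have hT := (tendsto_integral_abs_translate_sub hint).comp
    (show Tendsto (fun h : ℝ => ((0 : ℝ), h, (0 : ℝ))) (𝓝 0) (𝓝 0) from
      (Continuous.tendsto (by fun_prop) 0))
  refine ⟨fun h => hintg (isCompact_Icc.prod (isCompact_Icc.prod isCompact_Icc))
    ((hm h).sub hm0).abs (b := c + c) fun q => by
      rw [abs_abs]; exact (abs_sub _ _).trans (add_le_add (hc _ _) (hc _ _)),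
    squeeze_zero' (Eventually.of_forall fun h => integral_nonneg fun q =>
      indicator_nonneg (fun _ _ => abs_nonneg _) q) ?_ hT⟩
  filter_upwards [Metric.ball_mem_nhds (0 : ℝ) one_pos] with h hh
  rw [mem_ball_zero_iff, Real.norm_eq_abs, abs_lt] at hh
  refine integral_mono_of_nonneg (Eventually.of_forall fun q =>
    indicator_nonneg (fun _ _ => abs_nonneg _) q) ((hint.comp_add_right _).sub hint).abs
    (Eventually.of_forall fun q => ?_)
  by_cases hq : q ∈ Icc (-a) a ×ˢ (Icc (-a) a ×ˢ Icc (-a) a)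
  · rw [indicator_of_mem hq]
    have h1 : q ∈ S := ⟨hq.1, ⟨by linarith [hq.2.1.1], by linarith [hq.2.1.2]⟩, hq.2.2⟩
    have h2 : q + (0, h, 0) ∈ S := by
      refine ⟨by simpa using hq.1, ⟨?_, ?_⟩, by simpa using hq.2.2⟩
      · simp only [Prod.fst_add, Prod.snd_add]; linarith [hq.2.1.1]
      · simp only [Prod.fst_add, Prod.snd_add]; linarith [hq.2.1.2]
    simp [indicator_of_mem h1, indicator_of_mem h2]
  · rw [indicator_of_notMem hq]
    positivity

theorem notMem_Icc_neg_iff {C x : ℝ} : x ∉ Icc (-C) C ↔ C < |x| := by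
  rw [mem_Icc, ← abs_le, not_le]

theorem integrable_of_continuous_of_box {g : (ℝ × ℝ) × (ℝ × ℝ) → ℝ} (hc : Continuous g) (C : ℝ)
    (hz : ∀ z : (ℝ × ℝ) × (ℝ × ℝ), C < |z.1.1| ∨ C < |z.1.2| ∨ C < |z.2.1| ∨ C < |z.2.2| →
      g z = 0) : Integrable g := by
  refine hc.integrable_of_hasCompactSupport (HasCompactSupport.intro
    (K := (Icc (-C) C ×ˢ Icc (-C) C) ×ˢ (Icc (-C) C ×ˢ Icc (-C) C))
    ((isCompact_Icc.prod isCompact_Icc).prod (isCompact_Icc.prod isCompact_Icc)) fun z hzK =>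
      hz z ?_)
  simp only [mem_prod, not_and_or, notMem_Icc_neg_iff] at hzK
  tauto

section Doubling

variable {F : ℝ → ℝ} {R A M M' c Λ T : ℝ} {u w V W Vx Wx : ℝ → ℝ → ℝ} {θ θ' δ δ' : ℝ → ℝ}
  {ψ ψx ψy : ℝ → ℝ → ℝ}

/-- The doubled integrand with the second time shifted by `h`. -/
noncomputable def shiftIntegrand (F : ℝ → ℝ) (u w V W Vx Wx : ℝ → ℝ → ℝ) (θ θ' : ℝ → ℝ)
    (ψ ψx ψy : ℝ → ℝ → ℝ) (h t x y : ℝ) : ℝ :=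
  pairIntegrand F (u t x) (w (t + h) y) (V t x) (W (t + h) y) (Vx t x) (Wx (t + h) y)
    (θ' t * ψ x y) (θ t * ψx x y) (θ t * ψy x y) (θ t * ψ x y)

theorem IsTimeTest.mul_shift (hθ : IsTimeTest T θ θ') (hδ : IsTestFn δ δ') (s : ℝ) :
    IsTimeTest T (fun t => θ t * δ (s - t)) (fun t => θ' t * δ (s - t) - θ t * δ' (s - t)) := by
  have h1 := hθ.cont'
  have h2 := hδ.continuous
  have h3 := hθ.continuous
  have h4 := hδ.cont'
  refine ⟨⟨fun t => ?_, by fun_prop, hθ.supp.mul_right, fun t =>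
    mul_nonneg (hθ.nonneg t) (hδ.nonneg _)⟩, ?_⟩
  · exact ((hθ.hasDeriv t).fun_mul ((hδ.hasDeriv (s - t)).comp_const_sub s t)).congr_deriv (by ring)
  · obtain ⟨b, hb, hz⟩ := hθ.zero_of_le
    exact ⟨b, hb, fun t ht => by simp [hz t ht]⟩

/-- As a function of the second time `s`, the product lives within `r` of `t`, and it vanishes
altogether for `t ≥ b`. Its support therefore ends at `b + r`, which must stay below `T`. -/
theorem IsTimeTest.mul_shift' {b r : ℝ} (hθ : IsTimeTest T θ θ') (hb : ∀ t, b ≤ t → θ t = 0)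
    (hδ : IsTestFn δ δ') (hr : ∀ x, r ≤ |x| → δ x = 0) (hbr : b + r < T) (t : ℝ) :
    IsTimeTest T (fun s => θ t * δ (s - t)) (fun s => θ t * δ' (s - t)) := by
  have h4 := hδ.cont'
  refine ⟨⟨fun s => ((hδ.hasDeriv (s - t)).comp_sub_const s t).const_mul _, by fun_prop,
    (hδ.comp_sub_right t).supp.mul_left, fun s => mul_nonneg (hθ.nonneg t) (hδ.nonneg _)⟩,
    b + r, hbr, fun s hs => ?_⟩
  rcases le_or_gt b t with h | h
  · simp [hb t h]
  · rw [hr (s - t) ((by linarith : r ≤ s - t).trans (le_abs_self _)), mul_zero]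

/-- For a frozen point `(s, y)` the value `w(s, y)` is an admissible constant in the inequality for
`u`, and conversely. Both are tested with `θ(t) δ(s - t) ψ(x, y)`, integrated over the frozen point
and added. With one point frozen this is a function of time multiplied by one of space, so product
test functions suffice although `ψ` is not a product. -/
theorem doubling_integral_nonneg (hF : IsFluxFactor F R A) (hu : IsDensity R M u)
    (hw : IsDensity R M' w) (hV : IsVelocity c Λ V Vx) (hW : IsVelocity c Λ W Wx)
    (ku : IsKruzkov F R T u V Vx) (kw : IsKruzkov F R T w W Wx) (hθ : IsTimeTest T θ θ')
    (hδ : IsTestFn δ δ') {b r : ℝ} (hb : ∀ t, b ≤ t → θ t = 0) (hr : ∀ x, r ≤ |x| → δ x = 0)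
    (hbr : b + r < T) (hψ : IsTestFn₂ ψ ψx ψy) :
    0 ≤ ∫ z : (ℝ × ℝ) × (ℝ × ℝ), pairIntegrand F (u z.1.1 z.1.2) (w z.2.1 z.2.2)
      (V z.1.1 z.1.2) (W z.2.1 z.2.2) (Vx z.1.1 z.1.2) (Wx z.2.1 z.2.2)
      (θ' z.1.1 * δ (z.2.1 - z.1.1) * ψ z.1.2 z.2.2)
      (θ z.1.1 * δ (z.2.1 - z.1.1) * ψx z.1.2 z.2.2)
      (θ z.1.1 * δ (z.2.1 - z.1.1) * ψy z.1.2 z.2.2)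
      (θ z.1.1 * δ (z.2.1 - z.1.1) * ψ z.1.2 z.2.2) := by
  obtain ⟨C₁, hC₁, -, -, hθz, hθz'⟩ := hθ.exists_bound
  obtain ⟨C₂, hC₂, -, -, hδz, hδz'⟩ := hδ.exists_bound
  obtain ⟨C₃, hC₃, -, hψz⟩ := hψ.exists_bound
  have hθc := hθ.continuous
  have hθc' := hθ.cont'
  have hδc := hδ.continuous
  have hδc' := hδ.cont'
  have hpr : Continuous fun z : (ℝ × ℝ) × (ℝ × ℝ) => (z.1.2, z.2.2) := by fun_prop
  have hψc := hψ.cont.comp hpr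
  have hψxc := hψ.cont_x.comp hpr
  have hψyc := hψ.cont_y.comp hpr
  simp only [Function.comp_def] at hψc hψxc hψyc
  have hsupp : ∀ (ψ₁ : ℝ → ℝ → ℝ) (τ : ℝ → ℝ → ℝ),
      (∀ x y, C₃ < |x| ∨ C₃ < |y| → ψ₁ x y = 0) →
      (∀ t s, C₁ < |t| ∨ C₂ < |s - t| → τ t s = 0) →
      (Continuous fun z : (ℝ × ℝ) × (ℝ × ℝ) => ψ₁ z.1.2 z.2.2) →
      (Continuous fun z : (ℝ × ℝ) × (ℝ × ℝ) => τ z.1.1 z.2.1) →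
      Integrable fun z : (ℝ × ℝ) × (ℝ × ℝ) => τ z.1.1 z.2.1 * ψ₁ z.1.2 z.2.2 := by
    intro ψ₁ τ h1 h2 hc1 hc2
    refine integrable_of_continuous_of_box (hc2.mul hc1) (C₁ + C₂ + C₃) fun z hz => ?_
    rcases hz with h | h | h | h
    · rw [h2 _ _ (Or.inl (by linarith)), zero_mul]
    · rw [h1 _ _ (Or.inl (by linarith)), mul_zero]
    · rw [h2 _ _, zero_mul]
      by_contra! hcon
      have := abs_add_le (z.2.1 - z.1.1) z.1.1
      rw [sub_add_cancel] at this
      linarith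
    · rw [h1 _ _ (Or.inr (by linarith)), mul_zero]
  have iψt := hsupp ψ (fun t s => θ' t * δ (s - t) - θ t * δ' (s - t))
    (fun x y h => (hψz x y h).1) (fun t s h => by
      rcases h with h | h
      · simp [hθz t h, hθz' t h]
      · simp [hδz _ h, hδz' _ h]) hψc (by fun_prop)
  have iψt2 := hsupp ψ (fun t s => θ t * δ' (s - t)) (fun x y h => (hψz x y h).1) (fun t s h => by
      rcases h with h | h
      · simp [hθz t h]
      · simp [hδz' _ h]) hψc (by fun_prop)
  have iψt3 := hsupp ψ (fun t s => θ' t * δ (s - t)) (fun x y h => (hψz x y h).1) (fun t s h => by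
      rcases h with h | h
      · simp [hθz' t h]
      · simp [hδz _ h]) hψc (by fun_prop)
  have hz0 : ∀ t s, C₁ < |t| ∨ C₂ < |s - t| → θ t * δ (s - t) = 0 := fun t s h => by
    rcases h with h | h
    · simp [hθz t h]
    · simp [hδz _ h]
  have iψ := hsupp ψ (fun t s => θ t * δ (s - t)) (fun x y h => (hψz x y h).1) hz0 hψc (by fun_prop)
  have iψx := hsupp ψx (fun t s => θ t * δ (s - t)) (fun x y h => (hψz x y h).2.1) hz0 hψxc (by fun_prop)
  have iψy := hsupp ψy (fun t s => θ t * δ (s - t)) (fun x y h => (hψz x y h).2.2) hz0 hψyc (by fun_prop)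
  have m1 : ∀ {f : ℝ → ℝ → ℝ}, (Measurable fun p : ℝ × ℝ => f p.1 p.2) →
      Measurable fun z : (ℝ × ℝ) × (ℝ × ℝ) => f z.1.1 z.1.2 := fun h => h.comp measurable_fst
  have m2 : ∀ {f : ℝ → ℝ → ℝ}, (Measurable fun p : ℝ × ℝ => f p.1 p.2) →
      Measurable fun z : (ℝ × ℝ) × (ℝ × ℝ) => f z.2.1 z.2.2 := fun h => h.comp measurable_snd
  have I1 := integrable_kruzIntegrand (μ := volume) hF (m1 hu.measurable) (m2 hw.measurable)
    (m1 hV.measurable) (m1 hV.measurable_x) (fun z => hu.mem _ _) (fun z => hw.mem _ _)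
    (fun z => hV.abs_le _ _) (fun z => hV.abs_x_le _ _) iψt iψx iψ
  have I2 := integrable_kruzIntegrand (μ := volume) hF (m2 hw.measurable) (m1 hu.measurable)
    (m2 hW.measurable) (m2 hW.measurable_x) (fun z => hw.mem _ _) (fun z => hu.mem _ _)
    (fun z => hW.abs_le _ _) (fun z => hW.abs_x_le _ _) iψt2 iψy iψ
  have I3 := integrable_pairIntegrand (μ := volume) hF (m1 hu.measurable) (m2 hw.measurable)
    (m1 hV.measurable) (m2 hW.measurable) (m1 hV.measurable_x) (m2 hW.measurable_x)
    (fun z => hu.mem _ _) (fun z => hw.mem _ _) (fun z => hV.abs_le _ _) (fun z => hW.abs_le _ _)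
    (fun z => hV.abs_x_le _ _) (fun z => hW.abs_x_le _ _) iψt3 iψx iψy iψ
  have P1 := integral_prod_symm _ I1
  have P2 := integral_prod _ I2
  have N1 : 0 ≤ ∫ p' : ℝ × ℝ, ∫ p : ℝ × ℝ, kruzIntegrand F (w p'.1 p'.2) (u p.1 p.2) (V p.1 p.2)
      (Vx p.1 p.2) ((θ' p.1 * δ (p'.1 - p.1) - θ p.1 * δ' (p'.1 - p.1)) * ψ p.2 p'.2)
      (θ p.1 * δ (p'.1 - p.1) * ψx p.2 p'.2) (θ p.1 * δ (p'.1 - p.1) * ψ p.2 p'.2) :=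
    integral_nonneg fun p' => ku _ (hw.mem _ _) _ _ _ _ (hθ.mul_shift hδ p'.1)
      (hψ.isTestFn_left p'.2)
  have N2 : 0 ≤ ∫ p : ℝ × ℝ, ∫ p' : ℝ × ℝ, kruzIntegrand F (u p.1 p.2) (w p'.1 p'.2) (W p'.1 p'.2)
      (Wx p'.1 p'.2) (θ p.1 * δ' (p'.1 - p.1) * ψ p.2 p'.2)
      (θ p.1 * δ (p'.1 - p.1) * ψy p.2 p'.2) (θ p.1 * δ (p'.1 - p.1) * ψ p.2 p'.2) :=
    integral_nonneg fun p => kw _ (hu.mem _ _) _ _ _ _ (hθ.mul_shift' hb hδ hr hbr p.1)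
      (hψ.isTestFn_right p.2)
  have h12 := add_nonneg (P1.symm ▸ N1) (P2.symm ▸ N2)
  refine h12.trans ?_
  refine (integral_add I1 I2).symm.le.trans (integral_mono (I1.add I2) I3 fun z => ?_)
  exact kruzIntegrand_add_le hF (hu.mem _ _)
    (mul_nonneg (mul_nonneg (hθ.nonneg _) (hδ.nonneg _)) (hψ.nonneg _ _))

end Doubling

section Doubling

variable {F : ℝ → ℝ} {R A M M' c Λ T : ℝ} {u w V W Vx Wx : ℝ → ℝ → ℝ} {θ θ' δ δ' : ℝ → ℝ}
  {ψ ψx ψy : ℝ → ℝ → ℝ}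

theorem mul_pairIntegrand (F : ℝ → ℝ) (k u w V W Vx Wx a b c d : ℝ) :
    k * pairIntegrand F u w V W Vx Wx a b c d
      = pairIntegrand F u w V W Vx Wx (k * a) (k * b) (k * c) (k * d) := by
  unfold pairIntegrand; ring

theorem integrable_test_mul {ψ₁ : ℝ → ℝ → ℝ} {ϑ : ℝ → ℝ} (hϑ : Continuous ϑ)
    (hϑz : ∃ C, ∀ t, C < |t| → ϑ t = 0)
    (hc : Continuous fun z : ℝ × ℝ => ψ₁ z.1 z.2)
    (hz : ∃ C, ∀ x y, C < |x| ∨ C < |y| → ψ₁ x y = 0) :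
    Integrable (fun q : ℝ × (ℝ × ℝ) => ϑ q.2.1 * ψ₁ q.2.2 q.1) := by
  obtain ⟨C₁, h1⟩ := hϑz
  obtain ⟨C₂, h2⟩ := hz
  have hc' : Continuous fun q : ℝ × (ℝ × ℝ) => ψ₁ q.2.2 q.1 :=
    hc.comp (by fun_prop : Continuous fun q : ℝ × (ℝ × ℝ) => (q.2.2, q.1))
  refine Continuous.integrable_of_hasCompactSupport (by fun_prop) (HasCompactSupport.intro
    (K := Icc (-C₂) C₂ ×ˢ (Icc (-C₁) C₁ ×ˢ Icc (-C₂) C₂))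
    (isCompact_Icc.prod (isCompact_Icc.prod isCompact_Icc)) fun z hzK => ?_)
  simp only [mem_prod, not_and_or, notMem_Icc_neg_iff] at hzK
  rcases hzK with h | h | h
  · rw [h2 _ _ (Or.inr h), mul_zero]
  · rw [h1 _ h, zero_mul]
  · rw [h2 _ _ (Or.inl h), mul_zero]

theorem integrable_shiftIntegrand (hF : IsFluxFactor F R A) (hu : IsDensity R M u)
    (hw : IsDensity R M' w) (hV : IsVelocity c Λ V Vx) (hW : IsVelocity c Λ W Wx)
    (hθ : IsTestFn θ θ') (hψ : IsTestFn₂ ψ ψx ψy) (h : ℝ) :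
    Integrable fun q : ℝ × (ℝ × ℝ) =>
      shiftIntegrand F u w V W Vx Wx θ θ' ψ ψx ψy h q.2.1 q.2.2 q.1 := by
  obtain ⟨C₁, -, -, -, hθz, hθz'⟩ := hθ.exists_bound
  obtain ⟨C₃, -, -, hψz⟩ := hψ.exists_bound
  have m1 : ∀ {f : ℝ → ℝ → ℝ}, (Measurable fun p : ℝ × ℝ => f p.1 p.2) →
      Measurable fun q : ℝ × (ℝ × ℝ) => f q.2.1 q.2.2 := fun h => h.comp measurable_snd
  have m2 : ∀ {f : ℝ → ℝ → ℝ}, (Measurable fun p : ℝ × ℝ => f p.1 p.2) →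
      Measurable fun q : ℝ × (ℝ × ℝ) => f (q.2.1 + h) q.1 := fun h' =>
    h'.comp (by fun_prop : Measurable fun q : ℝ × (ℝ × ℝ) => (q.2.1 + h, q.1))
  exact integrable_pairIntegrand (μ := volume) hF (m1 hu.measurable) (m2 hw.measurable)
    (m1 hV.measurable) (m2 hW.measurable) (m1 hV.measurable_x) (m2 hW.measurable_x)
    (fun z => hu.mem _ _) (fun z => hw.mem _ _) (fun z => hV.abs_le _ _) (fun z => hW.abs_le _ _)
    (fun z => hV.abs_x_le _ _) (fun z => hW.abs_x_le _ _)
    (integrable_test_mul hθ.cont' ⟨C₁, hθz'⟩ hψ.cont ⟨C₃, fun x y h => (hψz x y h).1⟩)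
    (integrable_test_mul hθ.continuous ⟨C₁, hθz⟩ hψ.cont_x ⟨C₃, fun x y h => (hψz x y h).2.1⟩)
    (integrable_test_mul hθ.continuous ⟨C₁, hθz⟩ hψ.cont_y ⟨C₃, fun x y h => (hψz x y h).2.2⟩)
    (integrable_test_mul hθ.continuous ⟨C₁, hθz⟩ hψ.cont ⟨C₃, fun x y h => (hψz x y h).1⟩)

/-- Integral of the doubled integrand at time shift `h`. -/
noncomputable def shiftIntegral (F : ℝ → ℝ) (u w V W Vx Wx : ℝ → ℝ → ℝ) (θ θ' : ℝ → ℝ)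
    (ψ ψx ψy : ℝ → ℝ → ℝ) (h : ℝ) : ℝ :=
  ∫ q : ℝ × (ℝ × ℝ), shiftIntegrand F u w V W Vx Wx θ θ' ψ ψx ψy h q.2.1 q.2.2 q.1

/-- The substitution `s = t + h` and Fubini exhibit the doubled integral as an average over the time
shift `h` with weight `δ`. -/
theorem integral_mul_shiftIntegral (hF : IsFluxFactor F R A) (hu : IsDensity R M u)
    (hw : IsDensity R M' w) (hV : IsVelocity c Λ V Vx) (hW : IsVelocity c Λ W Wx)
    (hθ : IsTestFn θ θ') (hδ : IsTestFn δ δ') (hψ : IsTestFn₂ ψ ψx ψy) :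
    Integrable (fun h => δ h * shiftIntegral F u w V W Vx Wx θ θ' ψ ψx ψy h) ∧
    ∫ z : (ℝ × ℝ) × (ℝ × ℝ), pairIntegrand F (u z.1.1 z.1.2) (w z.2.1 z.2.2)
      (V z.1.1 z.1.2) (W z.2.1 z.2.2) (Vx z.1.1 z.1.2) (Wx z.2.1 z.2.2)
      (θ' z.1.1 * δ (z.2.1 - z.1.1) * ψ z.1.2 z.2.2)
      (θ z.1.1 * δ (z.2.1 - z.1.1) * ψx z.1.2 z.2.2)
      (θ z.1.1 * δ (z.2.1 - z.1.1) * ψy z.1.2 z.2.2)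
      (θ z.1.1 * δ (z.2.1 - z.1.1) * ψ z.1.2 z.2.2)
      = ∫ h, δ h * shiftIntegral F u w V W Vx Wx θ θ' ψ ψx ψy h := by
  obtain ⟨C₁, hC₁, -, -, hθz, hθz'⟩ := hθ.exists_bound
  obtain ⟨C₂, hC₂, -, -, hδz, hδz'⟩ := hδ.exists_bound
  obtain ⟨C₃, hC₃, -, hψz⟩ := hψ.exists_bound
  have hθc := hθ.continuous
  have hθc' := hθ.cont'
  have hδc := hδ.continuous
  have hpr : Continuous fun z : (ℝ × ℝ) × (ℝ × ℝ) => (z.1.2, z.2.2) := by fun_prop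
  have hψc := hψ.cont.comp hpr
  have hψxc := hψ.cont_x.comp hpr
  have hψyc := hψ.cont_y.comp hpr
  simp only [Function.comp_def] at hψc hψxc hψyc
  have m1 : ∀ {f : ℝ → ℝ → ℝ}, (Measurable fun p : ℝ × ℝ => f p.1 p.2) →
      Measurable fun z : (ℝ × ℝ) × (ℝ × ℝ) => f z.1.1 z.1.2 := fun h => h.comp measurable_fst
  have m2 : ∀ {f : ℝ → ℝ → ℝ}, (Measurable fun p : ℝ × ℝ => f p.1 p.2) →
      Measurable fun z : (ℝ × ℝ) × (ℝ × ℝ) => f z.2.1 z.2.2 := fun h => h.comp measurable_snd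
  have m3 : ∀ {f : ℝ → ℝ → ℝ}, (Measurable fun p : ℝ × ℝ => f p.1 p.2) →
      Measurable fun z : (ℝ × ℝ) × (ℝ × ℝ) => f (z.1.1 + z.2.1) z.2.2 := fun h =>
    h.comp (by fun_prop : Measurable fun z : (ℝ × ℝ) × (ℝ × ℝ) => (z.1.1 + z.2.1, z.2.2))
  have hsupp : ∀ (ψ₁ : ℝ → ℝ → ℝ) (ϑ : ℝ → ℝ), Continuous ϑ →
      (∀ x y, C₃ < |x| ∨ C₃ < |y| → ψ₁ x y = 0) → (∀ t, C₁ < |t| → ϑ t = 0) →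
      (Continuous fun z : (ℝ × ℝ) × (ℝ × ℝ) => ψ₁ z.1.2 z.2.2) →
      (Integrable fun z : (ℝ × ℝ) × (ℝ × ℝ) => ϑ z.1.1 * δ (z.2.1 - z.1.1) * ψ₁ z.1.2 z.2.2) ∧
      Integrable fun z : (ℝ × ℝ) × (ℝ × ℝ) => δ z.2.1 * (ϑ z.1.1 * ψ₁ z.1.2 z.2.2) := by
    intro ψ₁ ϑ hϑ h1 h2 hc1
    constructor
    · refine integrable_of_continuous_of_box (Continuous.mul (by fun_prop) hc1) (C₁ + C₂ + C₃) fun z hz => ?_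
      rcases hz with h | h | h | h
      · rw [h2 _ (by linarith), zero_mul, zero_mul]
      · rw [h1 _ _ (Or.inl (by linarith)), mul_zero]
      · rcases lt_or_ge C₁ |z.1.1| with h' | h'
        · rw [h2 _ h', zero_mul, zero_mul]
        · have := abs_add_le (z.2.1 - z.1.1) z.1.1
          rw [sub_add_cancel] at this
          rw [hδz _ (by linarith), mul_zero, zero_mul]
      · rw [h1 _ _ (Or.inr (by linarith)), mul_zero]
    · refine integrable_of_continuous_of_box (Continuous.mul (by fun_prop)
        (Continuous.mul (by fun_prop) hc1)) (C₁ + C₂ + C₃) fun z hz => ?_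
      rcases hz with h | h | h | h
      · rw [h2 _ (by linarith), zero_mul, mul_zero]
      · rw [h1 _ _ (Or.inl (by linarith)), mul_zero, mul_zero]
      · rw [hδz _ (by linarith), zero_mul]
      · rw [h1 _ _ (Or.inr (by linarith)), mul_zero, mul_zero]
  obtain ⟨a1, b1⟩ := hsupp ψ θ' hθc' (fun x y h => (hψz x y h).1) hθz' hψc
  obtain ⟨a2, b2⟩ := hsupp ψx θ hθc (fun x y h => (hψz x y h).2.1) hθz hψxc
  obtain ⟨a3, b3⟩ := hsupp ψy θ hθc (fun x y h => (hψz x y h).2.2) hθz hψyc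
  obtain ⟨a4, b4⟩ := hsupp ψ θ hθc (fun x y h => (hψz x y h).1) hθz hψc
  have I1 := integrable_pairIntegrand (μ := volume) hF (m1 hu.measurable) (m2 hw.measurable)
    (m1 hV.measurable) (m2 hW.measurable) (m1 hV.measurable_x) (m2 hW.measurable_x)
    (fun z => hu.mem _ _) (fun z => hw.mem _ _) (fun z => hV.abs_le _ _) (fun z => hW.abs_le _ _)
    (fun z => hV.abs_x_le _ _) (fun z => hW.abs_x_le _ _) a1 a2 a3 a4
  have I2 := integrable_pairIntegrand (μ := volume) hF (m1 hu.measurable) (m3 hw.measurable)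
    (m1 hV.measurable) (m3 hW.measurable) (m1 hV.measurable_x) (m3 hW.measurable_x)
    (fun z => hu.mem _ _) (fun z => hw.mem _ _) (fun z => hV.abs_le _ _) (fun z => hW.abs_le _ _)
    (fun z => hV.abs_x_le _ _) (fun z => hW.abs_x_le _ _) b1 b2 b3 b4
  have hg : ∀ h, ∫ y, ∫ p : ℝ × ℝ, pairIntegrand F (u p.1 p.2) (w (p.1 + h) y) (V p.1 p.2)
      (W (p.1 + h) y) (Vx p.1 p.2) (Wx (p.1 + h) y) (δ h * (θ' p.1 * ψ p.2 y))
      (δ h * (θ p.1 * ψx p.2 y)) (δ h * (θ p.1 * ψy p.2 y)) (δ h * (θ p.1 * ψ p.2 y))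
      = δ h * shiftIntegral F u w V W Vx Wx θ θ' ψ ψx ψy h := fun h => by
    simp_rw [← mul_pairIntegrand, integral_const_mul]
    congr 1
    exact (integral_prod _ (integrable_shiftIntegrand hF hu hw hV hW hθ hψ h)).symm
  have I3 := I2.integral_prod_right
  refine ⟨I3.integral_prod_left.congr (Eventually.of_forall hg), ?_⟩
  calc _ = _ := integral_prod _ I1
    _ = ∫ p : ℝ × ℝ, ∫ p' : ℝ × ℝ, pairIntegrand F (u p.1 p.2) (w (p.1 + p'.1) p'.2) (V p.1 p.2)
      (W (p.1 + p'.1) p'.2) (Vx p.1 p.2) (Wx (p.1 + p'.1) p'.2) (δ p'.1 * (θ' p.1 * ψ p.2 p'.2))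
      (δ p'.1 * (θ p.1 * ψx p.2 p'.2)) (δ p'.1 * (θ p.1 * ψy p.2 p'.2))
      (δ p'.1 * (θ p.1 * ψ p.2 p'.2)) := by
        refine integral_congr_ae (Eventually.of_forall fun p => ?_)
        simp only
        rw [← integral_add_right_eq_self _ ((p.1, 0) : ℝ × ℝ)]
        refine integral_congr_ae (Eventually.of_forall fun p' => ?_)
        simp only [Prod.fst_add, Prod.snd_add, add_zero, add_sub_cancel_right]
        rw [add_comm p'.1 p.1]
        congr 1 <;> ring
    _ = _ := (integral_prod _ I2).symm
    _ = _ := integral_prod_symm _ I2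
    _ = _ := integral_prod _ I3
    _ = _ := integral_congr_ae (Eventually.of_forall hg)

end Doubling

section Doubling

variable {F : ℝ → ℝ} {R A M M' c Λ T : ℝ} {u w V W Vx Wx : ℝ → ℝ → ℝ} {θ θ' δ δ' : ℝ → ℝ}
  {ψ ψx ψy : ℝ → ℝ → ℝ}

/-- The integrand is Lipschitz in `w`, `W` and `Wx`, and a box contains the supports of the test
functions. Continuity of translation in `L¹` on that box suffices, so neither solution needs to be
continuous in time. -/
theorem tendsto_shiftIntegral (hF : IsFluxFactor F R A) (hu : IsDensity R M u)
    (hw : IsDensity R M' w) (hV : IsVelocity c Λ V Vx) (hW : IsVelocity c Λ W Wx)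
    (hθ : IsTestFn θ θ') (hψ : IsTestFn₂ ψ ψx ψy) :
    Tendsto (shiftIntegral F u w V W Vx Wx θ θ' ψ ψx ψy) (𝓝 0)
      (𝓝 (shiftIntegral F u w V W Vx Wx θ θ' ψ ψx ψy 0)) := by
  obtain ⟨C₁, hC₁, hθb, hθb', hθz, hθz'⟩ := hθ.exists_bound
  obtain ⟨C₃, hC₃, hψb, hψz⟩ := hψ.exists_bound
  set a := C₁ + C₃ with ha
  set B := C₁ * C₃ with hB
  obtain ⟨i1, l1⟩ := tendsto_box_translate hw.measurable (c := R)
    (fun t x => by rw [abs_of_nonneg (hw.mem t x).1]; exact (hw.mem t x).2) a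
  obtain ⟨i2, l2⟩ := tendsto_box_translate hW.measurable hW.abs_le a
  obtain ⟨i3, l3⟩ := tendsto_box_translate hW.measurable_x hW.abs_x_le a
  set S : Set (ℝ × ℝ × ℝ) := Icc (-a) a ×ˢ (Icc (-a) a ×ˢ Icc (-a) a) with hS
  rw [tendsto_iff_norm_sub_tendsto_zero]
  have hlim := ((((l1.const_mul (1 + A * (2 * c + Λ))).add (l2.const_mul (A * R))).add
    (l3.const_mul R))).const_mul B
  simp only [mul_zero, add_zero] at hlim
  refine squeeze_zero (fun h => norm_nonneg _) (fun h => ?_) hlim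
  have j1 := ((((i1 h).const_mul (1 + A * (2 * c + Λ))).add ((i2 h).const_mul (A * R))).add
    ((i3 h).const_mul R)).const_mul B
  have I0 := integrable_shiftIntegrand hF hu hw hV hW hθ hψ 0
  have Ih := integrable_shiftIntegrand hF hu hw hV hW hθ hψ h
  unfold shiftIntegral
  rw [← integral_sub Ih I0, Real.norm_eq_abs]
  refine abs_integral_le_integral_abs.trans ((integral_mono (Ih.sub I0).abs j1 fun q => ?_).trans
    (le_of_eq ?_))
  · simp only [Pi.sub_apply, Pi.add_apply]
    by_cases hq : q ∈ S
    · simp only [indicator_of_mem hq]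
      unfold shiftIntegrand
      simp only [add_zero]
      have hab : ∀ {x y : ℝ}, |x| ≤ C₁ → |y| ≤ C₃ → |x * y| ≤ B := fun hx hy => by
        rw [abs_mul]; exact mul_le_mul hx hy (abs_nonneg _) hC₁.le
      obtain ⟨h1, h2, h3⟩ := hψb q.2.2 q.1
      exact abs_pairIntegrand_sub_le hF (hu.mem _ _) (hw.mem _ _) (hw.mem _ _) (hV.abs_le _ _)
        (hW.abs_le _ _) (hV.abs_x_le _ _) (hab (hθb' _) h1) (hab (hθb _) h2) (hab (hθb _) h3)
        (hab (hθb _) h1)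
    · simp only [indicator_of_notMem hq]
      have hz : ∀ h, shiftIntegrand F u w V W Vx Wx θ θ' ψ ψx ψy h q.2.1 q.2.2 q.1 = 0 := fun h => by
        unfold shiftIntegrand pairIntegrand
        simp only [hS, mem_prod, not_and_or, notMem_Icc_neg_iff] at hq
        rcases hq with h | h | h
        · obtain ⟨e1, e2, e3⟩ := hψz q.2.2 q.1 (Or.inr (by linarith))
          simp [e1, e2, e3]
        · simp [hθz _ (by linarith : C₁ < |q.2.1|), hθz' _ (by linarith : C₁ < |q.2.1|)]
        · obtain ⟨e1, e2, e3⟩ := hψz q.2.2 q.1 (Or.inl (by linarith))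
          simp [e1, e2, e3]
      simp [hz]
  · rw [integral_const_mul]
    congr 1
    rw [← integral_const_mul, ← integral_const_mul, ← integral_const_mul, ← integral_add,
      ← integral_add]
    · rfl
    · exact ((i1 h).const_mul _).add ((i2 h).const_mul _)
    · exact (i3 h).const_mul _
    · exact (i1 h).const_mul _
    · exact (i2 h).const_mul _

/-- Were the value at 0 negative, the integral would be below half of it for all small shifts, and
averaging against a mollifier concentrated there would contradict `doubling_integral_nonneg`. The
radius of the mollifier is also kept below `T - b`, so that the second time stays before `T`. -/
theorem shiftIntegral_zero_nonneg (hF : IsFluxFactor F R A) (hu : IsDensity R M u)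
    (hw : IsDensity R M' w) (hV : IsVelocity c Λ V Vx) (hW : IsVelocity c Λ W Wx)
    (ku : IsKruzkov F R T u V Vx) (kw : IsKruzkov F R T w W Wx) (hθ : IsTimeTest T θ θ')
    (hψ : IsTestFn₂ ψ ψx ψy) : 0 ≤ shiftIntegral F u w V W Vx Wx θ θ' ψ ψx ψy 0 := by
  by_contra! hneg
  set g := shiftIntegral F u w V W Vx Wx θ θ' ψ ψx ψy with hg
  obtain ⟨b, hb, hbz⟩ := hθ.zero_of_le
  have hev := (tendsto_shiftIntegral hF hu hw hV hW hθ.toIsTestFn hψ).eventually_lt_const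
    (by linarith : g 0 < g 0 / 2)
  obtain ⟨ε, hε, hball⟩ := Metric.eventually_nhds_iff_ball.1 hev
  obtain ⟨n, hn⟩ := (tendsto_moll_radius.eventually_lt_const
    (lt_min hε (sub_pos.2 hb) : 0 < min ε (T - b))).exists
  have hδ := moll_isTestFn n
  have h0 := doubling_integral_nonneg hF hu hw hV hW ku kw hθ hδ hbz
    (fun x hx => moll_eq_zero hx) (by linarith [hn.trans_le (min_le_right _ _)]) hψ
  obtain ⟨hi, he⟩ := integral_mul_shiftIntegral hF hu hw hV hW hθ.toIsTestFn hδ hψ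
  rw [he] at h0
  have h1 : ∫ h, moll n h * g h ≤ ∫ h, moll n h * (g 0 / 2) := by
    refine integral_mono hi ((moll_integrable n).mul_const _) fun h => ?_
    by_cases hh : 1 / ((n : ℝ) + 1) ≤ |h|
    · simp [moll_eq_zero hh]
    · refine mul_le_mul_of_nonneg_left (le_of_lt (hball h ?_)) (moll_nonneg n h)
      rw [mem_ball_zero_iff, Real.norm_eq_abs]
      linarith [hn.trans_le (min_le_left _ _)]
  rw [integral_mul_const, moll_integral] at h1
  linarith

/-- The doubled inequality at equal times. -/
theorem doubling (hF : IsFluxFactor F R A) (hu : IsDensity R M u)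
    (hw : IsDensity R M' w) (hV : IsVelocity c Λ V Vx) (hW : IsVelocity c Λ W Wx)
    (ku : IsKruzkov F R T u V Vx) (kw : IsKruzkov F R T w W Wx) (hθ : IsTimeTest T θ θ')
    (hψ : IsTestFn₂ ψ ψx ψy) :
    0 ≤ ∫ t, (θ' t * (∫ z : ℝ × ℝ, |u t z.1 - w t z.2| * ψ z.1 z.2) + θ t * ∫ z : ℝ × ℝ,
      (kruzFlux F (u t z.1) (w t z.2) * (V t z.1 * ψx z.1 z.2 + W t z.2 * ψy z.1 z.2
        + Vx t z.1 * ψ z.1 z.2) + F (u t z.1) * |Wx t z.2 - Vx t z.1| * ψ z.1 z.2)) := by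
  have h0 := shiftIntegral_zero_nonneg hF hu hw hV hW ku kw hθ hψ
  have hI := integrable_shiftIntegrand hF hu hw hV hW hθ.toIsTestFn hψ 0
  unfold shiftIntegral at h0
  rw [Measure.volume_eq_prod, integral_prod_symm _ hI, Measure.volume_eq_prod,
    integral_prod _ hI.integral_prod_right] at h0
  refine h0.trans_eq (integral_congr_ae (Eventually.of_forall fun t => ?_))
  obtain ⟨C₃, -, hψb, hψz⟩ := hψ.exists_bound
  have hcs : ∀ {ψ₁ : ℝ → ℝ → ℝ}, (Continuous fun z : ℝ × ℝ => ψ₁ z.1 z.2) →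
      (∀ x y, C₃ < |x| ∨ C₃ < |y| → ψ₁ x y = 0) → Integrable fun z : ℝ × ℝ => ψ₁ z.1 z.2 := by
    intro ψ₁ hc hz
    refine hc.integrable_of_hasCompactSupport (HasCompactSupport.intro
      (isCompact_Icc.prod isCompact_Icc) (K := Icc (-C₃) C₃ ×ˢ Icc (-C₃) C₃) fun z hzK => hz _ _ ?_)
    simpa only [mem_prod, not_and_or, notMem_Icc_neg_iff] using hzK
  have jψ := hcs hψ.cont fun x y h => (hψz x y h).1
  have jx := hcs hψ.cont_x fun x y h => (hψz x y h).2.1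
  have jy := hcs hψ.cont_y fun x y h => (hψz x y h).2.2
  have m1 : ∀ {f : ℝ → ℝ → ℝ}, (Measurable fun p : ℝ × ℝ => f p.1 p.2) →
      Measurable fun z : ℝ × ℝ => f t z.1 := fun h =>
    h.comp (by fun_prop : Measurable fun z : ℝ × ℝ => (t, z.1))
  have m2 : ∀ {f : ℝ → ℝ → ℝ}, (Measurable fun p : ℝ × ℝ => f p.1 p.2) →
      Measurable fun z : ℝ × ℝ => f t z.2 := fun h =>
    h.comp (by fun_prop : Measurable fun z : ℝ × ℝ => (t, z.2))
  have hpair : ∀ {a b d e : ℝ × ℝ → ℝ}, Integrable a → Integrable b → Integrable d →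
      Integrable e → Integrable fun z : ℝ × ℝ => pairIntegrand F (u t z.1) (w t z.2) (V t z.1)
        (W t z.2) (Vx t z.1) (Wx t z.2) (a z) (b z) (d z) (e z) := fun ha hb hd he =>
    integrable_pairIntegrand (μ := volume) hF (m1 hu.measurable) (m2 hw.measurable)
      (m1 hV.measurable) (m2 hW.measurable) (m1 hV.measurable_x) (m2 hW.measurable_x)
      (fun z => hu.mem _ _) (fun z => hw.mem _ _) (fun z => hV.abs_le _ _) (fun z => hW.abs_le _ _)
      (fun z => hV.abs_x_le _ _) (fun z => hW.abs_x_le _ _) ha hb hd he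
  have P1 := hpair jψ (integrable_zero _ _ _) (integrable_zero _ _ _) (integrable_zero _ _ _)
  have P2 := hpair (integrable_zero _ _ _) jx jy jψ
  have P3 := hpair (jψ.const_mul (θ' t)) (jx.const_mul (θ t)) (jy.const_mul (θ t))
    (jψ.const_mul (θ t))
  simp only [shiftIntegrand, add_zero]
  rw [← integral_const_mul, ← integral_const_mul, ← integral_add]
  · rw [Measure.volume_eq_prod, ← integral_prod _ P3]
    refine integral_congr_ae (Eventually.of_forall fun z => ?_)
    simp only [pairIntegrand]
    ring
  · refine (P1.const_mul (θ' t)).congr (Eventually.of_forall fun z => ?_)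
    simp only [pairIntegrand, Pi.zero_apply]
    ring
  · refine (P2.const_mul (θ t)).congr (Eventually.of_forall fun z => ?_)
    simp only [pairIntegrand, Pi.zero_apply]
    ring

end Doubling

/-! ### From compactly supported test functions to integrable kernels -/

/-- A nonnegative integrable `C¹` kernel on the line, with its derivative. -/
structure IsKernel (η η' : ℝ → ℝ) : Prop where
  hasDeriv : ∀ x, HasDerivAt η (η' x) x
  cont' : Continuous η'
  nonneg : ∀ x, 0 ≤ η x
  integrable : Integrable η
  integrable' : Integrable η'
  exists_bound : ∃ C, ∀ x, |η x| ≤ C ∧ |η' x| ≤ C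

theorem IsKernel.continuous {η η' : ℝ → ℝ} (h : IsKernel η η') : Continuous η :=
  continuous_iff_continuousAt.2 fun t => (h.hasDeriv t).continuousAt

theorem IsTestFn.isKernel {η η' : ℝ → ℝ} (h : IsTestFn η η') : IsKernel η η' := by
  obtain ⟨C, -, h1, h2, -, -⟩ := h.exists_bound
  exact ⟨h.hasDeriv, h.cont', h.nonneg, h.integrable, h.integrable', C, fun x => ⟨h1 x, h2 x⟩⟩

/-- Smooth cutoffs with small derivatives. -/
theorem exists_cutoff : ∃ (χ χ' : ℕ → ℝ → ℝ) (C : ℝ), 0 < C ∧ ∀ N : ℕ, IsTestFn (χ N) (χ' N) ∧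
    (∀ x, χ N x ≤ 1) ∧ (∀ x, |χ' N x| ≤ C * (1 / ((N : ℝ) + 1))) ∧
    ∀ x : ℝ, |x| ≤ (N : ℝ) + 1 → χ N x = 1 := by
  obtain ⟨C, hC, hb, -, -, -⟩ := (moll_isTestFn 0).exists_bound
  -- A product of two smooth steps at scale `N + 1`: it is 1 for `|x| ≤ N + 1` and 0 for `|x| ≥ 3 (N
  -- + 1)`.
  refine ⟨fun N x => mollPrim 0 (2 + x * (1 / ((N : ℝ) + 1))) * mollPrim 0 (2 - x * (1 / ((N : ℝ) + 1))),
    fun N x => (moll 0 (2 + x * (1 / ((N : ℝ) + 1))) * mollPrim 0 (2 - x * (1 / ((N : ℝ) + 1)))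
      - mollPrim 0 (2 + x * (1 / ((N : ℝ) + 1))) * moll 0 (2 - x * (1 / ((N : ℝ) + 1))))
      * (1 / ((N : ℝ) + 1)), 2 * C, by positivity, fun N => ?_⟩
  have hN : (0 : ℝ) < (N : ℝ) + 1 := by positivity
  have hp : ∀ x, |mollPrim 0 x| ≤ 1 := fun x => by
    rw [abs_of_nonneg (mollPrim_nonneg 0 x)]; exact mollPrim_le_one 0 x
  have hpc : Continuous (mollPrim 0) :=
    continuous_iff_continuousAt.2 fun t => (mollPrim_hasDerivAt 0 t).continuousAt
  have hmc := moll_continuous 0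
  refine ⟨.of_bounded_support (a := -(3 * ((N : ℝ) + 1))) (b := 3 * ((N : ℝ) + 1)) (fun x => ?_)
    (by fun_prop) (fun x => mul_nonneg (mollPrim_nonneg _ _) (mollPrim_nonneg _ _))
    fun x hx => ?_, fun x => ?_, fun x => ?_, fun x hx => ?_⟩
  · have h1 : HasDerivAt (fun x : ℝ => 2 + x * (1 / ((N : ℝ) + 1))) (1 / ((N : ℝ) + 1)) x := by
      simpa using ((hasDerivAt_id x).mul_const (1 / ((N : ℝ) + 1))).const_add 2
    have h2 : HasDerivAt (fun x : ℝ => 2 - x * (1 / ((N : ℝ) + 1))) (-(1 / ((N : ℝ) + 1))) x := by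
      simpa using ((hasDerivAt_id x).mul_const (1 / ((N : ℝ) + 1))).const_sub 2
    exact (((mollPrim_hasDerivAt 0 _).comp x h1).fun_mul
      ((mollPrim_hasDerivAt 0 _).comp x h2)).congr_deriv (by simp only [Function.comp]; ring)
  · rw [notMem_Icc_neg_iff] at hx
    rcases abs_cases x with ⟨e, _⟩ | ⟨e, _⟩ <;> rw [e] at hx
    · have : 3 ≤ x * (1 / ((N : ℝ) + 1)) := by rw [mul_one_div, le_div_iff₀ hN]; exact hx.le
      beta_reduce
      rw [mollPrim_of_le (x := 2 - x * (1 / ((N : ℝ) + 1))), mul_zero]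
      norm_num at *; linarith
    · have : 3 ≤ -x * (1 / ((N : ℝ) + 1)) := by rw [mul_one_div, le_div_iff₀ hN]; exact hx.le
      beta_reduce
      rw [mollPrim_of_le (x := 2 + x * (1 / ((N : ℝ) + 1))), zero_mul]
      norm_num at *; linarith
  · exact mul_le_one₀ (mollPrim_le_one _ _) (mollPrim_nonneg _ _) (mollPrim_le_one _ _)
  · rw [abs_mul, abs_of_pos (by positivity : 0 < 1 / ((N : ℝ) + 1))]
    refine mul_le_mul_of_nonneg_right ((abs_sub _ _).trans ?_) (by positivity)
    rw [two_mul, abs_mul, abs_mul]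
    refine add_le_add ?_ ?_
    · simpa using mul_le_mul (hb _) (hp _) (abs_nonneg _) hC.le
    · simpa using mul_le_mul (hp _) (hb _) (abs_nonneg _) zero_le_one
  · have h1 : |x * (1 / ((N : ℝ) + 1))| ≤ 1 := by
      rw [abs_mul, abs_of_pos (by positivity : 0 < 1 / ((N : ℝ) + 1)), mul_one_div,
        div_le_one hN]; exact hx
    rw [abs_le] at h1
    beta_reduce
    rw [mollPrim_of_ge, mollPrim_of_ge, one_mul] <;> norm_num at * <;> linarith

theorem integrable_mul_kernel_left {u k : ℝ → ℝ} (hu : Integrable u) (hk : Integrable k) :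
    Integrable (fun z : ℝ × ℝ => u z.1 * k (z.1 - z.2)) := by
  have h := (hu.convolution_integrand (μ := volume) (ContinuousLinearMap.mul ℝ ℝ) hk.comp_neg).swap
  refine h.congr (Eventually.of_forall fun z => ?_)
  simp

theorem integrable_mul_kernel_right {u k : ℝ → ℝ} (hu : Integrable u) (hk : Integrable k) :
    Integrable (fun z : ℝ × ℝ => u z.2 * k (z.1 - z.2)) :=
  hu.convolution_integrand (μ := volume) (ContinuousLinearMap.mul ℝ ℝ) hk

theorem integral_mul_kernel_left {u k : ℝ → ℝ} (hu : Integrable u) (hk : Integrable k) :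
    ∫ z : ℝ × ℝ, u z.1 * k (z.1 - z.2) = (∫ x, u x) * ∫ x, k x := by
  rw [Measure.volume_eq_prod, integral_prod _ (integrable_mul_kernel_left hu hk)]
  simp_rw [integral_const_mul, integral_sub_left_eq_self k volume]
  rw [integral_mul_const]

theorem integral_mul_kernel_right {u k : ℝ → ℝ} (hu : Integrable u) (hk : Integrable k) :
    ∫ z : ℝ × ℝ, u z.2 * k (z.1 - z.2) = (∫ x, u x) * ∫ x, k x := by
  rw [Measure.volume_eq_prod, integral_prod_symm _ (integrable_mul_kernel_right hu hk)]
  simp_rw [integral_const_mul, integral_sub_right_eq_self k]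
  rw [integral_mul_const]

theorem isTestFn₂_of_kernel {η η' χ χ' : ℝ → ℝ} (hη : IsKernel η η') (hχ : IsTestFn χ χ') :
    IsTestFn₂ (fun x y => η (x - y) * χ x * χ y)
      (fun x y => (η' (x - y) * χ x + η (x - y) * χ' x) * χ y)
      (fun x y => (-η' (x - y) * χ y + η (x - y) * χ' y) * χ x) := by
  have h1 := hη.continuous
  have h2 := hη.cont'
  have h3 := hχ.continuous
  have h4 := hχ.cont'
  obtain ⟨C, hC⟩ := hη.exists_bound
  obtain ⟨D, hD, b1, b2, z1, z2⟩ := hχ.exists_bound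
  refine ⟨fun x y => ?_, fun x y => ?_, by fun_prop, by fun_prop, by fun_prop,
    fun x y => mul_nonneg (mul_nonneg (hη.nonneg _) (hχ.nonneg _)) (hχ.nonneg _),
    1 + D + 2 * |C| * D * D, by positivity, fun x y => ?_, fun x y h => ?_⟩
  · exact ((((hη.hasDeriv (x - y)).comp_sub_const x y).fun_mul (hχ.hasDeriv x)).mul_const (χ y))
  · have := (((hη.hasDeriv (x - y)).comp_const_sub x y).fun_mul (hχ.hasDeriv y)).mul_const (χ x)
    refine (this.congr_of_eventuallyEq (Eventually.of_forall fun z => ?_))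
    simp only; ring
  · have hle : ∀ {a b e : ℝ}, |a| ≤ C → |b| ≤ D → |e| ≤ D → |a * b * e| ≤ |C| * D * D := by
      intro a b e ha hb he
      rw [abs_mul, abs_mul]
      have := ha.trans (le_abs_self C)
      gcongr
    obtain ⟨c1, c2⟩ := hC (x - y)
    have hp : 0 ≤ |C| * D * D := by positivity
    refine ⟨(hle c1 (b1 x) (b1 y)).trans (by linarith), ?_, ?_⟩
    · rw [add_mul]
      exact (abs_add_le _ _).trans ((add_le_add (hle c2 (b1 x) (b1 y))
        (hle c1 (b2 x) (b1 y))).trans (by linarith))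
    · rw [add_mul]
      exact (abs_add_le _ _).trans ((add_le_add (hle (by rwa [abs_neg]) (b1 y) (b1 x))
        (hle c1 (b2 y) (b1 x))).trans (by linarith))
  · have hp : 0 ≤ 2 * |C| * D * D := by positivity
    rcases h with h | h
    · simp [z1 x (by linarith), z2 x (by linarith)]
    · simp [z1 y (by linarith), z2 y (by linarith)]

section

variable {F : ℝ → ℝ} {R A M M' c Λ T : ℝ} {u w V W Vx Wx : ℝ → ℝ → ℝ} {θ θ' η η' : ℝ → ℝ}

theorem IsDensity.norm_integral_le (hu : IsDensity R M u) (hw : IsDensity R M' w) {k : ℝ → ℝ}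
    (hk : Integrable k) (hk0 : ∀ x, 0 ≤ k x) {K : ℝ} (hK : 0 ≤ K) (t : ℝ) {g : ℝ × ℝ → ℝ}
    (hg : ∀ z, |g z| ≤ K * ((u t z.1 + w t z.2) * k (z.1 - z.2))) :
    |∫ z, g z| ≤ K * ((M + M') * ∫ x, k x) := by
  have i1 := integrable_mul_kernel_left (hu.integrable t) hk
  have i2 := integrable_mul_kernel_right (hw.integrable t) hk
  have hi : Integrable fun z : ℝ × ℝ => (u t z.1 + w t z.2) * k (z.1 - z.2) :=
    (i1.add i2).congr (Eventually.of_forall fun z => by simp [add_mul])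
  refine abs_integral_le_integral_abs.trans ((integral_mono_of_nonneg
    (Eventually.of_forall fun _ => abs_nonneg _) (hi.const_mul K)
    (Eventually.of_forall hg)).trans ?_)
  rw [integral_const_mul]
  refine mul_le_mul_of_nonneg_left ?_ hK
  have e : ∫ z : ℝ × ℝ, (u t z.1 + w t z.2) * k (z.1 - z.2)
      = ∫ z : ℝ × ℝ, (u t z.1 * k (z.1 - z.2) + w t z.2 * k (z.1 - z.2)) :=
    integral_congr_ae (Eventually.of_forall fun z => add_mul _ _ _)
  rw [e, integral_add i1 i2, integral_mul_kernel_left (hu.integrable t) hk,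
    integral_mul_kernel_right (hw.integrable t) hk, ← add_mul]
  exact mul_le_mul_of_nonneg_right (add_le_add (hu.mass_le t) (hw.mass_le t)) (integral_nonneg hk0)

theorem IsDensity.integrable_pair (hu : IsDensity R M u) (hw : IsDensity R M' w) {k : ℝ → ℝ}
    (hk : Integrable k) (t : ℝ) :
    Integrable fun z : ℝ × ℝ => (u t z.1 + w t z.2) * k (z.1 - z.2) :=
  ((integrable_mul_kernel_left (hu.integrable t) hk).add
    (integrable_mul_kernel_right (hw.integrable t) hk)).congr
    (Eventually.of_forall fun z => by simp [add_mul])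

/-- A bound free of the cutoffs `χ₁`, `χ₂`, used as a dominating function when they are removed.
Both `F u ≤ u` and `|u - w| ≤ u + w` put the factor `u + w` in front of the kernel, which makes it
integrable over the plane because the masses are finite. -/
theorem abs_pair_bound (hF : IsFluxFactor F R A) {u w V W Vx Wx η η' χ₁ χ₂ ξ₁ ξ₂ C : ℝ}
    (hu : u ∈ Icc 0 R) (hw : w ∈ Icc 0 R) (hV : |V| ≤ c) (hW : |W| ≤ c) (hVx : |Vx| ≤ Λ)
    (hWx : |Wx| ≤ Λ) (h1 : |χ₁| ≤ 1) (h2 : |χ₂| ≤ 1) (h3 : |ξ₁| ≤ C) (h4 : |ξ₂| ≤ C) :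
    |kruzFlux F u w * (V * ((η' * χ₁ + η * ξ₁) * χ₂) + W * ((-η' * χ₂ + η * ξ₂) * χ₁)
      + Vx * (η * χ₁ * χ₂)) + F u * |Wx - Vx| * (η * χ₁ * χ₂)|
      ≤ (A * (2 * c * (1 + C) + Λ) + 2 * Λ) * ((u + w) * (|η| + |η'|)) := by
  have hC : 0 ≤ C := (abs_nonneg _).trans h3
  have hc : 0 ≤ c := (abs_nonneg _).trans hV
  have hΛ : 0 ≤ Λ := (abs_nonneg _).trans hVx
  have hA := hF.A_nonneg
  have hu0 := hu.1
  have hw0 := hw.1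
  set k := |η| + |η'| with hk
  have hk0 : 0 ≤ k := by positivity
  have hηk : |η| ≤ k := le_add_of_nonneg_right (abs_nonneg _)
  have hηk' : |η'| ≤ k := le_add_of_nonneg_left (abs_nonneg _)
  have hq : |kruzFlux F u w| ≤ A * (u + w) := (hF.abs_kruzFlux_le hu hw).trans
    (mul_le_mul_of_nonneg_left (abs_le.2 ⟨by linarith, by linarith⟩) hA)
  have hψ : |η * χ₁ * χ₂| ≤ k := by
    rw [abs_mul, abs_mul]
    calc |η| * |χ₁| * |χ₂| ≤ k * 1 * 1 := by gcongr
      _ = k := by ring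
  have hd : ∀ {a x y ξ : ℝ}, |a| ≤ k → |x| ≤ 1 → |y| ≤ 1 → |ξ| ≤ C →
      |(a * x + η * ξ) * y| ≤ (1 + C) * k := by
    intro a x y ξ ha hx hy hξ
    rw [abs_mul]
    have : |a * x + η * ξ| ≤ k * 1 + k * C := by
      refine (abs_add_le _ _).trans (add_le_add ?_ ?_) <;> rw [abs_mul] <;> gcongr
    calc |a * x + η * ξ| * |y| ≤ (k * 1 + k * C) * 1 := by gcongr
      _ = _ := by ring
  have hd1 := hd hηk' h1 h2 h3
  have hd2 := hd (a := -η') (by rwa [abs_neg]) h2 h1 h4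
  have hb : |V * ((η' * χ₁ + η * ξ₁) * χ₂) + W * ((-η' * χ₂ + η * ξ₂) * χ₁)
      + Vx * (η * χ₁ * χ₂)| ≤ c * ((1 + C) * k) + c * ((1 + C) * k) + Λ * k := by
    refine (abs_add_le _ _).trans (add_le_add ((abs_add_le _ _).trans (add_le_add ?_ ?_)) ?_) <;>
      rw [abs_mul] <;> gcongr
  have hF1 : |F u * |Wx - Vx| * (η * χ₁ * χ₂)| ≤ (u + w) * (Λ + Λ) * k := by
    rw [abs_mul, abs_mul, abs_abs]
    have e1 : |F u| ≤ u + w := by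
      rw [abs_of_nonneg (hF.nonneg u hu)]; linarith [hF.le_self u hu]
    have e2 : |Wx - Vx| ≤ Λ + Λ := (abs_sub _ _).trans (add_le_add hWx hVx)
    gcongr
  refine (abs_add_le _ _).trans ?_
  rw [abs_mul (kruzFlux F u w)]
  calc _ ≤ A * (u + w) * (c * ((1 + C) * k) + c * ((1 + C) * k) + Λ * k)
        + (u + w) * (Λ + Λ) * k := by gcongr
    _ = _ := by ring

/-- The doubled inequality at equal times for an integrable kernel. -/
theorem doubling_kernel (hF : IsFluxFactor F R A) (hu : IsDensity R M u)
    (hw : IsDensity R M' w) (hV : IsVelocity c Λ V Vx) (hW : IsVelocity c Λ W Wx)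
    (ku : IsKruzkov F R T u V Vx) (kw : IsKruzkov F R T w W Wx) (hθ : IsTimeTest T θ θ')
    (hη : IsKernel η η') :
    0 ≤ ∫ t, (θ' t * (∫ z : ℝ × ℝ, |u t z.1 - w t z.2| * η (z.1 - z.2)) + θ t * ∫ z : ℝ × ℝ,
      (kruzFlux F (u t z.1) (w t z.2) * ((V t z.1 - W t z.2) * η' (z.1 - z.2)
        + Vx t z.1 * η (z.1 - z.2))
        + F (u t z.1) * |Wx t z.2 - Vx t z.1| * η (z.1 - z.2))) := by
  obtain ⟨χ, χ', C, hC, hχ⟩ := exists_cutoff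
  have hχ1 : ∀ N x, |χ N x| ≤ 1 := fun N x => by
    rw [abs_of_nonneg ((hχ N).1.nonneg x)]; exact (hχ N).2.1 x
  have hχC : ∀ N x, |χ' N x| ≤ C := fun N x => ((hχ N).2.2.1 x).trans
    (mul_le_of_le_one_right hC.le (one_div_succ_le_one N))
  have hlim1 : ∀ x, Tendsto (fun N => χ N x) atTop (𝓝 1) := fun x => by
    obtain ⟨N₀, hN₀⟩ := exists_nat_ge |x|
    refine tendsto_const_nhds.congr' ?_
    filter_upwards [eventually_ge_atTop N₀] with N hN
    refine ((hχ N).2.2.2 x (hN₀.trans ?_)).symm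
    have : (N₀ : ℝ) ≤ N := by exact_mod_cast hN
    linarith
  have hlim0 : ∀ x, Tendsto (fun N => χ' N x) atTop (𝓝 0) := fun x =>
    squeeze_zero_norm (fun N => (hχ N).2.2.1 x) (by
      simpa using tendsto_moll_radius.const_mul C)
  set k : ℝ → ℝ := fun x => |η x| + |η' x| with hk
  have hki : Integrable k := hη.integrable.abs.add hη.integrable'.abs
  have hk0 : ∀ x, 0 ≤ k x := fun x => by positivity
  set K := A * (2 * c * (1 + C) + Λ) + 2 * Λ with hK
  have hc : 0 ≤ c := (abs_nonneg _).trans (hV.abs_le 0 0)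
  have hΛ : 0 ≤ Λ := (abs_nonneg _).trans (hV.abs_x_le 0 0)
  have hA := hF.A_nonneg
  have hK0 : 0 ≤ K := by positivity
  have hηc := hη.continuous
  have hηc' := hη.cont'
  set a : ℕ → ℝ → ℝ × ℝ → ℝ := fun N t z =>
    |u t z.1 - w t z.2| * (η (z.1 - z.2) * χ N z.1 * χ N z.2) with ha
  set b : ℕ → ℝ → ℝ × ℝ → ℝ := fun N t z =>
    kruzFlux F (u t z.1) (w t z.2) * (V t z.1 * ((η' (z.1 - z.2) * χ N z.1
      + η (z.1 - z.2) * χ' N z.1) * χ N z.2) + W t z.2 * ((-η' (z.1 - z.2) * χ N z.2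
      + η (z.1 - z.2) * χ' N z.2) * χ N z.1) + Vx t z.1 * (η (z.1 - z.2) * χ N z.1 * χ N z.2))
      + F (u t z.1) * |Wx t z.2 - Vx t z.1| * (η (z.1 - z.2) * χ N z.1 * χ N z.2) with hb
  have hbound_a : ∀ N t z, |a N t z| ≤ 1 * ((u t z.1 + w t z.2) * k (z.1 - z.2)) := by
    intro N t z
    have h1 := (hu.mem t z.1).1
    have h2 := (hw.mem t z.2).1
    rw [ha, one_mul]
    simp only [abs_mul, abs_abs]
    refine mul_le_mul (abs_le.2 ⟨by linarith, by linarith⟩) ?_ (by positivity) (by positivity)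
    calc |η (z.1 - z.2)| * |χ N z.1| * |χ N z.2| ≤ |η (z.1 - z.2)| * 1 * 1 := by
          gcongr
          · exact hχ1 N _
          · exact hχ1 N _
      _ ≤ k (z.1 - z.2) := by rw [hk]; simp
  have hbound_b : ∀ N t z, |b N t z| ≤ K * ((u t z.1 + w t z.2) * k (z.1 - z.2)) := fun N t z =>
    abs_pair_bound hF (hu.mem _ _) (hw.mem _ _) (hV.abs_le _ _) (hW.abs_le _ _)
      (hV.abs_x_le _ _) (hW.abs_x_le _ _) (hχ1 N _) (hχ1 N _) (hχC N _) (hχC N _)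
  have m1 : ∀ {f : ℝ → ℝ → ℝ}, (Measurable fun p : ℝ × ℝ => f p.1 p.2) →
      Measurable fun q : ℝ × ℝ × ℝ => f q.1 q.2.1 := fun h =>
    h.comp (by fun_prop : Measurable fun q : ℝ × ℝ × ℝ => (q.1, q.2.1))
  have m2 : ∀ {f : ℝ → ℝ → ℝ}, (Measurable fun p : ℝ × ℝ => f p.1 p.2) →
      Measurable fun q : ℝ × ℝ × ℝ => f q.1 q.2.2 := fun h =>
    h.comp (by fun_prop : Measurable fun q : ℝ × ℝ × ℝ => (q.1, q.2.2))
  have hχm : ∀ N, Measurable (χ N) := fun N => (hχ N).1.continuous.measurable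
  have hχm' : ∀ N, Measurable (χ' N) := fun N => (hχ N).1.cont'.measurable
  have hηm : Measurable fun q : ℝ × ℝ × ℝ => η (q.2.1 - q.2.2) := by fun_prop
  have hηm' : Measurable fun q : ℝ × ℝ × ℝ => η' (q.2.1 - q.2.2) := by fun_prop
  have ma : ∀ N, Measurable fun q : ℝ × ℝ × ℝ => a N q.1 q.2 := fun N => by
    have := hχm N
    exact ((m1 hu.measurable).sub (m2 hw.measurable)).abs.mul ((hηm.mul (by fun_prop)).mul
      (by fun_prop))
  have mb : ∀ N, Measurable fun q : ℝ × ℝ × ℝ => b N q.1 q.2 := fun N => by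
    have h3 := hχm N
    have h4 := hχm' N
    have e1 := measurable_kruzFlux hF.measurable (m1 hu.measurable) (m2 hw.measurable)
    have e2 := hF.measurable.comp (m1 hu.measurable)
    have e3 := m1 hV.measurable
    have e4 := m2 hW.measurable
    have e5 := m1 hV.measurable_x
    have e6 := m2 hW.measurable_x
    have c1 : Measurable fun q : ℝ × ℝ × ℝ => χ N q.2.1 := by fun_prop
    have c2 : Measurable fun q : ℝ × ℝ × ℝ => χ N q.2.2 := by fun_prop
    have c3 : Measurable fun q : ℝ × ℝ × ℝ => χ' N q.2.1 := by fun_prop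
    have c4 : Measurable fun q : ℝ × ℝ × ℝ => χ' N q.2.2 := by fun_prop
    exact (e1.mul (((e3.mul (((hηm'.mul c1).add (hηm.mul c3)).mul c2)).add (e4.mul
      (((hηm'.neg.mul c2).add (hηm.mul c4)).mul c1))).add (e5.mul ((hηm.mul c1).mul c2)))).add
      ((e2.mul (e6.sub e5).abs).mul ((hηm.mul c1).mul c2))
  -- As `N → ∞` the terms with `χ'` disappear. The two spatial derivatives become `η'(x - y)` and
  -- `-η'(x - y)`, so the velocities survive only through `V(x) - W(y)`.
  have key : ∀ N, 0 ≤ ∫ t, (θ' t * (∫ z, a N t z) + θ t * ∫ z, b N t z) := fun N =>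
    doubling hF hu hw hV hW ku kw hθ (isTestFn₂_of_kernel hη (hχ N).1)
  refine ge_of_tendsto (tendsto_integral_of_dominated_convergence (fun t =>
    |θ' t| * (1 * ((M + M') * ∫ x, k x)) + |θ t| * (K * ((M + M') * ∫ x, k x)))
    (fun N => ?_) ((hθ.integrable'.abs.mul_const _).add (hθ.integrable.abs.mul_const _))
    (fun N => Eventually.of_forall fun t => ?_) (Eventually.of_forall fun t => ?_))
    (Eventually.of_forall key)
  · exact (hθ.cont'.aestronglyMeasurable.mul
      (ma N).stronglyMeasurable.integral_prod_right'.aestronglyMeasurable).add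
      (hθ.continuous.aestronglyMeasurable.mul
      (mb N).stronglyMeasurable.integral_prod_right'.aestronglyMeasurable)
  · rw [Real.norm_eq_abs]
    refine (abs_add_le _ _).trans (add_le_add ?_ ?_) <;> rw [abs_mul] <;>
      refine mul_le_mul_of_nonneg_left ?_ (abs_nonneg _)
    · exact hu.norm_integral_le hw hki hk0 zero_le_one t (hbound_a N t)
    · exact hu.norm_integral_le hw hki hk0 hK0 t (hbound_b N t)
  · have ms : ∀ {g : ℝ × ℝ × ℝ → ℝ}, Measurable g →
        AEStronglyMeasurable (fun z : ℝ × ℝ => g (t, z)) volume := fun h =>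
      (h.comp measurable_prodMk_left).aestronglyMeasurable
    refine (Tendsto.const_mul _ ?_).add (Tendsto.const_mul _ ?_)
    · refine tendsto_integral_of_dominated_convergence _ (fun N => ms (ma N))
        ((hu.integrable_pair hw hki t).const_mul 1)
        (fun N => Eventually.of_forall (hbound_a N t)) (Eventually.of_forall fun z => ?_)
      have := (tendsto_const_nhds (x := |u t z.1 - w t z.2|)).mul
        (((tendsto_const_nhds (x := η (z.1 - z.2))).mul (hlim1 z.1)).mul (hlim1 z.2))
      simpa using this
    · refine tendsto_integral_of_dominated_convergence _ (fun N => ms (mb N))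
        ((hu.integrable_pair hw hki t).const_mul K)
        (fun N => Eventually.of_forall (hbound_b N t)) (Eventually.of_forall fun z => ?_)
      have l1 := hlim1 z.1
      have l2 := hlim1 z.2
      have d1 := hlim0 z.1
      have d2 := hlim0 z.2
      have := (((((((l1.const_mul (η' (z.1 - z.2))).add (d1.const_mul (η (z.1 - z.2)))).mul
        l2).const_mul (V t z.1)).add ((((l2.const_mul (-η' (z.1 - z.2))).add
        (d2.const_mul (η (z.1 - z.2)))).mul l1).const_mul (W t z.2))).add
        (((l1.const_mul (η (z.1 - z.2))).mul l2).const_mul (Vx t z.1))).const_mul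
        (kruzFlux F (u t z.1) (w t z.2))).add
        (((l1.const_mul (η (z.1 - z.2))).mul l2).const_mul
          (F (u t z.1) * |Wx t z.2 - Vx t z.1|))
      refine this.trans (le_of_eq (congrArg 𝓝 ?_))
      ring

end

/-! ### Smeared distances, and a kernel that controls its own derivative -/

theorem measurePreserving_shear_swap :
    MeasurePreserving (fun z : ℝ × ℝ => (z.1 + z.2, z.1)) (volume : Measure (ℝ × ℝ)) volume :=
  Measure.measurePreserving_swap.comp
    (measurePreserving_prod_add (volume : Measure ℝ) (volume : Measure ℝ))

/-- The average of the `L¹` modulus of continuity against a kernel. -/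
theorem integral_abs_sub_mul_kernel {g k : ℝ → ℝ} (hg : Integrable g) (hk : Integrable k) :
    Integrable (fun s => (∫ y, |g (y + s) - g y|) * k s) ∧
    ∫ z : ℝ × ℝ, |g z.1 - g z.2| * k (z.1 - z.2) = ∫ s, (∫ y, |g (y + s) - g y|) * k s := by
  have i0 : Integrable fun z : ℝ × ℝ => |g z.1 - g z.2| * k (z.1 - z.2) := by
    have h : Integrable fun z : ℝ × ℝ => (g z.1 - g z.2) * k (z.1 - z.2) :=
      ((integrable_mul_kernel_left hg hk).sub (integrable_mul_kernel_right hg hk)).congr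
        (Eventually.of_forall fun z => by simp [sub_mul])
    have hkn : Integrable fun z : ℝ × ℝ => |g z.1 - g z.2| * |k (z.1 - z.2)| :=
      h.abs.congr (Eventually.of_forall fun z => abs_mul _ _)
    refine hkn.mono' ?_ (Eventually.of_forall fun z => by simp)
    have m1 : AEStronglyMeasurable (fun z : ℝ × ℝ => g z.1) volume := hg.1.comp_fst
    have m2 : AEStronglyMeasurable (fun z : ℝ × ℝ => g z.2) volume := hg.1.comp_snd
    have m3 : AEStronglyMeasurable (fun z : ℝ × ℝ => k (z.1 - z.2)) volume :=
      hk.1.comp_quasiMeasurePreserving (quasiMeasurePreserving_sub volume volume)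
    exact (m1.sub m2).norm.mul m3
  have i1 := measurePreserving_shear_swap.integrable_comp_of_integrable i0
  have e : ∫ z : ℝ × ℝ, |g z.1 - g z.2| * k (z.1 - z.2)
      = ∫ z : ℝ × ℝ, |g (z.1 + z.2) - g z.1| * k z.2 := by
    have h := integral_map (μ := (volume : Measure (ℝ × ℝ)))
      measurePreserving_shear_swap.measurable.aemeasurable
      (f := fun z : ℝ × ℝ => |g z.1 - g z.2| * k (z.1 - z.2))
      (by rw [measurePreserving_shear_swap.map_eq]; exact i0.1)
    rw [measurePreserving_shear_swap.map_eq] at h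
    rw [h]
    simp
  have i2 : Integrable fun z : ℝ × ℝ => |g (z.1 + z.2) - g z.1| * k z.2 :=
    i1.congr (Eventually.of_forall fun z => by simp)
  have hs : ∀ s, ∫ y, |g (y + s) - g y| * k s = (∫ y, |g (y + s) - g y|) * k s := fun s =>
    integral_mul_const _ _
  refine ⟨i2.integral_prod_right.congr (Eventually.of_forall hs), ?_⟩
  rw [e, Measure.volume_eq_prod, integral_prod_symm _ i2]
  exact integral_congr_ae (Eventually.of_forall hs)

theorem HasVarLE.integral_kernel_le {g k : ℝ → ℝ} {N : ℝ} (hv : HasVarLE g N) (hg : Integrable g)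
    (hk : Integrable k) (hk0 : ∀ x, 0 ≤ k x) (hk1 : Integrable fun x => |x| * k x) :
    ∫ z : ℝ × ℝ, |g z.1 - g z.2| * k (z.1 - z.2) ≤ N * ∫ x, |x| * k x := by
  obtain ⟨i, e⟩ := integral_abs_sub_mul_kernel hg hk
  rw [e, ← integral_const_mul]
  refine integral_mono i (hk1.const_mul N) fun s => ?_
  change (∫ y, |g (y + s) - g y|) * k s ≤ N * (|s| * k s)
  rw [← mul_assoc]
  exact mul_le_mul_of_nonneg_right (hv s) (hk0 s)

section

variable {F : ℝ → ℝ} {R A M M' c Λ T : ℝ} {u w V W Vx Wx : ℝ → ℝ → ℝ} {θ θ' η η' : ℝ → ℝ}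

/-- The distance of two densities, smeared by a kernel. -/
noncomputable def kernDist (u w : ℝ → ℝ → ℝ) (η : ℝ → ℝ) (t : ℝ) : ℝ :=
  ∫ z : ℝ × ℝ, |u t z.1 - w t z.2| * η (z.1 - z.2)

/-- The production of distance in the doubled inequality. -/
noncomputable def kernFlux (F : ℝ → ℝ) (u w V W Vx Wx : ℝ → ℝ → ℝ) (η η' : ℝ → ℝ) (t : ℝ) : ℝ :=
  ∫ z : ℝ × ℝ, (kruzFlux F (u t z.1) (w t z.2) * ((V t z.1 - W t z.2) * η' (z.1 - z.2)
    + Vx t z.1 * η (z.1 - z.2)) + F (u t z.1) * |Wx t z.2 - Vx t z.1| * η (z.1 - z.2))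

theorem IsDensity.abs_sub_le_add (hu : IsDensity R M u) (hw : IsDensity R M' w) (t x y : ℝ) :
    |u t x - w t y| ≤ u t x + w t y := by
  have h1 := (hu.mem t x).1
  have h2 := (hw.mem t y).1
  exact abs_le.2 ⟨by linarith, by linarith⟩

theorem measurable_kernDist (hu : IsDensity R M u) (hw : IsDensity R M' w)
    (hη : IsKernel η η') : Measurable (kernDist u w η) := by
  have hηc := hη.continuous
  have m : Measurable fun q : ℝ × ℝ × ℝ => |u q.1 q.2.1 - w q.1 q.2.2| * η (q.2.1 - q.2.2) :=
    ((hu.measurable.comp (by fun_prop : Measurable fun q : ℝ × ℝ × ℝ => (q.1, q.2.1))).sub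
      (hw.measurable.comp (by fun_prop : Measurable fun q : ℝ × ℝ × ℝ => (q.1, q.2.2)))).abs.mul
      (by fun_prop)
  exact m.stronglyMeasurable.integral_prod_right'.measurable

theorem abs_kernDist_le (hu : IsDensity R M u) (hw : IsDensity R M' w)
    (hη : IsKernel η η') (t : ℝ) : |kernDist u w η t| ≤ (M + M') * ∫ x, η x := by
  rw [← one_mul ((M + M') * _)]
  refine hu.norm_integral_le hw hη.integrable hη.nonneg zero_le_one t fun z => ?_
  rw [one_mul, abs_mul, abs_abs, abs_of_nonneg (hη.nonneg _)]
  exact mul_le_mul_of_nonneg_right (hu.abs_sub_le_add hw t _ _) (hη.nonneg _)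

theorem measurable_kernFlux (hF : IsFluxFactor F R A) (hu : IsDensity R M u)
    (hw : IsDensity R M' w) (hV : IsVelocity c Λ V Vx) (hW : IsVelocity c Λ W Wx)
    (hη : IsKernel η η') : Measurable (kernFlux F u w V W Vx Wx η η') := by
  have hηc := hη.continuous
  have hηc' := hη.cont'
  have m1 : ∀ {f : ℝ → ℝ → ℝ}, (Measurable fun p : ℝ × ℝ => f p.1 p.2) →
      Measurable fun q : ℝ × ℝ × ℝ => f q.1 q.2.1 := fun h =>
    h.comp (by fun_prop : Measurable fun q : ℝ × ℝ × ℝ => (q.1, q.2.1))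
  have m2 : ∀ {f : ℝ → ℝ → ℝ}, (Measurable fun p : ℝ × ℝ => f p.1 p.2) →
      Measurable fun q : ℝ × ℝ × ℝ => f q.1 q.2.2 := fun h =>
    h.comp (by fun_prop : Measurable fun q : ℝ × ℝ × ℝ => (q.1, q.2.2))
  have hηm : Measurable fun q : ℝ × ℝ × ℝ => η (q.2.1 - q.2.2) := by fun_prop
  have hηm' : Measurable fun q : ℝ × ℝ × ℝ => η' (q.2.1 - q.2.2) := by fun_prop
  have m := ((measurable_kruzFlux hF.measurable (m1 hu.measurable) (m2 hw.measurable)).mul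
    ((((m1 hV.measurable).sub (m2 hW.measurable)).mul hηm').add
      ((m1 hV.measurable_x).mul hηm))).add (((hF.measurable.comp (m1 hu.measurable)).mul
      ((m2 hW.measurable_x).sub (m1 hV.measurable_x)).abs).mul hηm)
  exact m.stronglyMeasurable.integral_prod_right'.measurable

theorem abs_kernFlux_integrand_le (hF : IsFluxFactor F R A) (hu : IsDensity R M u)
    (hw : IsDensity R M' w) (hV : IsVelocity c Λ V Vx) (hW : IsVelocity c Λ W Wx) (t : ℝ)
    (z : ℝ × ℝ) :
    |kruzFlux F (u t z.1) (w t z.2) * ((V t z.1 - W t z.2) * η' (z.1 - z.2)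
      + Vx t z.1 * η (z.1 - z.2)) + F (u t z.1) * |Wx t z.2 - Vx t z.1| * η (z.1 - z.2)|
      ≤ (A * (2 * c * (1 + 0) + Λ) + 2 * Λ) * ((u t z.1 + w t z.2) *
        (|η (z.1 - z.2)| + |η' (z.1 - z.2)|)) := by
  have := abs_pair_bound hF (hu.mem t z.1) (hw.mem t z.2) (hV.abs_le t z.1) (hW.abs_le t z.2)
    (hV.abs_x_le t z.1) (hW.abs_x_le t z.2) (η := η (z.1 - z.2)) (η' := η' (z.1 - z.2))
    (abs_one.le : |(1 : ℝ)| ≤ 1) (abs_one.le : |(1 : ℝ)| ≤ 1) (abs_zero.le : |(0 : ℝ)| ≤ 0)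
    (abs_zero.le : |(0 : ℝ)| ≤ 0)
  refine le_trans (le_of_eq ?_) this
  congr 1
  ring

theorem exists_kernFlux_bound (hF : IsFluxFactor F R A) (hu : IsDensity R M u)
    (hw : IsDensity R M' w) (hV : IsVelocity c Λ V Vx) (hW : IsVelocity c Λ W Wx)
    (hη : IsKernel η η') : ∃ C, ∀ t, |kernFlux F u w V W Vx Wx η η' t| ≤ C := by
  have hc : 0 ≤ c := (abs_nonneg _).trans (hV.abs_le 0 0)
  have hΛ : 0 ≤ Λ := (abs_nonneg _).trans (hV.abs_x_le 0 0)
  have hA := hF.A_nonneg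
  exact ⟨_, fun t => hu.norm_integral_le hw (k := fun x => |η x| + |η' x|)
    (hη.integrable.abs.add hη.integrable'.abs) (fun x => by positivity)
    (K := A * (2 * c * (1 + 0) + Λ) + 2 * Λ) (by positivity) t
    fun z => abs_kernFlux_integrand_le hF hu hw hV hW t z⟩

theorem locallyIntegrable_of_bdd {E : ℝ → ℝ} (hm : Measurable E) {C : ℝ} (hC : ∀ t, |E t| ≤ C) :
    LocallyIntegrable E :=
  (locallyIntegrable_const C).mono hm.aestronglyMeasurable
    (Eventually.of_forall fun t => (hC t).trans (le_abs_self C))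

theorem IsTimeTest.mono {T' : ℝ} (h : IsTimeTest T' θ θ') (hT : T' ≤ T) : IsTimeTest T θ θ' :=
  ⟨h.toIsTestFn, let ⟨b, hb, hz⟩ := h.zero_of_le; ⟨b, hb.trans_le hT, hz⟩⟩

theorem IsTimeTest.zero_right (h : IsTimeTest T θ θ') {t : ℝ} (ht : T ≤ t) :
    θ t = 0 ∧ θ' t = 0 := by
  obtain ⟨b, hb, hz⟩ := h.zero_of_le
  refine ⟨hz t (hb.le.trans ht), ?_⟩
  have : HasDerivAt θ 0 t := (hasDerivAt_const t 0).congr_of_eventuallyEq (by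
    filter_upwards [Ioi_mem_nhds (hb.trans_le ht)] with s hs using hz s (le_of_lt hs))
  exact (h.hasDeriv t).unique this

/-- The kernel `(1 + z²)⁻²`, and its derivative. -/
noncomputable def decayKernel (z : ℝ) : ℝ := ((1 + z ^ 2) ^ 2)⁻¹

noncomputable def decayKernel' (z : ℝ) : ℝ := -(4 * z) * ((1 + z ^ 2) ^ 3)⁻¹

theorem one_add_sq_pos' (z : ℝ) : 0 < 1 + z ^ 2 := by positivity

theorem decayKernel_hasDerivAt (z : ℝ) : HasDerivAt decayKernel (decayKernel' z) z := by
  have h1 : HasDerivAt (fun z : ℝ => (1 + z ^ 2) ^ 2) (2 * (1 + z ^ 2) * (2 * z)) z := by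
    have := ((hasDerivAt_pow 2 z).const_add 1).fun_pow 2
    simpa using this
  have hz := one_add_sq_pos' z
  refine (h1.fun_inv (by positivity)).congr_deriv ?_
  unfold decayKernel'
  field_simp
  ring

theorem decayKernel_nonneg (z : ℝ) : 0 ≤ decayKernel z := by unfold decayKernel; positivity

theorem decayKernel_le (z : ℝ) : decayKernel z ≤ (1 + z ^ 2)⁻¹ := by
  unfold decayKernel
  have : 0 ≤ z ^ 2 := sq_nonneg z
  exact inv_anti₀ (by positivity) (by nlinarith)

theorem abs_mul_decayKernel_le (z : ℝ) : |z| * decayKernel z ≤ (1 + z ^ 2)⁻¹ := by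
  unfold decayKernel
  have hz := one_add_sq_pos' z
  rw [← div_eq_mul_inv, ← one_div, div_le_div_iff₀ (by positivity) hz]
  have h1 : |z| ≤ 1 + z ^ 2 := by nlinarith [sq_abs z, sq_nonneg (|z| - 1), abs_nonneg z]
  nlinarith

/-- The reason for an algebraically decaying kernel. The Lipschitz bound `Λ |z|` of the velocity
difference meets `η'`, and here `|z| |η'|` is absorbed by `η` itself. A nonzero kernel of compact
support cannot satisfy such a bound. -/
theorem abs_mul_decayKernel'_le (z : ℝ) : |z| * |decayKernel' z| ≤ 4 * decayKernel z := by
  have hz := one_add_sq_pos' z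
  unfold decayKernel decayKernel'
  rw [abs_mul, abs_neg, abs_mul, abs_of_pos (by norm_num : (0 : ℝ) < 4),
    abs_of_pos (by positivity : 0 < ((1 + z ^ 2) ^ 3)⁻¹)]
  have : |z| * (4 * |z| * ((1 + z ^ 2) ^ 3)⁻¹) = 4 * (z ^ 2 / (1 + z ^ 2)) * ((1 + z ^ 2) ^ 2)⁻¹ := by
    rw [← sq_abs z]; field_simp
  rw [this]
  have h1 : z ^ 2 / (1 + z ^ 2) ≤ 1 := by rw [div_le_one hz]; linarith
  have h2 : 0 ≤ ((1 + z ^ 2) ^ 2)⁻¹ := by positivity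
  nlinarith

theorem abs_decayKernel'_le (z : ℝ) : |decayKernel' z| ≤ 4 * (1 + z ^ 2)⁻¹ := by
  have hz := one_add_sq_pos' z
  unfold decayKernel'
  rw [abs_mul, abs_neg, abs_mul, abs_of_pos (by norm_num : (0 : ℝ) < 4),
    abs_of_pos (by positivity : 0 < ((1 + z ^ 2) ^ 3)⁻¹), ← div_eq_mul_inv, ← div_eq_mul_inv,
    div_le_div_iff₀ (by positivity) hz]
  have h1 : |z| ≤ 1 + z ^ 2 := by nlinarith [sq_abs z, sq_nonneg (|z| - 1), abs_nonneg z]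
  have h2 : 1 ≤ 1 + z ^ 2 := by nlinarith
  nlinarith [mul_nonneg hz.le (sub_nonneg.2 h1), mul_nonneg (mul_nonneg hz.le hz.le) (sub_nonneg.2 h2)]

theorem decayKernel_isKernel {l : ℝ} (hl : 0 < l) :
    IsKernel (fun z => decayKernel (l * z)) (fun z => decayKernel' (l * z) * l) := by
  have hc : Continuous decayKernel' := by
    unfold decayKernel'
    exact (by fun_prop : Continuous fun z : ℝ => -(4 * z)).mul
      (Continuous.inv₀ (by fun_prop) fun z => by positivity)
  have hcd : Continuous decayKernel :=
    continuous_iff_continuousAt.2 fun z => (decayKernel_hasDerivAt z).continuousAt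
  have h1 : ∀ z : ℝ, (1 + z ^ 2)⁻¹ ≤ 1 := fun z => inv_le_one_of_one_le₀ (by nlinarith [sq_nonneg z])
  refine ⟨fun z => ?_, by fun_prop, fun z => decayKernel_nonneg _, ?_, ?_, 1 + 4 * l, fun z => ⟨?_, ?_⟩⟩
  · have h2 : HasDerivAt (fun z : ℝ => l * z) l z := by
      simpa using (hasDerivAt_id z).const_mul l
    exact (decayKernel_hasDerivAt (l * z)).comp z h2
  · exact (integrable_inv_one_add_sq.mono' hcd.aestronglyMeasurable (Eventually.of_forall fun z => by
      rw [Real.norm_eq_abs, abs_of_nonneg (decayKernel_nonneg z)]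
      exact decayKernel_le z)).comp_mul_left' hl.ne'
  · exact (((integrable_inv_one_add_sq.const_mul 4).mono' hc.aestronglyMeasurable
      (Eventually.of_forall abs_decayKernel'_le)).comp_mul_left' hl.ne').mul_const l
  · rw [abs_of_nonneg (decayKernel_nonneg _)]
    linarith [decayKernel_le (l * z), h1 (l * z)]
  · rw [abs_mul, abs_of_pos hl]
    nlinarith [abs_decayKernel'_le (l * z), h1 (l * z)]

/-- The kernel is not normalised: its mass and its width are both of order `1 / l`, whence the first
moment of order `1 / l²`. -/
theorem integral_abs_mul_decayKernel {l : ℝ} (hl : 0 < l) :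
    Integrable (fun z => |z| * decayKernel (l * z)) ∧
    ∫ z, |z| * decayKernel (l * z) = (∫ z, |z| * decayKernel z) / l ^ 2 := by
  have hcd : Continuous decayKernel :=
    continuous_iff_continuousAt.2 fun z => (decayKernel_hasDerivAt z).continuousAt
  have i : Integrable fun z => |z| * decayKernel z :=
    integrable_inv_one_add_sq.mono' (by fun_prop) (Eventually.of_forall fun z => by
      rw [Real.norm_eq_abs, abs_of_nonneg (mul_nonneg (abs_nonneg z) (decayKernel_nonneg z))]
      exact abs_mul_decayKernel_le z)
  have e : (fun z => |z| * decayKernel (l * z)) = fun z => l⁻¹ * (|l * z| * decayKernel (l * z)) := by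
    funext z
    rw [abs_mul, abs_of_pos hl]
    field_simp
  constructor
  · rw [e]
    exact (i.comp_mul_left' hl.ne').const_mul _
  · rw [e, integral_const_mul, Measure.integral_comp_mul_left (fun z => |z| * decayKernel z),
      abs_of_pos (inv_pos.2 hl), smul_eq_mul]
    field_simp

end

/-! ### Finiteness of the total variation -/

section

variable {F : ℝ → ℝ} {R A M M' c Λ T : ℝ} {u w V W Vx Wx : ℝ → ℝ → ℝ} {θ θ' η η' : ℝ → ℝ}

theorem doubling_kernel' (hF : IsFluxFactor F R A) (hu : IsDensity R M u)
    (hw : IsDensity R M' w) (hV : IsVelocity c Λ V Vx) (hW : IsVelocity c Λ W Wx)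
    (ku : IsKruzkov F R T u V Vx) (kw : IsKruzkov F R T w W Wx) (hθ : IsTimeTest T θ θ')
    (hη : IsKernel η η') :
    0 ≤ ∫ t, (θ' t * kernDist u w η t + θ t * kernFlux F u w V W Vx Wx η η' t) :=
  doubling_kernel hF hu hw hV hW ku kw hθ hη

/-- A solution is compared with itself. The velocities differ by at most `Λ |x - y|`, which `hηa`
absorbs into the kernel, so the self-distance reappears on the right. What is left is the variation
of `Vx` times the first moment of the kernel. No variation of `u` enters. -/
theorem kernFlux_self_le (hF : IsFluxFactor F R A) (hu : IsDensity R M u)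
    (hV : IsVelocity c Λ V Vx) (hη : IsKernel η η') {a : ℝ}
    (hηa : ∀ x, |x| * |η' x| ≤ a * η x) (hη1 : Integrable fun x => |x| * η x) {t P : ℝ}
    (hP : HasVarLE (Vx t) P) :
    kernFlux F u u V V Vx Vx η η' t
      ≤ A * Λ * (a + 1) * kernDist u u η t + R * (P * ∫ x, |x| * η x) := by
  have hΛ : 0 ≤ Λ := (abs_nonneg _).trans (hV.abs_x_le 0 0)
  have hA := hF.A_nonneg
  have i1 : Integrable fun z : ℝ × ℝ => |u t z.1 - u t z.2| * η (z.1 - z.2) := by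
    have hηc := hη.continuous
    refine (hu.integrable_pair hu hη.integrable t).mono' ?_ (Eventually.of_forall fun z => ?_)
    · exact (((hu.integrable t).1.comp_fst (ν := volume)).sub
        ((hu.integrable t).1.comp_snd (μ := volume))).norm.mul
        (by fun_prop : Continuous fun z : ℝ × ℝ => η (z.1 - z.2)).aestronglyMeasurable
    · rw [Real.norm_eq_abs, abs_mul, abs_abs, abs_of_nonneg (hη.nonneg _)]
      exact mul_le_mul_of_nonneg_right (hu.abs_sub_le_add hu t _ _) (hη.nonneg _)
  have i2 : Integrable fun z : ℝ × ℝ => |Vx t z.1 - Vx t z.2| * η (z.1 - z.2) := by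
    have h := ((integrable_mul_kernel_left (hV.integrable_x t) hη.integrable).sub
      (integrable_mul_kernel_right (hV.integrable_x t) hη.integrable)).abs
    refine h.congr (Eventually.of_forall fun z => ?_)
    simp only [Pi.sub_apply, ← sub_mul, abs_mul, abs_of_nonneg (hη.nonneg _)]
  have hPk := hP.integral_kernel_le (hV.integrable_x t) hη.integrable hη.nonneg hη1
  refine le_trans ?_ (add_le_add_right (mul_le_mul_of_nonneg_left hPk hF.R_pos.le) _)
  unfold kernFlux kernDist
  rw [← integral_const_mul, ← integral_const_mul, ← integral_add (i1.const_mul _) (i2.const_mul _)]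
  refine integral_mono_ae ?_ ((i1.const_mul _).add (i2.const_mul _))
    (Eventually.of_forall fun z => ?_)
  · have hk := hη.integrable.abs.add hη.integrable'.abs
    refine ((hu.integrable_pair hu hk t).const_mul (A * (2 * c * (1 + 0) + Λ) + 2 * Λ)).mono'
      ?_ (Eventually.of_forall fun z => abs_kernFlux_integrand_le hF hu hu hV hV t z)
    have hηc := hη.continuous
    have hηc' := hη.cont'
    have m1 : ∀ {f : ℝ → ℝ → ℝ}, (Measurable fun p : ℝ × ℝ => f p.1 p.2) →
        Measurable fun q : ℝ × ℝ => f t q.1 := fun h =>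
      h.comp (by fun_prop : Measurable fun q : ℝ × ℝ => (t, q.1))
    have m2 : ∀ {f : ℝ → ℝ → ℝ}, (Measurable fun p : ℝ × ℝ => f p.1 p.2) →
        Measurable fun q : ℝ × ℝ => f t q.2 := fun h =>
      h.comp (by fun_prop : Measurable fun q : ℝ × ℝ => (t, q.2))
    have hηm : Measurable fun q : ℝ × ℝ => η (q.1 - q.2) := by fun_prop
    have hηm' : Measurable fun q : ℝ × ℝ => η' (q.1 - q.2) := by fun_prop
    exact (((measurable_kruzFlux hF.measurable (m1 hu.measurable) (m2 hu.measurable)).mul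
      ((((m1 hV.measurable).sub (m2 hV.measurable)).mul hηm').add
      ((m1 hV.measurable_x).mul hηm))).add (((hF.measurable.comp (m1 hu.measurable)).mul
      ((m2 hV.measurable_x).sub (m1 hV.measurable_x)).abs).mul hηm)).aestronglyMeasurable
  · have hη0 := hη.nonneg (z.1 - z.2)
    have h1 : |kruzFlux F (u t z.1) (u t z.2) * ((V t z.1 - V t z.2) * η' (z.1 - z.2)
        + Vx t z.1 * η (z.1 - z.2))| ≤ A * |u t z.1 - u t z.2| * (Λ * (a + 1) * η (z.1 - z.2)) := by
      rw [abs_mul]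
      refine mul_le_mul (hF.abs_kruzFlux_le (hu.mem _ _) (hu.mem _ _)) ?_ (abs_nonneg _)
        (by positivity)
      refine (abs_add_le _ _).trans ?_
      rw [abs_mul, abs_mul, abs_of_nonneg hη0]
      calc _ ≤ Λ * |z.1 - z.2| * |η' (z.1 - z.2)| + Λ * η (z.1 - z.2) := by
            gcongr
            · exact hV.lip t _ _
            · exact hV.abs_x_le t _
        _ ≤ Λ * (a * η (z.1 - z.2)) + Λ * η (z.1 - z.2) := by
            have := mul_le_mul_of_nonneg_left (hηa (z.1 - z.2)) hΛ
            linarith [mul_assoc Λ |z.1 - z.2| |η' (z.1 - z.2)|]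
        _ = _ := by ring
    have h2 : F (u t z.1) * |Vx t z.2 - Vx t z.1| * η (z.1 - z.2)
        ≤ R * (|Vx t z.1 - Vx t z.2| * η (z.1 - z.2)) := by
      rw [abs_sub_comm, mul_assoc]
      exact mul_le_mul_of_nonneg_right ((le_abs_self _).trans (hF.abs_le (hu.mem _ _)))
        (by positivity)
    have h3 := (le_abs_self _).trans h1
    simp only
    linarith

/-- The modulus of continuity at a given scale, from the smeared self-distance. -/
theorem shift_le_of_kernel {g : ℝ → ℝ} (hg : Integrable g) {l C : ℝ} (hl : 0 < l)
    (h : ∫ z : ℝ × ℝ, |g z.1 - g z.2| * decayKernel (l * (z.1 - z.2)) ≤ C / l ^ 2) :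
    ∫ x, |g (x + 1 / l) - g x| ≤ 8 * C * (1 / l) := by
  obtain ⟨i, e⟩ := integral_abs_sub_mul_kernel hg (decayKernel_isKernel hl).integrable
  rw [e] at h
  set G : ℝ → ℝ := fun s => ∫ y, |g (y + s) - g y| with hG
  have hG0 : ∀ s, 0 ≤ G s := fun s => integral_nonneg fun _ => abs_nonneg _
  have hgs : ∀ s, Integrable fun y => |g (y + s) - g y| := fun s =>
    ((hg.comp_add_right s).sub hg).abs
  -- Subadditivity bounds `G (1 / l)` by `G s + G (1 / l - s)`. Averaging over `s` in `[0, 1 / l]`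
  -- costs a factor 2, and the kernel is at least `1 / 4` there: together the constant 8.
  have hsub : ∀ s r, G (s + r) ≤ G s + G r := fun s r => by
    have e1 : G r = ∫ y, |g (y + s + r) - g (y + s)| :=
      (integral_add_right_eq_self (fun y => |g (y + r) - g y|) s).symm
    rw [e1, hG]
    simp only
    rw [← integral_add (hgs s) ((hgs r).comp_add_right s)]
    refine integral_mono (hgs _) ((hgs s).add ((hgs r).comp_add_right s)) fun y => ?_
    simp only
    rw [← add_assoc, add_comm |_|]
    refine le_trans (le_of_eq ?_) (abs_add_le _ _)
    congr 1; ring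
  have hdk : ∀ s ∈ Icc 0 (1 / l), (1 / 4 : ℝ) ≤ decayKernel (l * s) := fun s hs => by
    have h1 : l * s ≤ 1 := by
      have := mul_le_mul_of_nonneg_left hs.2 hl.le
      rwa [mul_one_div_cancel hl.ne'] at this
    have h0 : 0 ≤ l * s := mul_nonneg hl.le hs.1
    unfold decayKernel
    rw [one_div]
    refine inv_anti₀ (by positivity) ?_
    have : (l * s) ^ 2 ≤ 1 := by nlinarith
    nlinarith [sq_nonneg (l * s)]
  have hGm : AEStronglyMeasurable G volume := by
    have hcd : Continuous fun s => decayKernel (l * s) := (decayKernel_isKernel hl).continuous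
    have hpos : ∀ s, decayKernel (l * s) ≠ 0 := fun s => by
      unfold decayKernel; positivity
    refine (i.1.mul (hcd.inv₀ hpos).aestronglyMeasurable).congr (Eventually.of_forall fun s => ?_)
    simp [hpos s, hG]
  have hGi : IntegrableOn G (Icc 0 (1 / l)) := by
    refine (i.integrableOn.const_mul 4).mono' hGm.restrict ?_
    refine (ae_restrict_iff' measurableSet_Icc).2 (Eventually.of_forall fun s hs => ?_)
    rw [Real.norm_eq_abs, abs_of_nonneg (hG0 s)]
    nlinarith [hdk s hs, hG0 s]
  have h4 : ∫ s in (0 : ℝ)..1 / l, G s ≤ 4 * (C / l ^ 2) := by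
    rw [intervalIntegral.integral_of_le (by positivity), ← integral_Icc_eq_integral_Ioc]
    calc ∫ s in Icc 0 (1 / l), G s ≤ ∫ s in Icc 0 (1 / l), 4 * (G s * decayKernel (l * s)) :=
          setIntegral_mono_on hGi (i.integrableOn.const_mul 4) measurableSet_Icc fun s hs => by
            nlinarith [hdk s hs, hG0 s]
      _ ≤ ∫ s, 4 * (G s * decayKernel (l * s)) :=
          setIntegral_le_integral (i.const_mul 4) (Eventually.of_forall fun s => by
            have := mul_nonneg (hG0 s) (decayKernel_nonneg (l * s))
            simp only [Pi.zero_apply]; linarith)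
      _ ≤ _ := by rw [integral_const_mul]; linarith
  have hII : IntervalIntegrable G volume 0 (1 / l) :=
    (intervalIntegrable_iff_integrableOn_Icc_of_le (by positivity)).2 hGi
  have hII' : IntervalIntegrable (fun s => G (1 / l - s)) volume 0 (1 / l) := by
    have := hII.comp_sub_left (1 / l)
    simpa using this.symm
  have h5 : G (1 / l) * (1 / l) ≤ 2 * ∫ s in (0 : ℝ)..1 / l, G s := by
    have e1 : ∫ s in (0 : ℝ)..1 / l, G (1 / l - s) = ∫ s in (0 : ℝ)..1 / l, G s := by
      rw [intervalIntegral.integral_comp_sub_left]; simp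
    have e2 : ∫ _ in (0 : ℝ)..1 / l, G (1 / l) = G (1 / l) * (1 / l) := by
      rw [intervalIntegral.integral_const]; simp [mul_comm]
    have e3 : ∫ s in (0 : ℝ)..1 / l, (G s + G (1 / l - s)) = 2 * ∫ s in (0 : ℝ)..1 / l, G s := by
      rw [intervalIntegral.integral_add hII hII', e1, two_mul]
    rw [← e2, ← e3]
    refine intervalIntegral.integral_mono_on (by positivity) (by simp) (hII.add hII') fun s _ => ?_
    have := hsub s (1 / l - s)
    rwa [add_sub_cancel] at this
  have h6 : G (1 / l) * (1 / l) ≤ 8 * C * (1 / l) * (1 / l) := by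
    refine h5.trans ((mul_le_mul_of_nonneg_left h4 two_pos.le).trans (le_of_eq ?_))
    field_simp; ring
  exact le_of_mul_le_mul_right h6 (by positivity)

/-- A velocity of bounded variation in space propagates bounded variation. -/
theorem exists_hasVarLE (hF : IsFluxFactor F R A) (hu : IsDensity R M u)
    (hV : IsVelocity c Λ V Vx) (ku : IsKruzkov F R T u V Vx) {t₀ T' N P : ℝ} (h0 : t₀ < T')
    (hT' : T' ≤ T) (hP : ∀ᵐ t, t < T' → HasVarLE (Vx t) P)
    (hN : ∀ᵐ t, t < t₀ → HasVarLE (u t) N) :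
    ∃ N', ∀ᵐ t, t < T' → HasVarLE (u t) N' := by
  have hΛ : 0 ≤ Λ := (abs_nonneg _).trans (hV.abs_x_le 0 0)
  have hA := hF.A_nonneg
  have hR := hF.R_pos.le
  have hcd : Continuous decayKernel :=
    continuous_iff_continuousAt.2 fun z => (decayKernel_hasDerivAt z).continuousAt
  obtain ⟨t₁, ht₁⟩ : ∃ t₁, t₁ < t₀ ∧ HasVarLE (u t₁) N := by
    have h1 : ∃ᵐ t, t ∈ Iio t₀ := by
      rw [frequently_ae_mem_iff, Real.volume_Iio]; exact ENNReal.top_ne_zero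
    obtain ⟨t, h, h'⟩ := (h1.and_eventually hN).exists
    exact ⟨t, h, h' h⟩
  have hN0 := ht₁.2.nonneg
  have hP0 : 0 ≤ P := by
    have h1 : ∃ᵐ t, t ∈ Iio T' := by
      rw [frequently_ae_mem_iff, Real.volume_Iio]; exact ENNReal.top_ne_zero
    obtain ⟨t, h, h'⟩ := (h1.and_eventually hP).exists
    exact (h' h).nonneg
  -- The rate in `kernFlux_self_le`, with the 4 of `abs_mul_decayKernel'_le`. The weight `exp (-a
  -- t)` in the test function removes the corresponding term from the inequality.
  set a := A * Λ * (4 + 1) with ha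
  have ha0 : 0 ≤ a := by positivity
  set I := ∫ z, |z| * decayKernel z with hI
  have hI0 : 0 ≤ I := integral_nonneg fun z => mul_nonneg (abs_nonneg _) (decayKernel_nonneg _)
  set E₁ := Real.exp (-a * (t₀ - 2)) * (N * I) with hE₁
  set Y₁ := Real.exp (-a * t₀) * (R * (P * I)) with hY₁
  have hE₁0 : 0 ≤ E₁ := by positivity
  have hY₁0 : 0 ≤ Y₁ := by positivity
  -- The smeared self-distance at scale `1 / l` is at most `C / l²` with `C` free of `l`. By
  -- `shift_le_of_kernel` this is a modulus of continuity linear in `1 / l`.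
  set C := Real.exp (a * T') * (E₁ + (T' - t₀) * Y₁) with hC
  have hC0 : 0 ≤ C := by
    have : 0 ≤ T' - t₀ := by linarith
    positivity
  have main : ∀ n : ℕ, ∀ᵐ t, t ∈ Ioo t₀ T' →
      ∫ x, |u t (x + 1 / ((n : ℝ) + 1)) - u t x| ≤ 8 * C * (1 / ((n : ℝ) + 1)) := by
    intro n
    set l : ℝ := (n : ℝ) + 1 with hl
    have hl0 : 0 < l := by positivity
    have hη := decayKernel_isKernel hl0
    obtain ⟨hη1, hηI⟩ := integral_abs_mul_decayKernel hl0
    have hηa : ∀ x, |x| * |decayKernel' (l * x) * l| ≤ 4 * decayKernel (l * x) := fun x => by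
      have := abs_mul_decayKernel'_le (l * x)
      rw [abs_mul, abs_of_pos hl0] at this ⊢
      linarith
    set η : ℝ → ℝ := fun z => decayKernel (l * z) with hηd
    set η' : ℝ → ℝ := fun z => decayKernel' (l * z) * l with hηd'
    set D := kernDist u u η with hD
    have hD0 : ∀ t, 0 ≤ D t := fun t => integral_nonneg fun z =>
      mul_nonneg (abs_nonneg _) (hη.nonneg _)
    have hDm : Measurable D := measurable_kernDist hu hu hη
    have hDb : ∀ t, |D t| ≤ (M + M) * ∫ x, η x := abs_kernDist_le hu hu hη
    have hDl : LocallyIntegrable D := locallyIntegrable_of_bdd hDm hDb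
    obtain ⟨K, hK⟩ := exists_kernFlux_bound hF hu hu hV hV hη
    have hBl := locallyIntegrable_of_bdd (measurable_kernFlux hF hu hu hV hV hη) hK
    set Y : ℝ → ℝ := fun t => Real.exp (-a * t) * (R * (P * (I / l ^ 2))) with hY
    have hYc : Continuous Y := by fun_prop
    have hEl : LocallyIntegrable fun t => Real.exp (-a * t) * D t := by
      have := hDl.smul_continuous (g := fun t => Real.exp (-a * t)) (by fun_prop)
      simpa [mul_comm] using this
    have hti := ae_le_add_integral_of_distrib (t₀ := t₀) (T := T') (E₀ := E₁ / l ^ 2) hEl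
      hYc.locallyIntegrable (fun t => by positivity) ?_ ?_
    · filter_upwards [hti] with t ht htI
      refine shift_le_of_kernel (hu.integrable t) hl0 ?_
      change D t ≤ _
      have h1 := ht htI
      have h2 : ∫ s in t₀..t, Y s ≤ (T' - t₀) * (Y₁ / l ^ 2) := by
        calc ∫ s in t₀..t, Y s ≤ ∫ _ in t₀..t, Y₁ / l ^ 2 := by
              refine intervalIntegral.integral_mono_on htI.1.le (hYc.intervalIntegrable _ _)
                (by simp) fun s hs => ?_
              rw [hY, hY₁]
              simp only
              rw [mul_div_assoc, mul_div_assoc, mul_div_assoc]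
              refine mul_le_mul_of_nonneg_right (Real.exp_le_exp.2 ?_) (by positivity)
              nlinarith [hs.1]
          _ = (t - t₀) * (Y₁ / l ^ 2) := by
              rw [intervalIntegral.integral_const, smul_eq_mul]
          _ ≤ _ := mul_le_mul_of_nonneg_right (by linarith [htI.2]) (by positivity)
      have h3 : D t = Real.exp (a * t) * (Real.exp (-a * t) * D t) := by
        rw [← mul_assoc, ← Real.exp_add]; simp
      rw [h3, hC]
      have h4 : Real.exp (a * t) ≤ Real.exp (a * T') :=
        Real.exp_le_exp.2 (mul_le_mul_of_nonneg_left htI.2.le ha0)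
      calc _ ≤ Real.exp (a * T') * (E₁ / l ^ 2 + (T' - t₀) * (Y₁ / l ^ 2)) :=
            mul_le_mul h4 (h1.trans (by linarith)) (mul_nonneg (Real.exp_pos _).le (hD0 t))
              (Real.exp_pos _).le
        _ = _ := by ring
    · filter_upwards [hN] with t ht htI
      have h1 := (ht htI.2).integral_kernel_le (hu.integrable t) hη.integrable hη.nonneg hη1
      rw [hηI] at h1
      rw [hE₁, mul_div_assoc, mul_div_assoc]
      refine mul_le_mul (Real.exp_le_exp.2 ?_) h1 (hD0 t) (Real.exp_pos _).le
      nlinarith [htI.1]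
    · intro θ θ' hθ
      have hexp : ∀ t, HasDerivAt (fun t => Real.exp (-a * t)) (Real.exp (-a * t) * (-a)) t :=
        fun t => by
          have : HasDerivAt (fun t : ℝ => -a * t) (-a) t := by
            simpa using (hasDerivAt_id t).const_mul (-a)
          exact this.exp
      have hθc := hθ.continuous
      have hθc' := hθ.cont'
      have hθ₁ : IsTimeTest T' (fun t => Real.exp (-a * t) * θ t)
          (fun t => Real.exp (-a * t) * (-a) * θ t + Real.exp (-a * t) * θ' t) :=
        ⟨⟨fun t => (hexp t).fun_mul (hθ.hasDeriv t), by fun_prop, hθ.supp.mul_left,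
          fun t => mul_nonneg (Real.exp_pos _).le (hθ.nonneg t)⟩,
          let ⟨b, hb, hz⟩ := hθ.zero_of_le; ⟨b, hb, fun t ht => by simp [hz t ht]⟩⟩
      have hd := doubling_kernel' hF hu hu hV hV ku ku (hθ₁.mono hT') hη
      refine hd.trans (integral_mono_ae ((hθ₁.integrable_mul' hDl).add (hθ₁.integrable_mul hBl))
        ((hθ.integrable_mul' hEl).add (hθ.integrable_mul hYc.locallyIntegrable)) ?_)
      filter_upwards [hP] with t ht
      rcases lt_or_ge t T' with htT | htT
      · have h1 := kernFlux_self_le hF hu hV hη hηa hη1 (ht htT)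
        have hw : 0 ≤ Real.exp (-a * t) * θ t := mul_nonneg (Real.exp_pos _).le (hθ.nonneg t)
        have h2 := mul_le_mul_of_nonneg_left h1 hw
        have hηI' : ∫ x, |x| * η x = I / l ^ 2 := hηI
        rw [hηI'] at h2
        refine le_trans (add_le_add_right h2 _) (le_of_eq ?_)
        simp only [hY]
        rw [← hD, ← ha]
        ring
      · have z1 : θ t = 0 := (hθ.zero_right htT).1
        simp only [z1, mul_zero, zero_mul, add_zero, zero_add]
        exact le_of_eq (by ring)
  -- This bound is not the one of the theorem. Only its finiteness is used, as the starting point of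
  -- the iteration in `ae_hasVarLE_exp`.
  refine ⟨max N (8 * C), ?_⟩
  have hne : ∀ᵐ t : ℝ, t ≠ t₀ := by simp [ae_iff]
  filter_upwards [ae_all_iff.2 main, hN, hne] with t h1 h2 h3 htT
  rcases lt_or_gt_of_ne h3 with h | h
  · exact (h2 h).mono (le_max_left _ _)
  · exact (hasVarLE_of_totalVar_le (hu.integrable t) (by positivity)
      (totalVar_le_of_shift (hu.integrable t) fun n => h1 n ⟨h, htT⟩)).mono (le_max_right _ _)

end

/-! ### Stability with respect to the velocity field -/

section

variable {F : ℝ → ℝ} {R A M M' c Λ T : ℝ} {u w V W Vx Wx : ℝ → ℝ → ℝ} {θ θ' η η' : ℝ → ℝ}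

theorem IsVelocity.continuous (hV : IsVelocity c Λ V Vx) (t : ℝ) : Continuous (V t) := by
  have h : LipschitzWith Λ.toNNReal (V t) := LipschitzWith.of_dist_le' fun x y => by
    rw [Real.dist_eq, Real.dist_eq]; exact hV.lip t x y
  exact h.continuous

theorem integrable_kruzFlux_pair (hF : IsFluxFactor F R A) (hu : IsDensity R M u)
    (hw : IsDensity R M' w) (t : ℝ) {g : ℝ × ℝ → ℝ} (hg : AEStronglyMeasurable g) {k : ℝ → ℝ}
    (hk : Integrable k) (hgk : ∀ z, |g z| ≤ k (z.1 - z.2)) :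
    Integrable fun z : ℝ × ℝ => kruzFlux F (u t z.1) (w t z.2) * g z := by
  have m1 : Measurable fun q : ℝ × ℝ => u t q.1 :=
    hu.measurable.comp (by fun_prop : Measurable fun q : ℝ × ℝ => (t, q.1))
  have m2 : Measurable fun q : ℝ × ℝ => w t q.2 :=
    hw.measurable.comp (by fun_prop : Measurable fun q : ℝ × ℝ => (t, q.2))
  refine ((hu.integrable_pair hw hk t).const_mul A).mono'
    ((measurable_kruzFlux hF.measurable m1 m2).aestronglyMeasurable.mul hg)
    (Eventually.of_forall fun z => ?_)
  rw [Real.norm_eq_abs, abs_mul, ← mul_assoc]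
  have h1 := hF.abs_kruzFlux_le (hu.mem t z.1) (hw.mem t z.2)
  have h2 := mul_le_mul_of_nonneg_left (hu.abs_sub_le_add hw t z.1 z.2) hF.A_nonneg
  have h0 := (abs_nonneg _).trans (h1.trans h2)
  exact mul_le_mul (h1.trans h2) (hgk z) (abs_nonneg _) h0

/-- The transport part of the production is controlled by the variation of one density and the
distance of the velocities. -/
theorem integral_kruzFlux_mul_le (hF : IsFluxFactor F R A) (hu : IsDensity R M u)
    (hw : IsDensity R M' w) (hV : IsVelocity c Λ V Vx) (hW : IsVelocity c Λ W Wx)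
    (hη : IsTestFn η η') (hη1 : ∫ x, η x = 1) {ε : ℝ} (hε : ∀ x, ε ≤ |x| → η x = 0)
    (hε1 : ε ≤ 1) {t n d : ℝ} (hn : HasVarLE (u t) n) (hd : ∀ x, |V t x - W t x| ≤ d) :
    ∫ z : ℝ × ℝ, kruzFlux F (u t z.1) (w t z.2) * ((V t z.1 - W t z.2) * η' (z.1 - z.2)
      + Vx t z.1 * η (z.1 - z.2)) ≤ A * n * (d + Λ * ε) := by
  have hΛ : 0 ≤ Λ := (abs_nonneg _).trans (hV.abs_x_le 0 0)
  have hc : 0 ≤ c := (abs_nonneg _).trans (hV.abs_le 0 0)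
  have hA := hF.A_nonneg
  have hηc := hη.continuous
  obtain ⟨C, hC0, hCη, hCη', hCz⟩ : ∃ C : ℝ, 0 ≤ C ∧ (∀ x, |η x| ≤ C) ∧ (∀ x, |η' x| ≤ C) ∧
      True := by
    obtain ⟨C₁, h₁⟩ := hη.supp.exists_bound_of_continuous hη.continuous
    obtain ⟨C₂, h₂⟩ := hη.supp'.exists_bound_of_continuous hη.cont'
    exact ⟨max C₁ C₂, (norm_nonneg _).trans ((h₁ 0).trans (le_max_left _ _)),
      fun x => (h₁ x).trans (le_max_left _ _), fun x => (h₂ x).trans (le_max_right _ _), trivial⟩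
  set q : ℝ × ℝ → ℝ := fun z => kruzFlux F (u t z.1) (w t z.2) with hq
  -- The bracket is the `x`-derivative of `(V(x) - W(y)) η(x - y)`, that is, the derivative of `φ k`
  -- at `k = 0`. In the difference quotient the shift is moved onto the Kruzhkov flux, where it
  -- costs `A` times the variation of `u`; the remaining factor `φ 0` contains only the difference
  -- of the velocities.
  set φ : ℝ → ℝ × ℝ → ℝ := fun k z => (V t (z.1 + k) - W t z.2) * η (z.1 + k - z.2) with hφ
  have hVc := hV.continuous t
  have hWc := hW.continuous t
  have hφc : ∀ k, Continuous (φ k) := fun k => by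
    refine ((hVc.comp (by fun_prop : Continuous fun z : ℝ × ℝ => z.1 + k)).sub
      (hWc.comp continuous_snd)).mul
      (hηc.comp (by fun_prop : Continuous fun z : ℝ × ℝ => z.1 + k - z.2))
  set K := Λ * C + 2 * c * C with hK
  -- `η` vanishes off `[-1, 1]` and the shifts are at most 1, whence the window `[-2, 2]`.
  set kb : ℝ → ℝ := (Icc (-2 : ℝ) 2).indicator fun _ => K with hkb
  have hkbi : Integrable kb := (integrable_indicator_iff measurableSet_Icc).2 (by simp)
  have hkbm : Measurable kb := measurable_const.indicator measurableSet_Icc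
  have hVW : ∀ x y, |V t x - W t y| ≤ 2 * c := fun x y => by
    have h1 := abs_le.1 (hV.abs_le t x)
    have h2 := abs_le.1 (hW.abs_le t y)
    exact abs_le.2 ⟨by linarith, by linarith⟩
  have hηz : ∀ x, 1 ≤ |x| → η x = 0 := fun x hx => hε x (hε1.trans hx)
  have hφlip : ∀ k ∈ Icc (0 : ℝ) 1, ∀ z, |φ k z - φ 0 z| ≤ kb (z.1 - z.2) * k := by
    intro k hk z
    by_cases hz : z.1 - z.2 ∈ Icc (-2 : ℝ) 2
    · rw [hkb, indicator_of_mem hz]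
      have e : φ k z - φ 0 z = (V t (z.1 + k) - V t z.1) * η (z.1 + k - z.2)
          + (V t z.1 - W t z.2) * (η (z.1 + k - z.2) - η (z.1 - z.2)) := by
        simp only [hφ, add_zero]; ring
      rw [e]
      refine (abs_add_le _ _).trans ?_
      rw [abs_mul, abs_mul]
      have h1 := hV.lip t (z.1 + k) z.1
      have h2 := lipschitz_of_hasDerivAt hη.hasDeriv hCη' (z.1 + k - z.2) (z.1 - z.2)
      rw [add_sub_cancel_left, abs_of_nonneg hk.1] at h1
      rw [show z.1 + k - z.2 - (z.1 - z.2) = k by ring, abs_of_nonneg hk.1] at h2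
      have h3 := mul_le_mul h1 (hCη (z.1 + k - z.2)) (abs_nonneg _) (mul_nonneg hΛ hk.1)
      have h4 := mul_le_mul (hVW z.1 z.2) h2 (abs_nonneg _) (by positivity)
      rw [hK]; linarith
    · rw [hkb, indicator_of_notMem hz]
      have hz' : 2 < |z.1 - z.2| := by rwa [mem_Icc, ← abs_le, not_le] at hz
      have h1 : 1 ≤ |z.1 + k - z.2| := by
        rcases lt_abs.1 hz' with h | h
        · exact le_abs.2 (Or.inl (by linarith [hk.1]))
        · exact le_abs.2 (Or.inr (by linarith [hk.2]))
      simp [hφ, hηz _ h1, hηz _ (by linarith : 1 ≤ |z.1 - z.2|)]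
  have hm1 : Measurable fun z : ℝ × ℝ => u t z.1 :=
    hu.measurable.comp (by fun_prop : Measurable fun q : ℝ × ℝ => (t, q.1))
  have hm2 : Measurable fun z : ℝ × ℝ => w t z.2 :=
    hw.measurable.comp (by fun_prop : Measurable fun q : ℝ × ℝ => (t, q.2))
  have hqm : Measurable q := measurable_kruzFlux hF.measurable hm1 hm2
  have hK0 : 0 ≤ K := by positivity
  have hkb0 : ∀ x, 0 ≤ kb x := fun x => indicator_nonneg (fun _ _ => hK0) x
  have hlim := tendsto_integral_diffQuot (μ := (volume : Measure (ℝ × ℝ))) (u := q) (φ := φ)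
    (φ' := fun z => (V t z.1 - W t z.2) * η' (z.1 - z.2) + Vx t z.1 * η (z.1 - z.2))
    (bd := fun z => kb (z.1 - z.2)) hqm.aestronglyMeasurable
    (fun k => (hφc k).aestronglyMeasurable)
    (integrable_kruzFlux_pair hF hu hw t
      (hkbm.comp (by fun_prop : Measurable fun z : ℝ × ℝ => z.1 - z.2)).aestronglyMeasurable
      hkbi fun z => by rw [abs_of_nonneg (hkb0 _)])
    (fun n => Eventually.of_forall fun z => hφlip _ ⟨by positivity, one_div_succ_le_one n⟩ z)
    (by
      have h := Measure.quasiMeasurePreserving_fst (μ := (volume : Measure ℝ))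
        (ν := (volume : Measure ℝ)) |>.ae (hV.hasDerivAt t)
      filter_upwards [h] with z hz
      have h1 : HasDerivAt (fun k : ℝ => z.1 + k) 1 0 := by
        simpa using (hasDerivAt_id (0 : ℝ)).const_add z.1
      have h2 : HasDerivAt (fun k : ℝ => z.1 + k - z.2) 1 0 := h1.sub_const z.2
      have h3 : HasDerivAt (fun k : ℝ => V t (z.1 + k)) (Vx t z.1 * 1) 0 :=
        HasDerivAt.comp (h₂ := V t) 0 (by simpa using hz) h1
      have h4 : HasDerivAt (fun k : ℝ => η (z.1 + k - z.2)) (η' (z.1 - z.2) * 1) 0 :=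
        HasDerivAt.comp (h₂ := η) 0 (by simpa using hη.hasDeriv (z.1 - z.2)) h2
      refine ((h3.sub_const (W t z.2)).fun_mul h4).congr_deriv ?_
      simp; ring)
  refine le_of_tendsto hlim (Eventually.of_forall fun N => ?_)
  set k : ℝ := 1 / ((N : ℝ) + 1) with hk
  have hk0 : 0 < k := by positivity
  have hkN : (N : ℝ) + 1 = 1 / k := by rw [hk, one_div_one_div]
  have hφ0 : ∀ z, |φ 0 z| ≤ (d + Λ * ε) * η (z.1 - z.2) := fun z => by
    simp only [hφ, add_zero]
    rw [abs_mul, abs_of_nonneg (hη.nonneg _)]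
    rcases le_or_gt ε |z.1 - z.2| with h | h
    · simp [hε _ h]
    · refine mul_le_mul_of_nonneg_right ?_ (hη.nonneg _)
      have h1 := hW.lip t z.1 z.2
      have h2 := hd z.1
      have h3 := mul_le_mul_of_nonneg_left h.le hΛ
      have := abs_sub_le (V t z.1) (W t z.1) (W t z.2)
      linarith
  have hde : 0 ≤ d + Λ * ε := by
    have h1 := (abs_nonneg _).trans (hd 0)
    have h2 : 0 ≤ ε := by
      by_contra! hneg
      have : ∀ x, η x = 0 := fun x => hε x (hneg.le.trans (abs_nonneg _))
      simp [this] at hη1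
    positivity
  have iφ : ∀ k, k ∈ Icc (0 : ℝ) 1 → Integrable fun z => q z * φ k z := fun k hk => by
    have hki : Integrable fun x => 2 * c * η (x + k) := (hη.integrable.comp_add_right k).const_mul _
    refine integrable_kruzFlux_pair hF hu hw t (hφc k).aestronglyMeasurable hki fun z => ?_
    simp only [hφ]
    rw [abs_mul, sub_add_eq_add_sub, abs_of_nonneg (hη.nonneg _)]
    exact mul_le_mul_of_nonneg_right (hVW _ _) (hη.nonneg _)
  have hmp : MeasurePreserving (fun z : ℝ × ℝ => (z.1 - k, z.2)) volume volume :=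
    (measurePreserving_sub_right volume k).prod (MeasurePreserving.id (volume : Measure ℝ))
  have hme : MeasurableEmbedding (fun z : ℝ × ℝ => (z.1 - k, z.2)) :=
    ((Homeomorph.subRight k).prodCongr (Homeomorph.refl ℝ)).measurableEmbedding
  have ishift : Integrable fun z => q (z.1 - k, z.2) * φ 0 z := by
    have := (hmp.integrable_comp_emb hme).2 (iφ k ⟨hk0.le, one_div_succ_le_one N⟩)
    refine this.congr (Eventually.of_forall fun z => ?_)
    simp [hφ]
  have eshift : ∫ z, q z * φ k z = ∫ z, q (z.1 - k, z.2) * φ 0 z := by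
    rw [← hmp.integral_comp hme]
    simp [hφ]
  have i0 := iφ 0 ⟨le_rfl, zero_le_one⟩
  have iu : Integrable fun x => |u t (x - k) - u t x| :=
    (((hu.integrable t).comp_sub_right k).sub (hu.integrable t)).abs
  have ik := integrable_mul_kernel_left iu hη.integrable
  calc ∫ z, q z * ((φ k z - φ 0 z) * ((N : ℝ) + 1))
      = (∫ z, (q (z.1 - k, z.2) * φ 0 z - q z * φ 0 z)) * (1 / k) := by
        rw [integral_sub ishift i0, ← eshift, ← integral_sub (iφ k ⟨hk0.le, one_div_succ_le_one N⟩)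
          i0, ← integral_mul_const, hkN]
        exact integral_congr_ae (Eventually.of_forall fun z => by ring)
    _ ≤ (∫ z : ℝ × ℝ, A * (d + Λ * ε) * (|u t (z.1 - k) - u t z.1| * η (z.1 - z.2))) * (1 / k) := by
        refine mul_le_mul_of_nonneg_right (integral_mono (ishift.sub i0) (ik.const_mul _)
          fun z => ?_) (by positivity)
        change q (z.1 - k, z.2) * φ 0 z - q z * φ 0 z ≤ _
        rw [← sub_mul]
        refine (le_abs_self _).trans ?_
        rw [abs_mul]
        have h1 := hF.kruzFlux_lip (hu.mem t (z.1 - k)) (hu.mem t z.1) (hw.mem t z.2)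
        refine (mul_le_mul h1 (hφ0 z) (abs_nonneg _)
          (mul_nonneg hA (abs_nonneg _))).trans (le_of_eq ?_)
        ring
    _ = A * (d + Λ * ε) * (∫ x, |u t (x - k) - u t x|) * (1 / k) := by
        rw [integral_const_mul, integral_mul_kernel_left iu hη.integrable, hη1, mul_one]
    _ ≤ A * (d + Λ * ε) * (n * k) * (1 / k) := by
        have := hn (-k)
        rw [abs_neg, abs_of_pos hk0] at this
        simp only [← sub_eq_add_neg] at this
        gcongr
    _ = _ := by field_simp

/-- Once `u` has finite variation, a compactly supported approximate identity can replace the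
decaying kernel. Moving both velocities to the point `x` costs `Λ ε`, and moving both derivatives to
the point `y` costs `P ε`; both errors vanish with the width of the kernel, so the constants are
sharp enough for the theorem. -/
theorem kernFlux_le (hF : IsFluxFactor F R A) (hu : IsDensity R M u)
    (hw : IsDensity R M' w) (hV : IsVelocity c Λ V Vx) (hW : IsVelocity c Λ W Wx)
    (hη : IsTestFn η η') (hη1 : ∫ x, η x = 1) {ε : ℝ} (hε : ∀ x, ε ≤ |x| → η x = 0)
    (hε1 : ε ≤ 1) {t n d P : ℝ} (hn : HasVarLE (u t) n) (hd : ∀ x, |V t x - W t x| ≤ d)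
    (hP : HasVarLE (Vx t) P) :
    kernFlux F u w V W Vx Wx η η' t
      ≤ A * n * (d + Λ * ε) + R * ((∫ x, |Vx t x - Wx t x|) + P * ε) := by
  have hΛ : 0 ≤ Λ := (abs_nonneg _).trans (hV.abs_x_le 0 0)
  have hc : 0 ≤ c := (abs_nonneg _).trans (hV.abs_le 0 0)
  have hR := hF.R_pos.le
  have hηc := hη.continuous
  have hηc' := hη.cont'
  have hVc := hV.continuous t
  have hWc := hW.continuous t
  have m1 : Measurable fun q : ℝ × ℝ => Vx t q.1 :=
    hV.measurable_x.comp (by fun_prop : Measurable fun q : ℝ × ℝ => (t, q.1))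
  have m2 : Measurable fun q : ℝ × ℝ => Wx t q.2 :=
    hW.measurable_x.comp (by fun_prop : Measurable fun q : ℝ × ℝ => (t, q.2))
  have m3 : Measurable fun q : ℝ × ℝ => u t q.1 :=
    hu.measurable.comp (by fun_prop : Measurable fun q : ℝ × ℝ => (t, q.1))
  have i1 : Integrable fun z : ℝ × ℝ => kruzFlux F (u t z.1) (w t z.2) *
      ((V t z.1 - W t z.2) * η' (z.1 - z.2) + Vx t z.1 * η (z.1 - z.2)) := by
    have hk : Integrable fun x => 2 * c * |η' x| + Λ * η x :=
      (hη.integrable'.abs.const_mul _).add (hη.integrable.const_mul _)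
    refine integrable_kruzFlux_pair hF hu hw t ?_ hk fun z => ?_
    · exact ((((hVc.comp continuous_fst).sub (hWc.comp continuous_snd)).mul
        (by fun_prop : Continuous fun z : ℝ × ℝ => η' (z.1 - z.2))).measurable.add (m1.mul
        (by fun_prop : Continuous fun z : ℝ × ℝ =>
          η (z.1 - z.2)).measurable)).aestronglyMeasurable
    · refine (abs_add_le _ _).trans ?_
      rw [abs_mul, abs_mul, abs_of_nonneg (hη.nonneg _)]
      have h1 := abs_le.1 (hV.abs_le t z.1)
      have h2 := abs_le.1 (hW.abs_le t z.2)
      have h3 : |V t z.1 - W t z.2| ≤ 2 * c := abs_le.2 ⟨by linarith, by linarith⟩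
      exact add_le_add (mul_le_mul_of_nonneg_right h3 (abs_nonneg _))
        (mul_le_mul_of_nonneg_right (hV.abs_x_le _ _) (hη.nonneg _))
  have iVW : Integrable fun x => |Vx t x - Wx t x| :=
    ((hV.integrable_x t).sub (hW.integrable_x t)).abs
  have i2 := integrable_mul_kernel_right iVW hη.integrable
  have hη2 : Integrable fun x => |x| * η x :=
    (continuous_abs.mul hηc).integrable_of_hasCompactSupport hη.supp.mul_left
  have i3 : Integrable fun z : ℝ × ℝ => |Vx t z.1 - Vx t z.2| * η (z.1 - z.2) := by
    have h := ((integrable_mul_kernel_left (hV.integrable_x t) hη.integrable).sub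
      (integrable_mul_kernel_right (hV.integrable_x t) hη.integrable)).abs
    refine h.congr (Eventually.of_forall fun z => ?_)
    simp only [Pi.sub_apply, ← sub_mul, abs_mul, abs_of_nonneg (hη.nonneg _)]
  have i4 : Integrable fun z : ℝ × ℝ => R * (|Vx t z.2 - Wx t z.2| * η (z.1 - z.2)
      + |Vx t z.1 - Vx t z.2| * η (z.1 - z.2)) := (i2.add i3).const_mul R
  have hb : ∀ z : ℝ × ℝ, |F (u t z.1) * |Wx t z.2 - Vx t z.1| * η (z.1 - z.2)|
      ≤ R * (|Vx t z.2 - Wx t z.2| * η (z.1 - z.2) + |Vx t z.1 - Vx t z.2| * η (z.1 - z.2)) := by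
    intro z
    rw [abs_mul, abs_mul, abs_abs, abs_of_nonneg (hη.nonneg _), ← add_mul, mul_assoc]
    refine mul_le_mul (hF.abs_le (hu.mem _ _)) (mul_le_mul_of_nonneg_right ?_ (hη.nonneg _))
      (mul_nonneg (abs_nonneg _) (hη.nonneg _)) hR
    rw [abs_sub_comm, add_comm]
    exact abs_sub_le _ _ _
  have i5 : Integrable fun z : ℝ × ℝ => F (u t z.1) * |Wx t z.2 - Vx t z.1| * η (z.1 - z.2) :=
    i4.mono' (((hF.measurable.comp m3).mul (m2.sub m1).abs).mul
      (by fun_prop : Continuous fun z : ℝ × ℝ => η (z.1 - z.2)).measurable).aestronglyMeasurable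
      (Eventually.of_forall hb)
  unfold kernFlux
  rw [integral_add i1 i5]
  refine add_le_add (integral_kruzFlux_mul_le hF hu hw hV hW hη hη1 hε hε1 hn hd) ?_
  refine (integral_mono i5 i4 fun z => (le_abs_self _).trans (hb z)).trans ?_
  rw [integral_const_mul, integral_add i2 i3, integral_mul_kernel_right iVW hη.integrable, hη1,
    mul_one]
  have h1 := hP.integral_kernel_le (hV.integrable_x t) hη.integrable hη.nonneg hη2
  have h2 : ∫ x, |x| * η x ≤ ε := by
    calc ∫ x, |x| * η x ≤ ∫ x, ε * η x := integral_mono hη2 (hη.integrable.const_mul _) fun x => by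
          rcases le_or_gt ε |x| with h | h
          · simp [hε _ h]
          · exact mul_le_mul_of_nonneg_right h.le (hη.nonneg _)
      _ = ε := by rw [integral_const_mul, hη1, mul_one]
  have h3 := mul_le_mul_of_nonneg_left h2 hP.nonneg
  exact mul_le_mul_of_nonneg_left (by linarith) hR

theorem abs_kernDist_sub_le (hu : IsDensity R M u) (hw : IsDensity R M' w)
    (hη : IsTestFn η η') (hη1 : ∫ x, η x = 1) {ε : ℝ} (hε : ∀ x, ε ≤ |x| → η x = 0)
    {t n : ℝ} (hn : HasVarLE (u t) n) :
    |kernDist u w η t - (∫ x, |u t x - w t x|)| ≤ n * ε := by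
  have hηc := hη.continuous
  have iuw : Integrable fun x => |u t x - w t x| :=
    ((hu.integrable t).sub (hw.integrable t)).abs
  have i1 := integrable_mul_kernel_right iuw hη.integrable
  have hη2 : Integrable fun x => |x| * η x :=
    (continuous_abs.mul hηc).integrable_of_hasCompactSupport hη.supp.mul_left
  have i3 : Integrable fun z : ℝ × ℝ => |u t z.1 - u t z.2| * η (z.1 - z.2) := by
    have h := ((integrable_mul_kernel_left (hu.integrable t) hη.integrable).sub
      (integrable_mul_kernel_right (hu.integrable t) hη.integrable)).abs
    refine h.congr (Eventually.of_forall fun z => ?_)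
    simp only [Pi.sub_apply, ← sub_mul, abs_mul, abs_of_nonneg (hη.nonneg _)]
  have m1 : Measurable fun q : ℝ × ℝ => u t q.1 :=
    hu.measurable.comp (by fun_prop : Measurable fun q : ℝ × ℝ => (t, q.1))
  have m2 : Measurable fun q : ℝ × ℝ => w t q.2 :=
    hw.measurable.comp (by fun_prop : Measurable fun q : ℝ × ℝ => (t, q.2))
  have i2 : Integrable fun z : ℝ × ℝ => |u t z.1 - w t z.2| * η (z.1 - z.2) := by
    refine (hu.integrable_pair hw hη.integrable t).mono' ((m1.sub m2).abs.mul
      (by fun_prop : Continuous fun z : ℝ × ℝ => η (z.1 - z.2)).measurable).aestronglyMeasurable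
      (Eventually.of_forall fun z => ?_)
    rw [Real.norm_eq_abs, abs_mul, abs_abs, abs_of_nonneg (hη.nonneg _)]
    exact mul_le_mul_of_nonneg_right (hu.abs_sub_le_add hw t _ _) (hη.nonneg _)
  have e : ∫ x, |u t x - w t x| = ∫ z : ℝ × ℝ, |u t z.2 - w t z.2| * η (z.1 - z.2) := by
    rw [integral_mul_kernel_right iuw hη.integrable, hη1, mul_one]
  rw [e]
  unfold kernDist
  rw [← integral_sub i2 i1]
  refine abs_integral_le_integral_abs.trans ((integral_mono (i2.sub i1).abs i3 fun z => ?_).trans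
    ((hn.integral_kernel_le (hu.integrable t) hη.integrable hη.nonneg hη2).trans
    (mul_le_mul_of_nonneg_left ?_ hn.nonneg)))
  · simp only [Pi.sub_apply]
    rw [← sub_mul, abs_mul, abs_of_nonneg (hη.nonneg (z.1 - z.2))]
    refine mul_le_mul_of_nonneg_right ?_ (hη.nonneg _)
    refine (abs_abs_sub_abs_le_abs_sub _ _).trans (le_of_eq ?_)
    congr 1; ring
  · calc ∫ x, |x| * η x ≤ ∫ x, ε * η x := integral_mono hη2 (hη.integrable.const_mul _) fun x => by
          rcases le_or_gt ε |x| with h | h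
          · simp [hε _ h]
          · exact mul_le_mul_of_nonneg_right h.le (hη.nonneg _)
      _ = ε := by rw [integral_const_mul, hη1, mul_one]

/-- Stability of entropy solutions with respect to the velocity field. -/
theorem ae_integral_abs_sub_le (hF : IsFluxFactor F R A) (hu : IsDensity R M u)
    (hw : IsDensity R M' w) (hV : IsVelocity c Λ V Vx) (hW : IsVelocity c Λ W Wx)
    (ku : IsKruzkov F R T u V Vx) (kw : IsKruzkov F R T w W Wx) {t₀ T' N P E₀ : ℝ} {Y : ℝ → ℝ}
    (h0 : t₀ < T') (hT' : T' ≤ T) (hP : ∀ᵐ t, t < T' → HasVarLE (Vx t) P)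
    (hY : LocallyIntegrable Y) (hY0 : ∀ t, 0 ≤ Y t)
    (hN : ∀ᵐ t, t < T' → ∃ n d, n ≤ N ∧ HasVarLE (u t) n ∧ (∀ x, |V t x - W t x| ≤ d) ∧
      A * n * d + R * ∫ x, |Vx t x - Wx t x| ≤ Y t)
    (hE0 : ∀ᵐ t, t ∈ Ioo (t₀ - 2) t₀ → ∫ x, |u t x - w t x| ≤ E₀) :
    ∀ᵐ t, t ∈ Ioo t₀ T' → ∫ x, |u t x - w t x| ≤ E₀ + ∫ s in t₀..t, Y s := by
  have hΛ : 0 ≤ Λ := (abs_nonneg _).trans (hV.abs_x_le 0 0)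
  have hA := hF.A_nonneg
  have hR := hF.R_pos.le
  obtain ⟨hN0, hP0⟩ : 0 ≤ N ∧ 0 ≤ P := by
    have h1 : ∃ᵐ t, t ∈ Iio T' := by
      rw [frequently_ae_mem_iff, Real.volume_Iio]; exact ENNReal.top_ne_zero
    obtain ⟨t, h, h', h''⟩ := (h1.and_eventually (hP.and hN)).exists
    obtain ⟨n, d, hn, hv, -⟩ := h'' h
    exact ⟨hv.nonneg.trans hn, (h' h).nonneg⟩
  -- Per unit of time `kernFlux_le` loses at most `G ε`. Replacing the smeared distance by the
  -- distance costs `N ε` initially and `N ε` at time `t`.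
  set G := A * N * Λ + R * P with hG
  have hG0 : 0 ≤ G := by positivity
  have main : ∀ k : ℕ, ∀ᵐ t, t ∈ Ioo t₀ T' → ∫ x, |u t x - w t x|
      ≤ E₀ + (∫ s in t₀..t, Y s) + (2 * N + G * (T' - t₀)) * (1 / ((k : ℝ) + 1)) := by
    intro k
    set ε := 1 / ((k : ℝ) + 1) with hε
    have hε0 : 0 < ε := by positivity
    have hη := moll_isTestFn k
    have hη1 := moll_integral k
    have hηε : ∀ x, ε ≤ |x| → moll k x = 0 := fun x hx => moll_eq_zero hx
    have hD := locallyIntegrable_of_bdd (measurable_kernDist hu hw hη.isKernel)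
      (abs_kernDist_le hu hw hη.isKernel)
    obtain ⟨K, hK⟩ := exists_kernFlux_bound hF hu hw hV hW hη.isKernel
    have hB := locallyIntegrable_of_bdd (measurable_kernFlux hF hu hw hV hW hη.isKernel) hK
    have hYε : LocallyIntegrable fun t => Y t + G * ε := hY.add (locallyIntegrable_const _)
    have hti := ae_le_add_integral_of_distrib (t₀ := t₀) (T := T') (E₀ := E₀ + N * ε) hD
      hYε (fun t => add_nonneg (hY0 t) (by positivity)) ?_ ?_
    · filter_upwards [hti, hN] with t ht ht2 htI
      obtain ⟨n, d, hn, hv, -⟩ := ht2 htI.2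
      have h1 := ht htI
      have h2 := abs_le.1 (abs_kernDist_sub_le hu hw hη hη1 hηε hv)
      have h3 := mul_le_mul_of_nonneg_right hn hε0.le
      rw [intervalIntegral.integral_add
        (hY.integrableOn_isCompact isCompact_uIcc).intervalIntegrable (by simp),
        intervalIntegral.integral_const, smul_eq_mul] at h1
      have h4 : (t - t₀) * (G * ε) ≤ (T' - t₀) * (G * ε) :=
        mul_le_mul_of_nonneg_right (by linarith [htI.2]) (by positivity)
      linarith [h2.1]
    · filter_upwards [hE0, hN] with t ht ht2 htI
      obtain ⟨n, d, hn, hv, -⟩ := ht2 (htI.2.trans h0)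
      have h2 := abs_le.1 (abs_kernDist_sub_le hu hw hη hη1 hηε hv)
      have h3 := mul_le_mul_of_nonneg_right hn hε0.le
      linarith [ht htI, h2.2]
    · intro θ θ' hθ
      have hd := doubling_kernel' hF hu hw hV hW ku kw (hθ.mono hT') hη.isKernel
      refine hd.trans (integral_mono_ae ((hθ.integrable_mul' hD).add (hθ.integrable_mul hB))
        ((hθ.integrable_mul' hD).add (hθ.integrable_mul hYε)) ?_)
      filter_upwards [hP, hN] with t ht ht2
      rcases lt_or_ge t T' with htT | htT
      · obtain ⟨n, d, hn, hv, hd', hYt⟩ := ht2 htT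
        have h1 := kernFlux_le hF hu hw hV hW hη hη1 hηε (one_div_succ_le_one k) hv hd' (ht htT)
        have h2 : A * n * (Λ * ε) ≤ A * N * (Λ * ε) := by gcongr
        refine add_le_add_right (mul_le_mul_of_nonneg_left ?_ (hθ.nonneg t)) _
        rw [hG]
        linarith
      · have z1 : θ t = 0 := (hθ.zero_right htT).1
        simp [z1]
  filter_upwards [ae_all_iff.2 main] with t ht htI
  have hlim : Tendsto (fun k : ℕ => E₀ + (∫ s in t₀..t, Y s)
      + (2 * N + G * (T' - t₀)) * (1 / ((k : ℝ) + 1))) atTop (𝓝 (E₀ + (∫ s in t₀..t, Y s)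
      + (2 * N + G * (T' - t₀)) * 0)) :=
    tendsto_const_nhds.add (tendsto_moll_radius.const_mul _)
  rw [mul_zero, add_zero] at hlim
  exact ge_of_tendsto hlim (Eventually.of_forall fun k => ht k htI)

end

/-! ### Growth of the total variation -/

section

variable {F : ℝ → ℝ} {R A M c Λ T : ℝ} {u V Vx : ℝ → ℝ → ℝ}

theorem IsDensity.translate (hu : IsDensity R M u) (k : ℝ) :
    IsDensity R M fun t x => u t (x + k) where
  measurable := hu.measurable.comp (by fun_prop : Measurable fun p : ℝ × ℝ => (p.1, p.2 + k))
  mem t x := hu.mem t _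
  integrable t := (hu.integrable t).comp_add_right k
  mass_le t := by rw [integral_add_right_eq_self (u t) k]; exact hu.mass_le t

theorem IsVelocity.translate (hV : IsVelocity c Λ V Vx) (k : ℝ) :
    IsVelocity c Λ (fun t x => V t (x + k)) (fun t x => Vx t (x + k)) where
  measurable := hV.measurable.comp (by fun_prop : Measurable fun p : ℝ × ℝ => (p.1, p.2 + k))
  measurable_x :=
    hV.measurable_x.comp (by fun_prop : Measurable fun p : ℝ × ℝ => (p.1, p.2 + k))
  abs_le t x := hV.abs_le t _
  abs_x_le t x := hV.abs_x_le t _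
  lip t x y := by simpa using hV.lip t (x + k) (y + k)
  hasDerivAt t := by
    filter_upwards [(measurePreserving_add_right volume k).quasiMeasurePreserving.ae
      (hV.hasDerivAt t)] with x hx
    exact hx.comp_add_const x k
  integrable_x t := (hV.integrable_x t).comp_add_right k

theorem IsKruzkov.translate (ku : IsKruzkov F R T u V Vx) (k : ℝ) :
    IsKruzkov F R T (fun t x => u t (x + k)) (fun t x => V t (x + k))
      (fun t x => Vx t (x + k)) := by
  intro κ hκ α α' β β' hα hβ
  have h := ku κ hκ α α' _ _ hα (hβ.comp_sub_right k)
  have hmp : MeasurePreserving (fun z : ℝ × ℝ => (z.1, z.2 + k)) volume volume :=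
    (MeasurePreserving.id (volume : Measure ℝ)).prod (measurePreserving_add_right volume k)
  have hme : MeasurableEmbedding (fun z : ℝ × ℝ => (z.1, z.2 + k)) :=
    ((Homeomorph.refl ℝ).prodCongr (Homeomorph.addRight k)).measurableEmbedding
  rw [← hmp.integral_comp hme] at h
  simpa using h

/-- Stability applied to `u` and its translate by `k`: the velocities differ by at most `Λ k`, their
derivatives by `P k` in `L¹`, and the whole estimate is divided by `k`. The bound `n` may be any one
already known, so the lemma can be iterated to improve it. -/
theorem ae_hasVarLE_add_integral (hF : IsFluxFactor F R A) (hu : IsDensity R M u)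
    (hV : IsVelocity c Λ V Vx) (ku : IsKruzkov F R T u V Vx) {t₀ T' N P b : ℝ} {n : ℝ → ℝ}
    (h0 : t₀ < T') (hT' : T' ≤ T) (hP : ∀ᵐ t, t < T' → HasVarLE (Vx t) P) (hP0 : 0 ≤ P)
    (hnc : Continuous n) (hn0 : ∀ t, 0 ≤ n t) (hnN : ∀ t, t < T' → n t ≤ N)
    (hn : ∀ᵐ t, t < T' → HasVarLE (u t) (n t))
    (hb : ∀ᵐ t, t < t₀ → HasVarLE (u t) b) :
    ∀ᵐ t, t ∈ Ioo t₀ T' → HasVarLE (u t) (b + ∫ s in t₀..t, (A * Λ * n s + R * P)) := by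
  have hΛ : 0 ≤ Λ := (abs_nonneg _).trans (hV.abs_x_le 0 0)
  have hA := hF.A_nonneg
  have hR := hF.R_pos.le
  have hb0 : 0 ≤ b := by
    have h1 : ∃ᵐ t, t ∈ Iio t₀ := by
      rw [frequently_ae_mem_iff, Real.volume_Iio]; exact ENNReal.top_ne_zero
    obtain ⟨t, h, h'⟩ := (h1.and_eventually hb).exists
    exact (h' h).nonneg
  have main : ∀ j : ℕ, ∀ᵐ t, t ∈ Ioo t₀ T' → ∫ x, |u t (x + 1 / ((j : ℝ) + 1)) - u t x|
      ≤ (b + ∫ s in t₀..t, (A * Λ * n s + R * P)) * (1 / ((j : ℝ) + 1)) := by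
    intro j
    set k : ℝ := 1 / ((j : ℝ) + 1) with hk
    have hk0 : 0 < k := by positivity
    have h := ae_integral_abs_sub_le hF hu (hu.translate k) hV (hV.translate k) ku (ku.translate k)
      (t₀ := t₀) (T' := T') (N := N) (P := P) (E₀ := b * k)
      (Y := fun t => (A * Λ * n t + R * P) * k) h0 hT' hP
      (by fun_prop : Continuous _).locallyIntegrable
      (fun t => by have := hn0 t; positivity) ?_ ?_
    · filter_upwards [h] with t ht htI
      simp_rw [abs_sub_comm (u t (_ + k))]
      refine (ht htI).trans (le_of_eq ?_)
      rw [intervalIntegral.integral_mul_const, add_mul]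
    · filter_upwards [hn, hP] with t ht hPt htT
      refine ⟨n t, Λ * k, hnN t htT, ht htT, fun x => ?_, ?_⟩
      · simpa [abs_of_pos hk0] using hV.lip t x (x + k)
      · have := hPt htT k
        rw [abs_of_pos hk0] at this
        simp_rw [abs_sub_comm (Vx t _) (Vx t (_ + k))]
        have := mul_le_mul_of_nonneg_left this hR
        linarith
    · filter_upwards [hb] with t ht htI
      have := ht htI.2 k
      rw [abs_of_pos hk0] at this
      simp_rw [abs_sub_comm (u t _) (u t (_ + k))]
      exact this
  filter_upwards [ae_all_iff.2 main] with t h1 htI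
  have hI : 0 ≤ ∫ s in t₀..t, (A * Λ * n s + R * P) :=
    intervalIntegral.integral_nonneg htI.1.le fun s _ => by have := hn0 s; positivity
  exact hasVarLE_of_totalVar_le (hu.integrable t) (by positivity)
    (totalVar_le_of_shift (hu.integrable t) fun j => h1 j htI)

/-- In the weight `exp ((2r + 1) (t - t₀))` one integration with rate `r` gains the factor `r / (2r
+ 1) ≤ 1 / 2`. The summand 1 keeps the exponent positive when `r = 0`. -/
theorem integral_exp_le {r t₀ t : ℝ} (hr : 0 ≤ r) :
    r * ∫ s in t₀..t, Real.exp ((2 * r + 1) * (s - t₀))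
      ≤ 1 / 2 * Real.exp ((2 * r + 1) * (t - t₀)) := by
  have hl : 0 < 2 * r + 1 := by positivity
  have hd : ∀ s, HasDerivAt (fun s => Real.exp ((2 * r + 1) * (s - t₀)) / (2 * r + 1))
      (Real.exp ((2 * r + 1) * (s - t₀))) s := fun s => by
    have h1 : HasDerivAt (fun s : ℝ => (2 * r + 1) * (s - t₀)) (2 * r + 1) s := by
      simpa using ((hasDerivAt_id s).sub_const t₀).const_mul (2 * r + 1)
    refine (h1.exp.div_const (2 * r + 1)).congr_deriv ?_
    field_simp
  rw [intervalIntegral.integral_eq_sub_of_hasDerivAt (fun s _ => hd s)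
    ((by fun_prop : Continuous fun s => Real.exp ((2 * r + 1) * (s - t₀))).intervalIntegrable _ _)]
  rw [sub_self, mul_zero, Real.exp_zero, ← sub_div, ← mul_div_assoc, div_le_iff₀ hl]
  nlinarith [Real.exp_pos ((2 * r + 1) * (t - t₀))]

/-- The growth of the total variation on a time interval on which the variation of the velocity
is controlled by the past. -/
theorem ae_hasVarLE_exp (hF : IsFluxFactor F R A) (hu : IsDensity R M u)
    (hV : IsVelocity c Λ V Vx) (ku : IsKruzkov F R T u V Vx) {t₀ T' P b r : ℝ}
    (h0 : t₀ < T') (hT' : T' ≤ T) (hP : ∀ᵐ t, t < T' → HasVarLE (Vx t) P) (hP0 : 0 ≤ P)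
    (hr : A * Λ ≤ r) (hrb : R * P ≤ r * b) (hb : ∀ᵐ t, t < t₀ → HasVarLE (u t) b) :
    ∀ᵐ t, t ∈ Ioo t₀ T' → HasVarLE (u t) ((2 * Real.exp (r * (t - t₀)) - 1) * b) := by
  have hΛ : 0 ≤ Λ := (abs_nonneg _).trans (hV.abs_x_le 0 0)
  have hA := hF.A_nonneg
  have hr0 : 0 ≤ r := (mul_nonneg hA hΛ).trans hr
  have hb0 : 0 ≤ b := by
    have h1 : ∃ᵐ t, t ∈ Iio t₀ := by
      rw [frequently_ae_mem_iff, Real.volume_Iio]; exact ENNReal.top_ne_zero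
    obtain ⟨t, h, h'⟩ := (h1.and_eventually hb).exists
    exact (h' h).nonneg
  obtain ⟨N, hN⟩ := exists_hasVarLE hF hu hV ku h0 hT' hP hb
  have hN0 : 0 ≤ N := by
    have h1 : ∃ᵐ t, t ∈ Iio T' := by
      rw [frequently_ae_mem_iff, Real.volume_Iio]; exact ENNReal.top_ne_zero
    obtain ⟨t, h, h'⟩ := (h1.and_eventually hN).exists
    exact (h' h).nonneg
  -- The solution of `y' = r (y + b)` with `y t₀ = b`: the rate `r` acts on the present variation,
  -- and the summand `r b` dominates the variation `R P` produced by the velocity.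
  set y : ℝ → ℝ := fun t => (2 * Real.exp (r * (t - t₀)) - 1) * b with hy
  set e : ℝ → ℝ := fun t => Real.exp ((2 * r + 1) * (t - t₀)) with he
  have hyc : Continuous y := by fun_prop
  have hec : Continuous e := by fun_prop
  have he1 : ∀ t, t₀ ≤ t → 1 ≤ e t := fun t ht =>
    Real.one_le_exp (mul_nonneg (by positivity) (by linarith))
  have hyb : ∀ t, t₀ ≤ t → b ≤ y t := fun t ht => by
    have : 1 ≤ Real.exp (r * (t - t₀)) := Real.one_le_exp (mul_nonneg hr0 (by linarith))
    rw [hy]; nlinarith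
  have hymono : Monotone y := fun s t hst => by
    have : Real.exp (r * (s - t₀)) ≤ Real.exp (r * (t - t₀)) :=
      Real.exp_le_exp.2 (mul_le_mul_of_nonneg_left (by linarith) hr0)
    rw [hy]; beta_reduce
    exact mul_le_mul_of_nonneg_right (by linarith) hb0
  have hemono : Monotone e := fun s t hst =>
    Real.exp_le_exp.2 (mul_le_mul_of_nonneg_left (by linarith) (by positivity))
  have hyint : ∀ t, b + r * ∫ s in t₀..t, (y s + b) = y t := fun t => by
    have hd : ∀ s, HasDerivAt y (r * (y s + b)) s := fun s => by
      have h1 : HasDerivAt (fun s : ℝ => r * (s - t₀)) r s := by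
        simpa using ((hasDerivAt_id s).sub_const t₀).const_mul r
      refine (((h1.exp.const_mul 2).sub_const 1).mul_const b).congr_deriv ?_
      rw [hy]; ring
    rw [← intervalIntegral.integral_const_mul,
      intervalIntegral.integral_eq_sub_of_hasDerivAt (fun s _ => hd s)
      ((by fun_prop : Continuous fun s => r * (y s + b)).intervalIntegrable _ _)]
    simp [hy]; ring
  have hne : ∀ᵐ t : ℝ, t ≠ t₀ := by simp [ae_iff]
  -- Picard iteration starting from the crude bound `N`: measured in the weight `e`, the excess over
  -- `y` is halved at every pass.
  have main : ∀ j : ℕ, ∀ᵐ t, t ∈ Ioo t₀ T' → HasVarLE (u t) (y t + N * (1 / 2) ^ j * e t) := by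
    intro j
    induction j with
    | zero =>
      filter_upwards [hN] with t ht htI
      refine (ht htI.2).mono ?_
      have h1 := he1 t htI.1.le
      have h2 := hyb t htI.1.le
      rw [pow_zero, mul_one]; nlinarith
    | succ j ih =>
      set m := N * (1 / 2) ^ j with hm
      have hm0 : 0 ≤ m := by positivity
      -- Freezing the bound before `t₀` gives one continuous function valid at all times before
      -- `T'`, since the variation is at most `b ≤ y t₀` there.
      set n : ℝ → ℝ := fun t => y (max t t₀) + m * e (max t t₀) with hn
      have hv : ∀ᵐ t, t < T' → HasVarLE (u t) (n t) := by
        filter_upwards [ih, hb, hne] with t h1 h2 h3 htT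
        rcases lt_or_gt_of_ne h3 with h | h
        · refine (h2 h).mono ?_
          rw [hn]; beta_reduce
          have h4 := hyb (max t t₀) (le_max_right _ _)
          have h5 : 0 ≤ m * e (max t t₀) := mul_nonneg hm0 (Real.exp_pos _).le
          linarith
        · simpa only [hn, max_eq_left h.le] using h1 ⟨h, htT⟩
      have h := ae_hasVarLE_add_integral hF hu hV ku (n := n) (N := y T' + m * e T') h0 hT' hP hP0
        (by fun_prop) (fun t => add_nonneg (hb0.trans (hyb _ (le_max_right _ _)))
          (mul_nonneg hm0 (Real.exp_pos _).le)) (fun t ht => add_le_add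
          (hymono (max_le ht.le h0.le)) (mul_le_mul_of_nonneg_left
          (hemono (max_le ht.le h0.le)) hm0)) hv hb
      filter_upwards [h] with t ht htI
      refine (ht htI).mono ?_
      have i1 : IntervalIntegrable (fun s => r * (y s + b)) volume t₀ t :=
        (by fun_prop : Continuous fun s => r * (y s + b)).intervalIntegrable _ _
      have i2 : IntervalIntegrable (fun s => r * (m * e s)) volume t₀ t :=
        (by fun_prop : Continuous fun s => r * (m * e s)).intervalIntegrable _ _
      have h1 : ∫ s in t₀..t, (A * Λ * n s + R * P)
          ≤ ∫ s in t₀..t, (r * (y s + b) + r * (m * e s)) := by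
        refine intervalIntegral.integral_mono_on htI.1.le
          ((by fun_prop : Continuous _).intervalIntegrable _ _) (i1.add i2) fun s hs => ?_
        have hns : n s = y s + m * e s := by simp only [hn, max_eq_left hs.1]
        have h3 := hyb s hs.1
        have h4 : 0 ≤ m * e s := mul_nonneg hm0 (Real.exp_pos _).le
        have h5 : A * Λ * n s ≤ r * n s := mul_le_mul_of_nonneg_right hr (by rw [hns]; linarith)
        rw [hns] at h5 ⊢
        linarith
      rw [intervalIntegral.integral_add i1 i2, intervalIntegral.integral_const_mul,
        intervalIntegral.integral_const_mul, intervalIntegral.integral_const_mul] at h1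
      have h2 := mul_le_mul_of_nonneg_left (integral_exp_le (t₀ := t₀) (t := t) hr0) hm0
      have h3 := hyint t
      rw [pow_succ, ← mul_assoc]
      have e1 : r * (m * ∫ s in t₀..t, e s) = m * (r * ∫ s in t₀..t, e s) := by ring
      rw [e1] at h1
      change m * (r * ∫ s in t₀..t, e s) ≤ m * (1 / 2 * e t) at h2
      linarith
  filter_upwards [ae_all_iff.2 main] with t ht htI k
  have hlim : Tendsto (fun j : ℕ => (y t + N * (1 / 2) ^ j * e t) * |k|) atTop
      (𝓝 ((y t + N * 0 * e t) * |k|)) :=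
    ((tendsto_const_nhds.add (((tendsto_pow_atTop_nhds_zero_of_lt_one (by norm_num)
      (by norm_num)).const_mul N).mul_const _)).mul_const _)
  rw [mul_zero, zero_mul, add_zero] at hlim
  exact ge_of_tendsto hlim (Eventually.of_forall fun j => ht j htI k)

/-- The growth of the total variation for a velocity with delay. -/
theorem ae_hasVarLE_of_delay (hF : IsFluxFactor F R A) (hu : IsDensity R M u)
    (hV : IsVelocity c Λ V Vx) (ku : IsKruzkov F R T u V Vx) {τ b p r : ℝ} (hT : 0 < T)
    (hτ : 0 < τ) (hp : 0 ≤ p) (hr : A * Λ ≤ r) (hrp : R * p ≤ r)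
    (hdelay : ∀ s b, (∀ᵐ t, t < s → HasVarLE (u t) b) →
      ∀ᵐ t, t < s + τ → HasVarLE (Vx t) (p * b))
    (hb0 : 0 ≤ b) (hb : ∀ᵐ t, t < 0 → HasVarLE (u t) b) :
    ∀ᵐ t, t < T → HasVarLE (u t) ((2 * Real.exp (r * (T - (⌊T / τ⌋₊ : ℝ) * τ)) - 1)
      * (2 * Real.exp (r * τ) - 1) ^ ⌊T / τ⌋₊ * b) := by
  have hΛ : 0 ≤ Λ := (abs_nonneg _).trans (hV.abs_x_le 0 0)
  have hr0 : 0 ≤ r := (mul_nonneg hF.A_nonneg hΛ).trans hr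
  -- On an interval of length at most `τ` the velocity sees only times before `t₀`, so the variation
  -- of its derivative is at most `p * b`.
  have step : ∀ t₀ T' b : ℝ, t₀ ≤ T' → T' ≤ t₀ + τ → T' ≤ T → 0 ≤ b →
      (∀ᵐ t, t < t₀ → HasVarLE (u t) b) →
      ∀ᵐ t, t < T' → HasVarLE (u t) ((2 * Real.exp (r * (T' - t₀)) - 1) * b) := by
    intro t₀ T' b h1 h2 h3 hb0 hb
    rcases h1.eq_or_lt with h | h
    · subst h
      simpa [show (2 : ℝ) - 1 = 1 by norm_num] using hb
    have hP : ∀ᵐ t, t < T' → HasVarLE (Vx t) (p * b) := by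
      filter_upwards [hdelay t₀ b hb] with t ht htT using ht (by linarith)
    have h4 := ae_hasVarLE_exp hF hu hV ku h h3 hP (by positivity) hr (by
      rw [← mul_assoc]; exact mul_le_mul_of_nonneg_right hrp hb0) hb
    have hne : ∀ᵐ t : ℝ, t ≠ t₀ := by simp [ae_iff]
    filter_upwards [hb, h4, hne] with t h5 h6 h7 htT
    rcases lt_or_gt_of_ne h7 with h8 | h8
    · refine (h5 h8).mono ?_
      have : 1 ≤ Real.exp (r * (T' - t₀)) := Real.one_le_exp (mul_nonneg hr0 (by linarith))
      nlinarith
    · refine (h6 ⟨h8, htT⟩).mono (mul_le_mul_of_nonneg_right ?_ hb0)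
      have : Real.exp (r * (t - t₀)) ≤ Real.exp (r * (T' - t₀)) :=
        Real.exp_le_exp.2 (mul_le_mul_of_nonneg_left (by linarith) hr0)
      linarith
  -- The factor gained over one full delay. There are `⌊T / τ⌋₊` of them, and the remaining time `T
  -- - ⌊T / τ⌋₊ τ` gives the other factor.
  set q := 2 * Real.exp (r * τ) - 1 with hq
  have hq1 : 1 ≤ q := by
    have : 1 ≤ Real.exp (r * τ) := Real.one_le_exp (by positivity)
    linarith
  have hK : (⌊T / τ⌋₊ : ℝ) * τ ≤ T := by
    rw [← le_div_iff₀ hτ]; exact Nat.floor_le (by positivity)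
  have hind : ∀ k : ℕ, k ≤ ⌊T / τ⌋₊ → ∀ᵐ t, t < (k : ℝ) * τ → HasVarLE (u t) (q ^ k * b) := by
    intro k
    induction k with
    | zero => intro _; simpa using hb
    | succ k ih =>
      intro hk
      have hk' : ((k + 1 : ℕ) : ℝ) * τ ≤ T := le_trans (by gcongr) hK
      have h := step _ (((k + 1 : ℕ) : ℝ) * τ) _ (by push_cast; nlinarith)
        (by push_cast; linarith) hk' (by positivity) (ih (by omega))
      filter_upwards [h] with t ht htT
      have h1 := ht htT
      rw [show ((k + 1 : ℕ) : ℝ) * τ - k * τ = τ by push_cast; ring, ← hq] at h1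
      rwa [pow_succ, mul_comm (q ^ k), mul_assoc]
  have hlt : T ≤ (⌊T / τ⌋₊ : ℝ) * τ + τ := by
    have := (Nat.lt_floor_add_one (T / τ)).le
    rw [div_le_iff₀ hτ] at this
    linarith
  have h := step _ T _ hK hlt le_rfl (by positivity) (hind _ le_rfl)
  simpa only [mul_assoc] using h

end

/-! ### Downstream averages and velocities with delay -/

section

variable {R Ω c v₁ v₂ : ℝ} {g g' j k u w p q sp dsp : ℝ → ℝ}

/-- The downstream average of `g` with weight `j`. -/
noncomputable def corr (g j : ℝ → ℝ) (x : ℝ) : ℝ := ∫ y, g y * j (y - x)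

theorem corr_translate (g j : ℝ → ℝ) (x h : ℝ) :
    corr (fun y => g (y + h)) j x = corr g j (x + h) := by
  unfold corr
  rw [← integral_add_right_eq_self (fun y => g y * j (y - (x + h))) h]
  refine integral_congr_ae (Eventually.of_forall fun y => ?_)
  beta_reduce
  rw [add_sub_add_right_eq_sub]

theorem integrable_corr_mul (hg : Integrable g) (hj : Integrable j) :
    Integrable fun z : ℝ × ℝ => g z.2 * j (z.2 - z.1) := by
  exact (integrable_mul_kernel_left hg hj).swap

theorem integral_abs_corr_le (hg : Integrable g) (hj : Integrable j) :
    Integrable (corr g j) ∧ ∫ x, |corr g j x| ≤ (∫ x, |g x|) * ∫ x, |j x| := by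
  have i := integrable_corr_mul hg hj
  have i' := integrable_corr_mul hg.abs hj.abs
  refine ⟨i.integral_prod_left, (integral_mono i.integral_prod_left.abs i'.integral_prod_left
    fun x => (abs_integral_le_integral_abs).trans (le_of_eq ?_)).trans (le_of_eq ?_)⟩
  · simp only [abs_mul]
  · rw [integral_integral_swap (f := fun x y => |g y| * |j (y - x)|) i']
    simp_rw [integral_const_mul, integral_sub_left_eq_self (fun s => |j s|) volume]
    rw [integral_mul_const]

theorem abs_corr_le_left {C : ℝ} (hg : ∀ x, |g x| ≤ C) (hj : Integrable j) (x : ℝ) :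
    |corr g j x| ≤ C * ∫ s, |j s| := by
  rw [← integral_sub_right_eq_self (fun s => |j s|) x, ← integral_const_mul]
  refine abs_integral_le_integral_abs.trans (integral_mono_of_nonneg
    (Eventually.of_forall fun _ => abs_nonneg _) ((hj.comp_sub_right x).abs.const_mul C)
    (Eventually.of_forall fun y => ?_))
  beta_reduce
  rw [abs_mul]
  exact mul_le_mul_of_nonneg_right (hg y) (abs_nonneg _)

theorem abs_corr_le_right {C : ℝ} (hg : Integrable g) (hj : ∀ x, |j x| ≤ C) (x : ℝ) :
    |corr g j x| ≤ C * ∫ s, |g s| := by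
  rw [← integral_const_mul]
  refine abs_integral_le_integral_abs.trans (integral_mono_of_nonneg
    (Eventually.of_forall fun _ => abs_nonneg _) (hg.abs.const_mul C)
    (Eventually.of_forall fun y => ?_))
  beta_reduce
  rw [abs_mul, mul_comm]
  exact mul_le_mul_of_nonneg_right (hj _) (abs_nonneg _)

/-- An averaging kernel bounded by `Ω`, of variation at most `2Ω`. -/
structure IsAvgKernel (Ω : ℝ) (k : ℝ → ℝ) : Prop where
  measurable : Measurable k
  nonneg : ∀ x, 0 ≤ k x
  le : ∀ x, k x ≤ Ω
  integrable : Integrable k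
  integral_eq : ∫ x, k x = 1
  hasVarLE : HasVarLE k (2 * Ω)

namespace IsAvgKernel

theorem bound_nonneg (hk : IsAvgKernel Ω k) : 0 ≤ Ω := (hk.nonneg 0).trans (hk.le 0)

theorem abs_le (hk : IsAvgKernel Ω k) (x : ℝ) : |k x| ≤ Ω := by
  rw [abs_of_nonneg (hk.nonneg x)]; exact hk.le x

theorem integrable_mul (hk : IsAvgKernel Ω k) (hu : Integrable u) (x : ℝ) :
    Integrable fun y => u y * k (y - x) :=
  hu.mul_bdd (hk.measurable.comp (by fun_prop : Measurable fun y : ℝ => y - x)).aestronglyMeasurable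
    (Eventually.of_forall fun y => hk.abs_le (y - x))

theorem corr_sub (hk : IsAvgKernel Ω k) (hu : Integrable u) (hw : Integrable w) (x : ℝ) :
    corr (fun y => u y - w y) k x = corr u k x - corr w k x := by
  unfold corr
  rw [← integral_sub (hk.integrable_mul hu x) (hk.integrable_mul hw x)]
  simp only [sub_mul]

/-- The shift passes from the density to the kernel, whose `L¹` modulus is at most `2Ω |h|`. This
makes averages Lipschitz, uniformly and in `L¹`, with no regularity of `u`. -/
theorem corr_shift_sub (hk : IsAvgKernel Ω k) (hu : Integrable u) (x h : ℝ) :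
    corr u k (x + h) - corr u k x = corr u (fun s => k (s - h) - k s) x := by
  unfold corr
  rw [← integral_sub (hk.integrable_mul hu _) (hk.integrable_mul hu x)]
  refine integral_congr_ae (Eventually.of_forall fun y => ?_)
  beta_reduce
  rw [← mul_sub, sub_sub]

theorem integrable_shift (hk : IsAvgKernel Ω k) (h : ℝ) : Integrable fun s => k (s - h) - k s :=
  (hk.integrable.comp_sub_right h).sub hk.integrable

theorem integral_shift_le (hk : IsAvgKernel Ω k) (h : ℝ) :
    ∫ s, |k (s - h) - k s| ≤ 2 * Ω * |h| := by
  have := hk.hasVarLE (-h)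
  rw [abs_neg] at this
  simpa only [← sub_eq_add_neg] using this

theorem corr_mem (hk : IsAvgKernel Ω k) (hu : Integrable u) (hur : ∀ x, u x ∈ Icc 0 R) (x : ℝ) :
    corr u k x ∈ Icc 0 R := by
  refine ⟨integral_nonneg fun y => mul_nonneg (hur y).1 (hk.nonneg _), ?_⟩
  calc corr u k x ≤ ∫ y, R * k (y - x) := integral_mono (hk.integrable_mul hu x)
        ((hk.integrable.comp_sub_right x).const_mul R)
        fun y => mul_le_mul_of_nonneg_right (hur y).2 (hk.nonneg _)
    _ = R := by rw [integral_const_mul, integral_sub_right_eq_self k, hk.integral_eq, mul_one]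

theorem corr_lip (hk : IsAvgKernel Ω k) (hu : Integrable u) (hur : ∀ x, u x ∈ Icc 0 R)
    (x y : ℝ) : |corr u k x - corr u k y| ≤ 2 * R * Ω * |x - y| := by
  have hR : 0 ≤ R := (hur 0).1.trans (hur 0).2
  have h := hk.corr_shift_sub hu y (x - y)
  rw [add_sub_cancel] at h
  rw [h]
  refine (abs_corr_le_left (C := R) (fun x => ?_) (hk.integrable_shift _) y).trans
    ((mul_le_mul_of_nonneg_left (hk.integral_shift_le _) hR).trans (le_of_eq (by ring)))
  rw [abs_of_nonneg (hur x).1]; exact (hur x).2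

theorem hasVarLE_corr (hk : IsAvgKernel Ω k) (hu : Integrable u) (h : ℝ) :
    ∫ x, |corr u k (x + h) - corr u k x| ≤ 2 * Ω * (∫ x, |u x|) * |h| := by
  simp only [hk.corr_shift_sub hu]
  refine (integral_abs_corr_le hu (hk.integrable_shift h)).2.trans ((mul_le_mul_of_nonneg_left
    (hk.integral_shift_le h) (integral_nonneg fun _ => abs_nonneg _)).trans (le_of_eq (by ring)))

theorem abs_corr_sub_le (hk : IsAvgKernel Ω k) (hu : Integrable u) (hw : Integrable w) (x : ℝ) :
    |corr u k x - corr w k x| ≤ Ω * ∫ x, |u x - w x| := by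
  rw [← hk.corr_sub hu hw]
  exact abs_corr_le_right (hu.sub hw) hk.abs_le x

theorem integral_abs_corr_sub_le (hk : IsAvgKernel Ω k) (hu : Integrable u)
    (hw : Integrable w) : ∫ x, |corr u k x - corr w k x| ≤ ∫ x, |u x - w x| := by
  have h := (integral_abs_corr_le (hu.sub hw) hk.integrable).2
  simp_rw [abs_of_nonneg (hk.nonneg _)] at h
  rw [hk.integral_eq, mul_one] at h
  refine le_trans (le_of_eq ?_) h
  refine integral_congr_ae (Eventually.of_forall fun x => ?_)
  beta_reduce
  rw [← hk.corr_sub hu hw]; rfl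

end IsAvgKernel

/-- The `L¹` norm of the derivative is bounded by the `L¹` modulus of continuity. -/
theorem integral_abs_deriv_le {C : ℝ} (hC : 0 ≤ C) (hg : Integrable g)
    (hd : ∀ᵐ x, HasDerivAt g (g' x) x)
    (h : ∀ n : ℕ, ∫ x, |g (x + 1 / ((n : ℝ) + 1)) - g x| ≤ C * |1 / ((n : ℝ) + 1)|) :
    Integrable g' ∧ ∫ x, |g' x| ≤ C := by
  have hm : AEStronglyMeasurable g' := by
    have hdm : Measurable (deriv g) := measurable_deriv g
    refine hdm.aestronglyMeasurable.congr ?_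
    filter_upwards [hd] with x hx using hx.deriv
  set Q : ℕ → ℝ → ℝ := fun n x => (g (x + 1 / ((n : ℝ) + 1)) - g x) * ((n : ℝ) + 1) with hQ
  have hQi : ∀ n, Integrable (Q n) := fun n => ((hg.comp_add_right _).sub hg).mul_const _
  have hlim : ∀ᵐ x, Tendsto (fun n => Q n x) atTop (𝓝 (g' x)) := by
    filter_upwards [hd] with x hx
    have h1 := hx.tendsto_slope_zero_right
    have h2 : Tendsto (fun n : ℕ => 1 / ((n : ℝ) + 1)) atTop (𝓝[>] 0) :=
      tendsto_nhdsWithin_iff.2 ⟨tendsto_moll_radius, Eventually.of_forall fun n => by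
        simp only [mem_Ioi]; positivity⟩
    refine (h1.comp h2).congr fun n => ?_
    simp only [Function.comp_apply, smul_eq_mul, one_div, inv_inv, hQ]
    ring
  -- Fatou's lemma for the difference quotients, whose `L¹` norms are at most `C`.
  have hle : ∫⁻ x, ‖g' x‖ₑ ≤ ENNReal.ofReal C := by
    calc ∫⁻ x, ‖g' x‖ₑ ≤ ∫⁻ x, liminf (fun n => ‖Q n x‖ₑ) atTop := by
          refine lintegral_mono_ae ?_
          filter_upwards [hlim] with x hx
          exact (hx.enorm.liminf_eq).ge
      _ ≤ liminf (fun n => ∫⁻ x, ‖Q n x‖ₑ) atTop :=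
          lintegral_liminf_le' fun n => (hQi n).1.enorm
      _ ≤ ENNReal.ofReal C := by
          refine liminf_le_of_frequently_le' (Frequently.of_forall fun n => ?_)
          rw [← ofReal_integral_norm_eq_lintegral_enorm (hQi n)]
          refine ENNReal.ofReal_le_ofReal ?_
          have hn : (0 : ℝ) < (n : ℝ) + 1 := by positivity
          simp only [hQ, norm_mul, Real.norm_eq_abs, abs_of_pos hn]
          rw [integral_mul_const]
          have := mul_le_mul_of_nonneg_right (h n) hn.le
          rwa [abs_of_pos (by positivity : 0 < 1 / ((n : ℝ) + 1)), mul_assoc,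
            one_div_mul_cancel hn.ne', mul_one] at this
  have hi : Integrable g' := ⟨hm, lt_of_le_of_lt hle ENNReal.ofReal_lt_top⟩
  refine ⟨hi, ?_⟩
  have h1 := ofReal_integral_norm_eq_lintegral_enorm hi
  rw [← h1] at hle
  exact (ENNReal.ofReal_le_ofReal_iff hC).1 hle

/-- A right derivative along a sequence, cut off at `±Λ`. -/
noncomputable def clampedDeriv (Λ : ℝ) (g : ℝ → ℝ) (x : ℝ) : ℝ :=
  max (-Λ) (min Λ (limUnder atTop fun n : ℕ => (g (x + 1 / ((n : ℝ) + 1)) - g x) * ((n : ℝ) + 1)))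

theorem abs_clampedDeriv_le {Λ : ℝ} (hΛ : 0 ≤ Λ) (g : ℝ → ℝ) (x : ℝ) :
    |clampedDeriv Λ g x| ≤ Λ :=
  abs_le.2 ⟨le_max_left _ _, max_le (by linarith) (min_le_left _ _)⟩

theorem HasDerivAt.clampedDeriv_eq {Λ d x : ℝ} (hd : HasDerivAt g d x) (hΛ : |d| ≤ Λ) :
    clampedDeriv Λ g x = d := by
  have h1 := hd.tendsto_slope_zero_right
  have h2 : Tendsto (fun n : ℕ => 1 / ((n : ℝ) + 1)) atTop (𝓝[>] 0) :=
    tendsto_nhdsWithin_iff.2 ⟨tendsto_moll_radius, Eventually.of_forall fun n => by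
      simp only [mem_Ioi]; positivity⟩
  have h3 : Tendsto (fun n : ℕ => (g (x + 1 / ((n : ℝ) + 1)) - g x) * ((n : ℝ) + 1)) atTop
      (𝓝 d) := by
    refine (h1.comp h2).congr fun n => ?_
    simp only [Function.comp_apply, smul_eq_mul, one_div, inv_inv]
    ring
  have h4 := abs_le.1 hΛ
  rw [clampedDeriv, h3.limUnder_eq, min_eq_right h4.2, max_eq_right h4.1]

theorem ae_hasDerivAt_clampedDeriv {Λ : ℝ} (hg : ∀ x y, |g x - g y| ≤ Λ * |x - y|) :
    ∀ᵐ x, HasDerivAt g (clampedDeriv Λ g x) x := by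
  have hΛ : 0 ≤ Λ := by simpa using (abs_nonneg _).trans (hg 1 0)
  have hl : LipschitzWith Λ.toNNReal g := LipschitzWith.of_dist_le' fun x y => by
    rw [Real.dist_eq, Real.dist_eq]; exact hg x y
  filter_upwards [hl.ae_differentiableAt_real] with x hx
  have hd := hx.hasDerivAt
  have hb : |deriv g x| ≤ Λ := by
    have := norm_deriv_le_of_lipschitz (x₀ := x) hl
    rwa [Real.coe_toNNReal _ hΛ, Real.norm_eq_abs] at this
  rw [hd.clampedDeriv_eq hb]
  exact hd

/-- The purpose of taking the derivative along a sequence: a limit of jointly measurable quotients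
is jointly measurable in time and space. The cut-off bounds the value also at points where the
quotients do not converge. -/
theorem measurable_clampedDeriv {Λ : ℝ} {a : ℝ → ℝ → ℝ}
    (ha : Measurable fun z : ℝ × ℝ => a z.1 z.2) :
    Measurable fun z : ℝ × ℝ => clampedDeriv Λ (a z.1) z.2 := by
  refine measurable_const.max (measurable_const.min ?_)
  refine (StronglyMeasurable.limUnder fun n => Measurable.stronglyMeasurable ?_).measurable
  exact ((ha.comp (by fun_prop : Measurable fun z : ℝ × ℝ => (z.1, z.2 + 1 / ((n : ℝ) + 1)))).sub
    ha).mul_const _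

/-- A speed law on `[0, R]`, extended to the line, with its derivative. -/
structure IsSpeed (R c v₁ v₂ : ℝ) (sp dsp : ℝ → ℝ) : Prop where
  continuous : Continuous sp
  continuous' : Continuous dsp
  abs_le : ∀ x, |sp x| ≤ c
  abs_le' : ∀ x, |dsp x| ≤ v₁
  lip : ∀ x y, |sp x - sp y| ≤ v₁ * |x - y|
  lip' : ∀ x y, |dsp x - dsp y| ≤ v₂ * |x - y|
  hasDerivAt : ∀ a : ℝ → ℝ, (∀ x, a x ∈ Icc 0 R) → ∀ x d, HasDerivAt a d x →
    HasDerivAt (fun y => sp (a y)) (dsp (a x) * d) x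

theorem IsAvgKernel.integral_abs_deriv_corr_le (hk : IsAvgKernel Ω k) (hu : Integrable u)
    (hp : ∀ᵐ x, HasDerivAt (corr u k) (p x) x) :
    Integrable p ∧ ∫ x, |p x| ≤ 2 * Ω * ∫ x, |u x| := by
  have := hk.bound_nonneg
  refine integral_abs_deriv_le (mul_nonneg (by positivity) (integral_nonneg fun _ => abs_nonneg _))
    (integral_abs_corr_le hu hk.integrable).1 hp fun n => hk.hasVarLE_corr hu _

/-- The `L¹` distance of the derivatives of two velocity profiles. -/
theorem IsSpeed.integral_abs_sub_le (hs : IsSpeed R c v₁ v₂ sp dsp) (hk : IsAvgKernel Ω k)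
    (hu : Integrable u) (hw : Integrable w) (hp : ∀ᵐ x, HasDerivAt (corr u k) (p x) x)
    (hq : ∀ᵐ x, HasDerivAt (corr w k) (q x) x) (hqb : ∀ x, |q x| ≤ 2 * R * Ω) :
    ∫ x, |dsp (corr u k x) * p x - dsp (corr w k x) * q x|
      ≤ (v₁ * (2 * Ω) + v₂ * (2 * R * Ω)) * ∫ x, |u x - w x| := by
  have hv₁ : 0 ≤ v₁ := (abs_nonneg _).trans (hs.abs_le' 0)
  have hv₂ : 0 ≤ v₂ := by simpa using (abs_nonneg _).trans (hs.lip' 1 0)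
  have hRΩ : 0 ≤ 2 * R * Ω := (abs_nonneg _).trans (hqb 0)
  -- Averaging is linear, so `p - q` is the derivative of the average of `u - w`, and its `L¹` norm
  -- is at most `2Ω ‖u - w‖₁`.
  have hpq : ∀ᵐ x, HasDerivAt (corr (fun y => u y - w y) k) (p x - q x) x := by
    filter_upwards [hp, hq] with x h1 h2
    refine (h1.sub h2).congr_of_eventuallyEq (Eventually.of_forall fun y => ?_)
    exact hk.corr_sub hu hw y
  obtain ⟨i1, h1⟩ := hk.integral_abs_deriv_corr_le (hu.sub hw) hpq
  simp only [Pi.sub_apply] at h1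
  have i2 : Integrable fun x => |corr u k x - corr w k x| :=
    ((integral_abs_corr_le hu hk.integrable).1.sub (integral_abs_corr_le hw hk.integrable).1).abs
  have h2 := hk.integral_abs_corr_sub_le hu hw
  have i3 : Integrable fun x => v₁ * |p x - q x| + v₂ * (2 * R * Ω) * |corr u k x - corr w k x| :=
    (i1.abs.const_mul v₁).add (i2.const_mul _)
  refine (integral_mono_of_nonneg (Eventually.of_forall fun _ => abs_nonneg _) i3
    (Eventually.of_forall fun x => ?_)).trans ?_
  · have e : dsp (corr u k x) * p x - dsp (corr w k x) * q x = dsp (corr u k x) * (p x - q x)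
        + (dsp (corr u k x) - dsp (corr w k x)) * q x := by ring
    beta_reduce
    rw [e]
    refine (abs_add_le _ _).trans ?_
    rw [abs_mul, abs_mul]
    have h3 := mul_le_mul_of_nonneg_right (hs.abs_le' (corr u k x)) (abs_nonneg (p x - q x))
    have h4 := mul_le_mul (hs.lip' (corr u k x) (corr w k x)) (hqb x) (abs_nonneg _)
      (by positivity)
    linarith
  · rw [integral_add (i1.abs.const_mul v₁) (i2.const_mul _), integral_const_mul,
      integral_const_mul]
    have h3 := mul_le_mul_of_nonneg_left h1 hv₁
    have h4 := mul_le_mul_of_nonneg_left h2 (mul_nonneg hv₂ hRΩ)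
    linarith

end

section

variable {R M Ω c v₁ v₂ τ : ℝ} {k sp dsp : ℝ → ℝ} {u : ℝ → ℝ → ℝ}

/-- The velocity with delay `τ`, switched off at nonpositive times. -/
noncomputable def delayVel (sp k : ℝ → ℝ) (τ : ℝ) (u : ℝ → ℝ → ℝ) (t x : ℝ) : ℝ :=
  if t ≤ 0 then 0 else sp (corr (u (t - τ)) k x)

/-- The spatial derivative of the velocity with delay. -/
noncomputable def delayVelx (Λ : ℝ) (dsp k : ℝ → ℝ) (τ : ℝ) (u : ℝ → ℝ → ℝ) (t x : ℝ) : ℝ :=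
  if t ≤ 0 then 0 else dsp (corr (u (t - τ)) k x) * clampedDeriv Λ (corr (u (t - τ)) k) x

theorem IsAvgKernel.measurable_corr (hk : IsAvgKernel Ω k)
    (hu : Measurable fun p : ℝ × ℝ => u p.1 p.2) (τ : ℝ) :
    Measurable fun z : ℝ × ℝ => corr (u (z.1 - τ)) k z.2 := by
  have h : Measurable fun q : (ℝ × ℝ) × ℝ => u (q.1.1 - τ) q.2 * k (q.2 - q.1.2) :=
    (hu.comp (by fun_prop : Measurable fun q : (ℝ × ℝ) × ℝ => (q.1.1 - τ, q.2))).mul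
      (hk.measurable.comp (by fun_prop : Measurable fun q : (ℝ × ℝ) × ℝ => q.2 - q.1.2))
  exact h.stronglyMeasurable.integral_prod_right'.measurable

theorem isVelocity_delayVel (hs : IsSpeed R c v₁ v₂ sp dsp) (hk : IsAvgKernel Ω k)
    (hu : IsDensity R M u) :
    IsVelocity c (v₁ * (2 * R * Ω)) (delayVel sp k τ u) (delayVelx (2 * R * Ω) dsp k τ u) := by
  have hv₁ : 0 ≤ v₁ := (abs_nonneg _).trans (hs.abs_le' 0)
  have hc : 0 ≤ c := (abs_nonneg _).trans (hs.abs_le 0)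
  have hR : 0 ≤ R := (hu.mem 0 0).1.trans (hu.mem 0 0).2
  have hΩ := hk.bound_nonneg
  have hlip := fun t => hk.corr_lip (hu.integrable (t - τ)) (hu.mem (t - τ))
  have hset : MeasurableSet {z : ℝ × ℝ | z.1 ≤ 0} := measurableSet_le measurable_fst measurable_const
  have hcm := hk.measurable_corr hu.measurable τ
  refine ⟨?_, ?_, fun t x => ?_, fun t x => ?_, fun t x y => ?_, fun t => ?_, fun t => ?_⟩
  · exact Measurable.ite hset measurable_const (hs.continuous.measurable.comp hcm)
  · exact Measurable.ite hset measurable_const ((hs.continuous'.measurable.comp hcm).mul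
      (measurable_clampedDeriv (a := fun t => corr (u (t - τ)) k) hcm))
  · unfold delayVel; split_ifs
    · simpa using hc
    · exact hs.abs_le _
  · unfold delayVelx; split_ifs
    · rw [abs_zero]; positivity
    · rw [abs_mul]
      exact mul_le_mul (hs.abs_le' _) (abs_clampedDeriv_le (by positivity) _ _) (abs_nonneg _) hv₁
  · unfold delayVel; split_ifs
    · rw [sub_self, abs_zero]; positivity
    · refine (hs.lip _ _).trans ?_
      rw [mul_assoc v₁]
      exact mul_le_mul_of_nonneg_left (hlip t x y) hv₁
  · by_cases ht : t ≤ 0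
    · refine Eventually.of_forall fun x => ?_
      have e : delayVel sp k τ u t = fun _ => 0 := funext fun y => if_pos ht
      rw [e, delayVelx, if_pos ht]
      exact hasDerivAt_const _ _
    · have e : delayVel sp k τ u t = fun y => sp (corr (u (t - τ)) k y) :=
        funext fun y => if_neg ht
      filter_upwards [ae_hasDerivAt_clampedDeriv (hlip t)] with x hx
      rw [e, delayVelx, if_neg ht]
      exact hs.hasDerivAt _ (hk.corr_mem (hu.integrable _) (hu.mem _)) x _ hx
  · by_cases ht : t ≤ 0
    · have e : delayVelx (2 * R * Ω) dsp k τ u t = fun _ => 0 := funext fun y => if_pos ht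
      rw [e]; exact integrable_zero _ _ _
    · have e : delayVelx (2 * R * Ω) dsp k τ u t = fun x => dsp (corr (u (t - τ)) k x)
          * clampedDeriv (2 * R * Ω) (corr (u (t - τ)) k) x := funext fun y => if_neg ht
      rw [e]
      refine (hk.integral_abs_deriv_corr_le (hu.integrable _)
        (ae_hasDerivAt_clampedDeriv (hlip t))).1.bdd_mul (c := v₁) ?_
        (Eventually.of_forall fun x => hs.abs_le' _)
      exact (hs.continuous'.measurable.comp (hcm.comp
        (by fun_prop : Measurable fun x : ℝ => (t, x)))).aestronglyMeasurable

theorem integral_abs_delayVelx_sub_le {M' : ℝ} {w : ℝ → ℝ → ℝ} {τ' : ℝ}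
    (hs : IsSpeed R c v₁ v₂ sp dsp) (hk : IsAvgKernel Ω k)
    (hu : IsDensity R M u) (hw : IsDensity R M' w) (t : ℝ) :
    ∫ x, |delayVelx (2 * R * Ω) dsp k τ u t x - delayVelx (2 * R * Ω) dsp k τ' w t x|
      ≤ (v₁ * (2 * Ω) + v₂ * (2 * R * Ω)) * ∫ x, |u (t - τ) x - w (t - τ') x| := by
  have hv₁ : 0 ≤ v₁ := (abs_nonneg _).trans (hs.abs_le' 0)
  have hv₂ : 0 ≤ v₂ := by simpa using (abs_nonneg _).trans (hs.lip' 1 0)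
  have hR : 0 ≤ R := (hu.mem 0 0).1.trans (hu.mem 0 0).2
  have hΩ := hk.bound_nonneg
  unfold delayVelx
  split_ifs
  · simp only [sub_self, abs_zero, integral_zero]
    exact mul_nonneg (by positivity) (integral_nonneg fun _ => abs_nonneg _)
  · exact hs.integral_abs_sub_le hk (hu.integrable _) (hw.integrable _)
      (ae_hasDerivAt_clampedDeriv (hk.corr_lip (hu.integrable _) (hu.mem _)))
      (ae_hasDerivAt_clampedDeriv (hk.corr_lip (hw.integrable _) (hw.mem _)))
      fun x => abs_clampedDeriv_le (by positivity) _ _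

theorem abs_delayVel_sub_le {M' : ℝ} {w : ℝ → ℝ → ℝ} {τ' : ℝ}
    (hs : IsSpeed R c v₁ v₂ sp dsp) (hk : IsAvgKernel Ω k)
    (hu : IsDensity R M u) (hw : IsDensity R M' w) (t x : ℝ) :
    |delayVel sp k τ u t x - delayVel sp k τ' w t x|
      ≤ v₁ * (Ω * ∫ x, |u (t - τ) x - w (t - τ') x|) := by
  have hv₁ : 0 ≤ v₁ := (abs_nonneg _).trans (hs.abs_le' 0)
  have hΩ := hk.bound_nonneg
  unfold delayVel
  split_ifs
  · simp only [sub_self, abs_zero]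
    exact mul_nonneg hv₁ (mul_nonneg hΩ (integral_nonneg fun _ => abs_nonneg _))
  · exact (hs.lip _ _).trans (mul_le_mul_of_nonneg_left
      (hk.abs_corr_sub_le (hu.integrable _) (hw.integrable _) x) hv₁)

/-- Averaging commutes with translation, so the difference estimate for `u` and its translate bounds
the modulus of `∂ₓV(t)` by that of `u(t - τ)`. Through this lemma the past alone controls the source
term in the growth of the variation. -/
theorem hasVarLE_delayVelx (hs : IsSpeed R c v₁ v₂ sp dsp) (hk : IsAvgKernel Ω k)
    (hu : IsDensity R M u) {t b : ℝ} (hb : HasVarLE (u (t - τ)) b) :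
    HasVarLE (delayVelx (2 * R * Ω) dsp k τ u t) ((v₁ * (2 * Ω) + v₂ * (2 * R * Ω)) * b) := by
  intro h
  have hv₁ : 0 ≤ v₁ := (abs_nonneg _).trans (hs.abs_le' 0)
  have hv₂ : 0 ≤ v₂ := by simpa using (abs_nonneg _).trans (hs.lip' 1 0)
  have hR : 0 ≤ R := (hu.mem 0 0).1.trans (hu.mem 0 0).2
  have hΩ := hk.bound_nonneg
  have h1 := integral_abs_delayVelx_sub_le (τ := τ) (τ' := τ) hs hk (hu.translate h) hu t
  have e : ∀ x, delayVelx (2 * R * Ω) dsp k τ (fun t x => u t (x + h)) t x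
      = delayVelx (2 * R * Ω) dsp k τ u t (x + h) := fun x => by
    simp only [delayVelx, funext fun x => corr_translate (u (t - τ)) k x h, clampedDeriv,
      add_right_comm]
  simp only [e] at h1
  refine h1.trans ?_
  rw [mul_assoc _ b]
  exact mul_le_mul_of_nonneg_left (hb h) (by positivity)

end

/-! ### Weak formulation and Lipschitz continuity in time -/

/-- A lower bound for the distributional derivative gives a one-sided Lipschitz bound at the
points of density. -/
theorem le_add_mul_of_distrib {E : ℝ → ℝ} {T C s r : ℝ} (hE : LocallyIntegrable E) (hC : 0 ≤ C)
    (H : ∀ θ θ', IsTimeTest T θ θ' → 0 ≤ ∫ t, (θ' t * E t + θ t * C))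
    (hs : Tendsto (fun n => ∫ t, moll n (t - s) * E t) atTop (𝓝 (E s)))
    (hr : Tendsto (fun n => ∫ t, moll n (t - r) * E t) atTop (𝓝 (E r))) (hsr : s ≤ r)
    (hrT : r < T) : E r ≤ E s + C * (r - s) := by
  have hlim : Tendsto (fun n : ℕ => (∫ t, moll n (t - s) * E t)
      + C * (r - s + 2 * (1 / ((n : ℝ) + 1)))) atTop (𝓝 (E s + C * (r - s + 2 * 0))) :=
    hs.add ((tendsto_const_nhds.add (tendsto_moll_radius.const_mul 2)).const_mul C)
  have hev : ∀ᶠ n : ℕ in atTop, 1 / ((n : ℝ) + 1) < T - r :=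
    tendsto_moll_radius.eventually_lt_const (by linarith)
  refine (le_of_tendsto_of_tendsto hr hlim ?_).trans (by simp)
  filter_upwards [hev] with n hn
  set ε : ℝ := 1 / ((n : ℝ) + 1) with hε
  have hεp : 0 < ε := by positivity
  have htest : IsTimeTest T (fun t => mollPrim n (t - s) - mollPrim n (t - r))
      (fun t => moll n (t - s) - moll n (t - r)) := by
    refine ⟨.of_bounded_support (a := s - ε) (b := r + ε) (fun t => ?_) ?_ (fun t => ?_)
      (fun t ht => ?_), r + ε, by linarith, fun t ht => ?_⟩
    · exact ((mollPrim_hasDerivAt n _).comp_sub_const t s).sub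
        ((mollPrim_hasDerivAt n _).comp_sub_const t r)
    · have := moll_continuous n; fun_prop
    · exact sub_nonneg.2 (mollPrim_mono n (by linarith))
    · simp only [mem_Icc, not_and_or, not_le] at ht
      rcases ht with ht | ht
      · rw [mollPrim_of_le (by linarith), mollPrim_of_le (by linarith), sub_self]
      · rw [mollPrim_of_ge (by linarith), mollPrim_of_ge (by linarith), sub_self]
    · rw [mollPrim_of_ge (by linarith), mollPrim_of_ge (by linarith), sub_self]
  have h0 := H _ _ htest
  rw [integral_add (htest.integrable_mul' hE) (htest.integrable.mul_const C)] at h0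
  have i1 : Integrable fun t => moll n (t - s) * E t :=
    ((moll_isTestFn n).comp_sub_right s).integrable_mul hE
  have i2 : Integrable fun t => moll n (t - r) * E t :=
    ((moll_isTestFn n).comp_sub_right r).integrable_mul hE
  simp_rw [sub_mul (moll n _)] at h0
  rw [integral_sub i1 i2] at h0
  have h2 : ∫ t, (mollPrim n (t - s) - mollPrim n (t - r)) * C ≤ C * (r - s + 2 * ε) := by
    calc ∫ t, (mollPrim n (t - s) - mollPrim n (t - r)) * C
        ≤ ∫ t, (Icc (s - ε) (r + ε)).indicator (fun _ => C) t := by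
          refine integral_mono (htest.integrable.mul_const C)
            ((integrable_indicator_iff measurableSet_Icc).2 (by simp)) fun t => ?_
          by_cases ht : t ∈ Icc (s - ε) (r + ε)
          · rw [indicator_of_mem ht]
            exact mul_le_of_le_one_left hC (by
              linarith [mollPrim_le_one n (t - s), mollPrim_nonneg n (t - r)])
          · rw [indicator_of_notMem ht]
            simp only [mem_Icc, not_and_or, not_le] at ht
            rcases ht with ht | ht
            · simp [mollPrim_of_le (n := n) (x := t - s) (by linarith),
                mollPrim_of_le (n := n) (x := t - r) (by linarith)]
            · simp [mollPrim_of_ge (n := n) (x := t - s) (by linarith),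
                mollPrim_of_ge (n := n) (x := t - r) (by linarith)]
      _ = C * (r - s + 2 * ε) := by
          rw [integral_indicator measurableSet_Icc, setIntegral_const, smul_eq_mul,
            Real.volume_real_Icc_of_le (by linarith)]
          ring
  linarith

section

variable {F : ℝ → ℝ} {R A M c Λ T : ℝ} {u V Vx : ℝ → ℝ → ℝ} {α α' β β' : ℝ → ℝ}

theorem IsFluxFactor.at_zero (hF : IsFluxFactor F R A) : F 0 = 0 :=
  le_antisymm (hF.le_self 0 ⟨le_rfl, hF.R_pos.le⟩) (hF.nonneg 0 ⟨le_rfl, hF.R_pos.le⟩)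

/-- `F` vanishes at `0` and at `R`, so for these two constants the source term drops out. For
densities in `[0, R]` the sign of `u - κ` does not change either. The entropy inequality becomes the
weak formulation, with one sign for `κ = 0` and the opposite one for `κ = R`. -/
theorem kruzIntegrand_zero (hF : IsFluxFactor F R A) {u V Vx a b d : ℝ} (hu : u ∈ Icc 0 R) :
    kruzIntegrand F 0 u V Vx a b d = u * a + F u * V * b := by
  unfold kruzIntegrand kruzFlux
  rw [hF.at_zero, sub_zero, sub_zero, abs_of_nonneg hu.1]
  rcases hu.1.eq_or_lt with h | h
  · rw [← h, hF.at_zero]; ring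
  · rw [Real.sign_of_pos h]; ring

theorem kruzIntegrand_R (hF : IsFluxFactor F R A) {u V Vx a b d : ℝ} (hu : u ∈ Icc 0 R) :
    kruzIntegrand F R u V Vx a b d = R * a - (u * a + F u * V * b) := by
  unfold kruzIntegrand kruzFlux
  rw [hF.at_R, sub_zero, abs_of_nonpos (sub_nonpos.2 hu.2)]
  rcases hu.2.eq_or_lt with h | h
  · rw [h, hF.at_R]; ring
  · rw [Real.sign_of_neg (sub_neg.2 h)]; ring

theorem integrable_weak (hF : IsFluxFactor F R A) (hu : IsDensity R M u)
    (hV : IsVelocity c Λ V Vx) (hα : Continuous α) (hα' : Continuous α')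
    (hαs : HasCompactSupport α) (hαs' : HasCompactSupport α') (hβ : Continuous β)
    (hβ' : Continuous β') (hβs : HasCompactSupport β) (hβs' : HasCompactSupport β') :
    Integrable fun p : ℝ × ℝ => u p.1 p.2 * (α' p.1 * β p.2)
      + F (u p.1 p.2) * V p.1 p.2 * (α p.1 * β' p.2) := by
  have i1 : Integrable fun p : ℝ × ℝ => α' p.1 * β p.2 :=
    (hα'.integrable_of_hasCompactSupport hαs').mul_prod (hβ.integrable_of_hasCompactSupport hβs)
  have i2 : Integrable fun p : ℝ × ℝ => α p.1 * β' p.2 :=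
    (hα.integrable_of_hasCompactSupport hαs).mul_prod (hβ'.integrable_of_hasCompactSupport hβs')
  refine (i1.bdd_mul (c := R) hu.measurable.aestronglyMeasurable
    (Eventually.of_forall fun p => ?_)).add (i2.bdd_mul (c := R * c)
    ((hF.measurable.comp hu.measurable).mul hV.measurable).aestronglyMeasurable
    (Eventually.of_forall fun p => ?_))
  · rw [Real.norm_eq_abs, abs_of_nonneg (hu.mem _ _).1]; exact (hu.mem _ _).2
  · rw [Real.norm_eq_abs, abs_mul]
    exact mul_le_mul (hF.abs_le (hu.mem _ _)) (hV.abs_le _ _) (abs_nonneg _) hF.R_pos.le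

/-- The inequalities for `κ = 0` and `κ = R` bound the integral from both sides. The additional term
`R α' β` of the second integrates to zero because `α` has compact support. -/
theorem IsKruzkov.weak_nonneg (hF : IsFluxFactor F R A) (hu : IsDensity R M u)
    (hV : IsVelocity c Λ V Vx) (ku : IsKruzkov F R T u V Vx) (hα : IsTimeTest T α α')
    (hβ : IsTestFn β β') : ∫ p : ℝ × ℝ, (u p.1 p.2 * (α' p.1 * β p.2)
      + F (u p.1 p.2) * V p.1 p.2 * (α p.1 * β' p.2)) = 0 := by
  have hR := hF.R_pos.le
  have h0 := ku 0 ⟨le_rfl, hR⟩ α α' β β' hα hβ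
  have h1 := ku R ⟨hR, le_rfl⟩ α α' β β' hα hβ
  simp only [kruzIntegrand_zero hF (hu.mem _ _)] at h0
  simp only [kruzIntegrand_R hF (hu.mem _ _)] at h1
  have i1 : Integrable fun p : ℝ × ℝ => α' p.1 * β p.2 := hα.integrable'.mul_prod hβ.integrable
  have i := integrable_weak hF hu hV hα.continuous hα.cont' hα.supp hα.supp' hβ.continuous
    hβ.cont' hβ.supp hβ.supp'
  rw [integral_sub (i1.const_mul R) i, integral_const_mul, Measure.volume_eq_prod,
    integral_prod_mul α' β, hα.integral_deriv, zero_mul, mul_zero, zero_sub] at h1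
  exact le_antisymm (neg_nonneg.1 h1) h0

/-- The weak formulation, for test functions of arbitrary sign. -/
theorem IsKruzkov.weak (hF : IsFluxFactor F R A) (hu : IsDensity R M u)
    (hV : IsVelocity c Λ V Vx) (ku : IsKruzkov F R T u V Vx) (hα : IsTimeTest T α α')
    (hβ : ContDiff ℝ 1 β) (hβs : HasCompactSupport β) :
    ∫ p : ℝ × ℝ, (u p.1 p.2 * (α' p.1 * β p.2)
      + F (u p.1 p.2) * V p.1 p.2 * (α p.1 * deriv β p.2)) = 0 := by
  obtain ⟨C, hC⟩ := hβs.exists_bound_of_continuous hβ.continuous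
  have hC0 : 0 ≤ C := (norm_nonneg _).trans (hC 0)
  obtain ⟨χ, χ', _, -, hχ⟩ := exists_cutoff
  obtain ⟨r, hr⟩ := hβs.isCompact.isBounded.subset_closedBall 0
  obtain ⟨N, hN⟩ := exists_nat_ge r
  obtain ⟨hχN, -, -, hχ1⟩ := hχ N
  have hz : ∀ x, χ N x ≠ 1 → β x = 0 := fun x hx => by
    by_contra h
    have h1 := hr (subset_tsupport β h)
    rw [mem_closedBall_zero_iff, Real.norm_eq_abs] at h1
    exact hx (hχ1 x (by linarith))
  have hd : ∀ x, HasDerivAt β (deriv β x) x := fun x =>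
    (hβ.differentiable (by norm_num) x).hasDerivAt
  have hβc := hβ.continuous
  have hβc' := hβ.continuous_deriv le_rfl
  have hχc := hχN.continuous
  have hχc' := hχN.cont'
  -- A signed `β` is the difference of the nonnegative `β + C χ` and `C χ`, where `χ = 1` wherever
  -- `β ≠ 0` and `C` bounds `|β|`.
  have h2 : IsTestFn (fun x => C * χ N x) (fun x => C * χ' N x) :=
    ⟨fun x => (hχN.hasDeriv x).const_mul C, by fun_prop, hχN.supp.mul_left,
      fun x => mul_nonneg hC0 (hχN.nonneg x)⟩
  have h1 : IsTestFn (fun x => β x + C * χ N x) (fun x => deriv β x + C * χ' N x) := by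
    refine ⟨fun x => (hd x).add (h2.hasDeriv x), by fun_prop, hβs.add h2.supp, fun x => ?_⟩
    by_cases hx : χ N x = 1
    · rw [hx, mul_one]; linarith [(abs_le.1 (hC x)).1]
    · rw [hz x hx, zero_add]; exact h2.nonneg x
  have e1 := ku.weak_nonneg hF hu hV hα h1
  have e2 := ku.weak_nonneg hF hu hV hα h2
  have i1 := integrable_weak hF hu hV hα.continuous hα.cont' hα.supp hα.supp' h1.continuous
    h1.cont' h1.supp h1.supp'
  have i2 := integrable_weak hF hu hV hα.continuous hα.cont' hα.supp hα.supp' h2.continuous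
    h2.cont' h2.supp h2.supp'
  have := integral_sub i1 i2
  rw [e1, e2, sub_zero] at this
  rw [← this]
  refine integral_congr_ae (Eventually.of_forall fun p => ?_)
  beta_reduce
  ring

/-- The total variation of the flux at a fixed time. -/
theorem hasVarLE_flux (hF : IsFluxFactor F R A) (hu : IsDensity R M u)
    (hV : IsVelocity c Λ V Vx) {t N : ℝ} (hN : HasVarLE (u t) N) :
    Integrable (fun x => F (u t x) * V t x) ∧
      HasVarLE (fun x => F (u t x) * V t x) (c * A * N + Λ * M) := by
  have hΛ : 0 ≤ Λ := (abs_nonneg _).trans (hV.abs_x_le 0 0)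
  have hc : 0 ≤ c := (abs_nonneg _).trans (hV.abs_le 0 0)
  have hum : Measurable (u t) := hu.measurable.comp (by fun_prop : Measurable fun x : ℝ => (t, x))
  have hFle : ∀ x, |F (u t x)| ≤ u t x := fun x => by
    rw [abs_of_nonneg (hF.nonneg _ (hu.mem t x))]; exact hF.le_self _ (hu.mem t x)
  have i : Integrable (fun x => F (u t x) * V t x) := by
    have iF : Integrable fun x => F (u t x) := (hu.integrable t).mono'
      (hF.measurable.comp hum).aestronglyMeasurable (Eventually.of_forall hFle)
    exact iF.mul_bdd (hV.continuous t).aestronglyMeasurable (Eventually.of_forall (hV.abs_le t))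
  refine ⟨i, fun k => ?_⟩
  have i1 : Integrable fun x => |u t (x + k) - u t x| :=
    (((hu.integrable t).comp_add_right k).sub (hu.integrable t)).abs
  calc ∫ x, |F (u t (x + k)) * V t (x + k) - F (u t x) * V t x|
      ≤ ∫ x, (c * A * |u t (x + k) - u t x| + Λ * |k| * u t x) := by
        refine integral_mono ((i.comp_add_right k).sub i).abs
          ((i1.const_mul _).add ((hu.integrable t).const_mul _)) fun x => ?_
        change |F (u t (x + k)) * V t (x + k) - F (u t x) * V t x| ≤ _
        have e : F (u t (x + k)) * V t (x + k) - F (u t x) * V t x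
            = (F (u t (x + k)) - F (u t x)) * V t (x + k)
              + F (u t x) * (V t (x + k) - V t x) := by ring
        rw [e]
        refine (abs_add_le _ _).trans ?_
        rw [abs_mul, abs_mul]
        have h1 := hF.lip _ (hu.mem t (x + k)) _ (hu.mem t x)
        have h2 := hV.lip t (x + k) x
        rw [add_sub_cancel_left] at h2
        have h3 := mul_le_mul h1 (hV.abs_le t (x + k)) (abs_nonneg _)
          (mul_nonneg hF.A_nonneg (abs_nonneg _))
        have h4 := mul_le_mul (hFle x) h2 (abs_nonneg _) (hu.mem t x).1
        linarith
    _ = c * A * (∫ x, |u t (x + k) - u t x|) + Λ * |k| * ∫ x, u t x := by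
        rw [integral_add (i1.const_mul _) ((hu.integrable t).const_mul _), integral_const_mul,
          integral_const_mul]
    _ ≤ c * A * (N * |k|) + Λ * |k| * M := by
        have := hF.A_nonneg
        have := hu.mass_le t
        have := hN k
        gcongr
    _ = _ := by ring

/-- Solutions of bounded variation are Lipschitz continuous in time with values in `L¹`, up to a
null set of times. -/
theorem exists_lipschitz_times (hF : IsFluxFactor F R A) (hu : IsDensity R M u)
    (hV : IsVelocity c Λ V Vx) (ku : IsKruzkov F R T u V Vx) {N : ℝ} (hN0 : 0 ≤ N)
    (hN : ∀ᵐ t, t < T → HasVarLE (u t) N) :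
    ∃ S : Set ℝ, (∀ᵐ t, t ∈ S) ∧ ∀ s ∈ S, ∀ t ∈ S, s < T → t < T →
      ∫ x, |u t x - u s x| ≤ (c * A * N + Λ * M) * |t - s| := by
  have hΛ : 0 ≤ Λ := (abs_nonneg _).trans (hV.abs_x_le 0 0)
  have hc : 0 ≤ c := (abs_nonneg _).trans (hV.abs_le 0 0)
  have hM : 0 ≤ M := (integral_nonneg fun x => (hu.mem 0 x).1).trans (hu.mass_le 0)
  have hA := hF.A_nonneg
  set C := c * A * N + Λ * M with hC
  have hC0 : 0 ≤ C := by positivity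
  obtain ⟨ψ, hψ, hfam⟩ := exists_dual_family
  set E : ℕ × ℕ → ℝ → ℝ := fun n t => ∫ x, u t x * ψ n x with hE
  have iuψ : ∀ n t, Integrable fun x => u t x * ψ n x := fun n t =>
    (hu.integrable t).mul_bdd (c := 1) (hψ n).1.continuous.aestronglyMeasurable
      (Eventually.of_forall (hψ n).2.2)
  have hEm : ∀ n, Measurable (E n) := fun n => by
    have hc := (hψ n).1.continuous
    have : Measurable fun p : ℝ × ℝ => u p.1 p.2 * ψ n p.2 :=
      hu.measurable.mul (by fun_prop)
    exact this.stronglyMeasurable.integral_prod_right'.measurable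
  have hEb : ∀ n t, |E n t| ≤ M := fun n t => by
    refine (abs_integral_le_integral_abs.trans (integral_mono (iuψ n t).abs (hu.integrable t)
      fun x => ?_)).trans (hu.mass_le t)
    beta_reduce
    rw [abs_mul, abs_of_nonneg (hu.mem t x).1]
    exact mul_le_of_le_one_right (hu.mem t x).1 ((hψ n).2.2 x)
  have hEl : ∀ n, LocallyIntegrable (E n) := fun n => locallyIntegrable_of_bdd (hEm n) (hEb n)
  have hEl' : ∀ (n : ℕ × ℕ) (σ : ℝ), LocallyIntegrable fun t => σ * E n t := fun n σ =>
    locallyIntegrable_of_bdd ((hEm n).const_mul σ) (C := |σ| * M) fun t => by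
      rw [abs_mul]; exact mul_le_mul_of_nonneg_left (hEb n t) (abs_nonneg _)
  -- The distributional derivative of `t ↦ σ ∫ u(t) ψ` is the pairing of the flux with `σ ψ'`, hence
  -- at most the variation of the flux, which is at most `C`. The signs `σ = ±1` give the two sides
  -- of the Lipschitz bound.
  have hH : ∀ (n : ℕ × ℕ) (σ : ℝ), |σ| ≤ 1 → ∀ θ θ', IsTimeTest T θ θ' →
      0 ≤ ∫ t, (θ' t * (σ * E n t) + θ t * C) := by
    intro n σ hσ θ θ' hθ
    obtain ⟨h1, h2, h3⟩ := hψ n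
    have hw := ku.weak hF hu hV hθ h1 h2
    have hi := integrable_weak hF hu hV hθ.continuous hθ.cont' hθ.supp hθ.supp' h1.continuous
      (h1.continuous_deriv le_rfl) h2 h2.deriv
    rw [Measure.volume_eq_prod, integral_prod _ hi] at hw
    have hii := hi.integral_prod_left
    have e : ∫ t, σ * ∫ x, (u t x * (θ' t * ψ n x) + F (u t x) * V t x * (θ t * deriv (ψ n) x))
        = 0 := by rw [integral_const_mul, hw, mul_zero]
    rw [← e]
    refine integral_mono_ae (hii.const_mul σ)
      ((hθ.integrable_mul' (hEl' n σ)).add (hθ.integrable.mul_const C)) ?_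
    filter_upwards [hN] with t ht
    change σ * (∫ x, (u t x * (θ' t * ψ n x) + F (u t x) * V t x * (θ t * deriv (ψ n) x))) ≤ _
    rcases lt_or_ge t T with htT | htT
    · obtain ⟨iF, hFv⟩ := hasVarLE_flux hF hu hV (ht htT)
      obtain ⟨D, hD⟩ := h2.deriv.exists_bound_of_continuous (h1.continuous_deriv le_rfl)
      have i2 : Integrable fun x => F (u t x) * V t x * deriv (ψ n) x :=
        iF.mul_bdd (h1.continuous_deriv le_rfl).aestronglyMeasurable (Eventually.of_forall hD)
      have e1 : ∫ x, (u t x * (θ' t * ψ n x) + F (u t x) * V t x * (θ t * deriv (ψ n) x))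
          = θ' t * E n t + θ t * ∫ x, F (u t x) * V t x * deriv (ψ n) x := by
        rw [hE, ← integral_const_mul, ← integral_const_mul,
          ← integral_add ((iuψ n t).const_mul _) (i2.const_mul _)]
        exact integral_congr_ae (Eventually.of_forall fun x => by beta_reduce; ring)
      have h4 : σ * ∫ x, F (u t x) * V t x * deriv (ψ n) x ≤ C := by
        have h5 := integral_mul_deriv_le hC0 (hFv.totalVar_le iF) (h1.const_smul σ)
          (h2.smul_left (f := fun _ => σ)) (fun x => by
            simp only [smul_eq_mul, abs_mul]
            exact mul_le_one₀ hσ (abs_nonneg _) (h3 x))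
        refine le_trans (le_of_eq ?_) h5
        rw [← integral_const_mul]
        refine integral_congr_ae (Eventually.of_forall fun x => ?_)
        have : deriv (fun y => σ • ψ n y) x = σ * deriv (ψ n) x := by
          simp only [smul_eq_mul, deriv_const_mul_field]
        beta_reduce
        rw [this]; ring
      rw [e1]
      have := mul_le_mul_of_nonneg_left h4 (hθ.nonneg t)
      linarith
    · obtain ⟨b, hb, hz⟩ := hθ.zero_of_le
      have z1 : θ t = 0 := hz t (hb.le.trans htT)
      have z2 : θ' t = 0 := by
        have : HasDerivAt θ 0 t := (hasDerivAt_const t 0).congr_of_eventuallyEq (by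
          filter_upwards [Ioi_mem_nhds (hb.trans_le htT)] with s hs using hz s (le_of_lt hs))
        exact (hθ.hasDeriv t).unique this
      simp [z1, z2]
  -- The good times are the common Lebesgue points of the countably many functions `E n`.
  refine ⟨{t | ∀ n, Tendsto (fun k => ∫ s, moll k (s - t) * E n s) atTop (𝓝 (E n t))},
    ae_all_iff.2 fun n => ae_tendsto_moll (hEl n), ?_⟩
  have key : ∀ (n : ℕ × ℕ) (s t : ℝ), (∀ n, Tendsto (fun k => ∫ r, moll k (r - s) * E n r) atTop
      (𝓝 (E n s))) → (∀ n, Tendsto (fun k => ∫ r, moll k (r - t) * E n r) atTop (𝓝 (E n t))) →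
      s ≤ t → t < T → |E n t - E n s| ≤ C * (t - s) := by
    intro n s t hs ht hst htT
    have hn1 : ∀ r, (∀ n, Tendsto (fun k => ∫ q, moll k (q - r) * E n q) atTop (𝓝 (E n r))) →
        Tendsto (fun k => ∫ q, moll k (q - r) * (-1 * E n q)) atTop (𝓝 (-1 * E n r)) := by
      intro r hr
      refine ((hr n).const_mul (-1)).congr fun k => ?_
      rw [← integral_const_mul]
      exact integral_congr_ae (Eventually.of_forall fun q => by beta_reduce; ring)
    have h1 := le_add_mul_of_distrib (hEl n) hC0
      (fun θ θ' hθ => by simpa using hH n 1 (by simp) θ θ' hθ) (hs n) (ht n) hst htT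
    have h2 := le_add_mul_of_distrib (E := fun t => -1 * E n t) (hEl' n (-1)) hC0
      (hH n (-1) (by simp)) (hn1 s hs) (hn1 t ht) hst htT
    exact abs_le.2 ⟨by linarith, by linarith⟩
  intro s hs t ht hsT htT
  refine le_of_forall_pos_le_add fun ε hε => ?_
  obtain ⟨n, hn⟩ := hfam (fun x => u t x - u s x) ((hu.integrable t).sub (hu.integrable s)) ε hε
  have e1 : ∫ x, (u t x - u s x) * ψ n x = E n t - E n s := by
    rw [hE]; beta_reduce
    rw [← integral_sub (iuψ n t) (iuψ n s)]
    simp only [sub_mul]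
  have h3 : |E n t - E n s| ≤ C * |t - s| := by
    rcases le_total s t with h | h
    · rw [abs_of_nonneg (sub_nonneg.2 h)]; exact key n s t hs ht h htT
    · rw [abs_sub_comm, abs_sub_comm t, abs_of_nonneg (sub_nonneg.2 h)]
      exact key n t s ht hs h hsT
  have := le_abs_self (E n t - E n s)
  linarith

end

/-! ### The flux factor, the speed law and the kernel of the model -/

theorem abs_le_supNormOn {a b : ℝ} {g : ℝ → ℝ} (hg : ContinuousOn g (Icc a b)) {x : ℝ}
    (hx : x ∈ Icc a b) : |g x| ≤ supNormOn a b g :=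
  le_csSup (isCompact_Icc.image_of_continuousOn hg.abs).bddAbove (mem_image_of_mem _ hx)

theorem abs_sub_le_supNormOn_derivWithin {a b : ℝ} {g : ℝ → ℝ}
    (hg : DifferentiableOn ℝ g (Icc a b)) (hg' : ContinuousOn (derivWithin g (Icc a b)) (Icc a b))
    {x y : ℝ} (hx : x ∈ Icc a b) (hy : y ∈ Icc a b) :
    |g x - g y| ≤ supNormOn a b (derivWithin g (Icc a b)) * |x - y| := by
  simpa [Real.norm_eq_abs] using Convex.norm_image_sub_le_of_norm_derivWithin_le
    (f := g) (s := Icc a b) (x := y) (y := x) hg (fun z hz => abs_le_supNormOn hg' hz)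
    (convex_Icc a b) hy hx

/-- The variation of a nonincreasing kernel on the half line. -/
theorem hasVarLE_of_antitoneOn {k : ℝ → ℝ} {Ω : ℝ} (hk : Integrable k) (hneg : ∀ x < 0, k x = 0)
    (hk0 : ∀ x, 0 ≤ k x) (hkΩ : ∀ x, k x ≤ Ω) (hanti : AntitoneOn k (Ici 0)) :
    HasVarLE k (2 * Ω) := by
  have hΩ : 0 ≤ Ω := (hk0 0).trans (hkΩ 0)
  have key : ∀ h, 0 ≤ h → ∫ x, |k (x + h) - k x| ≤ 2 * Ω * h := by
    intro h hh
    have i1 : Integrable fun x => k x - k (x + h) := hk.sub (hk.comp_add_right h)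
    have i2 : Integrable ((Icc (-h) 0).indicator fun _ => 2 * Ω) :=
      (integrable_indicator_iff measurableSet_Icc).2 continuous_const.integrableOn_Icc
    -- Off `[-h, 0]` the difference `k(x) - k(x + h)` is nonnegative, and its integral over the
    -- whole line is zero. On `[-h, 0)`, where the upward jump at 0 is crossed, `k(x) = 0` and `k(x
    -- + h) ≤ -k(x + h) + 2Ω`.
    calc ∫ x, |k (x + h) - k x|
        ≤ ∫ x, ((k x - k (x + h)) + (Icc (-h) 0).indicator (fun _ => 2 * Ω) x) := by
          refine integral_mono ((hk.comp_add_right h).sub hk).abs (i1.add i2) fun x => ?_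
          change |k (x + h) - k x| ≤ (k x - k (x + h)) + (Icc (-h) 0).indicator (fun _ => 2 * Ω) x
          rcases le_or_gt 0 x with hx | hx
          · have h1 := hanti hx (hx.trans (by linarith) : (0 : ℝ) ≤ x + h) (by linarith)
            rw [abs_of_nonpos (by linarith)]
            have := indicator_nonneg (s := Icc (-h) 0) (f := fun _ : ℝ => 2 * Ω)
              (fun _ _ => by positivity) x
            linarith
          · rw [hneg x hx]
            rcases lt_or_ge (x + h) 0 with h2 | h2
            · rw [hneg _ h2]
              simpa using indicator_nonneg (s := Icc (-h) 0) (f := fun _ : ℝ => 2 * Ω)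
                (fun _ _ => by positivity) x
            · rw [indicator_of_mem (show x ∈ Icc (-h) 0 from ⟨by linarith, hx.le⟩), sub_zero, abs_of_nonneg (hk0 _)]
              linarith [hkΩ (x + h)]
      _ = 2 * Ω * h := by
          rw [integral_add i1 i2, integral_sub hk (hk.comp_add_right h),
            integral_add_right_eq_self k h, sub_self, zero_add,
            integral_indicator measurableSet_Icc, setIntegral_const, smul_eq_mul,
            Real.volume_real_Icc_of_le (by linarith)]
          ring
  intro h
  rcases le_total 0 h with hh | hh
  · rw [abs_of_nonneg hh]; exact key h hh
  · rw [abs_of_nonpos hh]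
    refine le_trans (le_of_eq ?_) (key (-h) (by linarith))
    rw [← integral_add_right_eq_self (fun x => |k (x + -h) - k x|) h]
    refine integral_congr_ae (Eventually.of_forall fun x => ?_)
    beta_reduce
    rw [add_neg_cancel_right, abs_sub_comm]

namespace TrafficModel

variable (m : TrafficModel)

theorem clamp_mem (s : ℝ) : m.clamp s ∈ Icc 0 m.R :=
  ⟨le_max_left _ _, max_le m.R_pos.le (min_le_right _ _)⟩

theorem clamp_of_mem {s : ℝ} (hs : s ∈ Icc 0 m.R) : m.clamp s = s := by
  rw [clamp, min_eq_left hs.2, max_eq_right hs.1]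

theorem continuous_clamp : Continuous m.clamp :=
  continuous_const.max (continuous_id.min continuous_const)

theorem abs_clamp_sub_le (s r : ℝ) : |m.clamp s - m.clamp r| ≤ |s - r| := by
  simpa [Real.dist_eq, clamp] using
    ((LipschitzWith.id (α := ℝ)).min_const m.R |>.const_max 0).dist_le_mul s r

theorem continuous_comp_clamp {g : ℝ → ℝ} (hg : ContinuousOn g (Icc 0 m.R)) :
    Continuous fun s => g (m.clamp s) :=
  hg.comp_continuous m.continuous_clamp m.clamp_mem

theorem normf'_nonneg : 0 ≤ m.normf' := by
  have hc := m.f_contDiffOn.continuousOn_derivWithin (uniqueDiffOn_Icc m.R_pos) le_rfl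
  exact (abs_nonneg _).trans (abs_le_supNormOn hc ⟨le_rfl, m.R_pos.le⟩)

theorem continuous_F : Continuous m.F :=
  continuous_id.mul (m.continuous_comp_clamp m.f_contDiffOn.continuousOn)

theorem isFluxFactor : IsFluxFactor m.F m.R (1 + m.R * m.normf') where
  measurable := m.continuous_F.measurable
  R_pos := m.R_pos
  A_nonneg := by have := m.R_pos; have := m.normf'_nonneg; positivity
  nonneg s hs := mul_nonneg hs.1 (m.f_mapsTo (m.clamp_mem s)).1
  le_self s hs := mul_le_of_le_one_right hs.1 (m.f_mapsTo (m.clamp_mem s)).2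
  lip s hs r hr := by
    have hf := abs_sub_le_supNormOn_derivWithin
      (m.f_contDiffOn.differentiableOn (by norm_num))
      (m.f_contDiffOn.continuousOn_derivWithin (uniqueDiffOn_Icc m.R_pos) le_rfl) hs hr
    unfold F
    rw [m.clamp_of_mem hs, m.clamp_of_mem hr]
    have e : s * m.f s - r * m.f r = (s - r) * m.f s + r * (m.f s - m.f r) := by ring
    rw [e]
    refine (abs_add_le _ _).trans ?_
    rw [abs_mul, abs_mul, abs_of_nonneg hr.1, abs_of_nonneg (m.f_mapsTo hs).1]
    have h1 := mul_le_mul_of_nonneg_left (m.f_mapsTo hs).2 (abs_nonneg (s - r))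
    have h2 := mul_le_mul hr.2 hf (abs_nonneg _) m.R_pos.le
    have : m.normf' = supNormOn 0 m.R (derivWithin m.f (Icc 0 m.R)) := rfl
    rw [this]
    linarith
  at_R := by
    unfold F
    rw [m.clamp_of_mem ⟨m.R_pos.le, le_rfl⟩, m.f_R, mul_zero]

/-- The derivative of the speed law, extended to the line. -/
noncomputable def dspeed (s : ℝ) : ℝ := derivWithin m.v (Icc 0 m.R) (m.clamp s)

theorem continuousOn_derivWithin_v : ContinuousOn (derivWithin m.v (Icc 0 m.R)) (Icc 0 m.R) :=
  m.v_contDiffOn.continuousOn_derivWithin (uniqueDiffOn_Icc m.R_pos) (by norm_num)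

theorem abs_speed_le (s : ℝ) : |m.speed s| ≤ m.V := by
  have := m.v_mapsTo (m.clamp_mem s)
  unfold speed
  rw [abs_of_nonneg this.1]; exact this.2

theorem isSpeed : IsSpeed m.R m.V m.normv' m.normv'' m.speed m.dspeed where
  continuous := m.continuous_comp_clamp m.v_contDiffOn.continuousOn
  continuous' := m.continuous_comp_clamp m.continuousOn_derivWithin_v
  abs_le := m.abs_speed_le
  abs_le' s := abs_le_supNormOn m.continuousOn_derivWithin_v (m.clamp_mem s)
  lip s r := by
    refine (abs_sub_le_supNormOn_derivWithin (m.v_contDiffOn.differentiableOn (by norm_num))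
      m.continuousOn_derivWithin_v (m.clamp_mem s) (m.clamp_mem r)).trans ?_
    refine mul_le_mul_of_nonneg_left (m.abs_clamp_sub_le s r) ?_
    exact (abs_nonneg _).trans (abs_le_supNormOn m.continuousOn_derivWithin_v (m.clamp_mem s))
  lip' s r := by
    have hu := uniqueDiffOn_Icc m.R_pos
    have e : EqOn (iteratedDerivWithin 2 m.v (Icc 0 m.R))
        (derivWithin (derivWithin m.v (Icc 0 m.R)) (Icc 0 m.R)) (Icc 0 m.R) := fun x _ => by
      rw [iteratedDerivWithin_succ]
      congr 1
      exact iteratedDerivWithin_one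
    have hc : ContinuousOn (iteratedDerivWithin 2 m.v (Icc 0 m.R)) (Icc 0 m.R) :=
      m.v_contDiffOn.continuousOn_iteratedDerivWithin (by norm_num) hu
    have e' : m.normv'' = supNormOn 0 m.R
        (derivWithin (derivWithin m.v (Icc 0 m.R)) (Icc 0 m.R)) := by
      unfold normv'' supNormOn
      congr 1
      exact image_congr fun x hx => by rw [e hx]
    have hd : DifferentiableOn ℝ (derivWithin m.v (Icc 0 m.R)) (Icc 0 m.R) := by
      have := m.v_contDiffOn.differentiableOn_iteratedDerivWithin (m := 1) (by norm_num) hu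
      rwa [iteratedDerivWithin_one] at this
    rw [e']
    have hc' := hc.congr fun x hx => (e hx).symm
    refine (abs_sub_le_supNormOn_derivWithin hd hc' (m.clamp_mem s)
      (m.clamp_mem r)).trans ?_
    refine mul_le_mul_of_nonneg_left (m.abs_clamp_sub_le s r) ?_
    exact (abs_nonneg _).trans (abs_le_supNormOn hc' (m.clamp_mem s))
  -- The extended speed law may have corners at `0` and `R`. Since `a` never leaves `[0, R]`, the
  -- derivative within the interval is enough for the chain rule.
  hasDerivAt a ha x d hd := by
    have h1 : HasDerivWithinAt m.v (derivWithin m.v (Icc 0 m.R) (a x)) (Icc 0 m.R) (a x) :=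
      ((m.v_contDiffOn.differentiableOn (by norm_num)) _ (ha x)).hasDerivWithinAt
    have h2 := h1.comp_hasDerivAt x hd (Eventually.of_forall ha)
    rw [dspeed, m.clamp_of_mem (ha x)]
    refine h2.congr_of_eventuallyEq (Eventually.of_forall fun y => ?_)
    simp only [speed, m.clamp_of_mem (ha y), Function.comp_apply]

/-- The kernel, extended by zero. -/
noncomputable def kern : ℝ → ℝ := (Icc 0 m.L).indicator m.ω

theorem isAvgKernel : IsAvgKernel m.normω m.kern := by
  have hc := m.ω_contDiffOn.continuousOn
  have hi : Integrable m.kern :=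
    (integrable_indicator_iff measurableSet_Icc).2 (hc.integrableOn_compact isCompact_Icc)
  have h0 : ∀ x, 0 ≤ m.kern x := indicator_nonneg m.ω_nonneg
  have hΩ : 0 ≤ m.normω := (abs_nonneg _).trans (abs_le_supNormOn hc ⟨le_rfl, m.L_pos.le⟩)
  have hle : ∀ x, m.kern x ≤ m.normω := fun x => by
    unfold kern
    refine indicator_le' (f := m.ω) (g := fun _ => m.normω) (fun x hx => ?_) (fun _ _ => hΩ) x
    exact (le_abs_self _).trans (abs_le_supNormOn hc hx)
  have hanti : AntitoneOn m.ω (Icc 0 m.L) := by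
    refine antitoneOn_of_deriv_nonpos (convex_Icc 0 m.L) hc
      ((m.ω_contDiffOn.differentiableOn (by norm_num)).mono interior_subset) fun x hx => ?_
    rw [← derivWithin_of_mem_nhds (mem_interior_iff_mem_nhds.1 hx)]
    exact m.ω_deriv_nonpos x (interior_subset hx)
  refine ⟨?_, h0, hle, hi, ?_, hasVarLE_of_antitoneOn hi (fun x hx => ?_) h0 hle ?_⟩
  · rw [kern, ← piecewise_eq_indicator]
    exact hc.measurable_piecewise continuousOn_const measurableSet_Icc
  · rw [kern, integral_indicator measurableSet_Icc]; exact m.ω_integral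
  · exact indicator_of_notMem (fun h => absurd h.1 (not_le.2 hx)) _
  · intro x hx y hy hxy
    by_cases hyL : y ≤ m.L
    · rw [kern, indicator_of_mem (show y ∈ Icc 0 m.L from ⟨hy, hyL⟩),
        indicator_of_mem (show x ∈ Icc 0 m.L from ⟨hx, hxy.trans hyL⟩)]
      exact hanti ⟨hx, hxy.trans hyL⟩ ⟨hy, hyL⟩ hxy
    · have : m.kern y = 0 := indicator_of_notMem (fun h => hyL h.2) _
      rw [this]; exact h0 x

theorem average_eq (u : ℝ → ℝ) (x : ℝ) : m.average u x = corr u m.kern x := by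
  unfold average corr
  rw [← integral_indicator measurableSet_Icc,
    ← integral_add_right_eq_self (fun y => u y * m.kern (y - x)) x]
  refine integral_congr_ae (Eventually.of_forall fun s => ?_)
  beta_reduce
  rw [add_sub_cancel_right, add_comm s x]
  by_cases hs : s ∈ Icc 0 m.L
  · rw [indicator_of_mem hs, kern, indicator_of_mem hs]
  · rw [indicator_of_notMem hs, kern, indicator_of_notMem hs, mul_zero]

end TrafficModel

/-! ### Maximum principle, and entropy solutions as densities -/

theorem restrict_strip (T : ℝ) : (volume : Measure (ℝ × ℝ)).restrict (Icc 0 T ×ˢ univ)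
    = (volume.restrict (Icc 0 T)).prod volume := by
  rw [Measure.volume_eq_prod, ← Measure.prod_restrict, Measure.restrict_univ]

theorem IsTestFn.integral_Iic {θ θ' : ℝ → ℝ} (h : IsTestFn θ θ') (b : ℝ) :
    ∫ t in Iic b, θ' t = θ b := by
  have := h.supp.integral_Iic_deriv_eq h.contDiff b
  rwa [h.deriv_eq] at this

theorem IsTimeTest.integral_Icc {T : ℝ} {θ θ' : ℝ → ℝ} (h : IsTimeTest T θ θ') (hT : 0 ≤ T) :
    ∫ t in Icc 0 T, θ' t = -θ 0 := by
  rw [integral_Icc_eq_integral_Ioc, ← intervalIntegral.integral_of_le hT,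
    intervalIntegral.integral_eq_sub_of_hasDerivAt (fun t _ => h.hasDeriv t)
    (h.cont'.intervalIntegrable _ _), (h.zero_right le_rfl).1, zero_sub]

/-- The mass of a nonnegative density with flux controlled by it does not increase. -/
theorem ae_integral_le_of_strip {T C : ℝ} (hC : 0 ≤ C) {g h : ℝ → ℝ → ℝ} {g₀ : ℝ → ℝ}
    (hg : Integrable (fun p : ℝ × ℝ => g p.1 p.2) ((volume.restrict (Icc 0 T)).prod volume))
    (hg0 : ∀ t x, 0 ≤ g t x)
    (hh : AEStronglyMeasurable (fun p : ℝ × ℝ => h p.1 p.2)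
      ((volume.restrict (Icc 0 T)).prod volume))
    (hhg : ∀ t x, |h t x| ≤ C * g t x) (hg₀ : Integrable g₀)
    (H : ∀ α α' β β', IsTimeTest T α α' → IsTestFn β β' →
      0 ≤ (∫ p : ℝ × ℝ, (g p.1 p.2 * (α' p.1 * β p.2) + h p.1 p.2 * (α p.1 * β' p.2))
        ∂((volume.restrict (Icc 0 T)).prod volume)) + α 0 * ∫ x, g₀ x * β x) :
    ∀ᵐ t, t ∈ Ioo 0 T → ∫ x, g t x ≤ ∫ x, g₀ x := by
  set μ : Measure (ℝ × ℝ) := (volume.restrict (Icc 0 T)).prod volume with hμ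
  obtain ⟨χ, χ', K, hK, hχ⟩ := exists_cutoff
  have hχ1 : ∀ N x, |χ N x| ≤ 1 := fun N x => by
    rw [abs_of_nonneg ((hχ N).1.nonneg x)]; exact (hχ N).2.1 x
  have hχK : ∀ N x, |χ' N x| ≤ K := fun N x => ((hχ N).2.2.1 x).trans
    (mul_le_of_le_one_right hK.le (one_div_succ_le_one N))
  have hlim1 : ∀ x, Tendsto (fun N => χ N x) atTop (𝓝 1) := fun x => by
    obtain ⟨N₀, hN₀⟩ := exists_nat_ge |x|
    refine tendsto_const_nhds.congr' ?_
    filter_upwards [eventually_ge_atTop N₀] with N hN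
    refine ((hχ N).2.2.2 x (hN₀.trans ?_)).symm
    have : (N₀ : ℝ) ≤ N := by exact_mod_cast hN
    linarith
  have hlim2 : ∀ x, Tendsto (fun N => χ' N x) atTop (𝓝 0) := fun x => by
    refine squeeze_zero_norm (fun N => (hχ N).2.2.1 x) ?_
    simpa using tendsto_moll_radius.const_mul K
  -- The spatial test function is sent to 1. The bound `|h| ≤ C g` makes the flux integrable, so
  -- what passes through the far cutoffs tends to zero.
  have hA : ∀ α α', IsTimeTest T α α' →
      0 ≤ (∫ t in Icc 0 T, α' t * ∫ x, g t x) + α 0 * ∫ x, g₀ x := by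
    intro α α' hα
    obtain ⟨D₁, hD₁⟩ := hα.supp.exists_bound_of_continuous hα.continuous
    obtain ⟨D₂, hD₂⟩ := hα.supp'.exists_bound_of_continuous hα.cont'
    have hαc := hα.continuous
    have hαc' := hα.cont'
    have l1 : Tendsto (fun N => ∫ p : ℝ × ℝ, (g p.1 p.2 * (α' p.1 * χ N p.2)
        + h p.1 p.2 * (α p.1 * χ' N p.2)) ∂μ) atTop (𝓝 (∫ p : ℝ × ℝ, (g p.1 p.2 * (α' p.1 * 1)
        + h p.1 p.2 * (α p.1 * 0)) ∂μ)) := by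
      refine tendsto_integral_of_dominated_convergence
        (fun p => g p.1 p.2 * (D₂ + C * (D₁ * K))) (fun N => ?_) (hg.mul_const _) (fun N => ?_) ?_
      · have h1 := (hχ N).1.continuous
        have h2 := (hχ N).1.cont'
        exact (hg.1.mul (by fun_prop : Continuous fun p : ℝ × ℝ =>
          α' p.1 * χ N p.2).aestronglyMeasurable).add (hh.mul (by fun_prop : Continuous
          fun p : ℝ × ℝ => α p.1 * χ' N p.2).aestronglyMeasurable)
      · refine Eventually.of_forall fun p => ?_
        refine (norm_add_le _ _).trans ?_
        simp only [Real.norm_eq_abs, abs_mul, abs_of_nonneg (hg0 _ _)]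
        have hD0 : 0 ≤ D₁ := (norm_nonneg _).trans (hD₁ 0)
        have hD0' : 0 ≤ D₂ := (norm_nonneg _).trans (hD₂ 0)
        have h1 : |α' p.1| * |χ N p.2| ≤ D₂ := by
          simpa using mul_le_mul (hD₂ p.1) (hχ1 N p.2) (abs_nonneg _) hD0'
        have h2 : |α p.1| * |χ' N p.2| ≤ D₁ * K :=
          mul_le_mul (hD₁ p.1) (hχK N p.2) (abs_nonneg _) hD0
        have h3 := mul_le_mul_of_nonneg_left h1 (hg0 p.1 p.2)
        have h4 := mul_le_mul (hhg p.1 p.2) h2 (by positivity) (mul_nonneg hC (hg0 _ _))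
        linarith
      · refine Eventually.of_forall fun p => ?_
        exact (((hlim1 p.2).const_mul _).const_mul _).add (((hlim2 p.2).const_mul _).const_mul _)
    have l2 : Tendsto (fun N => ∫ x, g₀ x * χ N x) atTop (𝓝 (∫ x, g₀ x * 1)) := by
      refine tendsto_integral_of_dominated_convergence (fun x => |g₀ x|) (fun N => ?_) hg₀.abs
        (fun N => ?_) (Eventually.of_forall fun x => (hlim1 x).const_mul _)
      · exact hg₀.1.mul (hχ N).1.continuous.aestronglyMeasurable
      · refine Eventually.of_forall fun x => ?_
        rw [Real.norm_eq_abs, abs_mul]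
        exact mul_le_of_le_one_right (abs_nonneg _) (hχ1 N x)
    have l := ge_of_tendsto' (l1.add (l2.const_mul (α 0))) fun N => H α α' _ _ hα (hχ N).1
    simp only [mul_one, mul_zero, add_zero] at l
    refine l.trans (le_of_eq ?_)
    congr 1
    have i : Integrable (fun p : ℝ × ℝ => g p.1 p.2 * α' p.1) μ :=
      hg.mul_bdd (c := D₂) (by fun_prop) (Eventually.of_forall fun p => hD₂ p.1)
    rw [integral_prod _ i]
    refine integral_congr_ae (Eventually.of_forall fun t => ?_)
    change ∫ x, g t x * α' t = α' t * ∫ x, g t x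
    rw [integral_mul_const, mul_comm]
  have hgi : Integrable (fun t => ∫ x, g t x) (volume.restrict (Icc 0 T)) := hg.integral_prod_left
  have i1 : LocallyIntegrable ((Iic (0 : ℝ)).indicator fun _ => ∫ x, g₀ x) :=
    (locallyIntegrable_const _).indicator measurableSet_Iic
  have i2 : Integrable ((Ioc 0 T).indicator fun t => ∫ x, g t x) :=
    (integrable_indicator_iff measurableSet_Ioc).2
      (IntegrableOn.mono_set (t := Icc 0 T) hgi Ioc_subset_Icc_self)
  -- At times `t ≤ 0` the mass is given its initial value. The integral of `θ'` over `(-∞, 0]` is `θ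
  -- 0`, so the initial term becomes part of one distributional inequality on the line.
  have hti := ae_le_add_integral_of_distrib (t₀ := 0) (T := T) (E₀ := ∫ x, g₀ x)
    (E := fun t => (Iic (0 : ℝ)).indicator (fun _ => ∫ x, g₀ x) t
      + (Ioc 0 T).indicator (fun t => ∫ x, g t x) t) (Y := fun _ => 0)
    (i1.add i2.locallyIntegrable) (locallyIntegrable_const _) (fun _ => le_rfl) ?_ ?_
  · filter_upwards [hti] with t ht htI
    have := ht htI
    rw [indicator_of_notMem (by simpa using htI.1), indicator_of_mem (Ioo_subset_Ioc_self htI)]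
      at this
    simpa using this
  · refine Eventually.of_forall fun t ht => ?_
    rw [indicator_of_mem (show t ∈ Iic (0 : ℝ) from ht.2.le),
      indicator_of_notMem (fun h => absurd h.1 (not_lt.2 ht.2.le)), add_zero]
  · intro θ θ' hθ
    rcases le_or_gt 0 T with hT | hT
    · refine (hA θ θ' hθ).trans (le_of_eq ?_)
      have e : ∀ t, θ' t * ((Iic (0 : ℝ)).indicator (fun _ => ∫ x, g₀ x) t
          + (Ioc 0 T).indicator (fun t => ∫ x, g t x) t) + θ t * 0
          = (Iic (0 : ℝ)).indicator (fun t => θ' t * ∫ x, g₀ x) t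
          + (Ioc 0 T).indicator (fun t => θ' t * ∫ x, g t x) t := fun t => by
        rw [indicator_mul_right, indicator_mul_right]; ring
      simp only [e]
      obtain ⟨D₂, hD₂⟩ := hθ.supp'.exists_bound_of_continuous hθ.cont'
      rw [integral_add, integral_indicator measurableSet_Iic, integral_indicator measurableSet_Ioc,
        integral_mul_const, hθ.integral_Iic, integral_Icc_eq_integral_Ioc]
      · ring
      · exact (hθ.integrable'.mul_const _).indicator measurableSet_Iic
      · refine (integrable_indicator_iff measurableSet_Ioc).2 ?_
        have := (IntegrableOn.mono_set (t := Icc 0 T) hgi Ioc_subset_Icc_self)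
        exact Integrable.bdd_mul (c := D₂) this hθ.cont'.aestronglyMeasurable
          (Eventually.of_forall hD₂)
    · have e : ∀ t, θ' t * ((Iic (0 : ℝ)).indicator (fun _ => ∫ x, g₀ x) t
          + (Ioc 0 T).indicator (fun t => ∫ x, g t x) t) + θ t * 0 = θ' t * ∫ x, g₀ x := fun t => by
        rw [Ioc_eq_empty (by linarith), indicator_empty, add_zero, mul_zero, add_zero]
        rcases le_or_gt t 0 with h | h
        · rw [indicator_of_mem (show t ∈ Iic (0 : ℝ) from h)]
        · rw [(hθ.zero_right (hT.le.trans h.le)).2]; simp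
      simp only [e]
      rw [integral_mul_const, hθ.integral_deriv, zero_mul]

/-- `u` represents the solution `ρ`, extended to the past by the initial datum. -/
structure IsRep (T : ℝ) (ρ₀ : ℝ → ℝ) (ρ u : ℝ → ℝ → ℝ) : Prop where
  measurable : Measurable fun p : ℝ × ℝ => u p.1 p.2
  past : ∀ t ≤ 0, u t =ᵐ[volume] ρ₀
  ae_eq : ∀ᵐ t, t ∈ Ioc 0 T → u t =ᵐ[volume] ρ t

theorem IsTimeTest.isTest {T : ℝ} {α α' β β' : ℝ → ℝ} (hα : IsTimeTest T α α')
    (hβ : IsTestFn β β') : TrafficModel.IsTest T fun p => α p.1 * β p.2 where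
  contDiff := (hα.contDiff.comp contDiff_fst).mul (hβ.contDiff.comp contDiff_snd)
  hasCompactSupport := by
    refine HasCompactSupport.intro (hα.supp.isCompact.prod hβ.supp.isCompact) fun p hp => ?_
    rw [mem_prod, not_and_or] at hp
    rcases hp with h | h
    · rw [image_eq_zero_of_notMem_tsupport h, zero_mul]
    · rw [image_eq_zero_of_notMem_tsupport h, mul_zero]
  tsupport_subset := by
    obtain ⟨b, hb, hz⟩ := hα.zero_of_le
    have h1 : tsupport (fun p : ℝ × ℝ => α p.1 * β p.2) ⊆ Iic b ×ˢ univ := by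
      refine closure_minimal (fun p hp => ⟨?_, mem_univ _⟩) (isClosed_Iic.prod isClosed_univ)
      by_contra h
      exact hp (by simp [hz p.1 (le_of_lt (not_le.1 h))])
    exact h1.trans (prod_mono_left (Iic_subset_Iio.2 hb))
  nonneg t x _ := mul_nonneg (hα.nonneg t) (hβ.nonneg x)

namespace TrafficModel

variable {m : TrafficModel} {T τ : ℝ} {ρ₀ : ℝ → ℝ} {ρ u : ℝ → ℝ → ℝ}

/-- The velocity at time `t` sees the slice at time `t - τ`, and the null set of exceptional slices
remains null after the shift by `τ`. -/
theorem velocity_ae_eq (hτ : 0 < τ) (hu : IsRep T ρ₀ ρ u) :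
    ∀ᵐ t, t ∈ Ioc 0 T → ∀ x, m.velocity τ ρ₀ ρ t x = delayVel m.speed m.kern τ u t x := by
  filter_upwards [(measurePreserving_sub_right volume τ).quasiMeasurePreserving.ae hu.ae_eq]
    with t ht htI x
  rw [velocity, delayVel, if_neg (not_le.2 htI.1), average_eq]
  congr 1
  refine integral_congr_ae ?_
  split_ifs with h
  · filter_upwards [hu.past _ h] with y hy
    rw [hy]
  · filter_upwards [ht ⟨not_le.1 h, by linarith [htI.2]⟩] with y hy
    rw [hy]

theorem IsEntropySolution.entropy_rep (hρ : m.IsEntropySolution T τ ρ₀ ρ) (hτ : 0 < τ)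
    (hu : IsRep T ρ₀ ρ u) {α α' β β' : ℝ → ℝ} (hα : IsTimeTest T α α') (hβ : IsTestFn β β')
    (κ : ℝ) :
    0 ≤ (∫ t in Icc 0 T, ∫ x, kruzIntegrand m.F κ (u t x) (delayVel m.speed m.kern τ u t x)
      (deriv (delayVel m.speed m.kern τ u t) x) (α' t * β x) (α t * β' x) (α t * β x))
      + α 0 * ∫ x, |ρ₀ x - κ| * β x := by
  refine (hρ.entropy _ κ (hα.isTest hβ)).trans (le_of_eq ?_)
  congr 1
  · rw [integral_Icc_eq_integral_Ioc, integral_Icc_eq_integral_Ioc]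
    refine setIntegral_congr_ae measurableSet_Ioc ?_
    filter_upwards [hu.ae_eq, velocity_ae_eq (m := m) hτ hu] with t h1 h2 htI
    refine integral_congr_ae ?_
    filter_upwards [h1 htI] with x hx
    have e : (fun y => m.velocity τ ρ₀ ρ t y) = delayVel m.speed m.kern τ u t :=
      funext (h2 htI)
    rw [h2 htI x, e, ← hx, kruzIntegrand, kruzFlux, deriv_mul_const_field, hα.deriv_eq,
      deriv_const_mul_field, hβ.deriv_eq]
  · rw [← integral_const_mul]
    exact integral_congr_ae (Eventually.of_forall fun x => by beta_reduce; ring)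

end TrafficModel

namespace TrafficModel

variable {m : TrafficModel} {T τ : ℝ} {ρ₀ : ℝ → ℝ} {ρ u : ℝ → ℝ → ℝ}

theorem abs_F_le (s : ℝ) : |m.F s| ≤ |s| := by
  have h := m.f_mapsTo (m.clamp_mem s)
  rw [F, abs_mul, abs_of_nonneg h.1]
  exact mul_le_of_le_one_right (abs_nonneg _) h.2

theorem F_zero : m.F 0 = 0 := zero_mul _

theorem F_of_ge {s : ℝ} (hs : m.R ≤ s) : m.F s = 0 := by
  have : m.clamp s = m.R := by
    rw [clamp, min_eq_right hs, max_eq_right m.R_pos.le]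
  rw [F, this, m.f_R, mul_zero]

theorem F_of_le {s : ℝ} (hs : s ≤ 0) : m.F s = s := by
  have : m.clamp s = 0 := by
    rw [clamp, min_eq_left (hs.trans m.R_pos.le), max_eq_left hs]
  rw [F, this, m.f_zero, mul_one]

theorem abs_kruzFlux_zero_le (s : ℝ) : |kruzFlux m.F s 0| ≤ |s| := by
  rw [kruzFlux, abs_mul, F_zero, sub_zero, sub_zero]
  exact (mul_le_of_le_one_left (abs_nonneg _) (abs_sign_le_one _)).trans (m.abs_F_le s)

/-- The distance to `[0, R]`, doubled, is an entropy whose flux it controls. -/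
theorem abs_kruzFlux_add_le (s : ℝ) :
    |kruzFlux m.F s 0 + kruzFlux m.F s m.R| ≤ |s| + |s - m.R| - m.R := by
  have hR := m.R_pos
  unfold kruzFlux
  rw [F_zero, F_of_ge le_rfl, sub_zero, sub_zero, ← add_mul]
  rcases le_total s 0 with h0 | h0
  · rw [F_of_le h0, abs_of_nonpos h0, abs_of_neg (by linarith : s - m.R < 0),
      Real.sign_of_neg (by linarith : s - m.R < 0)]
    rcases h0.eq_or_lt with h | h
    · simp [h]
    · rw [Real.sign_of_neg h, abs_of_nonneg (by linarith)]; linarith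
  · rcases le_total m.R s with h1 | h1
    · rw [F_of_ge h1, mul_zero, abs_zero, abs_of_nonneg h0, abs_of_nonneg (by linarith)]
      linarith
    · have e : (Real.sign s + Real.sign (s - m.R)) * m.F s = 0 := by
        rcases h0.eq_or_lt with h | h
        · rw [← h, F_zero, mul_zero]
        · rcases h1.eq_or_lt with h' | h'
          · rw [h', F_of_ge le_rfl, mul_zero]
          · rw [Real.sign_of_pos h, Real.sign_of_neg (by linarith : s - m.R < 0)]; ring
      rw [e, abs_zero, abs_of_nonneg h0, abs_of_nonpos (by linarith)]
      linarith

theorem dist_Icc_nonneg (s : ℝ) : 0 ≤ |s| + |s - m.R| - m.R :=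
  (abs_nonneg _).trans (m.abs_kruzFlux_add_le s)

theorem mem_Icc_of_dist_le {s : ℝ} (h : |s| + |s - m.R| - m.R ≤ 0) : s ∈ Icc 0 m.R := by
  constructor
  · by_contra! hs
    have := neg_abs_le (s - m.R)
    rw [abs_of_neg hs, abs_of_neg (by linarith [m.R_pos] : s - m.R < 0)] at h
    linarith
  · by_contra! hs
    rw [abs_of_pos (m.R_pos.trans hs), abs_of_pos (sub_pos.2 hs)] at h
    linarith

/-- The entropy inequality for the entropies without a source term, as one integral. -/
theorem IsEntropySolution.entropy_no_source (hρ : m.IsEntropySolution T τ ρ₀ ρ) (hτ : 0 < τ)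
    (hu : IsRep T ρ₀ ρ u)
    (hui : Integrable (fun p : ℝ × ℝ => u p.1 p.2) ((volume.restrict (Icc 0 T)).prod volume))
    {α α' β β' : ℝ → ℝ} (hα : IsTimeTest T α α') (hβ : IsTestFn β β') {κ : ℝ}
    (hκ : m.F κ = 0) :
    Integrable (fun p : ℝ × ℝ => |u p.1 p.2 - κ| * (α' p.1 * β p.2) + kruzFlux m.F (u p.1 p.2) κ
      * delayVel m.speed m.kern τ u p.1 p.2 * (α p.1 * β' p.2))
      ((volume.restrict (Icc 0 T)).prod volume) ∧
    0 ≤ (∫ p : ℝ × ℝ, (|u p.1 p.2 - κ| * (α' p.1 * β p.2) + kruzFlux m.F (u p.1 p.2) κ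
      * delayVel m.speed m.kern τ u p.1 p.2 * (α p.1 * β' p.2))
      ∂((volume.restrict (Icc 0 T)).prod volume)) + α 0 * ∫ x, |ρ₀ x - κ| * β x := by
  set μ : Measure (ℝ × ℝ) := (volume.restrict (Icc 0 T)).prod volume with hμ
  have h := hρ.entropy_rep hτ hu hα hβ κ
  have hαc := hα.continuous
  have hαc' := hα.cont'
  have hβc := hβ.continuous
  have hβc' := hβ.cont'
  have hum := hu.measurable
  have hVm : Measurable fun p : ℝ × ℝ => delayVel m.speed m.kern τ u p.1 p.2 :=
    Measurable.ite (measurableSet_le measurable_fst measurable_const) measurable_const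
      (m.isSpeed.continuous.measurable.comp (m.isAvgKernel.measurable_corr hum τ))
  have hVb : ∀ t x, |delayVel m.speed m.kern τ u t x| ≤ m.V := fun t x => by
    unfold delayVel; split_ifs
    · simpa using m.V_pos.le
    · exact m.abs_speed_le _
  have bdd : ∀ {a b a' b' : ℝ → ℝ}, IsTestFn a a' → IsTestFn b b' → ∃ C, 0 ≤ C ∧
      (∀ p : ℝ × ℝ, |a' p.1 * b p.2| ≤ C) ∧ (∀ p : ℝ × ℝ, |a p.1 * b' p.2| ≤ C) := by
    intro a b a' b' ha hb
    obtain ⟨C₁, h₁⟩ := ha.supp.exists_bound_of_continuous ha.continuous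
    obtain ⟨C₂, h₂⟩ := ha.supp'.exists_bound_of_continuous ha.cont'
    obtain ⟨C₃, h₃⟩ := hb.supp.exists_bound_of_continuous hb.continuous
    obtain ⟨C₄, h₄⟩ := hb.supp'.exists_bound_of_continuous hb.cont'
    have p1 := (norm_nonneg _).trans (h₁ 0)
    have p2 := (norm_nonneg _).trans (h₂ 0)
    have p3 := (norm_nonneg _).trans (h₃ 0)
    have p4 := (norm_nonneg _).trans (h₄ 0)
    refine ⟨C₂ * C₃ + C₁ * C₄, by positivity, fun p => ?_, fun p => ?_⟩
    · rw [abs_mul]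
      have := mul_le_mul (h₂ p.1) (h₃ p.2) (abs_nonneg _) p2
      have := mul_nonneg p1 p4
      simp only [Real.norm_eq_abs] at *; linarith
    · rw [abs_mul]
      have := mul_le_mul (h₁ p.1) (h₄ p.2) (abs_nonneg _) p1
      have := mul_nonneg p2 p3
      simp only [Real.norm_eq_abs] at *; linarith
  obtain ⟨C, hC0, hC1, hC2⟩ := bdd hα.toIsTestFn hβ
  have iαβ : Integrable (fun p : ℝ × ℝ => α' p.1 * β p.2) μ :=
    (hα.integrable'.integrableOn (s := Icc 0 T)).mul_prod hβ.integrable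
  have i1 : Integrable (fun p : ℝ × ℝ => |u p.1 p.2 - κ| * (α' p.1 * β p.2)) μ := by
    have i2 : Integrable (fun p : ℝ × ℝ => (|u p.1 p.2| * C + |κ| * |α' p.1 * β p.2|)) μ :=
      (hui.abs.mul_const C).add (iαβ.abs.const_mul |κ|)
    refine i2.mono' (((hum.sub_const κ).abs.mul (by fun_prop : Continuous fun p : ℝ × ℝ =>
      α' p.1 * β p.2).measurable).aestronglyMeasurable) (Eventually.of_forall fun p => ?_)
    rw [Real.norm_eq_abs, abs_mul, abs_abs]
    have h1 := abs_sub (u p.1 p.2) κ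
    have h2 := mul_le_mul_of_nonneg_left (hC1 p) (abs_nonneg (u p.1 p.2))
    have h3 := mul_le_mul_of_nonneg_right h1 (abs_nonneg (α' p.1 * β p.2))
    linarith
  have i3 : Integrable (fun p : ℝ × ℝ => kruzFlux m.F (u p.1 p.2) κ
      * delayVel m.speed m.kern τ u p.1 p.2 * (α p.1 * β' p.2)) μ := by
    refine (hui.abs.mul_const (m.V * C)).mono' ((((measurable_kruzFlux m.continuous_F.measurable hum
      measurable_const).mul hVm).mul (by fun_prop : Continuous fun p : ℝ × ℝ =>
      α p.1 * β' p.2).measurable).aestronglyMeasurable) (Eventually.of_forall fun p => ?_)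
    rw [Real.norm_eq_abs, abs_mul, abs_mul, mul_assoc]
    have h1 : |kruzFlux m.F (u p.1 p.2) κ| ≤ |u p.1 p.2| := by
      rw [kruzFlux, abs_mul, hκ, sub_zero]
      exact (mul_le_of_le_one_left (abs_nonneg _) (abs_sign_le_one _)).trans (m.abs_F_le _)
    exact mul_le_mul h1 (mul_le_mul (hVb _ _) (hC2 p) (abs_nonneg _) m.V_pos.le)
      (by positivity) (abs_nonneg _)
  refine ⟨i1.add i3, h.trans (le_of_eq ?_)⟩
  congr 1
  have e := integral_prod _ (i1.add i3)
  simp only [Pi.add_apply] at e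
  rw [hμ, e]
  simp only [kruzIntegrand, hκ, mul_zero, zero_mul, sub_zero]

/-- The maximum principle and the bound on the mass. -/
theorem IsEntropySolution.ae_bounds (hρ : m.IsEntropySolution T τ ρ₀ ρ) (hT : 0 < T) (hτ : 0 < τ)
    (hρ₀ : Integrable ρ₀) (hρ₀' : ∀ᵐ x, ρ₀ x ∈ Icc 0 m.R) (hu : IsRep T ρ₀ ρ u)
    (hui : Integrable (fun p : ℝ × ℝ => u p.1 p.2) ((volume.restrict (Icc 0 T)).prod volume)) :
    ∀ᵐ t, t ∈ Ioo 0 T → (∀ᵐ x, u t x ∈ Icc 0 m.R) ∧ Integrable (u t) ∧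
      ∫ x, |u t x| ≤ ∫ x, |ρ₀ x| := by
  set μ : Measure (ℝ × ℝ) := (volume.restrict (Icc 0 T)).prod volume with hμ
  have hum := hu.measurable
  have hR := m.R_pos
  have hVm : Measurable fun p : ℝ × ℝ => delayVel m.speed m.kern τ u p.1 p.2 :=
    Measurable.ite (measurableSet_le measurable_fst measurable_const) measurable_const
      (m.isSpeed.continuous.measurable.comp (m.isAvgKernel.measurable_corr hum τ))
  have hVb : ∀ t x, |delayVel m.speed m.kern τ u t x| ≤ m.V := fun t x => by
    unfold delayVel; split_ifs
    · simpa using m.V_pos.le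
    · exact m.abs_speed_le _
  have hkm : ∀ κ, Measurable fun p : ℝ × ℝ => kruzFlux m.F (u p.1 p.2) κ := fun κ =>
    measurable_kruzFlux m.continuous_F.measurable hum measurable_const
  have hmass := ae_integral_le_of_strip (T := T) (C := m.V) (g := fun t x => |u t x|)
    (h := fun t x => kruzFlux m.F (u t x) 0 * delayVel m.speed m.kern τ u t x)
    (g₀ := fun x => |ρ₀ x|) m.V_pos.le hui.abs (fun _ _ => abs_nonneg _)
    ((hkm 0).mul hVm).aestronglyMeasurable (fun t x => by
      rw [abs_mul, mul_comm]
      exact mul_le_mul (hVb t x) (abs_kruzFlux_zero_le _) (abs_nonneg _) m.V_pos.le) hρ₀.abs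
    (fun α α' β β' hα hβ => by
      simpa using (hρ.entropy_no_source hτ hu hui hα hβ (κ := 0) m.F_zero).2)
  have hgle : ∀ s : ℝ, |s| + |s - m.R| - m.R ≤ 2 * |s| := fun s => by
    have := abs_sub s m.R
    rw [abs_of_pos hR] at this; linarith
  have hgi : Integrable (fun p : ℝ × ℝ => |u p.1 p.2| + |u p.1 p.2 - m.R| - m.R) μ := by
    refine (hui.abs.const_mul 2).mono' ((hum.abs.add (hum.sub_const _).abs).sub_const
      _).aestronglyMeasurable (Eventually.of_forall fun p => ?_)
    rw [Real.norm_eq_abs, abs_of_nonneg (m.dist_Icc_nonneg _)]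
    exact hgle _
  have hg₀ : ∀ᵐ x, |ρ₀ x| + |ρ₀ x - m.R| - m.R = 0 := by
    filter_upwards [hρ₀'] with x hx
    rw [abs_of_nonneg hx.1, abs_of_nonpos (by linarith [hx.2])]; ring
  -- The inequalities for `κ = 0` and `κ = R` are added, and the identity for the constant `R` is
  -- subtracted. The resulting entropy is twice the distance to `[0, R]`: it vanishes initially,
  -- hence at almost all times.
  have hrange := ae_integral_le_of_strip (T := T) (C := m.V)
    (g := fun t x => |u t x| + |u t x - m.R| - m.R)
    (h := fun t x => (kruzFlux m.F (u t x) 0 + kruzFlux m.F (u t x) m.R)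
      * delayVel m.speed m.kern τ u t x)
    (g₀ := fun _ => 0) m.V_pos.le hgi (fun _ _ => m.dist_Icc_nonneg _)
    (((hkm 0).add (hkm m.R)).mul hVm).aestronglyMeasurable (fun t x => by
      rw [abs_mul, mul_comm]
      exact mul_le_mul (hVb t x) (m.abs_kruzFlux_add_le _) (abs_nonneg _) m.V_pos.le)
    (integrable_zero _ _ _) (fun α α' β β' hα hβ => by
      obtain ⟨i1, h1⟩ := hρ.entropy_no_source hτ hu hui hα hβ (κ := 0) m.F_zero
      obtain ⟨i2, h2⟩ := hρ.entropy_no_source hτ hu hui hα hβ (κ := m.R) (F_of_ge le_rfl)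
      have iαβ : Integrable (fun p : ℝ × ℝ => α' p.1 * β p.2) μ :=
        (hα.integrable'.integrableOn (s := Icc 0 T)).mul_prod hβ.integrable
      have e3 : ∫ p : ℝ × ℝ, m.R * (α' p.1 * β p.2) ∂μ = -(m.R * (α 0 * ∫ x, β x)) := by
        rw [integral_const_mul, hμ, integral_prod_mul α' β, hα.integral_Icc hT.le]; ring
      have e4 : (∫ x, |ρ₀ x - 0| * β x) + (∫ x, |ρ₀ x - m.R| * β x) = m.R * ∫ x, β x := by
        obtain ⟨C, hC⟩ := hβ.supp.exists_bound_of_continuous hβ.continuous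
        have j1 : Integrable fun x => |ρ₀ x - 0| * β x := by
          simp only [sub_zero]
          exact hρ₀.abs.mul_bdd hβ.continuous.aestronglyMeasurable (Eventually.of_forall hC)
        have j2 : Integrable fun x => |ρ₀ x - m.R| * β x := by
          refine hβ.integrable.bdd_mul (c := m.R)
            (hρ₀.1.sub aestronglyMeasurable_const).norm ?_
          filter_upwards [hρ₀'] with x hx
          rw [Real.norm_eq_abs, abs_abs, abs_of_nonpos (by linarith [hx.2])]; linarith [hx.1]
        rw [← integral_add j1 j2, ← integral_const_mul]
        refine integral_congr_ae ?_
        filter_upwards [hg₀] with x hx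
        rw [sub_zero, ← add_mul]
        congr 1; linarith
      have e5 : ∫ p : ℝ × ℝ, ((|u p.1 p.2| + |u p.1 p.2 - m.R| - m.R) * (α' p.1 * β p.2)
          + (kruzFlux m.F (u p.1 p.2) 0 + kruzFlux m.F (u p.1 p.2) m.R)
          * delayVel m.speed m.kern τ u p.1 p.2 * (α p.1 * β' p.2)) ∂μ
          = (∫ p : ℝ × ℝ, (|u p.1 p.2 - 0| * (α' p.1 * β p.2) + kruzFlux m.F (u p.1 p.2) 0
            * delayVel m.speed m.kern τ u p.1 p.2 * (α p.1 * β' p.2)) ∂μ)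
          + (∫ p : ℝ × ℝ, (|u p.1 p.2 - m.R| * (α' p.1 * β p.2) + kruzFlux m.F (u p.1 p.2) m.R
            * delayVel m.speed m.kern τ u p.1 p.2 * (α p.1 * β' p.2)) ∂μ)
          - ∫ p : ℝ × ℝ, m.R * (α' p.1 * β p.2) ∂μ := by
        have e6 := integral_sub (i1.add i2) (iαβ.const_mul m.R)
        rw [integral_add' i1 i2] at e6
        rw [← e6]
        refine integral_congr_ae (Eventually.of_forall fun p => ?_)
        simp only [Pi.add_apply, sub_zero]
        ring
      rw [e5, e3]
      simp only [zero_mul, integral_zero, mul_zero, add_zero]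
      have := congrArg (α 0 * ·) e4
      simp only [mul_add] at this
      linarith)
  have hu1 : ∀ᵐ t, t ∈ Icc 0 T → Integrable (u t) :=
    (ae_restrict_iff' measurableSet_Icc).1 hui.prod_right_ae
  have hg1 : ∀ᵐ t, t ∈ Icc 0 T → Integrable fun x => |u t x| + |u t x - m.R| - m.R :=
    (ae_restrict_iff' measurableSet_Icc).1 hgi.prod_right_ae
  filter_upwards [hmass, hrange, hu1, hg1] with t h1 h2 h3 h4 htI
  have htI' := Ioo_subset_Icc_self htI
  refine ⟨?_, h3 htI', h1 htI⟩
  have h5 : ∫ x, (|u t x| + |u t x - m.R| - m.R) = 0 :=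
    le_antisymm ((h2 htI).trans (by simp)) (integral_nonneg fun x => m.dist_Icc_nonneg _)
  have h6 := (integral_eq_zero_iff_of_nonneg (fun x => m.dist_Icc_nonneg _) (h4 htI')).1 h5
  filter_upwards [h6] with x hx
  exact m.mem_Icc_of_dist_le hx.le

/-- A solution has a measurable representative with values in `[0, R]` and bounded mass. -/
theorem IsEntropySolution.exists_density (hρ : m.IsEntropySolution T τ ρ₀ ρ) (hT : 0 < T)
    (hτ : 0 < τ) (hρ₀ : Integrable ρ₀) (hρ₀' : ∀ᵐ x, ρ₀ x ∈ Icc 0 m.R) :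
    ∃ u, IsRep T ρ₀ ρ u ∧ IsDensity m.R (∫ x, |ρ₀ x|) u := by
  set M := ∫ x, |ρ₀ x| with hM
  have hM0 : 0 ≤ M := integral_nonneg fun _ => abs_nonneg _
  have hi := hρ.integrableOn
  rw [IntegrableOn, restrict_strip] at hi
  set g := hi.1.mk with hg
  have hgm : Measurable g := hi.1.stronglyMeasurable_mk.measurable
  set r := hρ₀.1.mk with hr
  have hrm : Measurable r := hρ₀.1.stronglyMeasurable_mk.measurable
  have hrρ : r =ᵐ[volume] ρ₀ := hρ₀.1.ae_eq_mk.symm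
  have hgρ : ∀ᵐ t, t ∈ Icc 0 T → (fun x => g (t, x)) =ᵐ[volume] ρ t :=
    (ae_restrict_iff' measurableSet_Icc).1 (by
      filter_upwards [Measure.ae_ae_of_ae_prod hi.1.ae_eq_mk] with t ht
      filter_upwards [ht] with x hx using hx.symm)
  set w : ℝ → ℝ → ℝ := fun t x => if t ≤ 0 then r x else g (t, x) with hw
  have hwset : MeasurableSet {p : ℝ × ℝ | p.1 ≤ 0} := measurableSet_le measurable_fst measurable_const
  have hwm : Measurable fun p : ℝ × ℝ => w p.1 p.2 :=
    Measurable.ite hwset (hrm.comp measurable_snd) hgm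
  have hwrep : IsRep T ρ₀ ρ w := by
    refine ⟨hwm, fun t ht => ?_, ?_⟩
    · filter_upwards [hrρ] with x hx
      simp only [hw, if_pos ht, hx]
    · filter_upwards [hgρ] with t ht htI
      filter_upwards [ht (Ioc_subset_Icc_self htI)] with x hx
      simp only [hw, if_neg (not_le.2 htI.1), hx]
  have hne : ∀ a : ℝ, ∀ᵐ t : ℝ, t ≠ a := fun a => by simp [ae_iff]
  have hwi : Integrable (fun p : ℝ × ℝ => w p.1 p.2)
      ((volume.restrict (Icc 0 T)).prod volume) := by
    refine hi.congr ?_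
    have h1 : ∀ᵐ p : ℝ × ℝ ∂((volume.restrict (Icc 0 T)).prod volume), p.1 ∈ Icc 0 T ∧ p.1 ≠ 0 := by
      refine Measure.quasiMeasurePreserving_fst.ae (p := fun t : ℝ => t ∈ Icc 0 T ∧ t ≠ 0) ?_
      exact (ae_restrict_mem measurableSet_Icc).and (ae_restrict_of_ae (hne 0))
    filter_upwards [h1, hi.1.ae_eq_mk] with p hp hpg
    have : ¬ p.1 ≤ 0 := not_le.2 (lt_of_le_of_ne hp.1.1 hp.2.symm)
    rw [hpg]
    simp only [hw, if_neg this, hg]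
  have hb := hρ.ae_bounds hT hτ hρ₀ hρ₀' hwrep hwi
  have hcm : Measurable fun p : ℝ × ℝ => m.clamp (w p.1 p.2) :=
    m.continuous_clamp.measurable.comp hwm
  -- A measurable set of times of full measure in `(0, T)`. Setting the density to zero at the other
  -- times makes the bounds hold at every time.
  set G : Set ℝ := {t | ∫⁻ x, ‖m.clamp (w t x)‖ₑ ≤ ENNReal.ofReal M} with hG
  have hGm : MeasurableSet G :=
    measurableSet_le (Measurable.lintegral_prod_right' (f := fun p : ℝ × ℝ =>
      ‖m.clamp (w p.1 p.2)‖ₑ) hcm.enorm) measurable_const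
  set u : ℝ → ℝ → ℝ := fun t x => if t ∈ G then m.clamp (w t x) else 0 with hu
  have hum : Measurable fun p : ℝ × ℝ => u p.1 p.2 :=
    Measurable.ite (measurable_fst hGm) hcm measurable_const
  have hmemG : ∀ t, (∀ᵐ x, w t x ∈ Icc 0 m.R) → Integrable (w t) → ∫ x, |w t x| ≤ M →
      u t =ᵐ[volume] w t := by
    intro t h1 h2 h3
    have hc : ∀ᵐ x, m.clamp (w t x) = w t x := by
      filter_upwards [h1] with x hx using m.clamp_of_mem hx
    have hin : t ∈ G := by
      change ∫⁻ x, ‖m.clamp (w t x)‖ₑ ≤ ENNReal.ofReal M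
      calc ∫⁻ x, ‖m.clamp (w t x)‖ₑ = ∫⁻ x, ‖w t x‖ₑ :=
            lintegral_congr_ae (by filter_upwards [hc] with x hx; rw [hx])
        _ = ENNReal.ofReal (∫ x, ‖w t x‖) := (ofReal_integral_norm_eq_lintegral_enorm h2).symm
        _ ≤ _ := ENNReal.ofReal_le_ofReal h3
    filter_upwards [hc] with x hx
    simp only [hu, if_pos hin, hx]
  refine ⟨u, ⟨hum, fun t ht => ?_, ?_⟩, hum, fun t x => ?_, fun t => ?_, fun t => ?_⟩
  · have h1 := hwrep.past t ht
    refine (hmemG t ?_ (hρ₀.congr h1.symm) (le_of_eq ?_)).trans h1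
    · filter_upwards [h1, hρ₀'] with x hx hx'
      rwa [hx]
    · exact integral_congr_ae (by filter_upwards [h1] with x hx; rw [hx])
  · filter_upwards [hb, hwrep.ae_eq, hne T] with t h1 h2 h3 htI
    obtain ⟨h4, h5, h6⟩ := h1 ⟨htI.1, lt_of_le_of_ne htI.2 h3⟩
    exact (hmemG t h4 h5 h6).trans (h2 htI)
  · simp only [hu]; split_ifs
    · exact m.clamp_mem _
    · exact ⟨le_rfl, m.R_pos.le⟩
  · by_cases ht : t ∈ G
    · simp only [hu, if_pos ht]
      exact ⟨(hcm.comp (by fun_prop : Measurable fun x : ℝ => (t, x))).aestronglyMeasurable,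
        lt_of_le_of_lt ht ENNReal.ofReal_lt_top⟩
    · simp only [hu, if_neg ht]; exact integrable_zero _ _ _
  · by_cases ht : t ∈ G
    · simp only [hu, if_pos ht]
      have hi2 : Integrable fun x => m.clamp (w t x) :=
        ⟨(hcm.comp (by fun_prop : Measurable fun x : ℝ => (t, x))).aestronglyMeasurable,
        lt_of_le_of_lt ht ENNReal.ofReal_lt_top⟩
      have h1 := ofReal_integral_norm_eq_lintegral_enorm hi2
      have h2 : ENNReal.ofReal (∫ x, ‖m.clamp (w t x)‖) ≤ ENNReal.ofReal M := h1.trans_le ht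
      rw [ENNReal.ofReal_le_ofReal_iff hM0] at h2
      refine le_trans (le_of_eq ?_) h2
      exact integral_congr_ae (Eventually.of_forall fun x =>
        (Real.norm_of_nonneg (m.clamp_mem _).1).symm)
    · simp only [hu, if_neg ht]; simpa using hM0

/-- The Kruzhkov inequality for the representative. -/
theorem IsEntropySolution.isKruzkov (hρ : m.IsEntropySolution T τ ρ₀ ρ) (hτ : 0 < τ)
    (hu : IsRep T ρ₀ ρ u) {M : ℝ} (hd : IsDensity m.R M u) :
    IsKruzkov m.F m.R T u (delayVel m.speed m.kern τ u)
      (delayVelx (2 * m.R * m.normω) m.dspeed m.kern τ u) := by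
  intro κ hκ α α' β β' hα hβ
  have hV := isVelocity_delayVel (τ := τ) m.isSpeed m.isAvgKernel hd
  set V := delayVel m.speed m.kern τ u with hVd
  set Vx := delayVelx (2 * m.R * m.normω) m.dspeed m.kern τ u with hVxd
  have h := hρ.entropy_rep hτ hu hα hβ κ
  set K : ℝ → ℝ := fun t => ∫ x, kruzIntegrand m.F κ (u t x) (V t x) (Vx t x)
    (α' t * β x) (α t * β' x) (α t * β x) with hK
  have h1 : 0 ≤ (∫ t in Icc 0 T, K t) + α 0 * ∫ x, |ρ₀ x - κ| * β x := by
    refine h.trans (le_of_eq ?_)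
    congr 1
    refine integral_congr_ae (Eventually.of_forall fun t => integral_congr_ae ?_)
    filter_upwards [hV.hasDerivAt t] with x hx
    rw [hx.deriv]
  have hi : Integrable fun p : ℝ × ℝ => kruzIntegrand m.F κ (u p.1 p.2) (V p.1 p.2) (Vx p.1 p.2)
      (α' p.1 * β p.2) (α p.1 * β' p.2) (α p.1 * β p.2) :=
    integrable_kruzIntegrand m.isFluxFactor hd.measurable measurable_const hV.measurable
      hV.measurable_x (fun z => hd.mem _ _) (fun _ => hκ) (fun z => hV.abs_le _ _)
      (fun z => hV.abs_x_le _ _) (hα.integrable'.mul_prod hβ.integrable)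
      (hα.integrable.mul_prod hβ.integrable') (hα.integrable.mul_prod hβ.integrable)
  rw [Measure.volume_eq_prod, integral_prod _ hi]
  have hKi : Integrable K := hi.integral_prod_left
  -- This is why the velocity is switched off for `t ≤ 0`: the integrand is then `|ρ₀ - κ| α' β`,
  -- and its integral over the past is exactly the initial term of the entropy inequality.
  have e1 : ∫ t in Iic 0, K t = α 0 * ∫ x, |ρ₀ x - κ| * β x := by
    rw [← hα.integral_Iic, ← integral_mul_const]
    refine setIntegral_congr_fun measurableSet_Iic fun t ht => ?_
    have ht' : t ≤ 0 := ht
    simp only [hK]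
    rw [← integral_const_mul]
    refine integral_congr_ae ?_
    filter_upwards [hu.past t ht'] with x hx
    have z1 : V t x = 0 := if_pos ht'
    have z2 : Vx t x = 0 := if_pos ht'
    rw [hx, z1, z2, kruzIntegrand]; ring
  have e2 : ∫ t in Ioi 0, K t = ∫ t in Icc 0 T, K t := by
    rw [integral_Icc_eq_integral_Ioc]
    refine setIntegral_eq_of_subset_of_forall_sdiff_eq_zero (s := Ioc 0 T) measurableSet_Ioi
      (fun t ht => ht.1) fun t ht => ?_
    have htT : T ≤ t := by
      by_contra! hlt
      exact ht.2 ⟨ht.1, hlt.le⟩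
    obtain ⟨z1, z2⟩ := hα.zero_right htT
    simp [hK, kruzIntegrand, z1, z2]
  have e3 := integral_add_compl (μ := volume) (measurableSet_Iic (a := (0 : ℝ))) hKi
  rw [compl_Iic, e1, e2] at e3
  change 0 ≤ ∫ t, K t
  linarith

end TrafficModel

/-! ### The representative continuous in time -/

/-- A Lipschitz curve defined on a dense set of times extends. -/
theorem exists_lipschitz_extension {E : Type*} [PseudoMetricSpace E] [CompleteSpace E] {S : Set ℝ}
    {U : ℝ → E} {C T : ℝ} (hC : 0 ≤ C) (hS : ∀ t ≤ T, ∀ ε > 0, ∃ s ∈ S, |s - t| < ε)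
    (hU : ∀ s ∈ S, ∀ t ∈ S, dist (U s) (U t) ≤ C * |s - t|) :
    ∃ r : ℝ → E, (∀ s ≤ T, ∀ t ≤ T, dist (r s) (r t) ≤ C * |s - t|) ∧
      ∀ t ≤ T, ∀ s ∈ S, dist (r t) (U s) ≤ C * |t - s| := by
  have key : ∀ t, ∃ l : E, t ≤ T → ∀ s ∈ S, dist l (U s) ≤ C * |t - s| := by
    intro t
    by_cases ht : t ≤ T
    · choose s hs hst using fun n : ℕ => hS t ht (1 / ((n : ℝ) + 1)) (by positivity)
      have hlim : Tendsto s atTop (𝓝 t) := by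
        rw [tendsto_iff_dist_tendsto_zero]
        refine squeeze_zero (fun _ => dist_nonneg) (fun n => (hst n).le) tendsto_moll_radius
      have hc : CauchySeq fun n => U (s n) := by
        refine Metric.cauchySeq_iff.2 fun ε hε => ?_
        obtain ⟨N, hN⟩ := Metric.cauchySeq_iff.1 hlim.cauchySeq (ε / (C + 1)) (by positivity)
        refine ⟨N, fun m hm n hn => ?_⟩
        have h1 := hU _ (hs m) _ (hs n)
        have h2 := hN m hm n hn
        rw [Real.dist_eq, lt_div_iff₀ (by positivity)] at h2
        nlinarith [abs_nonneg (s m - s n)]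
      obtain ⟨l, hl⟩ := cauchySeq_tendsto_of_complete hc
      refine ⟨l, fun _ q hq => ?_⟩
      refine le_of_tendsto_of_tendsto' (hl.dist tendsto_const_nhds)
        (((hlim.sub_const q).abs).const_mul C) fun n => hU _ (hs n) _ hq
    · obtain ⟨q, -⟩ := hS T le_rfl 1 one_pos
      exact ⟨U q, fun h => absurd h ht⟩
  choose r hr using key
  refine ⟨r, fun s hs t ht => le_of_forall_pos_le_add fun ε hε => ?_, hr⟩
  obtain ⟨q, hq, hqt⟩ := hS t ht (ε / (2 * C + 1)) (by positivity)
  rw [lt_div_iff₀ (by positivity)] at hqt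
  have h1 := hr s hs q hq
  have h2 := hr t ht q hq
  have h3 := dist_triangle_right (r s) (r t) (U q)
  have h4 := mul_le_mul_of_nonneg_left (abs_sub_le s t q) hC
  rw [abs_sub_comm q t] at hqt
  nlinarith [abs_nonneg (t - q)]

/-- Variation bounds pass to limits in `L¹`. -/
theorem HasVarLE.of_approx {u : ℝ → ℝ} {N : ℝ} (hu : Integrable u)
    (h : ∀ ε > 0, ∃ w, Integrable w ∧ HasVarLE w N ∧ ∫ x, |u x - w x| ≤ ε) : HasVarLE u N := by
  intro k
  refine le_of_forall_pos_le_add fun ε hε => ?_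
  obtain ⟨w, hw, hwN, hd⟩ := h (ε / 2) (by positivity)
  have i1 : Integrable fun x => |u x - w x| := (hu.sub hw).abs
  have i2 : Integrable fun x => |u (x + k) - w (x + k)| := i1.comp_add_right k
  have i3 : Integrable fun x => |w (x + k) - w x| := ((hw.comp_add_right k).sub hw).abs
  have i4 : Integrable fun x => |w (x + k) - w x| + |u x - w x| := i3.add i1
  calc ∫ x, |u (x + k) - u x|
      ≤ ∫ x, (|u (x + k) - w (x + k)| + (|w (x + k) - w x| + |u x - w x|)) := by
        refine integral_mono ((hu.comp_add_right k).sub hu).abs (i2.add i4) fun x => ?_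
        change |u (x + k) - u x| ≤ _
        have h1 := abs_sub_le (u (x + k)) (w (x + k)) (u x)
        have h2 := abs_sub_le (w (x + k)) (w x) (u x)
        rw [abs_sub_comm (w x)] at h2
        linarith
    _ = (∫ x, |u x - w x|) + ((∫ x, |w (x + k) - w x|) + ∫ x, |u x - w x|) := by
        rw [integral_add i2 i4, integral_add i3 i1,
          integral_add_right_eq_self (fun x => |u x - w x|) k]
    _ ≤ N * |k| + ε := by linarith [hwN k]

theorem norm_sub_eq_integral (a b : ℝ →₁[volume] ℝ) {u w : ℝ → ℝ}
    (ha : (a : ℝ → ℝ) =ᵐ[volume] u) (hb : (b : ℝ → ℝ) =ᵐ[volume] w) :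
    ‖a - b‖ = ∫ x, |u x - w x| := by
  rw [L1.norm_eq_integral_norm]
  refine integral_congr_ae ?_
  filter_upwards [Lp.coeFn_sub a b, ha, hb] with x h1 h2 h3
  rw [h1, Pi.sub_apply, h2, h3, Real.norm_eq_abs]

/-- The nearby time is taken to the left of `t`, so that it lies before `T` even for `t = T`. With
`T = 0` this gives times in the past, where the solution equals its datum. -/
theorem exists_near_of_ae {p : ℝ → Prop} {T : ℝ} (hp : ∀ᵐ t, p t) :
    ∀ t ≤ T, ∀ ε > 0, ∃ s, (p s ∧ s < T) ∧ |s - t| < ε := by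
  intro t ht ε hε
  have h1 : ∃ᵐ s, s ∈ Ioo (t - ε) t := by
    rw [frequently_ae_mem_iff, Real.volume_Ioo]
    simpa using hε
  obtain ⟨s, hs, hps⟩ := (h1.and_eventually hp).exists
  exact ⟨s, ⟨hps, hs.2.trans_le ht⟩, abs_lt.2 ⟨by linarith [hs.1], by linarith [hs.2]⟩⟩

namespace TrafficModel

variable {m : TrafficModel} {T τ : ℝ} {ρ₀ : ℝ → ℝ} {ρ u : ℝ → ℝ → ℝ}

theorem normω_nonneg : 0 ≤ m.normω := m.isAvgKernel.bound_nonneg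

theorem normv'_nonneg : 0 ≤ m.normv' := (abs_nonneg _).trans (m.isSpeed.abs_le' 0)

theorem normv''_nonneg : 0 ≤ m.normv'' := by simpa using (abs_nonneg _).trans (m.isSpeed.lip' 1 0)

/-- The total variation of a solution. -/
theorem IsEntropySolution.ae_hasVarLE (hρ : m.IsEntropySolution T τ ρ₀ ρ) (hT : 0 < T)
    (hτ : 0 < τ) (hρ₀ : IsBVDatum m.R ρ₀) (hu : IsRep T ρ₀ ρ u) {M : ℝ}
    (hd : IsDensity m.R M u) :
    ∀ᵐ t, t < T → HasVarLE (u t) (m.factorC T τ * (totalVar ρ₀).toReal) := by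
  have hΩ := m.normω_nonneg
  have hv₁ := m.normv'_nonneg
  have hv₂ := m.normv''_nonneg
  have hf := m.normf'_nonneg
  have hR := m.R_pos
  have hρ₀N : HasVarLE ρ₀ (totalVar ρ₀).toReal :=
    hasVarLE_of_totalVar_le hρ₀.integrable ENNReal.toReal_nonneg
      (ENNReal.ofReal_toReal hρ₀.totalVar_lt_top.ne).ge
  have hmax1 := le_max_left (3 * m.normv'') (m.normv' * m.normf')
  have hmax2 := le_max_right (3 * m.normv'') (m.normv' * m.normf')
  have h := ae_hasVarLE_of_delay (r := m.rateM)
    (p := m.normv' * (2 * m.normω) + m.normv'' * (2 * m.R * m.normω))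
    m.isFluxFactor hd (isVelocity_delayVel (τ := τ) m.isSpeed m.isAvgKernel hd)
    (hρ.isKruzkov hτ hu hd) hT hτ (by positivity) ?_ ?_ (fun s b hb => ?_)
    ENNReal.toReal_nonneg (Eventually.of_forall fun t ht => hρ₀N.congr (hu.past t ht.le).symm)
  · exact h
  -- `rateM` has to dominate two rates: `A Λ`, through the entry `‖v'‖ ‖f'‖` of the maximum, and `R
  -- p`, through the other entry. For the latter the coefficient 1 of `‖v''‖` would suffice.
  · have h1 := mul_le_mul_of_nonneg_left hmax2 (by positivity : 0 ≤ 2 * m.normω * m.R * m.R)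
    unfold rateM; linarith
  · have h1 := mul_le_mul_of_nonneg_left hmax1 (by positivity : 0 ≤ 2 * m.normω * m.R * m.R)
    have h2 : 0 ≤ 2 * m.normω * m.R * m.R * m.normv'' := by positivity
    unfold rateM; linarith
  · filter_upwards [(measurePreserving_sub_right volume τ).quasiMeasurePreserving.ae hb]
      with t ht hts
    exact hasVarLE_delayVelx m.isSpeed m.isAvgKernel hd (ht (by linarith))

/-- The representative of a solution that is continuous in time. -/
theorem IsEntropySolution.exists_continuousRep (hρ : m.IsEntropySolution T τ ρ₀ ρ) (hT : 0 < T)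
    (hτ : 0 < τ) (hρ₀ : IsBVDatum m.R ρ₀) :
    ∃ (u : ℝ → ℝ → ℝ) (r : ℝ → (ℝ →₁[volume] ℝ)), IsRep T ρ₀ ρ u ∧
      IsDensity m.R (∫ x, |ρ₀ x|) u ∧ IsContinuousRep T ρ₀ ρ r ∧ supBV T r < ⊤ ∧
      0 ≤ m.lipTime T τ ρ₀ ∧
      (∀ s ≤ T, ∀ t ≤ T, ‖r s - r t‖ ≤ m.lipTime T τ ρ₀ * |s - t|) ∧
      (∀ᵐ t, t < T → (r t : ℝ → ℝ) =ᵐ[volume] u t) ∧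
      ∀ᵐ t, t < T → HasVarLE (u t) (supBV T r).toReal := by
  obtain ⟨u, hu, hd⟩ := hρ.exists_density hT hτ hρ₀.integrable hρ₀.mem_Icc
  have hΩ := m.normω_nonneg
  have hv₁ := m.normv'_nonneg
  have hf := m.normf'_nonneg
  have hR := m.R_pos
  have hVp := m.V_pos
  set N := m.factorC T τ * (totalVar ρ₀).toReal with hN
  have hvar := hρ.ae_hasVarLE hT hτ hρ₀ hu hd
  have hN0 : 0 ≤ N := by
    obtain ⟨s, ⟨hs, hsT⟩, -⟩ := exists_near_of_ae hvar T le_rfl 1 one_pos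
    exact (hs hsT).nonneg
  have hM0 : 0 ≤ ∫ x, |ρ₀ x| := integral_nonneg fun _ => abs_nonneg _
  obtain ⟨S, hS, hlip⟩ := exists_lipschitz_times m.isFluxFactor hd
    (isVelocity_delayVel (τ := τ) m.isSpeed m.isAvgKernel hd) (hρ.isKruzkov hτ hu hd) hN0 hvar
  have eC : m.V * (1 + m.R * m.normf') * N + m.normv' * (2 * m.R * m.normω) * ∫ x, |ρ₀ x|
      = m.lipTime T τ ρ₀ := by
    rw [hN, lipTime]; ring
  rw [eC] at hlip
  have hC0 : 0 ≤ m.lipTime T τ ρ₀ := by rw [← eC]; positivity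
  set U : ℝ → (ℝ →₁[volume] ℝ) := fun t => (hd.integrable t).toL1 (u t) with hU
  have hUu : ∀ t, (U t : ℝ → ℝ) =ᵐ[volume] u t := fun t => Integrable.coeFn_toL1 _
  have hgood := hS.and hvar
  obtain ⟨r, hr1, hr2⟩ := exists_lipschitz_extension (U := U)
    (S := {s | (s ∈ S ∧ (s < T → HasVarLE (u s) N)) ∧ s < T}) hC0
    (exists_near_of_ae (T := T) hgood) (fun s hs t ht => by
      rw [dist_eq_norm, norm_sub_eq_integral _ _ (hUu s) (hUu t)]
      exact hlip t ht.1.1 s hs.1.1 ht.2 hs.2)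
  have hreq : ∀ᵐ t, t < T → (r t : ℝ → ℝ) =ᵐ[volume] u t := by
    filter_upwards [hgood] with t ht htT
    have h1 := hr2 t htT.le t ⟨ht, htT⟩
    rw [sub_self, abs_zero, mul_zero] at h1
    rw [dist_le_zero.1 h1]
    exact hUu t
  -- The Lipschitz bound holds across time 0, and at good negative times the curve is the class of
  -- `ρ₀`. Letting these times tend to 0 identifies the initial value.
  have hr0 : (r 0 : ℝ → ℝ) =ᵐ[volume] ρ₀ := by
    have e : r 0 = hρ₀.integrable.toL1 ρ₀ := by
      refine eq_of_forall_dist_le fun ε hε => ?_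
      obtain ⟨s, ⟨hs, hs0⟩, hsε⟩ := exists_near_of_ae (T := 0) hgood 0 le_rfl
        (ε / (m.lipTime T τ ρ₀ + 1)) (by positivity)
      have e1 : U s = hρ₀.integrable.toL1 ρ₀ :=
        (Integrable.toL1_eq_toL1_iff _ _ _ _).2 (hu.past s hs0.le)
      rw [← e1]
      refine (hr2 0 hT.le s ⟨hs, hs0.trans hT⟩).trans ?_
      rw [lt_div_iff₀ (by positivity)] at hsε
      rw [abs_sub_comm]
      nlinarith [abs_nonneg (s - 0)]
    rw [e]; exact Integrable.coeFn_toL1 _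
  -- Lower semicontinuity of the variation under `L¹` convergence extends the bound from almost
  -- every time to every time, as the supremum requires.
  have hrvar : ∀ t ≤ T, HasVarLE (r t) N := fun t ht => by
    refine HasVarLE.of_approx (L1.integrable_coeFn (r t)) fun ε hε => ?_
    obtain ⟨s, ⟨hs, hsT⟩, hsε⟩ := exists_near_of_ae (T := T) hgood t ht
      (ε / (m.lipTime T τ ρ₀ + 1)) (by positivity)
    refine ⟨u s, hd.integrable s, hs.2 hsT, ?_⟩
    rw [← norm_sub_eq_integral (r t) (U s) (ae_eq_refl _) (hUu s), ← dist_eq_norm]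
    refine (hr2 t ht s ⟨hs, hsT⟩).trans ?_
    rw [lt_div_iff₀ (by positivity)] at hsε
    rw [abs_sub_comm]
    nlinarith [abs_nonneg (s - t)]
  have hsup : supBV T r < ⊤ := by
    refine lt_of_le_of_lt (b := ENNReal.ofReal (‖r 0‖ + m.lipTime T τ ρ₀ * T) + ENNReal.ofReal N)
      (iSup₂_le fun t ht => ?_) (by simp)
    refine add_le_add ?_ ((hrvar t ht.2).totalVar_le (L1.integrable_coeFn _))
    rw [← ENNReal.ofReal_toReal (Lp.eLpNorm_ne_top (r t))]
    refine ENNReal.ofReal_le_ofReal ?_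
    rw [← Lp.norm_def]
    have h1 := hr1 t ht.2 0 hT.le
    rw [dist_eq_norm, sub_zero, abs_of_nonneg ht.1] at h1
    have h2 := norm_le_insert' (r t) (r 0)
    have h3 := mul_le_mul_of_nonneg_left ht.2 hC0
    linarith
  have htv : ∀ t ∈ Icc 0 T, HasVarLE (r t) (supBV T r).toReal := fun t ht => by
    refine hasVarLE_of_totalVar_le (L1.integrable_coeFn _) ENNReal.toReal_nonneg ?_
    rw [ENNReal.ofReal_toReal hsup.ne]
    exact le_trans le_add_self (le_iSup₂ (f := fun t (_ : t ∈ Icc 0 T) => bvNorm (r t)) t ht)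
  refine ⟨u, r, hu, hd, ⟨?_, ?_, hr0⟩, hsup, hC0, fun s hs t ht => ?_, hreq, ?_⟩
  · have hl : LipschitzOnWith (m.lipTime T τ ρ₀).toNNReal r (Icc 0 T) :=
      LipschitzOnWith.of_dist_le_mul fun s hs t ht => by
        rw [Real.coe_toNNReal _ hC0, Real.dist_eq]; exact hr1 s hs.2 t ht.2
    exact hl.continuousOn
  · rw [ae_restrict_iff' measurableSet_Icc]
    have hne : ∀ a : ℝ, ∀ᵐ t : ℝ, t ≠ a := fun a => by simp [ae_iff]
    filter_upwards [hreq, hu.ae_eq, hne 0, hne T] with t h1 h2 h3 h4 htI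
    have htT : t < T := lt_of_le_of_ne htI.2 h4
    exact (h1 htT).trans (h2 ⟨lt_of_le_of_ne htI.1 h3.symm, htI.2⟩)
  · rw [← dist_eq_norm]; exact hr1 s hs t ht
  · filter_upwards [hreq] with t ht htT
    rcases le_or_gt t 0 with h | h
    · exact (htv 0 ⟨le_rfl, hT.le⟩).congr (hr0.trans (hu.past t h).symm)
    · exact (htv t ⟨h.le, htT.le⟩).congr (ht htT)

end TrafficModel

/-! ### Gronwall's inequality with delay and the stability estimate -/

/-- Gronwall's inequality with a delay. -/
theorem ae_le_of_delay_integral {D : ℝ → ℝ} {K δ D₀ T τ B : ℝ} (hτ : 0 < τ) (hK : 0 ≤ K)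
    (hδ : 0 ≤ δ) (hD₀ : 0 ≤ D₀) (hDm : Measurable D) (hDb : ∀ t, |D t| ≤ B)
    (h0 : ∀ᵐ t, t < 0 → D t ≤ D₀)
    (h : ∀ᵐ t, t ∈ Ioo 0 T → D t ≤ D₀ + ∫ s in (0 : ℝ)..t, K * (δ + D (s - τ))) :
    ∀ᵐ t, t ∈ Ioo 0 T → D t ≤ Real.exp (K * T) * (D₀ + K * δ * T) := by
  have hB : 0 ≤ B := (abs_nonneg _).trans (hDb 0)
  -- A supersolution: `y' = K y + exp(K t) K δ ≥ K (δ + y)` for `t ≥ 0`, with `y 0 = D₀`.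
  set y : ℝ → ℝ := fun t => Real.exp (K * t) * (D₀ + K * δ * t) with hy
  set e : ℝ → ℝ := fun t => Real.exp ((2 * K + 1) * (t - 0)) with he
  have hyc : Continuous y := by fun_prop
  have hec : Continuous e := by fun_prop
  have hymono : ∀ s t, 0 ≤ s → s ≤ t → y s ≤ y t := fun s t hs hst => by
    have h1 : Real.exp (K * s) ≤ Real.exp (K * t) :=
      Real.exp_le_exp.2 (mul_le_mul_of_nonneg_left hst hK)
    have h2 : K * δ * s ≤ K * δ * t := mul_le_mul_of_nonneg_left hst (by positivity)
    exact mul_le_mul h1 (by linarith) (by positivity) (Real.exp_pos _).le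
  have hemono : Monotone e := fun s t hst =>
    Real.exp_le_exp.2 (mul_le_mul_of_nonneg_left (by linarith) (by positivity))
  have hy0 : y 0 = D₀ := by simp [hy]
  have hyint : ∀ t, 0 ≤ t → D₀ + ∫ s in (0 : ℝ)..t, K * (δ + y s) ≤ y t := fun t ht => by
    have hd : ∀ s, HasDerivAt y (K * y s + Real.exp (K * s) * (K * δ)) s := fun s => by
      have h1 : HasDerivAt (fun s : ℝ => K * s) K s := by
        simpa using (hasDerivAt_id s).const_mul K
      have h2 : HasDerivAt (fun s : ℝ => D₀ + K * δ * s) (K * δ) s := by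
        simpa using ((hasDerivAt_id s).const_mul (K * δ)).const_add D₀
      refine (h1.exp.fun_mul h2).congr_deriv ?_
      rw [hy]; ring
    have h1 := intervalIntegral.integral_eq_sub_of_hasDerivAt (fun s _ => hd s)
      ((by fun_prop : Continuous fun s =>
        K * y s + Real.exp (K * s) * (K * δ)).intervalIntegrable 0 t)
    rw [hy0] at h1
    have h2 : ∫ s in (0 : ℝ)..t, K * (δ + y s)
        ≤ ∫ s in (0 : ℝ)..t, (K * y s + Real.exp (K * s) * (K * δ)) := by
      refine intervalIntegral.integral_mono_on ht
        ((by fun_prop : Continuous _).intervalIntegrable _ _)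
        ((by fun_prop : Continuous _).intervalIntegrable _ _) fun s hs => ?_
      have h3 : 1 ≤ Real.exp (K * s) := Real.one_le_exp (mul_nonneg hK hs.1)
      nlinarith [mul_nonneg hK hδ]
    linarith
  have hne : ∀ᵐ t : ℝ, t ≠ 0 := by simp [ae_iff]
  have main : ∀ j : ℕ, ∀ᵐ t, t ∈ Ioo 0 T → D t ≤ y t + B * (1 / 2) ^ j * e t := by
    intro j
    induction j with
    | zero =>
      refine Eventually.of_forall fun t ht => ?_
      have h1 : D t ≤ B := (le_abs_self _).trans (hDb t)
      have h2 := hymono 0 t le_rfl ht.1.le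
      have h3 : 1 ≤ e t := Real.one_le_exp (mul_nonneg (by positivity) (by linarith [ht.1]))
      rw [pow_zero, mul_one]
      nlinarith
    | succ j ih =>
      set q := B * (1 / 2) ^ j with hq
      have hq0 : 0 ≤ q := by positivity
      -- Before time 0 the bound `D₀ = y 0` applies. As `y` and `e` increase, the delayed argument
      -- may afterwards be replaced by the present one, so the delay costs nothing.
      have hv : ∀ᵐ t, t < T → D t ≤ y (max t 0) + q * e (max t 0) := by
        filter_upwards [ih, h0, hne] with t h1 h2 h3 htT
        rcases lt_or_gt_of_ne h3 with h | h
        · have h4 := hymono 0 (max t 0) le_rfl (le_max_right _ _)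
          have h5 : 0 ≤ q * e (max t 0) := mul_nonneg hq0 (Real.exp_pos _).le
          linarith [h2 h]
        · simpa only [max_eq_left h.le] using h1 ⟨h, htT⟩
      filter_upwards [h] with t ht htI
      refine (ht htI).trans ?_
      have i1 : IntervalIntegrable (fun s => K * (δ + y s)) volume 0 t :=
        (by fun_prop : Continuous fun s => K * (δ + y s)).intervalIntegrable _ _
      have i2 : IntervalIntegrable (fun s => K * (q * e s)) volume 0 t :=
        (by fun_prop : Continuous fun s => K * (q * e s)).intervalIntegrable _ _
      have i3 : IntervalIntegrable (fun s => K * (δ + D (s - τ))) volume 0 t := by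
        have hl : LocallyIntegrable fun s => K * (δ + D (s - τ)) :=
          locallyIntegrable_of_bdd (C := K * (δ + B)) (by fun_prop) fun s => by
            rw [abs_mul, abs_of_nonneg hK]
            refine mul_le_mul_of_nonneg_left ((abs_add_le _ _).trans ?_) hK
            rw [abs_of_nonneg hδ]
            exact add_le_add_right (hDb _) δ
        exact (hl.integrableOn_isCompact isCompact_uIcc).intervalIntegrable
      have h1 : ∫ s in (0 : ℝ)..t, K * (δ + D (s - τ))
          ≤ ∫ s in (0 : ℝ)..t, (K * (δ + y s) + K * (q * e s)) := by
        refine intervalIntegral.integral_mono_ae_restrict htI.1.le i3 (i1.add i2) ?_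
        rw [EventuallyLE, ae_restrict_iff' measurableSet_Icc]
        filter_upwards [(measurePreserving_sub_right volume τ).quasiMeasurePreserving.ae hv]
          with s hs hsI
        have h3 := hs (by linarith [hsI.2, htI.2])
        have h4 := hymono (max (s - τ) 0) s (le_max_right _ _) (max_le (by linarith) hsI.1)
        have h5 := mul_le_mul_of_nonneg_left
          (hemono (max_le (by linarith) hsI.1 : max (s - τ) 0 ≤ s)) hq0
        rw [← mul_add]
        exact mul_le_mul_of_nonneg_left (by linarith) hK
      rw [intervalIntegral.integral_add i1 i2] at h1
      have h2 := mul_le_mul_of_nonneg_left (integral_exp_le (t₀ := 0) (t := t) hK) hq0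
      have h3 := hyint t htI.1.le
      rw [pow_succ, ← mul_assoc]
      have e1 : ∫ s in (0 : ℝ)..t, K * (q * e s) = q * (K * ∫ s in (0 : ℝ)..t, e s) := by
        rw [intervalIntegral.integral_const_mul, intervalIntegral.integral_const_mul]; ring
      rw [e1] at h1
      change q * (K * ∫ s in (0 : ℝ)..t, e s) ≤ q * (1 / 2 * e t) at h2
      linarith
  filter_upwards [ae_all_iff.2 main] with t ht htI
  have hlim : Tendsto (fun j : ℕ => y t + B * (1 / 2) ^ j * e t) atTop
      (𝓝 (y t + B * 0 * e t)) :=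
    tendsto_const_nhds.add (((tendsto_pow_atTop_nhds_zero_of_lt_one (by norm_num)
      (by norm_num)).const_mul B).mul_const _)
  rw [mul_zero, zero_mul, add_zero] at hlim
  exact (ge_of_tendsto hlim (Eventually.of_forall fun j => ht j htI)).trans
    (hymono t T htI.1.le htI.2.le)

namespace TrafficModel

variable {m : TrafficModel} {T τ₁ τ₂ : ℝ} {ρ₀ σ₀ : ℝ → ℝ} {ρ σ : ℝ → ℝ → ℝ}

theorem K₁_nonneg {B : ℝ} (hB : 0 ≤ B) : 0 ≤ m.K₁ B := by
  have := m.normω_nonneg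
  have := m.normv'_nonneg
  have := m.normv''_nonneg
  have := m.normf'_nonneg
  have := m.R_pos
  unfold K₁; positivity

/-- The stability estimate, with the sharper constant in front of the initial distance. -/
theorem norm_sub_le_of_isEntropySolution (hT : 0 < T) (hτ₁ : 0 < τ₁) (hτ₂ : 0 < τ₂)
    (hρ : m.IsEntropySolution T τ₁ ρ₀ ρ)
    (hσ : m.IsEntropySolution T τ₂ σ₀ σ) {u w : ℝ → ℝ → ℝ} {r s : ℝ → (ℝ →₁[volume] ℝ)}
    {M M' B C C' : ℝ} (hu : IsRep T ρ₀ ρ u) (hud : IsDensity m.R M u) (hC : 0 ≤ C)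
    (hr : ∀ q ≤ T, ∀ t ≤ T, ‖r q - r t‖ ≤ C * |q - t|)
    (hru : ∀ᵐ t, t < T → (r t : ℝ → ℝ) =ᵐ[volume] u t)
    (huB : ∀ᵐ t, t < T → HasVarLE (u t) B) (hw : IsRep T σ₀ σ w) (hwd : IsDensity m.R M' w)
    (hC' : 0 ≤ C') (hs : ∀ q ≤ T, ∀ t ≤ T, ‖s q - s t‖ ≤ C' * |q - t|)
    (hsw : ∀ᵐ t, t < T → (s t : ℝ → ℝ) =ᵐ[volume] w t) :
    ∀ t ∈ Icc 0 T, ‖r t - s t‖ ≤ Real.exp (m.K₁ B * T)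
      * ((∫ x, |ρ₀ x - σ₀ x|) + m.K₁ B * (C * |τ₁ - τ₂|) * T) := by
  have hΩ := m.normω_nonneg
  have hv₁ := m.normv'_nonneg
  have hv₂ := m.normv''_nonneg
  have hf := m.normf'_nonneg
  have hR := m.R_pos
  have hB : 0 ≤ B := by
    obtain ⟨q, ⟨hq, hqT⟩, -⟩ := exists_near_of_ae huB T le_rfl 1 one_pos
    exact (hq hqT).nonneg
  have hK := m.K₁_nonneg hB
  set D : ℝ → ℝ := fun t => ∫ x, |u t x - w t x| with hD
  set Z : ℝ → ℝ := fun t => ∫ x, |u (t - τ₁) x - w (t - τ₂) x| with hZ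
  have hbdd : ∀ q t, |(∫ x, |u q x - w t x|)| ≤ M + M' := fun q t => by
    rw [abs_of_nonneg (integral_nonneg fun _ => abs_nonneg _)]
    calc ∫ x, |u q x - w t x| ≤ ∫ x, (u q x + w t x) :=
          integral_mono ((hud.integrable q).sub (hwd.integrable t)).abs
            ((hud.integrable q).add (hwd.integrable t)) fun x => by
            have h1 := (hud.mem q x).1
            have h2 := (hwd.mem t x).1
            exact abs_le.2 ⟨by linarith, by linarith⟩
      _ ≤ M + M' := by
          rw [integral_add (hud.integrable q) (hwd.integrable t)]
          exact add_le_add (hud.mass_le q) (hwd.mass_le t)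
  have hDm : Measurable D := by
    have : Measurable fun p : ℝ × ℝ => |u p.1 p.2 - w p.1 p.2| :=
      (hud.measurable.sub hwd.measurable).abs
    exact this.stronglyMeasurable.integral_prod_right'.measurable
  have hZm : Measurable Z := by
    have : Measurable fun p : ℝ × ℝ => |u (p.1 - τ₁) p.2 - w (p.1 - τ₂) p.2| :=
      ((hud.measurable.comp (by fun_prop : Measurable fun p : ℝ × ℝ => (p.1 - τ₁, p.2))).sub
        (hwd.measurable.comp (by fun_prop : Measurable fun p : ℝ × ℝ => (p.1 - τ₂, p.2)))).abs
    exact this.stronglyMeasurable.integral_prod_right'.measurable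
  have hZ0 : ∀ t, 0 ≤ Z t := fun t => integral_nonneg fun _ => abs_nonneg _
  have hYl : LocallyIntegrable fun t => m.K₁ B * Z t :=
    locallyIntegrable_of_bdd (C := m.K₁ B * (M + M')) (hZm.const_mul _) fun t => by
      rw [abs_mul, abs_of_nonneg hK]
      exact mul_le_mul_of_nonneg_left (hbdd _ _) hK
  have hshift : ∀ (τ : ℝ) {p : ℝ → Prop}, (∀ᵐ t, p t) → ∀ᵐ t, p (t - τ) := fun τ p hp =>
    (measurePreserving_sub_right volume τ).quasiMeasurePreserving.ae hp
  have hVP : ∀ᵐ t, t < T → HasVarLE (delayVelx (2 * m.R * m.normω) m.dspeed m.kern τ₁ u t)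
      ((m.normv' * (2 * m.normω) + m.normv'' * (2 * m.R * m.normω)) * B) := by
    filter_upwards [hshift τ₁ huB] with t ht htT
    exact hasVarLE_delayVelx m.isSpeed m.isAvgKernel hud (ht (by linarith))
  have hpast : ∀ t ≤ 0, D t = ∫ x, |ρ₀ x - σ₀ x| := fun t ht => by
    refine integral_congr_ae ?_
    filter_upwards [hu.past t ht, hw.past t ht] with x h1 h2
    rw [h1, h2]
  have hstab := ae_integral_abs_sub_le m.isFluxFactor hud hwd
    (isVelocity_delayVel (τ := τ₁) m.isSpeed m.isAvgKernel hud)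
    (isVelocity_delayVel (τ := τ₂) m.isSpeed m.isAvgKernel hwd) (hρ.isKruzkov hτ₁ hu hud)
    (hσ.isKruzkov hτ₂ hw hwd) (N := B) (Y := fun t => m.K₁ B * Z t) hT le_rfl hVP hYl
    (fun t => mul_nonneg hK (hZ0 t)) (by
      filter_upwards [huB] with t ht htT
      -- The supremum distance of the velocities, multiplied by `(1 + R ‖f'‖) B`, and the `L¹`
      -- distance of their derivatives, multiplied by `R`, are the two summands of `K₁`, each times
      -- the delayed distance `Z`.
      refine ⟨B, m.normv' * (m.normω * Z t), le_rfl, ht htT,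
        abs_delayVel_sub_le m.isSpeed m.isAvgKernel hud hwd t, ?_⟩
      have h1 := mul_le_mul_of_nonneg_left (integral_abs_delayVelx_sub_le (τ := τ₁) (τ' := τ₂)
        m.isSpeed m.isAvgKernel hud hwd t) hR.le
      refine (add_le_add_right h1 _).trans (le_of_eq ?_)
      rw [K₁]; ring)
    (Eventually.of_forall fun t ht => (hpast t ht.2.le).le)
  -- Triangle inequality through `u(t - τ₂)`. Only the time regularity of the first solution is
  -- used, which is why the constant involves `τ₁` and `ρ₀` alone.
  have hZD : ∀ᵐ t, t < T → Z t ≤ C * |τ₁ - τ₂| + D (t - τ₂) := by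
    filter_upwards [hshift τ₁ hru, hshift τ₂ hru] with t h1 h2 htT
    have h3 := hr (t - τ₁) (by linarith) (t - τ₂) (by linarith)
    rw [norm_sub_eq_integral _ _ (h1 (by linarith)) (h2 (by linarith)), sub_sub_sub_cancel_left,
      abs_sub_comm] at h3
    have i1 : Integrable fun x => |u (t - τ₁) x - u (t - τ₂) x| :=
      ((hud.integrable _).sub (hud.integrable _)).abs
    have i2 : Integrable fun x => |u (t - τ₂) x - w (t - τ₂) x| :=
      ((hud.integrable _).sub (hwd.integrable _)).abs
    refine le_trans ?_ (add_le_add_left h3 _)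
    rw [hZ, hD]; beta_reduce
    rw [← integral_add i1 i2]
    exact integral_mono ((hud.integrable _).sub (hwd.integrable _)).abs (i1.add i2)
      fun x => abs_sub_le _ _ _
  have hgron := ae_le_of_delay_integral (D := D) (K := m.K₁ B) (δ := C * |τ₁ - τ₂|)
    (D₀ := ∫ x, |ρ₀ x - σ₀ x|) (T := T) (B := M + M') hτ₂ hK (by positivity)
    (integral_nonneg fun _ => abs_nonneg _) hDm (fun t => hbdd t t)
    (Eventually.of_forall fun t ht => (hpast t ht.le).le) (by
      filter_upwards [hstab] with t ht htI
      refine (ht htI).trans (add_le_add_right ?_ _)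
      have hl : LocallyIntegrable fun q => m.K₁ B * (C * |τ₁ - τ₂| + D (q - τ₂)) :=
        locallyIntegrable_of_bdd (C := m.K₁ B * (C * |τ₁ - τ₂| + (M + M'))) (by fun_prop)
          fun q => by
          rw [abs_mul, abs_of_nonneg hK]
          refine mul_le_mul_of_nonneg_left ((abs_add_le _ _).trans ?_) hK
          rw [abs_of_nonneg (by positivity : 0 ≤ C * |τ₁ - τ₂|)]
          exact add_le_add_right (hbdd _ _) _
      refine intervalIntegral.integral_mono_ae_restrict htI.1.le
        (hYl.integrableOn_isCompact isCompact_uIcc).intervalIntegrable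
        (hl.integrableOn_isCompact isCompact_uIcc).intervalIntegrable ?_
      rw [EventuallyLE, ae_restrict_iff' measurableSet_Icc]
      filter_upwards [hZD] with q hq hqI
      exact mul_le_mul_of_nonneg_left (hq (by linarith [hqI.2, htI.2])) hK)
  intro t ht
  -- So far the estimate holds at almost every time. Both curves are Lipschitz in `L¹`, so it passes
  -- to every `t`, endpoints included.
  refine le_of_forall_pos_le_add fun ε hε => ?_
  have hnear : ∃ q, q ∈ Ioo 0 T ∧ |q - t| < ε / (C + C' + 1) ∧
      ((q ∈ Ioo 0 T → D q ≤ Real.exp (m.K₁ B * T)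
        * ((∫ x, |ρ₀ x - σ₀ x|) + m.K₁ B * (C * |τ₁ - τ₂|) * T)) ∧
      (q < T → (r q : ℝ → ℝ) =ᵐ[volume] u q) ∧ (q < T → (s q : ℝ → ℝ) =ᵐ[volume] w q)) := by
    have hε' : 0 < ε / (C + C' + 1) := by positivity
    set η := ε / (C + C' + 1) with hη
    have h1 : ∃ᵐ q, q ∈ Ioo (max 0 (t - η)) (min T (t + η)) := by
      rw [frequently_ae_mem_iff, Real.volume_Ioo]
      have : max 0 (t - η) < min T (t + η) :=
        max_lt (lt_min hT (by linarith [ht.1])) (lt_min (by linarith [ht.2]) (by linarith))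
      exact (ENNReal.ofReal_pos.2 (sub_pos.2 this)).ne'
    obtain ⟨q, hq, hq'⟩ := (h1.and_eventually (hgron.and (hru.and hsw))).exists
    have h2 := max_lt_iff.1 hq.1
    have h3 := lt_min_iff.1 hq.2
    exact ⟨q, ⟨h2.1, h3.1⟩, abs_lt.2 ⟨by linarith [h2.2], by linarith [h3.2]⟩, hq'⟩
  obtain ⟨q, hqI, hqε, h1, h2, h3⟩ := hnear
  have h4 := h1 hqI
  rw [hD] at h4; beta_reduce at h4
  rw [← norm_sub_eq_integral _ _ (h2 hqI.2) (h3 hqI.2)] at h4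
  have h5 := hr t ht.2 q hqI.2.le
  have h6 := hs q hqI.2.le t ht.2
  rw [lt_div_iff₀ (by positivity)] at hqε
  rw [abs_sub_comm] at h5
  have h7 : ‖r t - s t‖ ≤ ‖r t - r q‖ + ‖r q - s q‖ + ‖s q - s t‖ := by
    have e : r t - s t = (r t - r q) + (r q - s q) + (s q - s t) := by abel
    rw [e]; exact norm_add₃_le
  nlinarith [abs_nonneg (q - t)]

end TrafficModel

/-! ### The theorem -/

theorem mainTheorem2 (m : TrafficModel) (T τ₁ τ₂ : ℝ) (hT : 0 < T) (hτ₁ : 0 < τ₁) (hτ₂ : 0 < τ₂)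
    (ρ₀ σ₀ : ℝ → ℝ) (hρ₀ : IsBVDatum m.R ρ₀) (hσ₀ : IsBVDatum m.R σ₀)
    (ρ σ : ℝ → ℝ → ℝ)
    (hρ : m.IsEntropySolution T τ₁ ρ₀ ρ) (hσ : m.IsEntropySolution T τ₂ σ₀ σ) :
    ∃ r s : ℝ → (ℝ →₁[volume] ℝ),
      TrafficModel.IsContinuousRep T ρ₀ ρ r ∧ TrafficModel.IsContinuousRep T σ₀ σ s ∧
      TrafficModel.supBV T r < ⊤ ∧
      (∀ t ∈ Icc 0 T,
        ‖r t - s t‖ ≤ Real.exp (m.K₁ (TrafficModel.supBV T r).toReal * T)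
          * (m.K₃ (TrafficModel.supBV T r).toReal τ₁ τ₂ * (∫ x, |ρ₀ x - σ₀ x|)
            + m.K₂ (TrafficModel.supBV T r).toReal T τ₁ ρ₀ * |τ₁ - τ₂|)) ∧
      (ρ₀ =ᵐ[volume] σ₀ → ∀ t ∈ Icc 0 T,
        ‖r t - s t‖ ≤ Real.exp (m.K₁ (TrafficModel.supBV T r).toReal * T)
          * m.K₂ (TrafficModel.supBV T r).toReal T τ₁ ρ₀ * |τ₁ - τ₂|) ∧
      (ρ₀ =ᵐ[volume] σ₀ → τ₁ = τ₂ →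
        ∀ᵐ p : ℝ × ℝ ∂volume.restrict (Icc 0 T ×ˢ univ), ρ p.1 p.2 = σ p.1 p.2) := by
  obtain ⟨u, r, hu, hud, hrep, hsup, hC, hr, hru, huB⟩ := hρ.exists_continuousRep hT hτ₁ hρ₀
  obtain ⟨w, s, hw, hwd, hsrep, -, hC', hs, hsw, -⟩ := hσ.exists_continuousRep hT hτ₂ hσ₀
  have hmain := TrafficModel.norm_sub_le_of_isEntropySolution hT hτ₁ hτ₂ hρ hσ hu hud hC hr
    hru huB hw hwd hC' hs hsw
  set B := (TrafficModel.supBV T r).toReal with hB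
  have hK := m.K₁_nonneg (ENNReal.toReal_nonneg : 0 ≤ B)
  have hD₀ : 0 ≤ ∫ x, |ρ₀ x - σ₀ x| := integral_nonneg fun _ => abs_nonneg _
  have hzero : ρ₀ =ᵐ[volume] σ₀ → ∫ x, |ρ₀ x - σ₀ x| = 0 := fun h => by
    rw [← integral_zero ℝ ℝ]
    refine integral_congr_ae ?_
    filter_upwards [h] with x hx
    simp [hx]
  have hsame : ρ₀ =ᵐ[volume] σ₀ → ∀ t ∈ Icc 0 T, ‖r t - s t‖ ≤ Real.exp (m.K₁ B * T)
      * m.K₂ B T τ₁ ρ₀ * |τ₁ - τ₂| := fun h t ht => by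
    refine (hmain t ht).trans (le_of_eq ?_)
    rw [hzero h, TrafficModel.K₂]; ring
  refine ⟨r, s, hrep, hsrep, hsup, fun t ht => ?_, hsame, fun h hτ => ?_⟩
  · refine (hmain t ht).trans (mul_le_mul_of_nonneg_left ?_ (Real.exp_pos _).le)
    refine add_le_add ?_ (le_of_eq ?_)
    -- `K₃ ≥ 1`, while the estimate already holds with the factor 1: the past, where the distance is
    -- the initial one, is part of the Gronwall argument.
    · refine le_mul_of_one_le_left hD₀ ?_
      unfold TrafficModel.K₃
      have := mul_nonneg hK (le_min hτ₁.le hτ₂.le)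
      linarith
    · rw [TrafficModel.K₂]; ring
  · have heq : ∀ t ∈ Icc 0 T, r t = s t := fun t ht => by
      have := hsame h t ht
      rw [hτ, sub_self, abs_zero, mul_zero] at this
      exact sub_eq_zero.1 (norm_le_zero_iff.1 this)
    have hi := hρ.integrableOn
    have hj := hσ.integrableOn
    rw [IntegrableOn, restrict_strip] at hi hj
    rw [restrict_strip]
    obtain ⟨g, hg, hgρ⟩ := hi.1
    obtain ⟨k, hk, hkσ⟩ := hj.1
    -- Equality on almost every slice gives equality almost everywhere on the strip only for a
    -- measurable set of coincidence, hence the measurable versions `g` and `k`.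
    have hmk : ∀ᵐ p : ℝ × ℝ ∂(volume.restrict (Icc 0 T)).prod volume, g p = k p := by
      refine (Measure.ae_prod_mem_iff_ae_ae_mem
        (measurableSet_eq_fun hg.measurable hk.measurable)).2 ?_
      filter_upwards [Measure.ae_ae_of_ae_prod hgρ, Measure.ae_ae_of_ae_prod hkσ,
        hrep.ae_eq, hsrep.ae_eq, ae_restrict_mem measurableSet_Icc] with t h1 h2 h3 h4 h5
      rw [heq t h5] at h3
      filter_upwards [h1, h2, h3, h4] with x k1 k2 k3 k4
      rw [← k1, ← k2, ← k3, ← k4]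
    filter_upwards [hgρ, hkσ, hmk] with p h1 h2 h3
    rw [h1, h2, h3]
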